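/- **Setting.** The *4-qubit Bacon-Shor code* has gauge operators $Z_1Z_2, Z_3Z_4, X_1X_3, X_2X_4$, stabilizer $\langle Z^{\otimes 4},X^{\otimes 4}\rangle$ and logical operators $\bar X=X_1X_2$, $\bar Z=Z_1Z_3$; a *gauge fixing* is a choice of one of the six stabilizer states of the gauge qubit (whose $Z$, $X$ are $Z_1Z_2$, $X_1X_3$), e.g. $ZZ=+1$. The *$N$-copy Bacon-Shor tensor* ($N\ge 1$) is the encoding isometry $|x\rangle\mapsto|\tilde x\rangle=|\bar x\rangle^{\otimes N}$ extended linearly; it has one bulk leg and four in-plane legs of $N$ qubits each, and in each copy the assignment of the four qubits to the four legs and the gauge are arbitrary. The *perfect tensor* is the $[[6,0,4]]$ stabilizer state $|T\rangle$ obtained from the $[[5,1,3]]$ code; the $N$-copy version is $|T\rangle^{\otimes N}$. A *network* is a finite collection of squares (carrying $N$-copy Bacon-Shor tensors, hence one bulk qubit each) and hexagons (carrying $N$-copy perfect tensors) in which some pairs of legs, each consisting of a leg of a square and a leg of a hexagon, are glued by projection onto Bell pairs (each projection $\langle\Phi^+|$ being multiplied by $2$); unglued legs are boundary legs. It defines an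 encoding map $V$ from the bulk qubits to the boundary qubits. For a boundary region $A$ (a set of boundary legs) the *Greedy algorithm* starts with the empty set of tiles and repeatedly absorbs a tile at least three of whose legs are accessible, i.e. lie in $A$ or are glued to an absorbed tile; the set obtained when no move is left is the *Greedy wedge* $W(A)$. In one *round* several moves may be made simultaneously on tiles no two of which share an edge. A *2-local Clifford circuit* consists of layers of disjointly supported gates $H$, $S$, CNOT; its depth is the number of layers. For even $d\ge 4$ consider the semiregular tiling by squares and hexagons alternating around vertices of degree $d$. The *hybrid holographic code* is the code of the network of a patch consisting of a central square, $n$ complete layers of tiles around it, and an arbitrary part of the next layer. **Theorem.** 1. *(Local moves.)* Let $S$ be a set of legs of the perfect tensor. The following are equivalent: (a) $|S|\ge 3$; (b) for every operator $O_{S^c}$ there is an operator $O_S$ with $O_{S^c}|T\rangle=O_S|T\rangle$; (c) there is a Clifford circuit on $S$ that maps $|T\rangle$ to $|0\cdots0\rangle_{S_1}\otimes|\Phi^+\rangle^{\otimes|S^c|}_{S_2S^c}$ for some partition $S=S_1\sqcup S_2$. Likewise, for a set $S$ of legs of an $N$-copy Bacon-Shor tensor, in any gauge, the following are equivalent: (a)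 $|S|\ge3$; (b) for every $O_{S^c}$ there is $O_S$ with $O_{S^c}|\tilde\psi\rangle=O_S|\tilde\psi\rangle$ for all code states $|\tilde\psi\rangle$; (c) there is a Clifford circuit on $S$ that maps every code state $|\tilde\psi\rangle$ to $|\psi\rangle\otimes|0\cdots0\rangle\otimes|\Phi^+\rangle^{\otimes N|S^c|}$, with $|\psi\rangle$ on one qubit of $S$ and each Bell pair across $S|S^c$. 2. *(GHZ-like entanglement.)* In the gauge $ZZ=+1$, let $S$ be two legs of the $N$-copy Bacon-Shor tensor such that in at least one copy $\bar Z$ has a representative on $S$. Then there is a Clifford circuit on $S$ that maps, for $x\in\{0,1\}$, the state $|\tilde x\rangle$ to $|x\rangle$ on one qubit of $S$ (independent of $x$), tensored, for each copy, with a GHZ state up to bit flips (which may depend on $x$) on all the remaining qubits of that copy. 3. *(Composition.)* For every $N$ there is a constant $c$ such that for every network with non-empty boundary and every boundary region $A$: the Greedy wedge does not depend on the order of the moves and is reached in finitely many rounds; and for every run of the Greedy algorithm there are Clifford circuits $B_0,B_1,\dots$ on the qubits of $A$, of depth at most $c$ each, one for each round, such that every gate of $B_r$ acts only on qubits that, before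 round $r$, carry the accessible legs of one single tile absorbed in round $r$; these qubits then receive the newly cut legs and the bulk qubit (if any) of this tile and nothing else is moved; and for every $r$ and every bulk state $|\psi\rangle$ (entangled or not) the circuit $B_0,\dots,B_{r-1}$ maps $V|\psi\rangle$ to the following state. If $W$ is the set of tiles absorbed so far, then each bulk qubit of $W$ sits on its own qubit of $A$; each qubit of each boundary leg outside $A$ belonging to a tile in $W$ forms a Bell pair with a qubit of $A$; the remaining degrees of freedom are in the state of the network of the tiles outside $W$, whose legs cut by the Greedy curve are held by further qubits of $A$; and all other qubits of $A$ are in the state $|0\rangle$. 4. *(Global decoding.)* For the hybrid holographic code, $V$ is an isometry, and the Greedy wedge of the whole boundary consists of all tiles. 5. *(Log depth.)* For all $N\ge1$, even $d\ge4$ and $m$ there is a constant $C$ such that for every hybrid holographic code and every boundary region $A$ that is a union of at most $m$ intervals (for instance an interval or the whole boundary) there is a run of the Greedy algorithm that reaches $W(A)$ and for which the composed circuit $B_0,B_1,\dots$ as in 3, which decodes all the bulk qubits in $W(A)$ from $A$, is a 2-local Clifford circuit of total depth at most $C\log n_{\rm phys}$, where $n_{\rm phys}$ is the number of boundary qubits.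 -/

import Mathlib

open scoped Classical

noncomputable section

namespace HybridCode

/-! ## Qubits, states, Clifford circuits -/

/-- State vectors of a register of qubits labelled by `Q`, as amplitudes in the computational
basis (`false` is `|0⟩`, `true` is `|1⟩`). -/
abbrev QState (Q : Type) := (Q → Bool) → ℂ

/-- The number `1 / √2`. -/
def invSqrtTwo : ℂ := ((Real.sqrt 2 : ℝ) : ℂ)⁻¹

/-- The standard one- and two-qubit Clifford gates (they generate the Clifford group). -/
inductive Gate (Q : Type) where
  | hadamard (q : Q)
  | phase (q : Q)
  | cnot (p q : Q) (hpq : p ≠ q)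

/-- The set of (at most two) qubits that a gate acts on. -/
def Gate.support {Q : Type} : Gate Q → Set Q
  | .hadamard q => {q}
  | .phase q => {q}
  | .cnot p q _ => {p, q}

/-- The unitary of a gate. `cnot p q` has control `p` and target `q`. -/
def Gate.apply {Q : Type} : Gate Q → QState Q → QState Q
  | .hadamard q, φ => fun y =>
      invSqrtTwo * (φ (Function.update y q false)
        + (if y q then -1 else 1) * φ (Function.update y q true))
  | .phase q, φ => fun y => (if y q then Complex.I else 1) * φ y
  | .cnot p q _, φ => fun y => φ (Function.update y q (xor (y p) (y q)))

/-- A 2-local Clifford circuit: a list of layers, each a list of gates; time runs from left to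
right. The depth is the number of layers, `C.length`. -/
abbrev Circuit (Q : Type) := List (List (Gate Q))

/-- The gates of one layer act on pairwise disjoint sets of qubits. -/
def Circuit.Layered {Q : Type} (C : Circuit Q) : Prop :=
  ∀ layer ∈ C, layer.Pairwise fun g g' => Disjoint g.support g'.support

/-- Every gate acts on qubits of `S` only. -/
def Circuit.ActsOn {Q : Type} (C : Circuit Q) (S : Set Q) : Prop :=
  ∀ layer ∈ C, ∀ g ∈ layer, g.support ⊆ S

/-- The unitary of a circuit. -/
def Circuit.run {Q : Type} (C : Circuit Q) (φ : QState Q) : QState Q :=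
  C.foldl (fun φ' layer => layer.foldl (fun φ'' g => g.apply φ'') φ') φ

/-- The linear operator on a register that acts as the matrix `K` on the qubits of `S` and
trivially on the others. -/
def localOp {Q : Type} (S : Finset Q) (K : Matrix (S → Bool) (S → Bool) ℂ)
    (φ : QState Q) : QState Q :=
  fun y => ∑ v : S → Bool,
    K (fun q => y q) v * φ (fun q => if h : q ∈ S then v ⟨q, h⟩ else y q)

/-- Bell pairs `(|00⟩ + |11⟩)/√2` on `(j, β j)` for all `j ∉ S`, and `|0⟩` on all the qubits of `S`
that are neither of the form `β j` with `j ∉ S` nor in `L`; the qubits in `L` are left open. -/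
def bellAndZeros {Q : Type} [Fintype Q] (S : Finset Q) (β : Q → Q) (L : Set Q) : QState Q :=
  fun y =>
    (∏ q : Q, if q ∈ S ∧ q ∉ L ∧ (∀ j, j ∉ S → β j ≠ q) then (if y q then 0 else 1) else 1) *
    ∏ j : Q, if j ∉ S then (if y (β j) = y j then invSqrtTwo else 0) else 1

/-- GHZ-like state on the qubits satisfying `P`: the GHZ state `(|0⋯0⟩ + |1⋯1⟩)/√2` with the
bit-flip pattern `f` applied. -/
def ghzLike {Q : Type} (P : Q → Prop) (f : Q → Bool) : QState Q :=
  fun y => if ∃ b : Bool, ∀ q, P q → y q = xor b (f q) then invSqrtTwo else 0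

/-! ## The two tensors -/

/-- The stabilizer states `Z = ±1`, `X = ±1`, `Y = ±1` of the gauge qubit; for the 4-qubit
Bacon-Shor code, the `Z` and `X` of the gauge qubit are the gauge operators `Z₁Z₂` and `X₁X₃`. -/
inductive Gauge where
  | zPlus | zMinus | xPlus | xMinus | yPlus | yMinus

/-- Amplitudes of the state of the gauge qubit. -/
def Gauge.vec : Gauge → Bool → ℂ
  | .zPlus, a => if a then 0 else 1
  | .zMinus, a => if a then 1 else 0
  | .xPlus, _ => invSqrtTwo
  | .xMinus, a => if a then -invSqrtTwo else invSqrtTwo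
  | .yPlus, a => if a then Complex.I * invSqrtTwo else invSqrtTwo
  | .yMinus, a => if a then -(Complex.I * invSqrtTwo) else invSqrtTwo

/-- Amplitude `⟨u|x̄⟩` of the logical basis state `x̄` of the gauge-fixed 4-qubit Bacon-Shor code with
gauge operators `Z₁Z₂, Z₃Z₄, X₁X₃, X₂X₄`, stabilizer `⟨ZZZZ, XXXX⟩`, and `Z̄ = Z₁Z₃`, `X̄ = X₁X₂`
(the qubits 1, 2, 3, 4 are `0, 1, 2, 3 : Fin 4`). -/
def bsAmp (γ : Gauge) (x : Bool) (u : Fin 4 → Bool) : ℂ :=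
  if xor (xor (u 0) (u 1)) (xor (u 2) (u 3)) = false ∧ xor (u 0) (u 2) = x then
    invSqrtTwo * γ.vec (xor (u 0) (u 1))
  else 0

/-- The `N`-copy Bacon-Shor code, `N` Bacon-Shor codes concatenated with the repetition code
`|x⟩ ↦ |x̄⟩⋯|x̄⟩`: four legs of `N` qubits each. Physical qubit `i` of copy `c` sits on leg `ρ c i`. -/
def bsCopies {N : ℕ} (ρ : Fin N → Equiv.Perm (Fin 4)) (γ : Fin N → Gauge) (x : Bool)
    (b : Fin 4 → Fin N → Bool) : ℂ :=
  ∏ c, bsAmp (γ c) x fun i => b (ρ c i) c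

/-- The encoding isometry `|ψ⟩ ↦ |ψ̃⟩` of the `N`-copy Bacon-Shor code. -/
def bsEncode {N : ℕ} (ρ : Fin N → Equiv.Perm (Fin 4)) (γ : Fin N → Gauge) (ψ : Bool → ℂ) :
    QState (Fin 4 × Fin N) :=
  fun y => ∑ x, ψ x * bsCopies ρ γ x fun i c => y (i, c)

/-- The perfect tensor: the `[[6,0,4]]` stabilizer state
`(|0⟩_L |0⟩ + |1⟩_L |1⟩)/√2` of the `[[5,1,3]]` code, with stabilizer generated by the cyclic shifts of
`XZZXI` on the first five qubits together with `XXXXXX` and `ZZZZZZ`. -/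
def perfectTensor : QState (Fin 6) :=
  fun u =>
    let e : Fin 6 → ℕ := fun i => if u i then 1 else 0
    if Even (e 0 + e 1 + e 2 + e 3 + e 4 + e 5) then
      invSqrtTwo ^ 5 * (-1) ^ (e 0 * e 1 + e 1 * e 2 + e 2 * e 3 + e 3 * e 4 + e 4 * e 0 + e 5)
    else 0

/-! ## Tensor networks of Bacon-Shor and perfect tensors -/

inductive TileKind where
  | square | hexagon

def TileKind.legs : TileKind → ℕ
  | .square => 4
  | .hexagon => 6

/-- A finite network of square and hexagonal tiles; `glued l l'` says that the legs `l` and `l'` are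
the two halves of one interior edge. -/
structure Network where
  Tile : Type
  [fintypeTile : Fintype Tile]
  kind : Tile → TileKind
  glued : ((t : Tile) × Fin (kind t).legs) → ((t : Tile) × Fin (kind t).legs) → Prop

attribute [instance] Network.fintypeTile

namespace Network

variable (net : Network)

/-- In-plane legs. -/
abbrev Leg := (t : net.Tile) × Fin (net.kind t).legs

/-- Every leg is glued to at most one leg, and squares are glued to hexagons only. -/
structure Proper : Prop where
  symm : ∀ l l', net.glued l l' → net.glued l' l
  unique : ∀ l l' l'', net.glued l l' → net.glued l l'' → l' = l''
  bipartite : ∀ l l', net.glued l l' → net.kind l.1 ≠ net.kind l'.1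

/-- A leg that is not glued lies on the boundary. -/
def IsBoundary (l : net.Leg) : Prop := ∀ l', ¬ net.glued l l'

abbrev Boundary := {l : net.Leg // net.IsBoundary l}

/-- The physical qubits of the `N`-copy code: `N` qubits on every boundary leg. -/
abbrev Qubit (N : ℕ) := net.Boundary × Fin N

/-- The bulk (logical) qubits: one for each square. -/
abbrev Bulk := {t : net.Tile // net.kind t = TileKind.square}

/-- The choices in the construction: for every tile and every copy, which physical qubit of the
tensor sits on which leg (qubit `i` of copy `c` sits on leg `orient t c i`), and the gauge of the
Bacon-Shor codes. -/
structure Dressing (N : ℕ) where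
  orient : (t : net.Tile) → Fin N → Equiv.Perm (Fin (net.kind t).legs)
  gauge : net.Tile → Fin N → Gauge

end Network

/-- The `N`-copy tensor of a tile: the multi-copy Bacon-Shor tensor with bulk leg `x` on a square,
`N` perfect tensors on a hexagon (for which `x` and `γ` play no role). -/
def tileAmp {N : ℕ} : (k : TileKind) → (ρ : Fin N → Equiv.Perm (Fin k.legs)) →
    (γ : Fin N → Gauge) → (x : Bool) → (b : Fin k.legs → Fin N → Bool) → ℂ
  | .square, ρ, γ, x, b => bsCopies ρ γ x b
  | .hexagon, ρ, _, _, b => ∏ c, perfectTensor fun i => b (ρ c i) c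

namespace Network

variable {net : Network} {N : ℕ}

/-- The leg `l` belongs to an edge that joins two tiles of `R`. -/
def Interior (R : Finset net.Tile) (l : net.Leg) : Prop :=
  l.1 ∈ R ∧ ∃ l', net.glued l l' ∧ l'.1 ∈ R

/-- The number of edges joining two tiles of `R`. -/
def edgeCount (R : Finset net.Tile) : ℕ :=
  (Finset.univ.filter fun l : net.Leg => Interior R l).card / 2

/-- The contracted network of the tiles in `R`, with bulk legs `x` and open legs `w`. Each of the
`N` qubits of an interior edge is projected onto `⟨Φ⁺| = (⟨00| + ⟨11|)/√2` and the result is multiplied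
by the normalization `2` for each such projection; `2 · (1/√2) = √2`. -/
def Dressing.contract (D : net.Dressing N) (R : Finset net.Tile) (x : net.Bulk → Bool)
    (w : net.Leg → Fin N → Bool) : ℂ :=
  ((Real.sqrt 2 : ℝ) : ℂ) ^ (N * edgeCount R) *
    ∑ z : net.Leg → Fin N → Bool,
      if (∀ l, ¬ Interior R l → z l = w l) ∧
          (∀ l l', Interior R l → net.glued l l' → z l = z l') then
        ∏ t ∈ R, tileAmp (net.kind t) (D.orient t) (D.gauge t)
          (if h : net.kind t = TileKind.square then x ⟨t, h⟩ else false) (fun i => z ⟨t, i⟩)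
      else 0

/-- The encoding map of the holographic code, from the bulk qubits to the boundary qubits. -/
def Dressing.encode (D : net.Dressing N) (ψ : QState net.Bulk) : QState (net.Qubit N) :=
  fun y => ∑ x, ψ x * D.contract Finset.univ x
    fun l c => if h : net.IsBoundary l then y (⟨l, h⟩, c) else false

/-! ## The Greedy algorithm -/

/-- Once the tiles of `W` are absorbed, the cut passes through the leg `l` of a tile outside `W` with
the accessible side beyond `l`: `l` lies in the boundary region `A` or is glued to a tile of `W`. -/
def Accessible (A : Set net.Boundary) (W : Finset net.Tile) (l : net.Leg) : Prop :=
  (∃ h : net.IsBoundary l, (⟨l, h⟩ : net.Boundary) ∈ A) ∨ ∃ l', net.glued l l' ∧ l'.1 ∈ W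

/-- The local moves: a square or a hexagon may be absorbed once at least three of its legs are
accessible. -/
def ThreeLegs (A : Set net.Boundary) (W : Finset net.Tile) (t : net.Tile) : Prop :=
  3 ≤ (Finset.univ.filter fun i => Accessible A W (⟨t, i⟩ : net.Leg)).card

/-- The Greedy wedge of `A`: the smallest set of tiles to which no local move can be applied. -/
def greedyWedge (A : Set net.Boundary) : Finset net.Tile :=
  Finset.univ.filter fun t => ∀ W : Finset net.Tile, (∀ u, ThreeLegs A W u → u ∈ W) → t ∈ W

/-- The tiles absorbed in the first `r` rounds, if the tiles of `M i` are absorbed in round `i`. -/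
def absorbed (M : ℕ → Finset net.Tile) (r : ℕ) : Finset net.Tile := (Finset.range r).biUnion M

/-- A run of the Greedy algorithm: in every round some (possibly no) local moves are performed
simultaneously, on tiles no two of which share an edge. -/
structure IsGreedyRun (A : Set net.Boundary) (M : ℕ → Finset net.Tile) : Prop where
  move : ∀ r, ∀ t ∈ M r, t ∉ absorbed M r ∧ ThreeLegs A (absorbed M r) t
  apart : ∀ r, ∀ t ∈ M r, ∀ u ∈ M r, ∀ i j, ¬ net.glued ⟨t, i⟩ ⟨u, j⟩

/-! ## Decoding along the Greedy algorithm -/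

/-- The legs cut by the Greedy curve when `W` is absorbed: the accessible legs of the tiles outside
`W`, and the boundary legs outside `A` of the tiles in `W`. -/
def OnCut (A : Set net.Boundary) (W : Finset net.Tile) (l : net.Leg) : Prop :=
  (l.1 ∉ W ∧ Accessible A W l) ∨ (l.1 ∈ W ∧ ∃ h : net.IsBoundary l, (⟨l, h⟩ : net.Boundary) ∉ A)

/-- Where the decoder keeps things: `carrier l c` is the physical qubit that carries copy `c` of the
cut leg `l` on the side of `A`, `logical s` the one that holds the decoded bulk qubit `s`. Only the
values for legs on the cut and squares in the absorbed region matter. -/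
structure Placement (net : Network) (N : ℕ) where
  carrier : net.Leg → Fin N → net.Qubit N
  logical : net.Bulk → net.Qubit N

/-- All these qubits are in `A`, and they are pairwise different. -/
structure Placement.Valid (p : Placement net N) (A : Set net.Boundary) (W : Finset net.Tile) :
    Prop where
  carrier_mem : ∀ l c, OnCut A W l → (p.carrier l c).1 ∈ A
  logical_mem : ∀ s : net.Bulk, s.1 ∈ W → (p.logical s).1 ∈ A
  carrier_inj : ∀ l c l' c', OnCut A W l → OnCut A W l' →
    p.carrier l c = p.carrier l' c' → l = l' ∧ c = c'
  logical_inj : ∀ s s' : net.Bulk, s.1 ∈ W → s'.1 ∈ W → p.logical s = p.logical s' → s = s'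
  disjoint : ∀ l c (s : net.Bulk), OnCut A W l → s.1 ∈ W → p.carrier l c ≠ p.logical s

/-- A qubit of `A` that carries neither a cut leg nor a decoded bulk qubit. -/
def Placement.Idle (p : Placement net N) (A : Set net.Boundary) (W : Finset net.Tile)
    (q : net.Qubit N) : Prop :=
  q.1 ∈ A ∧ (∀ l c, OnCut A W l → p.carrier l c ≠ q) ∧
    ∀ s : net.Bulk, s.1 ∈ W → p.logical s ≠ q

/-- The state in which the region `W` has been decoded. Its factors are: each bulk qubit `s` of `W` on
the physical qubit `logical s`; `|0⟩` on the idle qubits of `A`; a Bell pair across `A | Aᶜ` for each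
qubit of each boundary leg outside `A` of a tile in `W`; and the contracted network of the tiles
outside `W`, whose open legs are the cut legs, held by their carriers in `A`, and the boundary legs
outside `A`. -/
def Dressing.decodedState (D : net.Dressing N) (A : Set net.Boundary) (W : Finset net.Tile)
    (p : Placement net N) (ψ : QState net.Bulk) : QState (net.Qubit N) :=
  fun y => ∑ x, ψ x *
    ((∏ s : net.Bulk, if s.1 ∈ W then (if y (p.logical s) = x s then 1 else 0) else 1) *
     (∏ q : net.Qubit N, if p.Idle A W q then (if y q then 0 else 1) else 1) *
     (∏ q : net.Qubit N, if q.1.1.1 ∈ W ∧ q.1 ∉ A then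
        (if y (p.carrier q.1.1 q.2) = y q then invSqrtTwo else 0) else 1) *
     D.contract Wᶜ x fun l c =>
       if OnCut A W l then y (p.carrier l c)
       else if h : net.IsBoundary l then y (⟨l, h⟩, c) else false)

/-- The physical qubits that carry the accessible legs of the tile `t`. -/
def Placement.region (p : Placement net N) (A : Set net.Boundary) (W : Finset net.Tile)
    (t : net.Tile) : Set (net.Qubit N) :=
  {q | ∃ i c, Accessible A W ⟨t, i⟩ ∧ q = p.carrier ⟨t, i⟩ c}

/-- The concatenation of the first `r` blocks. -/
def firstBlocks {Q : Type} (B : ℕ → Circuit Q) (r : ℕ) : Circuit Q := (List.range r).flatMap B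

/-- The blocks `B 0, B 1, …` decode along the Greedy run `M`: block `r` consists of Clifford gates each
of which acts within the accessible legs of a single tile absorbed in round `r`, this local
transformation puts the new cut legs and the decoded bulk qubit of the tile onto these same qubits
and leaves everything else in place, and after `r` blocks the region absorbed so far is decoded. -/
structure Dressing.Decodes (D : net.Dressing N) (A : Set net.Boundary) (M : ℕ → Finset net.Tile)
    (B : ℕ → Circuit (net.Qubit N)) (p : ℕ → Placement net N) : Prop where
  start : ∀ (b : net.Boundary) (c : Fin N), b ∈ A → (p 0).carrier b.1 c = (b, c)
  valid : ∀ r, (p r).Valid A (absorbed M r)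
  layered : ∀ r, (B r).Layered
  isLocal : ∀ r, ∀ layer ∈ B r, ∀ g ∈ layer, ∃ t ∈ M r,
    g.support ⊆ (p r).region A (absorbed M r) t
  carrier_old : ∀ r l c, OnCut A (absorbed M r) l → OnCut A (absorbed M (r + 1)) l →
    (p (r + 1)).carrier l c = (p r).carrier l c
  carrier_new : ∀ r l c, OnCut A (absorbed M (r + 1)) l → ¬ OnCut A (absorbed M r) l →
    ∃ t ∈ M r, (l.1 = t ∨ ∃ i, net.glued l ⟨t, i⟩) ∧
      (p (r + 1)).carrier l c ∈ (p r).region A (absorbed M r) t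
  logical_old : ∀ r (s : net.Bulk), s.1 ∈ absorbed M r →
    (p (r + 1)).logical s = (p r).logical s
  logical_new : ∀ r (s : net.Bulk), s.1 ∈ M r →
    (p (r + 1)).logical s ∈ (p r).region A (absorbed M r) s.1
  decoded : ∀ r (ψ : QState net.Bulk),
    (firstBlocks B r).run (D.encode ψ) = D.decodedState A (absorbed M r) (p r) ψ

end Network

/-! ## The hyperbolic tiling -/

/-- A simply connected patch of the tiling. `tiles` lists for each tile its kind and its inward legs:
the leg `a` of the tile is glued to entry `a` of the list (legs are written as pairs (tile, leg), and
the legs of a tile are numbered cyclically around it). `front` lists the exposed legs in cyclic order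
around the patch, each with the number of tiles that meet at the vertex following it. -/
structure Patch where
  tiles : List (TileKind × List (ℕ × ℕ))
  front : List ((ℕ × ℕ) × ℕ)

/-- Groups the exposed edges by the tile to be attached to them, in a tiling with `d` tiles around
each vertex: two consecutive edges share a tile if only one tile is missing at their common vertex.
A group comes with the number of tiles at the vertex following it. -/
def frontGroups (d : ℕ) : List ((ℕ × ℕ) × ℕ) → List (List (ℕ × ℕ) × ℕ)
  | [] => []
  | [(l, c)] => [([l], c)]
  | (l, c) :: (l', c') :: rest =>
      if c + 1 = d then ([l', l], c') :: frontGroups d rest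
      else ([l], c) :: frontGroups d ((l', c') :: rest)

/-- Attaches a tile of kind `k` to each selected group (`pos` is the position of the first group, `idx`
the index of the next new tile), and returns the new tiles and the new front. -/
def attach (k : TileKind) (sel : ℕ → Bool) : (pos idx : ℕ) → List (List (ℕ × ℕ) × ℕ) → Patch
  | _, _, [] => ⟨[], []⟩
  | pos, idx, g :: gs =>
      if sel pos then
        let P := attach k sel (pos + 1) (idx + 1) gs
        ⟨(k, g.1) :: P.tiles,
          ((List.range' g.1.length (k.legs - g.1.length)).map fun i =>
            ((idx, i), if i + 1 = k.legs then g.2 + 2 else 1)) ++ P.front⟩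
      else
        let P := attach k sel (pos + 1) idx gs
        ⟨P.tiles, (g.1.reverse.map fun l => (l, 0)) ++ P.front⟩

/-- Adds (the selected part of) one more layer of tiles, all of kind `k`. The rotation by one step
keeps the list from ending at a vertex where a tile is missing between two exposed edges. -/
def Patch.grow (d : ℕ) (k : TileKind) (sel : ℕ → Bool) (P : Patch) : Patch :=
  let P' := attach k sel 0 P.tiles.length (frontGroups d P.front)
  ⟨P.tiles ++ P'.tiles, P'.front.rotate 1⟩

/-- Tiles of the same layer are of the same kind; the central tile is a square. -/
def layerKind (n : ℕ) : TileKind := if n % 2 = 0 then .square else .hexagon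

/-- The central square with `n` complete layers around it, in the semiregular tiling by squares and
hexagons alternating around vertices of degree `d`. -/
def ball (d : ℕ) : ℕ → Patch
  | 0 => ⟨[(.square, [])], [((0, 0), 1), ((0, 1), 1), ((0, 2), 1), ((0, 3), 1)]⟩
  | n + 1 => (ball d n).grow d (layerKind (n + 1)) fun _ => true

/-- The network of a patch: tensors glued along the common edges of the tiles. -/
def Patch.network (P : Patch) : Network where
  Tile := Fin P.tiles.length
  kind t := (P.tiles.get t).1
  glued l l' :=
    (P.tiles.get l.1).2[l.2.val]? = some (l'.1.val, l'.2.val) ∨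
    (P.tiles.get l'.1).2[l'.2.val]? = some (l.1.val, l.2.val)

/-- `n` complete layers around the central square, and the tiles of the next layer selected by `sel`
(none, some or all). -/
def tiling (d n : ℕ) (sel : ℕ → Bool) : Patch := (ball d n).grow d (layerKind (n + 1)) sel

/-- `A` is a union of at most `m` intervals of the (cyclically ordered) boundary of the patch; the
`j`-th one starts at position `s j` and has `e j` legs. -/
def Patch.IsUnionOfIntervals (P : Patch) (m : ℕ) (A : Set P.network.Boundary) : Prop :=
  ∃ s e : Fin m → ℕ, ∀ b : P.network.Boundary, b ∈ A ↔
    ∃ j, (b.1.1.val, b.1.2.val) ∈ ((P.front.map Prod.fst).rotate (s j)).take (e j)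

end HybridCode

end

/-!
The proof rests on one fact about a single tensor: three of its legs determine everything. For the
perfect tensor this is an explicit Clifford circuit on the three legs (`perfect_decodes_three`),
for the Bacon-Shor tensor an explicit circuit in every gauge (`bs_decodes_three`), and taking it
copy by copy gives `tile_decodes`. A state decoded in this way is a product of the bulk state, of
zeros and of Bell pairs, so operators on the complement can be transposed through the Bell pairs
(`push_of_bell`). Conversely, if all operators on the complement of a set of legs can be pushed
onto it, then the set is at least as large as its complement together with the bulk leg: pushing
the matrix units shows that the rows of the tensor, one for each bit string on the set, span the
space of the complement and the bulk leg (`card_mul_le_of_push`). For the GHZ statement a single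
CNOT suffices: in the gauge `ZZ = +1` all copies are GHZ states up to bit flips, and the CNOT
reads the logical bit from one of them (`baconShor_ghz`).

Composition. The contraction of a network factors through any one of its tiles
(`Dressing.contract_insert`). Hence a circuit that decodes the tensor of one tile from three of
its accessible legs may be run on the qubits which carry these legs, and it replaces the tile by
its bulk qubit, by Bell pairs on the newly cut legs and by zeros (`runGates_step`). Tiles without
common edges use disjoint sets of qubits, so all moves of a round can be carried out in parallel
(`Dressing.exists_decodesRound`, `Dressing.exists_decodes`). The depth of a round is bounded
because for fixed `N` there are only finitely many tensors and sets of legs (`exists_tile_depth`).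
The greedy wedge is the smallest set of tiles closed under moves, so that each maximal run ends
with it (`IsGreedyRun.absorbed_eq`).

Tilings. Each layer determines the next one (`layer_succ`), and every tile but the central square
has one or two legs towards the centre. Once the layers outside are absorbed, a square with one
inward leg has three accessible legs, and so has a hexagon, except for `d = 4`, where a hexagon
with two inward legs may have to wait for its predecessor in the layer; of three consecutive
hexagons one has a single inward leg, so that the waiting time is bounded
(`layerAbsorbed_hexagon`). A square with two inward legs is absorbed after one of its parents.
Proceeding from the outside to the centre, all tiles are absorbed (`tiling_greedyWedge_univ`), and
the isometry property follows from the decoding of the whole network (`Dressing.norm_encode`).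

Logarithmic depth. The number of layers is logarithmic in the number of boundary qubits, because
the layers grow exponentially (`two_pow_le_layer`). A tile whose descendants on the boundary,
together with those of nearby tiles, all lie in the region is absorbed after a number of rounds
proportional to the number of layers (`absorbed_of_good`); a tile for which they all lie outside
the region is never absorbed (`not_mem_greedyWedge_of_window`). A region with few intervals leaves
only a bounded number of other tiles in each layer (`card_mixed_le`, `exists_exceptional`), and
even if these are absorbed one after the other, the number of rounds stays proportional to the
number of layers (`log_depth_decoding`).
-/

noncomputable section

namespace HybridCode

/-! ### States and circuits -/

theorem invSqrtTwo_mul_self : invSqrtTwo * invSqrtTwo = 1 / 2 := by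
  unfold invSqrtTwo
  rw [← mul_inv, ← Complex.ofReal_mul, Real.mul_self_sqrt (by norm_num)]
  norm_num

theorem invSqrtTwo_sq : invSqrtTwo ^ 2 = 1 / 2 := by
  rw [pow_two, invSqrtTwo_mul_self]

theorem invSqrtTwo_ne_zero : invSqrtTwo ≠ 0 := by
  intro h
  have := invSqrtTwo_mul_self
  simp [h] at this

theorem sqrtTwo_mul_invSqrtTwo : ((Real.sqrt 2 : ℝ) : ℂ) * invSqrtTwo = 1 := by
  unfold invSqrtTwo
  apply mul_inv_cancel₀
  simp

section Gates

variable {Q : Type}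

/-- The unitary of a list of gates, applied from left to right. -/
def runGates (G : List (Gate Q)) (φ : QState Q) : QState Q :=
  G.foldl (fun φ' g => g.apply φ') φ

@[simp] theorem runGates_nil (φ : QState Q) : runGates [] φ = φ := rfl

@[simp] theorem runGates_cons (g : Gate Q) (G : List (Gate Q)) (φ : QState Q) :
    runGates (g :: G) φ = runGates G (g.apply φ) := rfl

theorem runGates_append (G G' : List (Gate Q)) (φ : QState Q) :
    runGates (G ++ G') φ = runGates G' (runGates G φ) := by
  simp [runGates]

theorem Circuit.run_eq_runGates (C : Circuit Q) (φ : QState Q) :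
    C.run φ = runGates C.flatten φ := by
  induction C generalizing φ with
  | nil => rfl
  | cons l C ih =>
    rw [List.flatten_cons, runGates_append, ← ih]
    rfl

theorem Circuit.run_append (C C' : Circuit Q) (φ : QState Q) :
    Circuit.run (C ++ C') φ = C'.run (C.run φ) := by
  simp [Circuit.run_eq_runGates, runGates_append]

/-- The circuit that performs one gate per layer. -/
def sequential (G : List (Gate Q)) : Circuit Q := G.map fun g => [g]

theorem run_sequential (G : List (Gate Q)) (φ : QState Q) :
    (sequential G).run φ = runGates G φ := by
  rw [Circuit.run_eq_runGates]
  congr 1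
  induction G with
  | nil => rfl
  | cons g G ih => simpa [sequential] using ih

theorem sequential_layered (G : List (Gate Q)) : (sequential G).Layered := by
  intro l hl
  obtain ⟨g, -, rfl⟩ := List.mem_map.1 hl
  simp

theorem sequential_actsOn {G : List (Gate Q)} {S : Set Q} (h : ∀ g ∈ G, g.support ⊆ S) :
    (sequential G).ActsOn S := by
  intro l hl g hg
  obtain ⟨g', hg', rfl⟩ := List.mem_map.1 hl
  simp only [List.mem_singleton] at hg
  exact hg ▸ h g' hg'

theorem mem_flatten_support {C : Circuit Q} {S : Set Q} (h : C.ActsOn S) :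
    ∀ g ∈ C.flatten, g.support ⊆ S := by
  intro g hg
  obtain ⟨l, hl, hgl⟩ := List.mem_flatten.1 hg
  exact h l hl g hgl

theorem Gate.apply_sum {ι : Type} (g : Gate Q) (s : Finset ι) (a : ι → ℂ) (φ : ι → QState Q) :
    g.apply (fun y => ∑ i ∈ s, a i * φ i y) = fun y => ∑ i ∈ s, a i * g.apply (φ i) y := by
  funext y
  cases g with
  | hadamard q =>
    simp only [Gate.apply, Finset.mul_sum, ← Finset.sum_add_distrib]
    exact Finset.sum_congr rfl fun i _ => by ring
  | phase q =>
    simp only [Gate.apply, Finset.mul_sum]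
    exact Finset.sum_congr rfl fun i _ => by ring
  | cnot p q h => rfl

theorem runGates_sum {ι : Type} (G : List (Gate Q)) (s : Finset ι) (a : ι → ℂ)
    (φ : ι → QState Q) :
    runGates G (fun y => ∑ i ∈ s, a i * φ i y) = fun y => ∑ i ∈ s, a i * runGates G (φ i) y := by
  induction G generalizing φ with
  | nil => rfl
  | cons g G ih => rw [runGates_cons, Gate.apply_sum, ih]; rfl

/-! ### Inverses and norms -/

/-- A list of gates that undoes a gate. -/
def Gate.undo : Gate Q → List (Gate Q)
  | .hadamard q => [.hadamard q]
  | .phase q => [.phase q, .phase q, .phase q]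
  | .cnot p q h => [.cnot p q h]

theorem Gate.undo_support (g : Gate Q) : ∀ g' ∈ g.undo, g'.support = g.support := by
  cases g <;> simp [Gate.undo, Gate.support]

theorem Gate.runGates_undo (g : Gate Q) (φ : QState Q) : runGates g.undo (g.apply φ) = φ := by
  funext y
  cases g with
  | hadamard q =>
    have h2 := invSqrtTwo_mul_self
    have hy : Function.update y q (y q) = y := Function.update_eq_self q y
    simp only [Gate.undo, runGates_cons, runGates_nil, Gate.apply, Function.update_idem,
      Function.update_self]
    cases hq : y q <;> rw [hq] at hy <;> simp only [hy] <;> norm_num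
    · linear_combination (2 * φ y) * h2
    · linear_combination (2 * φ y) * h2
  | phase q =>
    simp only [Gate.undo, runGates_cons, runGates_nil, Gate.apply]
    cases y q
    · simp
    · simp only [if_true]
      linear_combination (Complex.I ^ 2 - 1) * φ y * Complex.I_sq
  | cnot p q h =>
    simp only [Gate.undo, runGates_cons, runGates_nil, Gate.apply]
    congr 1
    rw [Function.update_idem, Function.update_self, Function.update_of_ne h]
    simp

/-- A list of gates that undoes a list of gates. -/
def undoGates : List (Gate Q) → List (Gate Q)
  | [] => []
  | g :: G => undoGates G ++ g.undo

theorem runGates_undoGates (G : List (Gate Q)) (φ : QState Q) :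
    runGates (undoGates G) (runGates G φ) = φ := by
  induction G generalizing φ with
  | nil => rfl
  | cons g G ih =>
    rw [undoGates, runGates_cons, runGates_append, ih, Gate.runGates_undo]

theorem undoGates_support {G : List (Gate Q)} {S : Set Q} (h : ∀ g ∈ G, g.support ⊆ S) :
    ∀ g ∈ undoGates G, g.support ⊆ S := by
  induction G with
  | nil => simp [undoGates]
  | cons g G ih =>
    intro g' hg'
    rcases List.mem_append.1 hg' with h1 | h1
    · exact ih (fun g hg => h g (List.mem_cons_of_mem _ hg)) g' h1
    · rw [g.undo_support g' h1]
      exact h g List.mem_cons_self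

theorem sum_comp_involutive [Fintype Q] (f : (Q → Bool) → (Q → Bool))
    (hf : Function.Involutive f) (F : (Q → Bool) → ℝ) : ∑ y, F (f y) = ∑ y, F y :=
  Equiv.sum_comp hf.toPerm F

/-- Gates preserve the norm. For a Hadamard gate this is the parallelogram identity, applied to the
pairs of basis states that differ in the qubit of the gate. -/
theorem Gate.norm_apply [Fintype Q] (g : Gate Q) (φ : QState Q) :
    ∑ y, ‖g.apply φ y‖ ^ 2 = ∑ y, ‖φ y‖ ^ 2 := by
  cases g with
  | hadamard q =>
    have hflip : Function.Involutive fun y : Q → Bool => Function.update y q (!y q) := by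
      intro y
      funext r
      by_cases hr : r = q
      · subst hr; simp
      · simp [hr]
    have key : ∀ y, ‖(Gate.hadamard q).apply φ y‖ ^ 2
        + ‖(Gate.hadamard q).apply φ (Function.update y q (!y q))‖ ^ 2
        = ‖φ y‖ ^ 2 + ‖φ (Function.update y q (!y q))‖ ^ 2 := by
      intro y
      have hn : ‖invSqrtTwo‖ ^ 2 = 1 / 2 := by
        rw [← norm_pow, invSqrtTwo_sq]; norm_num
      have par : ∀ a b : ℂ, ‖a + b‖ ^ 2 + ‖a - b‖ ^ 2 = 2 * (‖a‖ ^ 2 + ‖b‖ ^ 2) := by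
        intro a b
        have := parallelogram_law_with_norm ℝ a b
        nlinarith [this]
      have hy : Function.update y q (y q) = y := Function.update_eq_self q y
      simp only [Gate.apply, Function.update_idem, Function.update_self, norm_mul, mul_pow, hn]
      cases hq : y q <;> rw [hq] at hy <;> simp [hy, ← sub_eq_add_neg]
      · have := par (φ y) (φ (Function.update y q true)); linarith
      · have := par (φ (Function.update y q false)) (φ y); linarith
    have h1 := sum_comp_involutive _ hflip fun y => ‖(Gate.hadamard q).apply φ y‖ ^ 2
    have h2 := sum_comp_involutive _ hflip fun y => ‖φ y‖ ^ 2
    have h3 := Finset.sum_congr (rfl : (Finset.univ : Finset (Q → Bool)) = _) fun y _ => key y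
    rw [Finset.sum_add_distrib, Finset.sum_add_distrib] at h3
    linarith
  | phase q =>
    refine Finset.sum_congr rfl fun y _ => ?_
    simp only [Gate.apply]
    cases y q <;> simp
  | cnot p q h =>
    refine sum_comp_involutive (fun y => Function.update y q (xor (y p) (y q))) ?_
      fun y => ‖φ y‖ ^ 2
    intro y
    simp only [Function.update_idem, Function.update_self, Function.update_of_ne h]
    simp

theorem runGates_norm [Fintype Q] (G : List (Gate Q)) (φ : QState Q) :
    ∑ y, ‖runGates G φ y‖ ^ 2 = ∑ y, ‖φ y‖ ^ 2 := by
  induction G generalizing φ with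
  | nil => rfl
  | cons g G ih => rw [runGates_cons, ih, Gate.norm_apply]

/-! ### Local operators -/

/-- The bit string that is `v` on `S` and `y` elsewhere. -/
def splice (S : Finset Q) (v : S → Bool) (y : Q → Bool) : Q → Bool :=
  fun q => if h : q ∈ S then v ⟨q, h⟩ else y q

theorem splice_mem {S : Finset Q} (v : S → Bool) (y : Q → Bool) {q : Q} (h : q ∈ S) :
    splice S v y q = v ⟨q, h⟩ := by simp [splice, h]

theorem splice_not_mem {S : Finset Q} (v : S → Bool) (y : Q → Bool) {q : Q} (h : q ∉ S) :
    splice S v y q = y q := by simp [splice, h]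

theorem localOp_apply (S : Finset Q) (K : Matrix (S → Bool) (S → Bool) ℂ) (φ : QState Q)
    (y : Q → Bool) : localOp S K φ y = ∑ v, K (fun q => y q) v * φ (splice S v y) := rfl

theorem localOp_localOp (S : Finset Q) (K K' : Matrix (S → Bool) (S → Bool) ℂ) (φ : QState Q) :
    localOp S K (localOp S K' φ) = localOp S (K * K') φ := by
  funext y
  simp only [localOp_apply, Matrix.mul_apply, Finset.mul_sum, Finset.sum_mul]
  rw [Finset.sum_comm]
  refine Finset.sum_congr rfl fun v' _ => Finset.sum_congr rfl fun v _ => ?_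
  have h1 : (fun q : S => splice S v y q) = v := by
    funext q; simp [splice]
  have h2 : splice S v' (splice S v y) = splice S v' y := by
    funext q; by_cases h : q ∈ S <;> simp [splice, h]
  rw [h1, h2, mul_assoc]

theorem localOp_comm {S S' : Finset Q} (hS : Disjoint S S') (K : Matrix (S → Bool) (S → Bool) ℂ)
    (K' : Matrix (S' → Bool) (S' → Bool) ℂ) (φ : QState Q) :
    localOp S K (localOp S' K' φ) = localOp S' K' (localOp S K φ) := by
  funext y
  simp only [localOp_apply, Finset.mul_sum]
  rw [Finset.sum_comm]
  refine Finset.sum_congr rfl fun v' _ => Finset.sum_congr rfl fun v _ => ?_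
  have h1 : (fun q : S' => splice S v y q) = fun q : S' => y q := by
    funext q; exact splice_not_mem _ _ (Finset.disjoint_right.1 hS q.2)
  have h2 : (fun q : S => splice S' v' y q) = fun q : S => y q := by
    funext q; exact splice_not_mem _ _ (Finset.disjoint_left.1 hS q.2)
  have h3 : splice S' v' (splice S v y) = splice S v (splice S' v' y) := by
    funext q
    by_cases h : q ∈ S
    · simp [splice, h, Finset.disjoint_left.1 hS h]
    · by_cases h' : q ∈ S' <;> simp [splice, h, h']
  rw [h1, h2, h3]
  ring

theorem localOp_one (S : Finset Q) (φ : QState Q) : localOp S 1 φ = φ := by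
  funext y
  rw [localOp_apply, Finset.sum_eq_single fun q : S => y q]
  · have : splice S (fun q : S => y q) y = y := by
      funext q; by_cases h : q ∈ S <;> simp [splice, h]
    simp [this]
  · intro v _ hv
    simp [hv.symm]
  · simp

/-- A gate is a local operator on every set of qubits containing its support. -/
theorem Gate.exists_localOp (g : Gate Q) {S : Finset Q} (hg : g.support ⊆ ↑S) :
    ∃ K, ∀ φ, g.apply φ = localOp S K φ := by
  have main : ∀ f : (S → Bool) → (S → Bool), ∀ f' : (Q → Bool) → (Q → Bool),
      (∀ y, f' y = splice S (f fun q => y q) y) → ∀ k : (S → Bool) → ℂ, ∀ φ : QState Q, ∀ y,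
      localOp S (Matrix.of fun u v => if v = f u then k u else 0) φ y = k (fun q => y q) * φ (f' y) := by
    intro f f' hf k φ y
    rw [localOp_apply, Finset.sum_eq_single (f fun q => y q)]
    · simp [hf]
    · intro v _ hv; simp [hv]
    · simp
  have upd : ∀ (y : Q → Bool) (q : Q) (hq : q ∈ S) (b : Bool),
      Function.update y q b = splice S (Function.update (fun q' : S => y q') ⟨q, hq⟩ b) y := by
    intro y q hq b
    funext r
    by_cases hr : r ∈ S
    · by_cases hrq : r = q
      · subst hrq; simp [splice, hr]
      · rw [Function.update_of_ne hrq, splice_mem _ _ hr, Function.update_of_ne]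
        simpa using hrq
    · rw [splice_not_mem _ _ hr, Function.update_of_ne]
      rintro rfl; exact hr hq
  have add : ∀ (K K' : Matrix (S → Bool) (S → Bool) ℂ) (φ : QState Q) (y),
      localOp S (K + K') φ y = localOp S K φ y + localOp S K' φ y := by
    intro K K' φ y
    simp [localOp_apply, add_mul, Finset.sum_add_distrib]
  cases g with
  | hadamard q =>
    have hq : q ∈ S := by simpa [Gate.support] using hg
    refine ⟨(Matrix.of fun u v => if v = Function.update u ⟨q, hq⟩ false then invSqrtTwo else 0) +
      (Matrix.of fun u v => if v = Function.update u ⟨q, hq⟩ true then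
        (invSqrtTwo * if u ⟨q, hq⟩ then -1 else 1) else 0), fun φ => ?_⟩
    funext y
    rw [add, main _ _ (fun y => upd y q hq false) (fun _ => invSqrtTwo),
      main _ _ (fun y => upd y q hq true) (fun u => invSqrtTwo * if u ⟨q, hq⟩ then -1 else 1)]
    simp only [Gate.apply]
    ring
  | phase q =>
    have hq : q ∈ S := by simpa [Gate.support] using hg
    refine ⟨Matrix.of fun u v => if v = u then (if u ⟨q, hq⟩ then Complex.I else 1) else 0, fun φ => ?_⟩
    funext y
    refine Eq.trans ?_ (main id id (fun y => by funext r; by_cases hr : r ∈ S <;> simp [splice, hr])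
      (fun u => if u ⟨q, hq⟩ then Complex.I else 1) φ y).symm
    rfl
  | cnot p q h =>
    have hp : p ∈ S := hg (by simp [Gate.support])
    have hq : q ∈ S := hg (by simp [Gate.support])
    refine ⟨Matrix.of fun u v => if v = Function.update u ⟨q, hq⟩ (xor (u ⟨p, hp⟩) (u ⟨q, hq⟩))
      then 1 else 0, fun φ => ?_⟩
    funext y
    rw [main _ _ (fun y => upd y q hq (xor (y p) (y q))) (fun _ => 1)]
    simp [Gate.apply]

theorem runGates_exists_localOp {G : List (Gate Q)} {S : Finset Q}
    (hG : ∀ g ∈ G, g.support ⊆ ↑S) : ∃ K, ∀ φ, runGates G φ = localOp S K φ := by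
  induction G with
  | nil => exact ⟨1, fun φ => (localOp_one S φ).symm⟩
  | cons g G ih =>
    obtain ⟨K, hK⟩ := ih fun g hg => hG g (List.mem_cons_of_mem _ hg)
    obtain ⟨K', hK'⟩ := g.exists_localOp (hG g List.mem_cons_self)
    exact ⟨K * K', fun φ => by rw [runGates_cons, hK, hK', localOp_localOp]⟩

theorem Gate.support_finite (g : Gate Q) : g.support.Finite := by
  cases g <;> simp [Gate.support]

theorem Gate.apply_comm {g g' : Gate Q} (h : Disjoint g.support g'.support) (φ : QState Q) :
    g.apply (g'.apply φ) = g'.apply (g.apply φ) := by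
  obtain ⟨K, hK⟩ := g.exists_localOp (S := g.support_finite.toFinset) (by simp)
  obtain ⟨K', hK'⟩ := g'.exists_localOp (S := g'.support_finite.toFinset) (by simp)
  rw [hK, hK', hK', hK]
  apply localOp_comm
  rw [Finset.disjoint_left]
  intro q hq hq'
  exact Set.disjoint_left.1 h (by simpa using hq) (by simpa using hq')

theorem runGates_apply_comm {G : List (Gate Q)} {g : Gate Q}
    (h : ∀ g' ∈ G, Disjoint g.support g'.support) (φ : QState Q) :
    runGates G (g.apply φ) = g.apply (runGates G φ) := by
  induction G generalizing φ with
  | nil => rfl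
  | cons g' G ih =>
    rw [runGates_cons, runGates_cons, ← Gate.apply_comm (h g' List.mem_cons_self),
      ih fun g'' hg'' => h g'' (List.mem_cons_of_mem _ hg'')]

/-- Operator pushing bounds dimensions. Suppose that every operator on the complement `S'` of `S`
can be replaced by one on `S`, for all states `T x` of a family in which each state has an amplitude
that vanishes for the others. Then the vectors `(T x)(s, ·)`, where `s` runs through the bit strings
on `S`, span the whole space of functions of `x` and of the bits on `S'`. -/
theorem card_mul_le_of_push {R : Type} [Fintype R] [Fintype Q] {S S' : Finset Q}
    (hS : ∀ q, q ∈ S' ↔ q ∉ S)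
    (T : R → QState Q) (hpush : ∀ K, ∃ K', ∀ x, localOp S' K (T x) = localOp S K' (T x))
    (hT : ∀ x, ∃ y, T x y ≠ 0 ∧ ∀ x', x' ≠ x → T x' y = 0) :
    Fintype.card R * 2 ^ S'.card ≤ 2 ^ S.card := by
  let V : (S → Bool) → (R × (S' → Bool) → ℂ) := fun s r =>
    T r.1 (splice S' r.2 (splice S s fun _ => false))
  have hspan : Submodule.span ℂ (Set.range V) = ⊤ := by
    rw [eq_top_iff, ← (Pi.basisFun ℂ (R × (S' → Bool))).span_eq, Submodule.span_le]
    rintro _ ⟨⟨x₀, t⟩, rfl⟩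
    obtain ⟨y₀, hy₀, hx₀⟩ := hT x₀
    -- The operator that turns the bits `y₀` outside `S` into `t`, and kills all others, isolates
    -- one basis vector.
    obtain ⟨K', hK'⟩ := hpush (Matrix.of fun u v => if u = t ∧ v = (fun q : S' => y₀ q) then 1 else 0)
    have key : (T x₀ y₀) • (Pi.basisFun ℂ (R × (S' → Bool))) (x₀, t) =
        ∑ s, K' (fun q : S => y₀ q) s • V s := by
      funext ⟨x, t'⟩
      have h := congrFun (hK' x) (splice S' t' y₀)
      rw [localOp_apply, localOp_apply, Finset.sum_eq_single fun q : S' => y₀ q] at h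
      · have e1 : splice S' (fun q : S' => y₀ q) (splice S' t' y₀) = y₀ := by
          funext q; by_cases hq : q ∈ S' <;> simp [splice, hq]
        have e2 : (fun q : S' => splice S' t' y₀ q) = t' := by
          funext q; simp [splice_mem _ _ q.2]
        have e3 : (fun q : ↥S => splice S' t' y₀ q) = fun q : S => y₀ q := by
          funext q; exact splice_not_mem _ _ (by simp [hS])
        have e4 : ∀ s, splice S s (splice S' t' y₀) =
            splice S' t' (splice S s fun _ => false) := by
          intro s; funext q
          by_cases hq : q ∈ S
          · simp [splice, hS, hq]
          · simp [splice, hS, hq]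
        simp only [e1, e2, e3, e4] at h
        simp only [Pi.smul_apply, Finset.sum_apply, smul_eq_mul, Pi.basisFun_apply]
        refine Eq.trans ?_ h
        by_cases hx : x = x₀
        · subst hx
          by_cases ht : t' = t
          · subst ht; simp
          · simp [ht]
        · simp [hx, hx₀ x hx]
      · intro v _ hv
        simp [hv]
      · simp
    have hmem : (T x₀ y₀) • (Pi.basisFun ℂ (R × (S' → Bool))) (x₀, t) ∈
        Submodule.span ℂ (Set.range V) := by
      rw [key]
      exact Submodule.sum_mem _ fun s _ =>
        Submodule.smul_mem _ _ (Submodule.subset_span ⟨s, rfl⟩)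
    exact (Submodule.smul_mem_iff _ hy₀).1 hmem
  have h := finrank_range_le_card (R := ℂ) V
  rw [Set.finrank, hspan, finrank_top, Module.finrank_pi] at h
  simpa using h

end Gates

/-! ### Bell pairs -/

section Bell

variable {Q : Type} [Fintype Q]

theorem bellAndZeros_eq (S : Finset Q) (β : Q → Q) (L : Set Q) (y : Q → Bool) :
    bellAndZeros S β L y =
      if (∀ q ∈ S, q ∉ L → (∀ j, j ∉ S → β j ≠ q) → y q = false) ∧ ∀ j, j ∉ S → y (β j) = y j
      then invSqrtTwo ^ (Finset.univ.filter fun j => j ∉ S).card else 0 := by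
  unfold bellAndZeros
  have h1 : (∏ q : Q, if q ∈ S ∧ q ∉ L ∧ (∀ j, j ∉ S → β j ≠ q) then
      (if y q then (0 : ℂ) else 1) else 1) =
      if ∀ q ∈ S, q ∉ L → (∀ j, j ∉ S → β j ≠ q) → y q = false then 1 else 0 := by
    split_ifs with h
    · refine Finset.prod_eq_one fun q _ => ?_
      split_ifs with h1 h2
      · simp [h q h1.1 h1.2.1 h1.2.2] at h2
      · rfl
      · rfl
    · push Not at h
      obtain ⟨q, h1, h2, h3, h4⟩ := h
      refine Finset.prod_eq_zero (Finset.mem_univ q) ?_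
      rw [if_pos ⟨h1, h2, h3⟩, if_pos (by simpa using h4)]
  have h2 : (∏ j : Q, if j ∉ S then (if y (β j) = y j then invSqrtTwo else 0) else 1) =
      if ∀ j, j ∉ S → y (β j) = y j then
        invSqrtTwo ^ (Finset.univ.filter fun j => j ∉ S).card else 0 := by
    split_ifs with h
    · rw [← Finset.prod_const, Finset.prod_filter]
      refine Finset.prod_congr rfl fun j _ => ?_
      by_cases h1 : j ∉ S
      · rw [if_pos h1, if_pos h1, if_pos (h j h1)]
      · rw [if_neg h1, if_neg h1]
    · push Not at h
      obtain ⟨j, h1, h2⟩ := h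
      refine Finset.prod_eq_zero (Finset.mem_univ j) ?_
      rw [if_pos h1, if_neg h2]
  rw [h1, h2, ite_and]
  split_ifs <;> simp

/-- Operators can be moved through Bell pairs. The factor `F` collects what is not entangled
with `Sᶜ`. -/
theorem push_bell {S S' : Finset Q} (hS : ∀ q, q ∈ S' ↔ q ∉ S) (β : Q → Q)
    (hβ : Set.InjOn β {j | j ∉ S})
    (hβS : ∀ j, j ∉ S → β j ∈ S) (K : Matrix (S' → Bool) (S' → Bool) ℂ) :
    ∃ K', ∀ F : QState Q,
      (∀ y y', (∀ q ∈ S, (∀ j, j ∉ S → β j ≠ q) → y q = y' q) → F y = F y') →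
      localOp S' K (fun y => if ∀ j, j ∉ S → y (β j) = y j then F y else 0) =
        localOp S K' (fun y => if ∀ j, j ∉ S → y (β j) = y j then F y else 0) := by
  let bs : (S → Bool) → (S' → Bool) := fun u j => u ⟨β j, hβS j ((hS _).1 j.2)⟩
  -- On a Bell pair, an operator on one half equals its transpose on the other half; so `K'` is the
  -- transpose of `K` on the partners of the qubits outside `S`, and the identity on the rest of
  -- `S`.
  refine ⟨Matrix.of fun u v => if ∀ q : S, (∀ j, j ∉ S → β j ≠ q) → u q = v q then K (bs v) (bs u) else 0,
    fun F hF => ?_⟩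
  funext y
  rw [localOp_apply, localOp_apply, Finset.sum_eq_single (bs fun q : S => y q)]
  · -- the only matrix element on the other side that meets the Bell pairs
    let v₀ : S → Bool := fun q => if h : ∃ j, j ∉ S ∧ β j = q then y h.choose else y q
    have hv₀ : ∀ j (hj : j ∉ S), v₀ ⟨β j, hβS j hj⟩ = y j := by
      intro j hj
      have h : ∃ j', j' ∉ S ∧ β j' = β j := ⟨j, hj, rfl⟩
      have : h.choose = j := hβ h.choose_spec.1 hj h.choose_spec.2
      simp only [v₀, dif_pos h, this]
    have hv₁ : ∀ q : S, (∀ j, j ∉ S → β j ≠ q) → v₀ q = y q := by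
      intro q hq
      simp only [v₀]
      rw [dif_neg]
      rintro ⟨j, hj, h⟩
      exact hq j hj h
    rw [Finset.sum_eq_single v₀]
    · rw [Matrix.of_apply, if_pos, if_pos, if_pos, hF (splice S' _ y) (splice S v₀ y)]
      · congr 2
        funext j
        exact (hv₀ j ((hS _).1 j.2)).symm
      · intro q hq hq'
        rw [splice_not_mem _ _ (by simp [hS, hq]), splice_mem _ _ hq, hv₁ ⟨q, hq⟩ hq']
      · intro j hj
        rw [splice_mem _ _ (hβS j hj), splice_not_mem _ _ hj, hv₀ j hj]
      · intro q hq
        exact (hv₁ q hq).symm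
      · intro j hj
        rw [splice_not_mem _ _ fun h => (hS _).1 h (hβS j hj), splice_mem _ _ ((hS j).2 hj)]
    · intro v _ hv
      rw [Matrix.of_apply]
      by_cases h1 : ∀ q : S, (∀ j, j ∉ S → β j ≠ q) → y q = v q
      swap
      · rw [if_neg h1, zero_mul]
      by_cases h2 : ∀ j, j ∉ S → splice S v y (β j) = splice S v y j
      swap
      · rw [if_neg h2, mul_zero]
      · exfalso
        apply hv
        funext q
        by_cases hq : ∃ j, j ∉ S ∧ β j = q
        · obtain ⟨j, hj, hjq⟩ := hq
          have hq' : q = ⟨β j, hβS j hj⟩ := Subtype.ext hjq.symm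
          have := h2 j hj
          rw [splice_mem _ _ (hβS j hj), splice_not_mem _ _ hj] at this
          rw [hq', this, hv₀ j hj]
        · have hq' : ∀ j, j ∉ S → β j ≠ q := fun j hj h => hq ⟨j, hj, h⟩
          rw [← h1 q hq', hv₁ q hq']
    · simp
  · intro v _ hv
    rw [if_neg, mul_zero]
    intro h
    apply hv
    funext j
    have hj := (hS _).1 j.2
    have := h j hj
    rw [splice_not_mem _ _ (by simpa [hS] using hβS j hj), splice_mem _ _ j.2] at this
    exact this.symm
  · simp

end Bell

/-! ### Relabelling the qubits of a circuit -/

section Relabel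

variable {K Q : Type}

/-- The gate `g` with its qubits relabelled by `e`. The map `e` need only be injective where it
matters; a controlled gate whose two qubits collide is replaced by an arbitrary gate. -/
def Gate.map (e : K → Q) : Gate K → Gate Q
  | .hadamard q => .hadamard (e q)
  | .phase q => .phase (e q)
  | .cnot p q _ => if h : e p ≠ e q then .cnot (e p) (e q) h else .phase (e q)

theorem Gate.map_support (e : K → Q) (g : Gate K) : (g.map e).support ⊆ e '' g.support := by
  cases g with
  | hadamard q => simp [Gate.map, Gate.support]
  | phase q => simp [Gate.map, Gate.support]
  | cnot p q h =>
    by_cases h' : e p = e q <;> simp [Gate.map, h', Gate.support, Set.image_pair]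

/-- A gate acts on the factor `τ` of a state whose other factor `c` does not involve the qubits
of the gate. Here `η` reads off the argument of `τ`. -/
theorem Gate.map_apply (e : K → Q) (S : Set K) (he : Set.InjOn e S) (c : QState Q)
    (η : (Q → Bool) → K → Bool)
    (hc : ∀ y, ∀ k ∈ S, ∀ b, c (Function.update y (e k) b) = c y)
    (hη : ∀ y, ∀ k ∈ S, ∀ b, η (Function.update y (e k) b) = Function.update (η y) k b)
    (hη' : ∀ y, ∀ k ∈ S, η y k = y (e k)) (g : Gate K) (hg : g.support ⊆ S) (τ : QState K) :
    (g.map e).apply (fun y => c y * τ (η y)) = fun y => c y * g.apply τ (η y) := by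
  funext y
  cases g with
  | hadamard q =>
    have hq : q ∈ S := hg (by simp [Gate.support])
    simp only [Gate.map, Gate.apply, hc _ _ hq, hη _ _ hq, hη' _ _ hq]
    ring
  | phase q =>
    have hq : q ∈ S := hg (by simp [Gate.support])
    simp only [Gate.map, Gate.apply, hη' _ _ hq]
    ring
  | cnot p q h =>
    have hp : p ∈ S := hg (by simp [Gate.support])
    have hq : q ∈ S := hg (by simp [Gate.support])
    have hne : e p ≠ e q := fun h' => h (he hp hq h')
    simp only [Gate.map, dif_pos hne, Gate.apply, hc _ _ hq, hη _ _ hq, hη' _ _ hq, hη' _ _ hp]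

theorem runGates_map (e : K → Q) (S : Set K) (he : Set.InjOn e S) (c : QState Q)
    (η : (Q → Bool) → K → Bool)
    (hc : ∀ y, ∀ k ∈ S, ∀ b, c (Function.update y (e k) b) = c y)
    (hη : ∀ y, ∀ k ∈ S, ∀ b, η (Function.update y (e k) b) = Function.update (η y) k b)
    (hη' : ∀ y, ∀ k ∈ S, η y k = y (e k)) (G : List (Gate K)) (hG : ∀ g ∈ G, g.support ⊆ S)
    (τ : QState K) :
    runGates (G.map (Gate.map e)) (fun y => c y * τ (η y)) = fun y => c y * runGates G τ (η y) := by
  induction G generalizing τ with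
  | nil => rfl
  | cons g G ih =>
    rw [List.map_cons, runGates_cons,
      Gate.map_apply e S he c η hc hη hη' g (hG g List.mem_cons_self),
      ih fun g hg => hG g (List.mem_cons_of_mem _ hg)]
    rfl

theorem map_gates_support (e : K → Q) {G : List (Gate K)} {S : Set K} {S' : Set Q}
    (hS : ∀ k ∈ S, e k ∈ S') (hG : ∀ g ∈ G, g.support ⊆ S) :
    ∀ g ∈ G.map (Gate.map e), g.support ⊆ S' := by
  intro g hg
  obtain ⟨g', hg', rfl⟩ := List.mem_map.1 hg
  refine (g'.map_support e).trans ?_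
  rintro _ ⟨k, hk, rfl⟩
  exact hS k (hG g' hg' hk)

end Relabel

/-! ### Decoding a single tensor -/

/-- The gates `G` on the qubits of `S` decode the family of states `φ x`: the qubit `a` (if any)
receives `x`, each qubit `j` outside `S` forms a Bell pair with `β j`, and all else in `S`
is set to zero. -/
structure LocallyDecodes {Q : Type} [Fintype Q] (S : Finset Q) (φ : Bool → QState Q)
    (G : List (Gate Q)) (β : Q → Q) (a : Option Q) : Prop where
  support : ∀ g ∈ G, g.support ⊆ ↑S
  inj : Set.InjOn β {j | j ∉ S}
  mem : ∀ j, j ∉ S → β j ∈ S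
  logical : ∀ q, a = some q → q ∈ S ∧ ∀ j, j ∉ S → β j ≠ q
  run : ∀ x y, runGates G (φ x) y =
    (if ∀ q, a = some q → y q = x then 1 else 0) * bellAndZeros S β {q | a = some q} y

/-- The condition under which the amplitude of a locally decoded state does not vanish. -/
def DecodedAt {Q : Type} (S : Finset Q) (β : Q → Q) (a : Option Q) (x : Bool) (y : Q → Bool) :
    Prop :=
  (∀ q, a = some q → y q = x) ∧
    (∀ q ∈ S, a ≠ some q → (∀ j, j ∉ S → β j ≠ q) → y q = false) ∧ ∀ j, j ∉ S → y (β j) = y j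

theorem decodedAt_amp {Q : Type} [Fintype Q] (S : Finset Q) (β : Q → Q) (a : Option Q) (x : Bool)
    (y : Q → Bool) :
    (if ∀ q, a = some q → y q = x then 1 else 0) * bellAndZeros S β {q | a = some q} y =
      if DecodedAt S β a x y then invSqrtTwo ^ (Finset.univ.filter fun j => j ∉ S).card else 0 := by
  rw [bellAndZeros_eq]
  by_cases h : DecodedAt S β a x y
  · rw [if_pos h, if_pos h.1, if_pos ⟨h.2.1, h.2.2⟩, one_mul]
  · rw [if_neg h]
    by_cases h1 : ∀ q, a = some q → y q = x
    · rw [if_pos h1, one_mul, if_neg fun h2 => h ⟨h1, h2.1, h2.2⟩]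
    · rw [if_neg h1, zero_mul]

theorem LocallyDecodes.relabel {K Q : Type} [Fintype K] [Fintype Q] {S : Finset K}
    {φ : Bool → QState K} {G : List (Gate K)} {β : K → K} {a : Option K}
    (h : LocallyDecodes S φ G β a) (σ : K ≃ Q) {S' : Finset Q} (hS : ∀ k, σ k ∈ S' ↔ k ∈ S)
    {φ' : Bool → QState Q} (hφ : ∀ x y, φ' x y = φ x fun k => y (σ k)) :
    LocallyDecodes S' φ' (G.map (Gate.map σ)) (fun q => σ (β (σ.symm q))) (a.map σ) := by
  have hS' : ∀ q, q ∈ S' ↔ σ.symm q ∈ S := fun q => by rw [← hS, Equiv.apply_symm_apply]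
  refine ⟨map_gates_support σ (fun k hk => ?_) h.support, ?_, ?_, ?_, ?_⟩
  · exact (hS k).2 hk
  · intro i hi j hj hij
    have := h.inj (fun h' => hi ((hS' i).2 h')) (fun h' => hj ((hS' j).2 h')) (σ.injective hij)
    simpa using this
  · intro j hj
    exact (hS _).2 (h.mem _ fun h' => hj ((hS' j).2 h'))
  · intro q hq
    obtain ⟨k, hk, rfl⟩ := Option.map_eq_some_iff.1 hq
    refine ⟨(hS k).2 (h.logical k hk).1, fun j hj hjk => ?_⟩
    exact (h.logical k hk).2 _ (fun h' => hj ((hS' j).2 h')) (σ.injective hjk)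
  · intro x y
    have h1 := runGates_map σ Set.univ σ.injective.injOn (fun _ => 1)
      (fun y k => y (σ k)) (fun _ _ _ _ => rfl) (fun y k _ b => by
        funext k'
        by_cases hk : k' = k
        · subst hk; simp
        · rw [Function.update_of_ne hk, Function.update_of_ne fun h' => hk (σ.injective h')])
      (fun _ _ _ => rfl) G (fun _ _ => Set.subset_univ _) (φ x)
    simp only [one_mul] at h1
    have h2 : φ' x = fun y => φ x fun k => y (σ k) := funext fun y => hφ x y
    rw [h2, h1]
    simp only
    rw [h.run, decodedAt_amp, decodedAt_amp]
    have hc : (Finset.univ.filter fun j => j ∉ S).card =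
        (Finset.univ.filter fun j => j ∉ S').card := by
      refine Finset.card_equiv σ fun k => ?_
      simp [hS]
    rw [hc]
    refine if_congr ?_ rfl rfl
    unfold DecodedAt
    refine and_congr ?_ (and_congr ?_ ?_)
    · constructor
      · intro h' q hq
        obtain ⟨k, hk, rfl⟩ := Option.map_eq_some_iff.1 hq
        exact h' k hk
      · intro h' k hk
        exact h' (σ k) (by simp [hk])
    · constructor
      · intro h' q hq hqa hqβ
        have := h' (σ.symm q) ((hS' q).1 hq) (fun h'' => hqa (by simp [h'']))
          fun j hj hjq => hqβ (σ j) (fun h'' => hj ((hS j).1 h'')) (by simp [hjq])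
        simpa using this
      · intro h' k hk hka hkβ
        refine h' (σ k) ((hS k).2 hk) (fun h'' => ?_) fun j hj hjk =>
          hkβ _ (fun h'' => hj ((hS' j).2 h'')) (σ.injective hjk)
        obtain ⟨k', hk', h3⟩ := Option.map_eq_some_iff.1 h''
        rw [σ.injective h3] at hk'
        exact hka hk'
    · constructor
      · intro h' q hq
        have := h' (σ.symm q) fun h'' => hq ((hS' q).2 h'')
        simpa using this
      · intro h' k hk
        have := h' (σ k) fun h'' => hk ((hS k).1 h'')
        simpa using this

/-- Decoding with one more qubit at hand: its Bell pair is disentangled. -/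
theorem LocallyDecodes.insert {Q : Type} [Fintype Q] {S : Finset Q}
    {φ : Bool → QState Q} {G : List (Gate Q)} {β : Q → Q} {a : Option Q}
    (h : LocallyDecodes S φ G β a) {j : Q} (hj : j ∉ S) {S' : Finset Q}
    (hS : ∀ q, q ∈ S' ↔ q = j ∨ q ∈ S) :
    ∃ G', LocallyDecodes S' φ G' β a := by
  have hjβ : j ≠ β j := fun h' => hj (h' ▸ h.mem j hj)
  have hn : ∀ {q}, q ∉ S' → q ≠ j ∧ q ∉ S := fun {q} hq => by rw [hS] at hq; tauto
  -- The CNOT gate leaves `j` in the state `(|0⟩ + |1⟩)/√2` and `β j` in the state `|0⟩`; the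
  -- Hadamard gate maps the former to `|0⟩`.
  refine ⟨G ++ [.cnot j (β j) hjβ, .hadamard j], ?_, ?_, ?_, ?_, ?_⟩
  · intro g hg
    rcases List.mem_append.1 hg with h1 | h1
    · exact (h.support g h1).trans fun q hq => by simpa [hS] using Or.inr hq
    · simp only [List.mem_cons, List.not_mem_nil, or_false] at h1
      rcases h1 with rfl | rfl
      · simp [Gate.support, Set.insert_subset_iff, hS, h.mem j hj]
      · simp [Gate.support, hS]
  · intro i hi k hk hik
    exact h.inj (hn hi).2 (hn hk).2 hik
  · intro i hi
    rw [hS]; exact Or.inr (h.mem i (hn hi).2)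
  · intro q hq
    exact ⟨(hS q).2 (Or.inr (h.logical q hq).1), fun i hi => (h.logical q hq).2 i (hn hi).2⟩
  · intro x y
    have hcard : (Finset.univ.filter fun i => i ∉ S).card =
        (Finset.univ.filter fun i => i ∉ S').card + 1 := by
      rw [← Finset.card_insert_of_notMem (a := j)
        (s := Finset.univ.filter fun i => i ∉ S') (by simp [hS])]
      congr 1
      ext i
      simp only [Finset.mem_filter, Finset.mem_univ, true_and, Finset.mem_insert, hS]
      by_cases hi : i = j <;> simp [hi, hj]
    have hrun : runGates G (φ x) = fun y => if DecodedAt S β a x y then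
        invSqrtTwo ^ (Finset.univ.filter fun i => i ∉ S).card else 0 := by
      funext y; rw [h.run, decodedAt_amp]
    have hcnot : ∀ y, DecodedAt S β a x (Function.update y (β j) (xor (y j) (y (β j)))) ↔
        (∀ q, a = some q → y q = x) ∧
        (∀ q ∈ S, a ≠ some q → (∀ i, i ∉ S' → β i ≠ q) → y q = false) ∧
        ∀ i, i ∉ S' → y (β i) = y i := by
      intro y
      set y' := Function.update y (β j) (xor (y j) (y (β j))) with hy'
      have h1 : ∀ q, q ≠ β j → y' q = y q := fun q hq => Function.update_of_ne hq _ _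
      have h2 : y' (β j) = y j ↔ y (β j) = false := by
        simp only [hy', Function.update_self]
        cases y j <;> cases y (β j) <;> simp
      have h3 : ∀ i, i ∉ S → i ≠ β j := fun i hi h' => hi (h' ▸ h.mem j hj)
      unfold DecodedAt
      constructor
      · rintro ⟨ha, hz, hb⟩
        refine ⟨fun q hq => ?_, fun q hq hqa hqβ => ?_, fun i hi => ?_⟩
        · rw [← h1 q ((h.logical q hq).2 j hj).symm]; exact ha q hq
        · by_cases hqj : q = β j
          · rw [hqj, ← h2, hb j hj]
            exact h1 j hjβ
          · rw [← h1 q hqj]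
            refine hz q hq hqa fun i hi => ?_
            by_cases hij : i = j
            · rw [hij]; exact fun h' => hqj h'.symm
            · exact hqβ i (by rw [hS]; tauto)
        · have := hb i (hn hi).2
          rwa [h1 i (h3 i (hn hi).2), h1] at this
          exact fun h' => (hn hi).1 (h.inj (hn hi).2 hj h')
      · rintro ⟨ha, hz, hb⟩
        refine ⟨fun q hq => ?_, fun q hq hqa hqβ => ?_, fun i hi => ?_⟩
        · rw [h1 q ((h.logical q hq).2 j hj).symm]; exact ha q hq
        · rw [h1 q fun h' => hqβ j hj h'.symm]
          exact hz q hq hqa fun i hi => hqβ i (hn hi).2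
        · by_cases hij : i = j
          · rw [hij, h1 j hjβ, h2]
            refine hz _ (h.mem j hj) (fun h' => (h.logical _ h').2 j hj rfl) fun i hi h' => ?_
            exact (hn hi).1 (h.inj (hn hi).2 hj h')
          · rw [h1 i (h3 i hi), h1]
            · exact hb i (by rw [hS]; tauto)
            · exact fun h' => hij (h.inj hi hj h')
    rw [runGates_append, hrun, decodedAt_amp]
    simp only [runGates_cons, runGates_nil, Gate.apply]
    simp only [hcnot]
    set D : (Q → Bool) → Prop := fun y => (∀ q, a = some q → y q = x) ∧
        (∀ q ∈ S, a ≠ some q → (∀ i, i ∉ S' → β i ≠ q) → y q = false) ∧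
        ∀ i, i ∉ S' → y (β i) = y i with hD
    -- After the CNOT gate, the amplitudes do not depend on the bit at `j`.
    have hDind : ∀ b, D (Function.update y j b) ↔ D y := by
      intro b
      have h1 : ∀ q, q ∈ S → Function.update y j b q = y q := fun q hq =>
        Function.update_of_ne (fun h0 : q = j => hj (by rw [← h0]; exact hq)) _ _
      simp only [hD]
      refine and_congr ?_ (and_congr ?_ ?_)
      · exact forall_congr' fun q => forall_congr' fun hq => by rw [h1 q (h.logical q hq).1]
      · exact forall_congr' fun q => forall_congr' fun hq => by rw [h1 q hq]
      · refine forall_congr' fun i => forall_congr' fun hi => ?_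
        rw [h1 _ (h.mem i (hn hi).2), Function.update_of_ne (hn hi).1]
    have hfin : DecodedAt S' β a x y ↔ y j = false ∧ D y := by
      unfold DecodedAt
      simp only [hD]
      constructor
      · rintro ⟨ha, hz, hb⟩
        refine ⟨hz j ((hS j).2 (Or.inl rfl)) (fun h' => hj (h.logical j h').1) fun i hi (h' : β i = j) =>
          hj (by rw [← h']; exact h.mem i (hn hi).2), ha, fun q hq => hz q ((hS q).2 (Or.inr hq)), hb⟩
      · rintro ⟨h0, ha, hz, hb⟩
        refine ⟨ha, fun q hq => ?_, hb⟩
        rcases (hS q).1 hq with rfl | hq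
        · exact fun _ _ => h0
        · exact hz q hq
    change invSqrtTwo * ((if D (Function.update y j false) then _ else 0) +
      _ * (if D (Function.update y j true) then _ else 0)) = _
    simp only [hDind, hfin, hcard, pow_succ]
    have h2 := invSqrtTwo_mul_self
    by_cases hDy : D y
    · cases hyj : y j
      · simp only [hDy, if_true, and_self]
        simp only [Bool.false_eq_true, if_false]
        linear_combination
          (2 * invSqrtTwo ^ (Finset.univ.filter fun i => i ∉ S').card) * h2
      · simp [hDy]
    · simp [hDy]

theorem LocallyDecodes.mono {Q : Type} [Fintype Q] {S : Finset Q}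
    {φ : Bool → QState Q} {G : List (Gate Q)} {β : Q → Q} {a : Option Q}
    (h : LocallyDecodes S φ G β a) {S' : Finset Q} (hS : S ⊆ S') :
    ∃ G', LocallyDecodes S' φ G' β a := by
  obtain ⟨T, rfl⟩ : ∃ T, S' = S ∪ T := ⟨S', by ext q; simpa using fun h => hS h⟩
  clear hS
  induction T using Finset.induction_on with
  | empty => exact ⟨G, by simpa using h⟩
  | insert j T _ ih =>
    obtain ⟨G', hG'⟩ := ih
    by_cases hj : j ∈ S ∪ T
    · refine ⟨G', ?_⟩
      rwa [Finset.union_insert, Finset.insert_eq_of_mem hj]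
    · exact hG'.insert hj fun q => by simp

/-! ### Exact evaluation of small circuits -/

/-- The complex number with the given real and imaginary parts. -/
def toComplex (z : ℤ × ℤ) : ℂ := z.1 + z.2 * Complex.I

theorem toComplex_add (z w : ℤ × ℤ) : toComplex (z + w) = toComplex z + toComplex w := by
  simp [toComplex]; ring

theorem toComplex_sub (z w : ℤ × ℤ) : toComplex (z - w) = toComplex z - toComplex w := by
  simp [toComplex]; ring

theorem toComplex_mul_I (z : ℤ × ℤ) : toComplex (-z.2, z.1) = Complex.I * toComplex z := by
  simp only [toComplex, Int.cast_neg]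
  linear_combination (-(z.2 : ℂ)) * Complex.I_sq

/-- Amplitudes after a list of gates, the last gate first, with Gaussian integer amplitudes `m`
before it and Hadamard gates without their normalization. -/
def evalGates {Q : Type} [DecidableEq Q] (m : (Q → Bool) → ℤ × ℤ) :
    List (Gate Q) → (Q → Bool) → ℤ × ℤ
  | [], y => m y
  | .hadamard q :: G, y =>
    match y q with
    | false => evalGates m G (Function.update y q false) + evalGates m G (Function.update y q true)
    | true => evalGates m G (Function.update y q false) - evalGates m G (Function.update y q true)
  | .phase q :: G, y =>
    match y q with
    | false => evalGates m G y
    | true => (-(evalGates m G y).2, (evalGates m G y).1)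
  | .cnot p q _ :: G, y =>
    match xor (y p) (y q) with
    | false => evalGates m G (Function.update y q false)
    | true => evalGates m G (Function.update y q true)

/-- The number of Hadamard gates. -/
def hadamards {Q : Type} : List (Gate Q) → ℕ
  | [] => 0
  | .hadamard _ :: G => hadamards G + 1
  | .phase _ :: G => hadamards G
  | .cnot _ _ _ :: G => hadamards G

theorem runGates_eq_evalGates {Q : Type} [inst : DecidableEq Q] (κ : ℂ) (φ : QState Q)
    (m : (Q → Bool) → ℤ × ℤ) (h : ∀ y, φ y = κ * toComplex (m y)) (G : List (Gate Q))
    (y : Q → Bool) : runGates G.reverse φ y =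
      κ * invSqrtTwo ^ hadamards G * toComplex (evalGates m G y) := by
  have hinst : inst = fun a b => Classical.propDecidable (a = b) := Subsingleton.elim _ _
  subst hinst
  induction G generalizing y with
  | nil => simp [hadamards, evalGates, h]
  | cons g G ih =>
    rw [List.reverse_cons, runGates_append, runGates_cons, runGates_nil]
    cases g with
    | hadamard q =>
      simp only [Gate.apply, ih, hadamards, evalGates]
      cases y q
      · simp only [toComplex_add, Bool.false_eq_true, if_false]; ring
      · simp only [toComplex_sub, if_true]; ring
    | phase q =>
      simp only [Gate.apply, ih, hadamards, evalGates]
      cases y q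
      · simp
      · simp only [if_true, toComplex_mul_I]; ring
    | cnot p q hpq =>
      simp only [Gate.apply, ih, hadamards, evalGates]
      cases xor (y p) (y q) <;> rfl

/-- It can be decided by a computation with Gaussian integers whether a circuit decodes a state. The
Hadamard gates together with the normalization of the state contribute `2 k` factors `1/√2` more
than the Bell pairs have, which are made up for by the amplitude `2 ^ k`. -/
theorem locallyDecodes_of_eval {n : ℕ} {S : Finset (Fin n)} {φ : Bool → QState (Fin n)}
    {G : List (Gate (Fin n))} {β : Fin n → Fin n} {a : Option (Fin n)} {e k : ℕ}
    {m : Bool → (Fin n → Bool) → ℤ × ℤ} (hφ : ∀ x y, φ x y = invSqrtTwo ^ e * toComplex (m x y))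
    (hk : e + hadamards G = (Finset.univ.filter fun j => j ∉ S).card + 2 * k)
    (support : ∀ g ∈ G, g.support ⊆ ↑S)
    (inj : Set.InjOn β {j | j ∉ S}) (mem : ∀ j, j ∉ S → β j ∈ S)
    (logical : ∀ q, a = some q → q ∈ S ∧ ∀ j, j ∉ S → β j ≠ q)
    (eval : ∀ x y, evalGates (m x) G y = if (∀ q, a = some q → y q = x) ∧
      (∀ q ∈ S, a ≠ some q → (∀ j, j ∉ S → β j ≠ q) → y q = false) ∧ ∀ j, j ∉ S → y (β j) = y j
      then (2 ^ k, 0) else (0, 0)) :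
    LocallyDecodes S φ G.reverse β a := by
  refine ⟨fun g hg => support g (List.mem_reverse.1 hg), inj, mem, logical, fun x y => ?_⟩
  rw [decodedAt_amp, runGates_eq_evalGates _ _ _ (hφ x), eval, ← pow_add, hk]
  by_cases h : DecodedAt S β a x y
  · have h' := h
    unfold DecodedAt at h'
    rw [if_pos h, if_pos h', pow_add, pow_mul, invSqrtTwo_sq]
    simp only [toComplex, one_div, inv_pow, Int.cast_pow, Int.cast_ofNat, Int.cast_zero, zero_mul,
      add_zero]
    field_simp
    congr!
  · have h' := h
    unfold DecodedAt at h'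
    rw [if_neg h, if_neg h']
    simp [toComplex]

/-! ### The perfect tensor -/

/-- Controlled-`Z`, with the gates in reversed order. -/
def czGates {n : ℕ} (p q : Fin n) (h : p ≠ q) : List (Gate (Fin n)) :=
  [.cnot p q h, .phase q, .phase q, .phase q, .cnot p q h, .phase q, .phase p]

/-- Pauli `Z`. -/
def zGates {n : ℕ} (q : Fin n) : List (Gate (Fin n)) := [.phase q, .phase q]

/-- The amplitudes of the perfect tensor, without normalization. -/
def perfectInt (u : Fin 6 → Bool) : ℤ × ℤ :=
  match xor (u 0) (xor (u 1) (xor (u 2) (xor (u 3) (xor (u 4) (u 5))))) with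
  | true => (0, 0)
  | false =>
    match xor (u 0 && u 1) (xor (u 1 && u 2) (xor (u 2 && u 3) (xor (u 3 && u 4)
      (xor (u 4 && u 0) (u 5))))) with
    | true => (-1, 0)
    | false => (1, 0)

theorem perfectTensor_eq (u : Fin 6 → Bool) :
    perfectTensor u = invSqrtTwo ^ 5 * toComplex (perfectInt u) := by
  have h1 : ∀ n : ℕ, (-1 : ℂ) ^ n = if Even n then 1 else -1 := by
    intro n
    split_ifs with h
    · exact h.neg_one_pow
    · exact (Nat.not_even_iff_odd.1 h).neg_one_pow
  have h2 : ∀ b0 b1 b2 b3 b4 b5 : Bool, Even ((if b0 then 1 else 0) + (if b1 then 1 else 0) +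
      (if b2 then 1 else 0) + (if b3 then 1 else 0) + (if b4 then 1 else 0) +
      (if b5 then 1 else 0)) ↔
      xor b0 (xor b1 (xor b2 (xor b3 (xor b4 b5)))) = false := by decide
  have h3 : ∀ b0 b1 b2 b3 b4 b5 : Bool, Even ((if b0 then 1 else 0) * (if b1 then 1 else 0) +
      (if b1 then 1 else 0) * (if b2 then 1 else 0) +
      (if b2 then 1 else 0) * (if b3 then 1 else 0) +
      (if b3 then 1 else 0) * (if b4 then 1 else 0) +
      (if b4 then 1 else 0) * (if b0 then 1 else 0) + (if b5 then 1 else 0)) ↔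
      xor (b0 && b1) (xor (b1 && b2) (xor (b2 && b3) (xor (b3 && b4) (xor (b4 && b0) b5)))) =
        false := by decide
  simp only [perfectTensor, h1, h2, h3, perfectInt]
  cases xor (u 0) (xor (u 1) (xor (u 2) (xor (u 3) (xor (u 4) (u 5)))))
  · cases xor (u 0 && u 1) (xor (u 1 && u 2) (xor (u 2 && u 3) (xor (u 3 && u 4)
      (xor (u 4 && u 0) (u 5))))) <;> simp [toComplex]
  · simp [toComplex]

theorem forall_six {P : (Fin 6 → Bool) → Prop}
    (h : ∀ b0 b1 b2 b3 b4 b5, P ![b0, b1, b2, b3, b4, b5]) (y : Fin 6 → Bool) : P y := by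
  have : y = ![y 0, y 1, y 2, y 3, y 4, y 5] := by
    funext i; fin_cases i <;> rfl
  rw [this]; exact h _ _ _ _ _ _

theorem forall_four {P : (Fin 4 → Bool) → Prop}
    (h : ∀ b0 b1 b2 b3, P ![b0, b1, b2, b3]) (y : Fin 4 → Bool) : P y := by
  have : y = ![y 0, y 1, y 2, y 3] := by
    funext i; fin_cases i <;> rfl
  rw [this]; exact h _ _ _ _

/-- The qubits of a gate, as a list. -/
def Gate.qubits {Q : Type} : Gate Q → List Q
  | .hadamard q => [q]
  | .phase q => [q]
  | .cnot p q _ => [p, q]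

theorem support_of_forall {n : ℕ} {G : List (Gate (Fin n))} {S : Finset (Fin n)}
    (h : ∀ g ∈ G, ∀ q ∈ g.qubits, q ∈ S) : ∀ g ∈ G, g.support ⊆ ↑S := by
  intro g hg
  have := h g hg
  cases g <;> simpa [Gate.qubits, Gate.support, Set.insert_subset_iff] using this

/-- One of four triples of legs that represent all triples up to rotation. As for the other three,
the circuit is given in reversed order. It removes the quadratic phases within the triple, uses CNOT
gates to make one qubit carry the parity of the triple, and turns the linear phases into bits by
means of two Hadamard gates. -/
theorem perfect_decodes_012 : ∃ G β, LocallyDecodes {0, 1, 2} (fun _ => perfectTensor) G β none := by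
  refine ⟨_, _, locallyDecodes_of_eval (e := 5) (k := 2) (m := fun _ => perfectInt)
    (G := zGates 1 ++ czGates 0 2 (by decide) ++ ([.cnot 2 1 (by decide), .cnot 0 1 (by decide),
      .hadamard 2, .hadamard 0, .cnot 2 1 (by decide), .cnot 0 1 (by decide)] :
      List (Gate (Fin 6))) ++ czGates 1 2 (by decide) ++ czGates 0 1 (by decide))
    (β := ![0, 0, 0, 2, 0, 1])
    (fun _ y => perfectTensor_eq y) (by decide) (support_of_forall (by decide))
    (by unfold Set.InjOn; simp only [Set.mem_ofPred_eq]; decide) (by decide) (by decide) ?_⟩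
  exact fun x => forall_six (by revert x; decide)

theorem perfect_decodes_013 : ∃ G β, LocallyDecodes {0, 1, 3} (fun _ => perfectTensor) G β none := by
  refine ⟨_, _, locallyDecodes_of_eval (e := 5) (k := 2) (m := fun _ => perfectInt)
    (G := zGates 0 ++ zGates 1 ++ zGates 3 ++ czGates 0 3 (by decide) ++ czGates 1 3 (by decide) ++
      ([.cnot 0 3 (by decide), .cnot 1 3 (by decide), .hadamard 0, .hadamard 1,
      .cnot 0 3 (by decide), .cnot 1 3 (by decide)] : List (Gate (Fin 6))) ++
      czGates 0 1 (by decide))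
    (β := ![0, 0, 0, 0, 1, 3])
    (fun _ y => perfectTensor_eq y) (by decide) (support_of_forall (by decide))
    (by unfold Set.InjOn; simp only [Set.mem_ofPred_eq]; decide) (by decide) (by decide) ?_⟩
  exact fun x => forall_six (by revert x; decide)

theorem perfect_decodes_015 : ∃ G β, LocallyDecodes {0, 1, 5} (fun _ => perfectTensor) G β none := by
  refine ⟨_, _, locallyDecodes_of_eval (e := 5) (k := 2) (m := fun _ => perfectInt)
    (G := czGates 0 5 (by decide) ++ czGates 1 5 (by decide) ++
      ([.cnot 0 5 (by decide), .cnot 1 5 (by decide), .hadamard 0, .hadamard 1,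
      .cnot 0 5 (by decide), .cnot 1 5 (by decide)] : List (Gate (Fin 6))) ++
      zGates 5 ++ czGates 0 1 (by decide))
    (β := ![0, 0, 1, 5, 0, 0])
    (fun _ y => perfectTensor_eq y) (by decide) (support_of_forall (by decide))
    (by unfold Set.InjOn; simp only [Set.mem_ofPred_eq]; decide) (by decide) (by decide) ?_⟩
  exact fun x => forall_six (by revert x; decide)

theorem perfect_decodes_025 : ∃ G β, LocallyDecodes {0, 2, 5} (fun _ => perfectTensor) G β none := by
  refine ⟨_, _, locallyDecodes_of_eval (e := 5) (k := 2) (m := fun _ => perfectInt)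
    (G := czGates 0 2 (by decide) ++
      ([.cnot 0 5 (by decide), .cnot 2 5 (by decide), .cnot 5 0 (by decide), .cnot 5 2 (by decide),
      .hadamard 0, .hadamard 2, .cnot 0 5 (by decide), .cnot 2 5 (by decide)] :
      List (Gate (Fin 6))) ++ zGates 5)
    (β := ![0, 5, 0, 0, 2, 0])
    (fun _ y => perfectTensor_eq y) (by decide) (support_of_forall (by decide))
    (by unfold Set.InjOn; simp only [Set.mem_ofPred_eq]; decide) (by decide) (by decide) ?_⟩
  exact fun x => forall_six (by revert x; decide)

/-- The rotation of the five code qubits of the perfect tensor. -/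
def rotateFive : Equiv.Perm (Fin 6) where
  toFun := ![1, 2, 3, 4, 0, 5]
  invFun := ![4, 0, 1, 2, 3, 5]
  left_inv := by decide
  right_inv := by decide

theorem perfectTensor_rotateFive (y : Fin 6 → Bool) :
    perfectTensor y = perfectTensor fun i => y (rotateFive i) := by
  rw [perfectTensor_eq, perfectTensor_eq]
  congr 2
  revert y
  refine forall_six ?_
  decide

theorem perfect_decodes_three (S : Finset (Fin 6)) (hS : S.card = 3) :
    ∃ G β, LocallyDecodes S (fun _ => perfectTensor) G β none := by
  have rot : ∀ T T' : Finset (Fin 6), (∀ k, rotateFive k ∈ T' ↔ k ∈ T) →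
      (∃ G β, LocallyDecodes T (fun _ => perfectTensor) G β none) →
      ∃ G β, LocallyDecodes T' (fun _ => perfectTensor) G β none := by
    rintro T T' hT ⟨G, β, h⟩
    exact ⟨_, _, h.relabel rotateFive hT fun _ y => perfectTensor_rotateFive y⟩
  have iter : ∀ (n : ℕ) (T T' : Finset (Fin 6)), (∀ k, (rotateFive^[n]) k ∈ T' ↔ k ∈ T) →
      (∃ G β, LocallyDecodes T (fun _ => perfectTensor) G β none) →
      ∃ G β, LocallyDecodes T' (fun _ => perfectTensor) G β none := by
    intro n
    induction n with
    | zero =>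
      intro T T' hT h
      have : T' = T := by ext k; simpa using hT k
      rwa [this]
    | succ n ih =>
      intro T T' hT h
      refine ih (T.map rotateFive.toEmbedding) T' (fun k => ?_) (rot T _ (fun k => by simp) h)
      rw [Finset.mem_map_equiv, ← hT, Function.iterate_succ_apply, Equiv.apply_symm_apply]
  -- The 20 triples form four orbits under rotation.
  have cover : ∀ T : Finset (Fin 6), T.card = 3 → ∃ n : Fin 5,
      ∃ R ∈ ({{0, 1, 2}, {0, 1, 3}, {0, 1, 5}, {0, 2, 5}} : Finset (Finset (Fin 6))),
      ∀ k, (rotateFive^[n.val]) k ∈ T ↔ k ∈ R := by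
    decide
  obtain ⟨n, R, hR, h⟩ := cover S hS
  refine iter n R S h ?_
  simp only [Finset.mem_insert, Finset.mem_singleton] at hR
  rcases hR with rfl | rfl | rfl | rfl
  exacts [perfect_decodes_012, perfect_decodes_013, perfect_decodes_015, perfect_decodes_025]

/-! ### The Bacon-Shor tensor -/

/-- Amplitudes of the gauge qubit, up to the normalization `gaugeExponent`. -/
def gaugeInt : Gauge → Bool → ℤ × ℤ
  | .zPlus, a => if a then (0, 0) else (1, 0)
  | .zMinus, a => if a then (1, 0) else (0, 0)
  | .xPlus, _ => (1, 0)
  | .xMinus, a => if a then (-1, 0) else (1, 0)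
  | .yPlus, a => if a then (0, 1) else (1, 0)
  | .yMinus, a => if a then (0, -1) else (1, 0)

/-- The amplitudes of the Bacon-Shor tensor are Gaussian integers times this power of `1/√2`. -/
def gaugeExponent : Gauge → ℕ
  | .zPlus => 1
  | .zMinus => 1
  | _ => 2

/-- A circuit, in reversed order, that maps the state of the gauge qubit to `|0⟩`. -/
def gaugeGates {n : ℕ} (q : Fin n) : Gauge → List (Gate (Fin n))
  | .zPlus => []
  | .zMinus => [.hadamard q, .phase q, .phase q, .hadamard q]
  | .xPlus => [.hadamard q]
  | .xMinus => [.hadamard q, .phase q, .phase q]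
  | .yPlus => [.hadamard q, .phase q, .phase q, .phase q]
  | .yMinus => [.hadamard q, .phase q]

/-- The amplitudes of the Bacon-Shor tensor, without normalization. -/
def bsInt (γ : Gauge) (x : Bool) (u : Fin 4 → Bool) : ℤ × ℤ :=
  match xor (xor (u 0) (u 1)) (xor (u 2) (u 3)) || xor x (xor (u 0) (u 2)) with
  | true => (0, 0)
  | false => gaugeInt γ (xor (u 0) (u 1))

theorem bsAmp_eq (γ : Gauge) (x : Bool) (u : Fin 4 → Bool) :
    bsAmp γ x u = invSqrtTwo ^ gaugeExponent γ * toComplex (bsInt γ x u) := by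
  have hv : ∀ a, invSqrtTwo * γ.vec a = invSqrtTwo ^ gaugeExponent γ * toComplex (gaugeInt γ a) := by
    intro a
    cases γ <;> cases a <;> simp [Gauge.vec, gaugeExponent, gaugeInt, toComplex] <;> ring
  unfold bsAmp bsInt
  rw [hv]
  generalize xor (u 0) (u 1) = g
  generalize xor (u 2) (u 3) = g'
  generalize xor (u 0) (u 2) = g''
  cases g <;> cases g' <;> cases g'' <;> cases x <;> simp [toComplex]

/-- The circuit, again in reversed order, separates the logical qubit and the gauge qubit from the
Bell pair between the qubits `0` and `3`, and then resets the gauge qubit. -/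
theorem bs_decodes_012 (γ : Gauge) : ∃ G β a, LocallyDecodes {0, 1, 2} (bsAmp γ) G β (some a) := by
  refine ⟨_, _, _, locallyDecodes_of_eval (e := gaugeExponent γ)
    (k := match γ with | .zPlus => 0 | _ => 1) (m := bsInt γ)
    (G := gaugeGates 1 γ ++ ([.cnot 2 0 (by decide), .cnot 1 0 (by decide), .cnot 0 2 (by decide),
      .cnot 0 1 (by decide)] : List (Gate (Fin 4))))
    (β := fun _ => 0) (a := some 2)
    (bsAmp_eq γ) (by cases γ <;> decide) (support_of_forall (by cases γ <;> decide))
    (by unfold Set.InjOn; simp only [Set.mem_ofPred_eq]; decide) (by decide) (by decide) ?_⟩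
  exact fun x => forall_four (by cases γ <;> revert x <;> decide)

/-- Two symmetries of the Bacon-Shor tensor: exchange of the two pairs `12` and `34`, and
exchange within both pairs. -/
theorem bsAmp_swap (γ : Gauge) (x : Bool) (y : Fin 4 → Bool) :
    (bsAmp γ x y = bsAmp γ x fun i => y ((Equiv.swap 0 2 * Equiv.swap 1 3 : Equiv.Perm _) i)) ∧
      bsAmp γ x y = bsAmp γ x fun i => y ((Equiv.swap 0 1 * Equiv.swap 2 3 : Equiv.Perm _) i) := by
  simp only [bsAmp_eq]
  constructor
  · congr 2
    revert y
    refine forall_four ?_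
    cases γ <;> revert x <;> decide
  · congr 2
    revert y
    refine forall_four ?_
    cases γ <;> revert x <;> decide

theorem bs_decodes_three (γ : Gauge) (S : Finset (Fin 4)) (hS : S.card = 3) :
    ∃ G β a, LocallyDecodes S (bsAmp γ) G β (some a) := by
  have key : ∀ σ : Equiv.Perm (Fin 4), (∀ x y, bsAmp γ x y = bsAmp γ x fun i => y (σ i)) →
      ∀ T T' : Finset (Fin 4), (∀ k, σ k ∈ T' ↔ k ∈ T) →
      (∃ G β a, LocallyDecodes T (bsAmp γ) G β (some a)) →
      ∃ G β a, LocallyDecodes T' (bsAmp γ) G β (some a) := by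
    rintro σ hσ T T' hT ⟨G, β, a, h⟩
    exact ⟨_, _, _, h.relabel σ hT hσ⟩
  have h1 := bs_decodes_012 γ
  have h2 := key _ (fun x y => (bsAmp_swap γ x y).1) {0, 1, 2} {0, 2, 3} (by decide) h1
  have h3 := key _ (fun x y => (bsAmp_swap γ x y).2) {0, 1, 2} {0, 1, 3} (by decide) h1
  have h4 := key _ (fun x y => (bsAmp_swap γ x y).2) {0, 2, 3} {1, 2, 3} (by decide) h2
  have cover : ∀ T : Finset (Fin 4), T.card = 3 →
      T ∈ ({{0, 1, 2}, {0, 2, 3}, {0, 1, 3}, {1, 2, 3}} : Finset (Finset (Fin 4))) := by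
    decide
  have := cover S hS
  simp only [Finset.mem_insert, Finset.mem_singleton] at this
  rcases this with rfl | rfl | rfl | rfl
  exacts [h1, h2, h3, h4]

/-! ### Several copies -/

theorem update_bit_of_ne {Q : Type} {_ : DecidableEq Q} {q q' : Q} (h : q ≠ q') (b : Bool)
    (y : Q → Bool) : Function.update y q' b q = y q := Function.update_of_ne h b y

section Copies

variable {K : Type} {N : ℕ}

/-- Circuits on the individual copies act on a product state factor by factor. -/
theorem runGates_copies (G : Fin N → List (Gate K)) (l : List (Fin N)) (hl : l.Nodup)
    (f : Fin N → QState K) :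
    runGates (l.flatMap fun c => (G c).map (Gate.map fun i => (i, c)))
      (fun y : K × Fin N → Bool => ∏ c, f c fun i => y (i, c)) =
    fun y => ∏ c, (if c ∈ l then runGates (G c) (f c) else f c) fun i => y (i, c) := by
  induction l generalizing f with
  | nil => simp
  | cons c l ih =>
    rw [List.nodup_cons] at hl
    have hsplit : ∀ f : Fin N → QState K, (fun y : K × Fin N → Bool => ∏ c, f c fun i => y (i, c)) =
        fun y => (∏ c' ∈ Finset.univ.erase c, f c' fun i => y (i, c')) *
          f c fun i => y (i, c) := by
      intro f
      funext y
      rw [mul_comm, Finset.mul_prod_erase _ (fun c => f c fun i => y (i, c)) (Finset.mem_univ c)]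
    have hstep : runGates ((G c).map (Gate.map fun i => (i, c)))
        (fun y : K × Fin N → Bool => ∏ c, f c fun i => y (i, c)) =
        fun y => ∏ c', (Function.update f c (runGates (G c) (f c))) c' fun i => y (i, c') := by
      rw [hsplit f, hsplit, runGates_map (fun i : K => (i, c)) Set.univ
        (fun _ _ _ _ h => (Prod.ext_iff.1 h).1)
        (fun y => ∏ c' ∈ Finset.univ.erase c, f c' fun i => y (i, c')) (fun y i => y (i, c))
        _ _ _ _ fun _ _ => Set.subset_univ _]
      · funext y
        rw [Function.update_self]
        congr 1
        refine Finset.prod_congr rfl fun c' hc' => ?_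
        rw [Function.update_of_ne (Finset.ne_of_mem_erase hc')]
      · intro y k _ b
        refine Finset.prod_congr rfl fun c' hc' => ?_
        congr 1
        funext i
        rw [update_bit_of_ne]
        intro h
        exact Finset.ne_of_mem_erase hc' (Prod.ext_iff.1 h).2
      · intro y k _ b
        funext i
        by_cases hi : i = k
        · subst hi; simp
        · rw [Function.update_of_ne hi, update_bit_of_ne]
          exact fun h => hi (Prod.ext_iff.1 h).1
      · exact fun _ _ _ => rfl
    rw [List.flatMap_cons, runGates_append, hstep, ih hl.2]
    funext y
    refine Finset.prod_congr rfl fun c' _ => ?_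
    by_cases hc : c' = c
    · subst hc; simp [hl.1]
    · simp [hc]

theorem prod_decodedAt (S : Finset K) (β : Fin N → K → K) (a : Fin N → Option K) (x : Bool)
    (κ : ℂ) (y : K × Fin N → Bool) :
    (∏ c, if DecodedAt S (β c) (a c) x (fun i => y (i, c)) then κ else 0) =
      if ∀ c, DecodedAt S (β c) (a c) x (fun i => y (i, c)) then κ ^ N else 0 := by
  split_ifs with h
  · simp [h]
  · push Not at h
    obtain ⟨c, hc⟩ := h
    exact Finset.prod_eq_zero (Finset.mem_univ c) (if_neg hc)

theorem card_outside_copies [Fintype K] (S : Finset K) (S' : Finset (K × Fin N))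
    {_ : DecidablePred fun j => j ∉ S} {_ : DecidablePred fun j => j ∉ S'}
    (hS' : ∀ q, q ∈ S' ↔ q.1 ∈ S) : (Finset.univ.filter fun j => j ∉ S').card =
      (Finset.univ.filter fun j => j ∉ S).card * N := by
  have : (Finset.univ.filter fun j => j ∉ S') =
      (Finset.univ.filter fun j => j ∉ S) ×ˢ (Finset.univ : Finset (Fin N)) := by
    ext q; simp [hS']
  rw [this, Finset.card_product, Finset.card_univ, Fintype.card_fin]

theorem copies_gates_support {S : Finset K} {S' : Finset (K × Fin N)}
    (hS' : ∀ q, q ∈ S' ↔ q.1 ∈ S) {G : Fin N → List (Gate K)}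
    (hG : ∀ c, ∀ g ∈ G c, g.support ⊆ ↑S) :
    ∀ g ∈ (List.finRange N).flatMap fun c => (G c).map (Gate.map fun i => (i, c)),
      g.support ⊆ ↑S' := by
  intro g hg
  obtain ⟨c, -, hgc⟩ := List.mem_flatMap.1 hg
  exact map_gates_support (fun i => (i, c)) (fun k hk => (hS' _).2 hk) (hG c) g hgc

theorem locallyDecodes_copies_none [Fintype K] {S : Finset K} {S' : Finset (K × Fin N)}
    (hS' : ∀ q, q ∈ S' ↔ q.1 ∈ S) {φ : Fin N → Bool → QState K}
    (h : ∀ c, ∃ G β, LocallyDecodes S (φ c) G β none) :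
    ∃ G β, LocallyDecodes S' (fun x y => ∏ c, φ c x fun i => y (i, c)) G β none := by
  choose G β h using h
  refine ⟨(List.finRange N).flatMap fun c => (G c).map (Gate.map fun i => (i, c)),
    fun q => (β q.2 q.1, q.2), copies_gates_support hS' fun c => (h c).support, ?_, ?_, ?_, ?_⟩
  · rintro ⟨i, c⟩ hi ⟨j, c'⟩ hj hij
    obtain ⟨h1, rfl⟩ := Prod.ext_iff.1 hij
    exact Prod.ext ((h c).inj (fun h' => hi ((hS' _).2 h')) (fun h' => hj ((hS' _).2 h')) h1) rfl
  · rintro ⟨i, c⟩ hi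
    exact (hS' _).2 ((h c).mem i fun h' => hi ((hS' _).2 h'))
  · simp
  · intro x y
    rw [runGates_copies G _ (List.nodup_finRange N), decodedAt_amp,
      card_outside_copies S S' hS', pow_mul]
    simp only [List.mem_finRange, if_true, (h _).run, decodedAt_amp]
    rw [prod_decodedAt]
    refine if_congr ?_ rfl rfl
    unfold DecodedAt
    constructor
    · intro h'
      refine ⟨by simp, ?_, ?_⟩
      · rintro ⟨i, c⟩ hi _ hz
        refine (h' c).2.1 i ((hS' _).1 hi) (by simp) fun j hj hji =>
          hz (j, c) (fun h'' => hj ((hS' _).1 h'')) (by simp [hji])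
      · rintro ⟨i, c⟩ hi
        exact (h' c).2.2 i fun h'' => hi ((hS' _).2 h'')
    · rintro ⟨-, hz, hb⟩ c
      refine ⟨by simp, fun i hi _ hi' => ?_, fun i hi => ?_⟩
      · refine hz (i, c) ((hS' _).2 hi) (by simp) ?_
        rintro ⟨j, c'⟩ hj hji
        obtain ⟨h1, h2⟩ := Prod.ext_iff.1 hji
        simp only at h1 h2
        subst h2
        exact hi' j (fun h'' => hj ((hS' _).2 h'')) h1
      · exact hb (i, c) fun h'' => hi ((hS' _).1 h'')

/-- The gates that compress a repetition code on the qubits `A` to the qubit `A c₀`. -/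
def fanIn {Q : Type} (A : Fin N → Q) (hA : Function.Injective A) (c₀ : Fin N) (l : List (Fin N)) :
    List (Gate Q) :=
  l.flatMap fun c => if h : c = c₀ then [] else [.cnot (A c₀) (A c) fun h' => h (hA h').symm]

/-- The bits `A c` agree with `x`, except those with `c ∈ T`, which have been reset by means of
`A c₀`. -/
def Repeats {Q : Type} (A : Fin N → Q) (c₀ : Fin N) (x : Bool) (T : Set (Fin N)) (y : Q → Bool) :
    Prop :=
  (∀ c, (c = c₀ ∨ c ∉ T) → y (A c) = x) ∧ ∀ c, c ≠ c₀ → c ∈ T → y (A c) = false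

theorem runGates_fanIn {Q : Type} (A : Fin N → Q) (hA : Function.Injective A) (c₀ : Fin N)
    (g : QState Q) (hg : ∀ y y', (∀ q, (∀ c, A c ≠ q) → y q = y' q) → g y = g y') (x : Bool)
    (l : List (Fin N)) (T : Set (Fin N)) (hl : ∀ c ∈ l, c ∉ T) (hnd : l.Nodup) :
    runGates (fanIn A hA c₀ l) (fun y => g y * if Repeats A c₀ x T y then 1 else 0) =
      fun y => g y * if Repeats A c₀ x {c | c ∈ T ∨ c ∈ l} y then 1 else 0 := by
  induction l generalizing T with
  | nil => simp [fanIn]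
  | cons c l ih =>
    rw [List.nodup_cons] at hnd
    have hcT : c ∉ T := hl c List.mem_cons_self
    have hset : {c' | c' ∈ T ∨ c' ∈ c :: l} = {c' | c' ∈ insert c T ∨ c' ∈ l} := by
      ext c'
      simp only [List.mem_cons, Set.mem_ofPred_eq, Set.mem_insert_iff]
      tauto
    have h1 := ih (insert c T) (fun c' hc' => by
        rintro (rfl | h')
        · exact hnd.1 hc'
        · exact hl c' (List.mem_cons_of_mem _ hc') h') hnd.2
    have hcons : fanIn A hA c₀ (c :: l) = (if h : c = c₀ then [] else
        [.cnot (A c₀) (A c) fun h' => h (hA h').symm]) ++ fanIn A hA c₀ l := rfl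
    rw [hset, ← h1, hcons, runGates_append]
    congr 1
    by_cases hc : c = c₀
    · rw [dif_pos hc, runGates_nil]
      funext y
      congr 1
      refine if_congr (and_congr (forall_congr' fun c' => ?_) (forall_congr' fun c' => ?_)) rfl rfl
      · by_cases hc' : c' = c₀ <;> simp [hc', hc]
      · by_cases hc' : c' = c₀ <;> simp [hc', hc]
    · rw [dif_neg hc, runGates_cons, runGates_nil]
      funext y
      simp only [Gate.apply]
      have hgu : ∀ b, g (Function.update y (A c) b) = g y := fun b =>
        hg _ _ fun q hq => Function.update_of_ne (fun h => hq c h.symm) _ _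
      rw [hgu]
      congr 1
      have h3 : ∀ c' b, c' ≠ c → Function.update y (A c) b (A c') = y (A c') :=
        fun c' b h => Function.update_of_ne (fun h' => h (hA h')) _ _
      refine if_congr ⟨?_, ?_⟩ rfl rfl
      · rintro ⟨ha, hb⟩
        have h0 := ha c₀ (Or.inl rfl)
        rw [h3 c₀ _ (Ne.symm hc)] at h0
        have h1 := ha c (Or.inr hcT)
        rw [Function.update_self, h0] at h1
        refine ⟨fun c' hc' => ?_, fun c' hc' hcT' => ?_⟩
        · by_cases h : c' = c₀
          · rw [h, h0]
          · have hn : c' ∉ insert c T := hc'.resolve_left h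
            rw [Set.mem_insert_iff, not_or] at hn
            rw [← ha c' (Or.inr hn.2), h3 c' _ hn.1]
        · by_cases h : c' = c
          · rw [h]
            revert h1
            cases x <;> cases y (A c) <;> simp
          · rw [← hb c' hc' (hcT'.resolve_left h), h3 c' _ h]
      · rintro ⟨ha, hb⟩
        have h0 := ha c₀ (Or.inl rfl)
        have h1 := hb c hc (Set.mem_insert _ _)
        refine ⟨fun c' hc' => ?_, fun c' hc' hcT' => ?_⟩
        · by_cases h : c' = c
          · rw [h, Function.update_self, h0, h1, Bool.xor_false]
          · rw [h3 c' _ h]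
            refine ha c' (hc'.imp id fun h' => ?_)
            rintro (h'' | h'')
            exacts [h h'', h' h'']
        · have h : c' ≠ c := fun h => hcT (h ▸ hcT')
          rw [h3 c' _ h]
          exact hb c' hc' (Or.inr hcT')

/-- Each copy of an encoded qubit hands over the same bit `x`; one of the `N` bits is kept, and it
is used to reset the others. -/
theorem locallyDecodes_copies_some [Fintype K] (hN : 0 < N) {S : Finset K} {S' : Finset (K × Fin N)}
    (hS' : ∀ q, q ∈ S' ↔ q.1 ∈ S) {φ : Fin N → Bool → QState K}
    (h : ∀ c, ∃ G β a, LocallyDecodes S (φ c) G β (some a)) :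
    ∃ G β a, LocallyDecodes S' (fun x y => ∏ c, φ c x fun i => y (i, c)) G β (some a) := by
  choose G β a h using h
  let c₀ : Fin N := ⟨0, hN⟩
  let A : Fin N → K × Fin N := fun c => (a c, c)
  have hA : Function.Injective A := fun c c' hcc => (Prod.ext_iff.1 hcc).2
  have haS : ∀ c, a c ∈ S := fun c => ((h c).logical _ rfl).1
  have haβ : ∀ c j, j ∉ S → β c j ≠ a c := fun c => ((h c).logical _ rfl).2
  refine ⟨((List.finRange N).flatMap fun c => (G c).map (Gate.map fun i => (i, c))) ++
    fanIn A hA c₀ (List.finRange N), fun q => (β q.2 q.1, q.2), A c₀, ?_, ?_, ?_, ?_, ?_⟩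
  · intro g hg
    rcases List.mem_append.1 hg with hg | hg
    · exact copies_gates_support hS' (fun c => (h c).support) g hg
    · obtain ⟨c, -, hgc⟩ := List.mem_flatMap.1 hg
      split_ifs at hgc with hc
      · simp at hgc
      · simp only [List.mem_singleton] at hgc
        subst hgc
        simp only [Gate.support, Set.insert_subset_iff, Set.singleton_subset_iff, Finset.mem_coe,
          hS']
        exact ⟨haS _, haS _⟩
  · rintro ⟨i, c⟩ hi ⟨j, c'⟩ hj hij
    obtain ⟨h1, rfl⟩ := Prod.ext_iff.1 hij
    exact Prod.ext ((h c).inj (fun h' => hi ((hS' _).2 h')) (fun h' => hj ((hS' _).2 h')) h1) rfl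
  · rintro ⟨i, c⟩ hi
    exact (hS' _).2 ((h c).mem i fun h' => hi ((hS' _).2 h'))
  · rintro q hq
    obtain rfl := Option.some.inj hq
    refine ⟨(hS' _).2 (haS _), ?_⟩
    rintro ⟨i, c⟩ hi hic
    obtain ⟨h1, h2⟩ := Prod.ext_iff.1 hic
    simp only [A] at h1 h2
    subst h2
    exact haβ _ i (fun h' => hi ((hS' _).2 h')) h1
  · intro x y
    -- The part of the state that does not involve the decoded bits: Bell pairs and zeros.
    let g : QState (K × Fin N) := fun y => if ∀ c,
      (∀ q ∈ S, a c ≠ q → (∀ j, j ∉ S → β c j ≠ q) → y (q, c) = false) ∧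
      ∀ j, j ∉ S → y (β c j, c) = y (j, c) then
        (invSqrtTwo ^ (Finset.univ.filter fun j => j ∉ S).card) ^ N else 0
    have hg : ∀ y y', (∀ q, (∀ c, A c ≠ q) → y q = y' q) → g y = g y' := by
      intro y y' hy
      have h1 : ∀ i c', i ≠ a c' → y (i, c') = y' (i, c') := by
        intro i c' hi
        refine hy _ fun c h' => hi ?_
        obtain ⟨h2, h3⟩ := Prod.ext_iff.1 h'
        simp only [A] at h2 h3
        rw [← h2, ← h3]
      refine if_congr (forall_congr' fun c' => and_congr (forall_congr' fun q =>
        forall_congr' fun _ => forall_congr' fun hq => ?_) (forall_congr' fun j =>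
        forall_congr' fun hj => ?_)) rfl rfl
      · rw [h1 q c' (Ne.symm hq)]
      · rw [h1 _ c' (haβ c' j hj), h1 j c' fun h' => hj (h' ▸ haS c')]
    have hrun : runGates ((List.finRange N).flatMap fun c => (G c).map (Gate.map fun i => (i, c)))
        (fun y => ∏ c, φ c x fun i => y (i, c)) = fun y => g y *
        if Repeats A c₀ x ∅ y then 1 else 0 := by
      funext y
      rw [runGates_copies G _ (List.nodup_finRange N)]
      simp only [List.mem_finRange, if_true, (h _).run, decodedAt_amp]
      rw [prod_decodedAt]
      simp only [g]
      rw [ite_zero_mul_ite_zero, mul_one]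
      refine if_congr ?_ rfl rfl
      unfold DecodedAt Repeats
      constructor
      · intro h'
        refine ⟨fun c => ⟨fun q hq hqa => (h' c).2.1 q hq fun h'' => hqa (Option.some.inj h''),
          (h' c).2.2⟩, fun c _ => (h' c).1 _ rfl, by simp⟩
      · rintro ⟨h1, h2, -⟩ c
        exact ⟨fun q hq => Option.some.inj hq ▸ h2 c (Or.inr (by simp)),
          fun q hq hqa => (h1 c).1 q hq fun h'' => hqa (by rw [h'']), (h1 c).2⟩
    rw [runGates_append, hrun, runGates_fanIn A hA c₀ g hg x _ ∅ (by simp)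
      (List.nodup_finRange N), decodedAt_amp, card_outside_copies S S' hS', pow_mul]
    simp only [g]
    rw [ite_zero_mul_ite_zero, mul_one]
    refine if_congr ?_ rfl rfl
    unfold DecodedAt Repeats
    constructor
    · rintro ⟨h1, h2, h3⟩
      refine ⟨fun q hq => ?_, ?_, ?_⟩
      · obtain rfl := Option.some.inj hq
        exact h2 c₀ (Or.inl rfl)
      · rintro ⟨i, c⟩ hi hia hiβ
        by_cases hic : a c = i
        · subst hic
          refine h3 c ?_ (Or.inr (List.mem_finRange c))
          rintro rfl
          exact hia rfl
        · exact (h1 c).1 i ((hS' _).1 hi) hic fun j hj hji =>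
            hiβ (j, c) (fun h' => hj ((hS' _).1 h')) (by simp [hji])
      · rintro ⟨i, c⟩ hi
        exact (h1 c).2 i fun h' => hi ((hS' _).2 h')
    · rintro ⟨h1, h2, h3⟩
      refine ⟨fun c => ⟨fun q hq hqa hqβ => ?_, fun j hj => ?_⟩, fun c hc => ?_, fun c hc _ => ?_⟩
      · refine h2 (q, c) ((hS' _).2 hq) (fun h' => hqa ?_) ?_
        · obtain ⟨h4, h5⟩ := Prod.ext_iff.1 (Option.some.inj h')
          simp only [A] at h4 h5
          rw [← h4, ← h5]
        · rintro ⟨j, c'⟩ hj hjq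
          obtain ⟨h4, h5⟩ := Prod.ext_iff.1 hjq
          simp only at h4 h5
          subst h5
          exact hqβ j (fun h' => hj ((hS' _).2 h')) h4
      · exact h3 (j, c) fun h' => hj ((hS' _).1 h')
      · have : c = c₀ := by simpa using hc
        rw [this]
        exact h1 _ rfl
      · refine h2 (A c) ((hS' _).2 (haS c)) (fun h' => hc (hA (Option.some.inj h')).symm) ?_
        rintro ⟨j, c'⟩ hj hjq
        obtain ⟨h4, h5⟩ := Prod.ext_iff.1 hjq
        simp only [A] at h4 h5
        subst h5
        exact haβ _ j (fun h' => hj ((hS' _).2 h')) h4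

end Copies

theorem perfect_decodes {S : Finset (Fin 6)} (hS : 3 ≤ S.card) :
    ∃ G β, LocallyDecodes S (fun _ => perfectTensor) G β none := by
  obtain ⟨T, hTS, hT⟩ := Finset.exists_subset_card_eq hS
  obtain ⟨G, β, h⟩ := perfect_decodes_three T hT
  obtain ⟨G', h'⟩ := h.mono hTS
  exact ⟨G', β, h'⟩

theorem bs_decodes (γ : Gauge) {S : Finset (Fin 4)} (hS : 3 ≤ S.card) :
    ∃ G β a, LocallyDecodes S (bsAmp γ) G β (some a) := by
  obtain ⟨T, hTS, hT⟩ := Finset.exists_subset_card_eq hS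
  obtain ⟨G, β, a, h⟩ := bs_decodes_three γ T hT
  obtain ⟨G', h'⟩ := h.mono hTS
  exact ⟨G', β, a, h'⟩

theorem bsCopies_decodes {N : ℕ} (hN : 0 < N) (ρ : Fin N → Equiv.Perm (Fin 4)) (γ : Fin N → Gauge)
    {S : Finset (Fin 4)} (hS : 3 ≤ S.card) :
    ∃ G β a, LocallyDecodes (S ×ˢ (Finset.univ : Finset (Fin N)))
      (fun x y => bsCopies ρ γ x fun i c => y (i, c)) G β (some a) := by
  refine locallyDecodes_copies_some hN (φ := fun c x y => bsAmp (γ c) x fun i => y (ρ c i))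
    (S := S) (fun q => by simp) fun c => ?_
  obtain ⟨G, β, a, h⟩ := bs_decodes (γ c) (S := S.map (ρ c).symm.toEmbedding) (by simpa using hS)
  exact ⟨_, _, _, h.relabel (ρ c) (fun k => by rw [Finset.mem_map_equiv, Equiv.symm_symm])
    fun x y => rfl⟩

theorem perfectCopies_decodes {N : ℕ} (ρ : Fin N → Equiv.Perm (Fin 6))
    {S : Finset (Fin 6)} (hS : 3 ≤ S.card) :
    ∃ G β, LocallyDecodes (S ×ˢ (Finset.univ : Finset (Fin N)))
      (fun _ y => ∏ c, perfectTensor fun i => y (ρ c i, c)) G β none := by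
  refine locallyDecodes_copies_none (φ := fun c _ y => perfectTensor fun i => y (ρ c i))
    (S := S) (fun q => by simp) fun c => ?_
  obtain ⟨G, β, h⟩ := perfect_decodes (S := S.map (ρ c).symm.toEmbedding) (by simpa using hS)
  exact ⟨_, _, h.relabel (ρ c) (fun k => by rw [Finset.mem_map_equiv, Equiv.symm_symm])
    fun x y => rfl⟩

/-- The local move through a tile: three legs suffice to decode it. -/
theorem tile_decodes {N : ℕ} (hN : 0 < N) (k : TileKind) (ρ : Fin N → Equiv.Perm (Fin k.legs))
    (γ : Fin N → Gauge) (S : Finset (Fin k.legs)) (hS : 3 ≤ S.card) :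
    ∃ G β a, LocallyDecodes (S ×ˢ (Finset.univ : Finset (Fin N)))
      (fun x y => tileAmp k ρ γ x fun i c => y (i, c)) G β a ∧
      (a.isSome ↔ k = TileKind.square) := by
  cases k with
  | square =>
    obtain ⟨G, β, a, h⟩ := bsCopies_decodes hN ρ γ hS
    exact ⟨G, β, some a, h, fun _ => rfl, fun _ => rfl⟩
  | hexagon =>
    obtain ⟨G, β, h⟩ := perfectCopies_decodes ρ hS
    exact ⟨G, β, none, h, by simp⟩

instance : Finite Gauge :=
  Finite.of_surjective (fun i : Fin 6 =>
    (![Gauge.zPlus, .zMinus, .xPlus, .xMinus, .yPlus, .yMinus] : Fin 6 → Gauge) i) (by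
      intro γ
      cases γ
      exacts [⟨0, rfl⟩, ⟨1, rfl⟩, ⟨2, rfl⟩, ⟨3, rfl⟩, ⟨4, rfl⟩, ⟨5, rfl⟩])

/-- The number of gates of the local decoders is bounded: there are finitely many tensors. -/
theorem exists_tile_depth {N : ℕ} (hN : 0 < N) : ∃ depth : ℕ, ∀ (k : TileKind)
    (ρ : Fin N → Equiv.Perm (Fin k.legs)) (γ : Fin N → Gauge) (S : Finset (Fin k.legs)),
    3 ≤ S.card → ∃ G β a, LocallyDecodes (S ×ˢ (Finset.univ : Finset (Fin N)))
      (fun x y => tileAmp k ρ γ x fun i c => y (i, c)) G β a ∧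
      (a.isSome ↔ k = TileKind.square) ∧ G.length ≤ depth := by
  have bound : ∀ k : TileKind, ∃ depth : ℕ, ∀
    (ρ : Fin N → Equiv.Perm (Fin k.legs)) (γ : Fin N → Gauge) (S : Finset (Fin k.legs)),
    3 ≤ S.card → ∃ G β a, LocallyDecodes (S ×ˢ (Finset.univ : Finset (Fin N)))
      (fun x y => tileAmp k ρ γ x fun i c => y (i, c)) G β a ∧
      (a.isSome ↔ k = TileKind.square) ∧ G.length ≤ depth := by
    intro k
    choose G β a h using tile_decodes hN k
    let ι := {d : (Fin N → Equiv.Perm (Fin k.legs)) × (Fin N → Gauge) × Finset (Fin k.legs) //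
      3 ≤ d.2.2.card}
    obtain ⟨d, hd⟩ := Set.Finite.bddAbove
      (Set.finite_range fun i : ι => (G i.1.1 i.1.2.1 i.1.2.2 i.2).length)
    exact ⟨d, fun ρ γ S hS => ⟨_, _, _, (h ρ γ S hS).1, (h ρ γ S hS).2,
      hd ⟨⟨(ρ, γ, S), hS⟩, rfl⟩⟩⟩
  obtain ⟨d₁, h₁⟩ := bound .square
  obtain ⟨d₂, h₂⟩ := bound .hexagon
  refine ⟨max d₁ d₂, fun k => ?_⟩
  cases k with
  | square =>
    intro ρ γ S hS
    obtain ⟨G, β, a, h, h', hl⟩ := h₁ ρ γ S hS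
    exact ⟨G, β, a, h, h', hl.trans (le_max_left _ _)⟩
  | hexagon =>
    intro ρ γ S hS
    obtain ⟨G, β, a, h, h', hl⟩ := h₂ ρ γ S hS
    exact ⟨G, β, a, h, h', hl.trans (le_max_right _ _)⟩

/-! ### Equivalent forms of the local moves -/

/-- Operators outside `S` can be pushed to `S` if a circuit on `S` turns the states into Bell
pairs across the cut: conjugate with the circuit. -/
theorem push_of_bell {Q ι : Type} [Fintype Q] {S S' : Finset Q} (hS : ∀ q, q ∈ S' ↔ q ∉ S)
    {β : Q → Q} (hβ : Set.InjOn β {j | j ∉ S}) (hβS : ∀ j, j ∉ S → β j ∈ S)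
    {G : List (Gate Q)} (hG : ∀ g ∈ G, g.support ⊆ ↑S) {L : Set Q} {T F : ι → QState Q}
    (hrun : ∀ i y, runGates G (T i) y = F i y * bellAndZeros S β L y)
    (hF : ∀ i y y', (∀ q ∈ S, (∀ j, j ∉ S → β j ≠ q) → y q = y' q) → F i y = F i y')
    (K : Matrix (S' → Bool) (S' → Bool) ℂ) :
    ∃ K', ∀ i, localOp S' K (T i) = localOp S K' (T i) := by
  let F' : ι → QState Q := fun i y => F i y *
    if ∀ q ∈ S, q ∉ L → (∀ j, j ∉ S → β j ≠ q) → y q = false then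
      invSqrtTwo ^ (Finset.univ.filter fun j => j ∉ S).card else 0
  have hF' : ∀ i y y', (∀ q ∈ S, (∀ j, j ∉ S → β j ≠ q) → y q = y' q) → F' i y = F' i y' := by
    intro i y y' h
    simp only [F']
    rw [hF i y y' h]
    congr 1
    refine if_congr (forall_congr' fun q => forall_congr' fun hq => forall_congr' fun _ =>
      forall_congr' fun hq' => ?_) rfl rfl
    rw [h q hq hq']
  have hrun' : ∀ i, runGates G (T i) = fun y => if ∀ j, j ∉ S → y (β j) = y j then
      F' i y else 0 := by
    intro i
    funext y
    rw [hrun, bellAndZeros_eq]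
    simp only [F']
    by_cases h : ∀ j, j ∉ S → y (β j) = y j
    · rw [if_pos h]
      congr 1
      refine if_congr ⟨fun h' => h'.1, fun h' => ⟨h', h⟩⟩ rfl rfl
    · rw [if_neg h, if_neg fun h' => h h'.2, mul_zero]
  obtain ⟨K₂, hK₂⟩ := push_bell hS β hβ hβS K
  obtain ⟨U, hU⟩ := runGates_exists_localOp hG
  obtain ⟨V, hV⟩ := runGates_exists_localOp (undoGates_support hG)
  refine ⟨V * K₂ * U, fun i => ?_⟩
  have hdisj : Disjoint S' S := Finset.disjoint_left.2 fun q hq => (hS q).1 hq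
  calc localOp S' K (T i) = localOp S' K (localOp S V (runGates G (T i))) := by
        rw [← hV, runGates_undoGates]
    _ = localOp S V (localOp S K₂ (runGates G (T i))) := by
        rw [localOp_comm hdisj, hrun', hK₂ _ (hF' i)]
    _ = localOp S (V * K₂ * U) (T i) := by
        rw [hU, localOp_localOp, localOp_localOp]

theorem perfectTensor_local_moves (S : Finset (Fin 6)) : List.TFAE [
    3 ≤ S.card,
    ∀ K, ∃ K', localOp Sᶜ K perfectTensor = localOp S K' perfectTensor,
    ∃ (C : Circuit (Fin 6)) (β : Fin 6 → Fin 6),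
      C.Layered ∧ C.ActsOn ↑S ∧ Set.InjOn β {j | j ∉ S} ∧ (∀ j, j ∉ S → β j ∈ S) ∧
      C.run perfectTensor = bellAndZeros S β ∅] := by
  tfae_have 1 → 3 := by
    intro hS
    obtain ⟨G, β, h⟩ := perfect_decodes hS
    refine ⟨sequential G, β, sequential_layered G, sequential_actsOn h.support, h.inj, h.mem, ?_⟩
    funext y
    rw [run_sequential, h.run false]
    simp
  tfae_have 3 → 2 := by
    rintro ⟨C, β, -, hC, hβ, hβS, hrun⟩ K
    obtain ⟨K', h⟩ := push_of_bell (ι := Unit) (S' := Sᶜ) (fun q => Finset.mem_compl) hβ hβS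
      (mem_flatten_support hC) (T := fun _ => perfectTensor) (F := fun _ _ => 1) (L := ∅)
      (fun _ y => by rw [← Circuit.run_eq_runGates, hrun, one_mul]) (fun _ _ _ _ => rfl) K
    exact ⟨K', h ()⟩
  -- By a count of dimensions, `S` has at least as many qubits as its complement.
  tfae_have 2 → 1 := by
    intro h
    have := card_mul_le_of_push (R := Unit) (S' := Sᶜ) (S := S) (fun q => Finset.mem_compl)
      (fun _ => perfectTensor) (fun K => (h K).imp fun K' h _ => h)
      fun _ => ⟨fun _ => false, by simp [perfectTensor, invSqrtTwo_ne_zero], by simp⟩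
    rw [Fintype.card_unit, one_mul, Nat.pow_le_pow_iff_right (by norm_num), Finset.card_compl,
      Fintype.card_fin] at this
    omega
  tfae_finish

theorem bsEncode_basis {N : ℕ} (ρ : Fin N → Equiv.Perm (Fin 4)) (γ : Fin N → Gauge) (x : Bool)
    (y : Fin 4 × Fin N → Bool) :
    bsEncode ρ γ (fun x' => if x' = x then 1 else 0) y = bsCopies ρ γ x fun i c => y (i, c) := by
  cases x <;> simp [bsEncode]

/-- The two code words have disjoint supports. -/
theorem bsCopies_support {N : ℕ} (hN : 0 < N) (ρ : Fin N → Equiv.Perm (Fin 4))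
    (γ : Fin N → Gauge) (x : Bool) : ∃ y : Fin 4 × Fin N → Bool,
      (bsCopies ρ γ x fun i c => y (i, c)) ≠ 0 ∧
      ∀ x', x' ≠ x → (bsCopies ρ γ x' fun i c => y (i, c)) = 0 := by
  have hγ : ∀ c, ∃ a, (γ c).vec a ≠ 0 := by
    intro c
    cases γ c
    exacts [⟨false, by simp [Gauge.vec]⟩, ⟨true, by simp [Gauge.vec]⟩,
      ⟨false, by simp [Gauge.vec, invSqrtTwo_ne_zero]⟩,
      ⟨false, by simp [Gauge.vec, invSqrtTwo_ne_zero]⟩,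
      ⟨false, by simp [Gauge.vec, invSqrtTwo_ne_zero]⟩,
      ⟨false, by simp [Gauge.vec, invSqrtTwo_ne_zero]⟩]
  choose a ha using hγ
  refine ⟨fun q => ![false, a q.2, x, xor x (a q.2)] ((ρ q.2).symm q.1), ?_, fun x' hx' => ?_⟩
  · refine Finset.prod_ne_zero_iff.2 fun c _ => ?_
    have h1 : xor (a c) (xor x (xor x (a c))) = false := by cases a c <;> cases x <;> rfl
    simp [bsAmp, invSqrtTwo_ne_zero, ha]
  · refine Finset.prod_eq_zero (Finset.mem_univ (⟨0, hN⟩ : Fin N)) ?_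
    simp [bsAmp, Ne.symm hx']

theorem baconShor_local_moves (N : ℕ) (hN : 0 < N) (ρ : Fin N → Equiv.Perm (Fin 4))
    (γ : Fin N → Gauge) (S : Finset (Fin 4)) : List.TFAE [
      3 ≤ S.card,
      ∀ K, ∃ K', ∀ ψ : Bool → ℂ,
        localOp (S ×ˢ Finset.univ)ᶜ K (bsEncode ρ γ ψ) =
          localOp (S ×ˢ Finset.univ) K' (bsEncode ρ γ ψ),
      ∃ (C : Circuit (Fin 4 × Fin N)) (β : Fin 4 × Fin N → Fin 4 × Fin N) (a : Fin 4 × Fin N),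
        C.Layered ∧ C.ActsOn {q | q.1 ∈ S} ∧ a.1 ∈ S ∧
        Set.InjOn β {j | j.1 ∉ S} ∧ (∀ j, j.1 ∉ S → (β j).1 ∈ S ∧ β j ≠ a) ∧
        ∀ (ψ : Bool → ℂ) (y : Fin 4 × Fin N → Bool), C.run (bsEncode ρ γ ψ) y =
          ψ (y a) * bellAndZeros (S ×ˢ Finset.univ) β {a} y] := by
  have hmem : ∀ q : Fin 4 × Fin N, q ∈ S ×ˢ (Finset.univ : Finset (Fin N)) ↔ q.1 ∈ S := by simp
  tfae_have 1 → 3 := by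
    intro hS
    obtain ⟨G, β, a, h⟩ := bsCopies_decodes hN ρ γ hS
    refine ⟨sequential G, β, a, sequential_layered G, sequential_actsOn fun g hg q hq => ?_,
      (hmem a).1 (h.logical a rfl).1, ?_, fun j hj => ⟨?_, ?_⟩, fun ψ y => ?_⟩
    · exact (hmem q).1 (h.support g hg hq)
    · intro i hi j hj hij
      exact h.inj (fun h' => hi ((hmem i).1 h')) (fun h' => hj ((hmem j).1 h')) hij
    · exact (hmem _).1 (h.mem j fun h' => hj ((hmem j).1 h'))
    · exact (h.logical a rfl).2 j fun h' => hj ((hmem j).1 h')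
    · have hL : {q | some a = some q} = {a} := by ext q; simp [eq_comm]
      rw [run_sequential]
      unfold bsEncode
      rw [runGates_sum]
      simp only [h.run, hL]
      cases hya : y a <;> simp [hya]
  tfae_have 3 → 2 := by
    rintro ⟨C, β, a, -, hC, ha, hβ, hβS, hrun⟩
    refine push_of_bell (fun q => Finset.mem_compl) (β := β) ?_ ?_ (G := C.flatten) ?_
      (F := fun ψ y => ψ (y a)) (L := {a}) (fun ψ y => ?_) ?_
    · intro i hi j hj hij
      exact hβ (fun h' => hi ((hmem i).2 h')) (fun h' => hj ((hmem j).2 h')) hij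
    · exact fun j hj => (hmem _).2 (hβS j fun h' => hj ((hmem j).2 h')).1
    · exact fun g hg q hq => (hmem q).2 (mem_flatten_support hC g hg hq)
    · rw [← Circuit.run_eq_runGates, hrun]
    · intro ψ y y' h
      have := h a ((hmem a).2 ha) fun j hj => (hβS j fun h' => hj ((hmem j).2 h')).2
      simp only [this]
  -- The same count, where the logical qubit makes the inequality strict.
  tfae_have 2 → 1 := by
    intro h
    have := card_mul_le_of_push (R := Bool) (S := S ×ˢ (Finset.univ : Finset (Fin N)))
      (S' := (S ×ˢ Finset.univ)ᶜ) (fun q => Finset.mem_compl)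
      (fun x => bsEncode ρ γ fun x' => if x' = x then 1 else 0)
      (fun K => (h K).imp fun K' h x => h _) fun x => by
        simp only [bsEncode_basis]
        exact bsCopies_support hN ρ γ x
    rw [Fintype.card_bool, mul_comm, ← pow_succ, Nat.pow_le_pow_iff_right (by norm_num),
      Finset.card_compl, Finset.card_product, Fintype.card_prod] at this
    simp only [Fintype.card_fin, Finset.card_univ] at this
    by_contra hS
    have h2 : S.card * N ≤ 2 * N := Nat.mul_le_mul_right N (by omega)
    omega
  tfae_finish

theorem ite_eq_of_iff {P P' : Prop} {_ : Decidable P} {_ : Decidable P'} (h : P ↔ P') (a b : ℂ) :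
    (if P then a else b) = if P' then a else b := if_congr h rfl rfl

theorem ite_eq_mul_ite {P P' R : Prop} {_ : Decidable P} {_ : Decidable P'} {_ : Decidable R}
    (h : R ↔ P ∧ P') (a : ℂ) :
    (if R then a else 0) = (if P then 1 else 0) * if P' then a else 0 := by
  by_cases h1 : P <;> by_cases h2 : P' <;> simp [h, h1, h2]

/-! ### Entanglement across two legs of the Bacon-Shor tensor -/

/-- In the gauge `ZZ = +1` the code words are GHZ states: `(|0000⟩ + |1111⟩)/√2` and
`(|0011⟩ + |1100⟩)/√2`. -/
theorem bsAmp_zPlus (x : Bool) (u : Fin 4 → Bool) : bsAmp .zPlus x u =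
    if ∃ b : Bool, ∀ k : Fin 4, u k = xor b (if k.val < 2 then false else x)
      then invSqrtTwo else 0 := by
  have h : (∃ b : Bool, ∀ k : Fin 4, u k = xor b (if k.val < 2 then false else x)) ↔
      (xor (xor (u 0) (u 1)) (xor (u 2) (u 3)) = false ∧ xor (u 0) (u 2) = x) ∧
        xor (u 0) (u 1) = false := by
    constructor
    · rintro ⟨b, hb⟩
      rw [hb 0, hb 1, hb 2, hb 3]
      cases b <;> cases x <;> simp
    · rintro ⟨⟨h1, h2⟩, h3⟩
      refine ⟨u 0, ?_⟩
      revert h1 h2 h3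
      simp only [Fin.forall_fin_succ, Fin.succ]
      generalize u 0 = a
      generalize hb : u 1 = b
      generalize hc : u 2 = c
      generalize hd : u 3 = d
      intro h1 h2 h3
      simp
      refine ⟨?_, ?_, ?_⟩
      · rw [hb]; revert h1 h2 h3; cases a <;> cases b <;> cases c <;> cases d <;> simp
      · rw [hc]; revert h1 h2 h3; cases a <;> cases b <;> cases c <;> cases d <;> simp
      · rw [hd]; revert h1 h2 h3; cases a <;> cases b <;> cases c <;> cases d <;> simp
  unfold bsAmp
  by_cases h1 : xor (xor (u 0) (u 1)) (xor (u 2) (u 3)) = false ∧ xor (u 0) (u 2) = x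
  · by_cases h2 : xor (u 0) (u 1) = false
    · rw [if_pos h1, if_pos (h.2 ⟨h1, h2⟩), h2]
      simp [Gauge.vec]
    · rw [if_pos h1, if_neg fun h' => h2 (h.1 h').2]
      simp only [Bool.not_eq_false] at h2
      simp [Gauge.vec, h2]
  · rw [if_neg h1, if_neg fun h' => h1 (h.1 h').1]

/-- One CNOT gate decouples the logical qubit from a copy in which `Z̄` acts within the cut. -/
theorem baconShor_ghz (N : ℕ) (ρ : Fin N → Equiv.Perm (Fin 4)) (S : Finset (Fin 4))
    (h : ∃ c, ∃ i ∈ S, ∃ j ∈ S, ((ρ c).symm i).val < 2 ∧ 2 ≤ ((ρ c).symm j).val) :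
    ∃ (C : Circuit (Fin 4 × Fin N)) (a : Fin 4 × Fin N) (f : Bool → Fin 4 × Fin N → Bool),
      C.Layered ∧ C.ActsOn {q | q.1 ∈ S} ∧ a.1 ∈ S ∧
      ∀ x y, C.run (bsEncode ρ (fun _ => Gauge.zPlus) (fun x' => if x' = x then 1 else 0)) y =
        (if y a = x then 1 else 0) * ∏ c, ghzLike (fun q => q.2 = c ∧ q ≠ a) (f x) y := by
  obtain ⟨c₀, i, hi, j, hj, hi2, hj2⟩ := h
  have hij : (i, c₀) ≠ (j, c₀) := by
    intro h
    have := (Prod.ext_iff.1 h).1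
    simp only at this
    subst this
    omega
  -- In the code word `x`, the bits on the qubits 3 and 4 differ by `x` from those on 1 and 2.
  let f : Bool → Fin 4 × Fin N → Bool := fun x q =>
    if ((ρ q.2).symm q.1).val < 2 then false else x
  refine ⟨sequential [.cnot (i, c₀) (j, c₀) hij], (j, c₀), f, sequential_layered _,
    sequential_actsOn ?_, hj, fun x y => ?_⟩
  · intro g hg
    simp only [List.mem_singleton] at hg
    subst hg
    simp [Gate.support, Set.insert_subset_iff, hi, hj]
  · rw [run_sequential, runGates_cons, runGates_nil]
    simp only [Gate.apply, bsEncode_basis]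
    set y' := @Function.update _ (fun _ => Bool) (fun a b => Classical.propDecidable (a = b)) y
      (j, c₀) (xor (y (i, c₀)) (y (j, c₀))) with hy'
    have hne : ∀ q, q ≠ (j, c₀) → y' q = y q := fun q hq => update_bit_of_ne hq _ _
    have hself : y' (j, c₀) = xor (y (i, c₀)) (y (j, c₀)) := by simp [hy']
    unfold bsCopies
    simp only [bsAmp_zPlus, ghzLike]
    have hcopy : ∀ c b, (∀ k : Fin 4, y' (ρ c k, c) = xor b (if k.val < 2 then false else x)) ↔
        ∀ l, y' (l, c) = xor b (f x (l, c)) := by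
      intro c b
      constructor
      · intro h l
        simpa [f] using h ((ρ c).symm l)
      · intro h k
        simpa [f] using h (ρ c k)
    simp only [hcopy]
    conv_lhs => rw [← Finset.mul_prod_erase _ _ (Finset.mem_univ c₀)]
    conv_rhs => rw [← Finset.mul_prod_erase _ _ (Finset.mem_univ c₀), ← mul_assoc]
    congr 1
    · refine ite_eq_mul_ite ⟨?_, ?_⟩ _
      · rintro ⟨b, hb⟩
        have h1 := hb i
        have h2 := hb j
        rw [hne _ hij] at h1
        rw [hself, h1] at h2
        simp only [f, if_pos hi2, if_neg (not_lt.2 hj2), Bool.xor_false] at h2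
        refine ⟨?_, b, ?_⟩
        · revert h2
          cases b <;> cases y (j, c₀) <;> cases x <;> simp
        · rintro ⟨l, c⟩ ⟨rfl, hl⟩
          rw [← hne _ hl, hb]
      · rintro ⟨hx, b, hb⟩
        refine ⟨b, fun l => ?_⟩
        by_cases hl : l = j
        · subst hl
          rw [hself, hb (i, c₀) ⟨rfl, hij⟩, hx]
          simp only [f, if_pos hi2, if_neg (not_lt.2 hj2), Bool.xor_false]
        · have : (l, c₀) ≠ (j, c₀) := fun h => hl (Prod.ext_iff.1 h).1
          rw [hne _ this, hb (l, c₀) ⟨rfl, this⟩]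
    · refine Finset.prod_congr rfl fun c hc => ite_eq_of_iff (exists_congr fun b => ?_) _ _
      have hcc := Finset.ne_of_mem_erase hc
      constructor
      · rintro h ⟨l, c'⟩ ⟨rfl, hl⟩
        rw [← hne _ hl, h]
      · intro h l
        have : (l, c) ≠ (j, c₀) := fun h => hcc (Prod.ext_iff.1 h).2
        rw [hne _ this, h (l, c) ⟨rfl, this⟩]

namespace Network

/-! ### Contraction of a network, tile by tile -/

section Contract

variable {net : Network} {N : ℕ}

theorem Proper.ne_tile (hnet : net.Proper) {l l' : net.Leg} (h : net.glued l l') : l.1 ≠ l'.1 :=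
  fun h' => hnet.bipartite l l' h (by rw [h'])

/-- Bit assignments `z` to the legs that contribute to the contraction of `R` with open
legs `w`. -/
def Consistent (R : Finset net.Tile) (w z : net.Leg → Fin N → Bool) : Prop :=
  (∀ l, ¬ Interior R l → z l = w l) ∧ ∀ l l', Interior R l → net.glued l l' → z l = z l'

/-- The tensor of the tile `t`. -/
def Dressing.tile (D : net.Dressing N) (x : net.Bulk → Bool) (t : net.Tile)
    (b : Fin (net.kind t).legs → Fin N → Bool) : ℂ :=
  tileAmp (net.kind t) (D.orient t) (D.gauge t)
    (if h : net.kind t = TileKind.square then x ⟨t, h⟩ else false) b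

theorem Dressing.contract_eq (D : net.Dressing N) (R : Finset net.Tile) (x : net.Bulk → Bool)
    (w : net.Leg → Fin N → Bool) : D.contract R x w =
      ((Real.sqrt 2 : ℝ) : ℂ) ^ (N * edgeCount R) * ∑ z : net.Leg → Fin N → Bool,
        if Consistent R w z then ∏ t ∈ R, D.tile x t fun i => z ⟨t, i⟩ else 0 := by
  unfold Dressing.contract
  congr 1
  exact Finset.sum_congr rfl fun z _ => ite_eq_of_iff Iff.rfl _ _

theorem Dressing.contract_empty (D : net.Dressing N) (x : net.Bulk → Bool)
    (w : net.Leg → Fin N → Bool) : D.contract ∅ x w = 1 := by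
  have hI : ∀ l : net.Leg, ¬ Interior (∅ : Finset net.Tile) l := by
    rintro l ⟨h, -⟩
    simp at h
  rw [Dressing.contract_eq, Finset.sum_eq_single w]
  · simp [Consistent, hI, edgeCount]
  · intro z _ hz
    rw [if_neg]
    exact fun h => hz (funext fun l => h.1 l (hI l))
  · simp

/-- A contraction depends only on the open legs of the contracted tiles. -/
theorem Dressing.contract_congr (hnet : net.Proper) (D : net.Dressing N) (R : Finset net.Tile)
    (x : net.Bulk → Bool) {w w' : net.Leg → Fin N → Bool}
    (h : ∀ l : net.Leg, l.1 ∈ R → ¬ Interior R l → w l = w' l) :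
    D.contract R x w = D.contract R x w' := by
  rw [Dressing.contract_eq, Dressing.contract_eq]
  congr 1
  rw [← Finset.sum_filter, ← Finset.sum_filter]
  have key : ∀ w w' z : net.Leg → Fin N → Bool,
      (∀ l : net.Leg, l.1 ∈ R → ¬ Interior R l → w l = w' l) → Consistent R w z →
      Consistent R w' fun l => if l.1 ∈ R then z l else w' l := by
    intro w w' z h hz
    constructor
    · intro l hl
      by_cases hR : l.1 ∈ R
      · simp only [hR, if_true, hz.1 l hl, h l hR hl]
      · simp only [hR, if_false]
    · intro l l' hl hll'
      have h1 : z l = z l' := hz.2 l l' hl hll'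
      obtain ⟨h2, l'', h3, h4⟩ := hl
      obtain rfl := hnet.unique _ _ _ hll' h3
      simp only [h2, h4, if_true, h1]
  have inv : ∀ w w' z : net.Leg → Fin N → Bool, Consistent R w z →
      (fun l : net.Leg => if l.1 ∈ R then (if l.1 ∈ R then z l else w' l) else w l) = z := by
    intro w w' z hz
    funext l
    by_cases hR : l.1 ∈ R
    · simp only [hR, if_true]
    · simp only [hR, if_false]
      exact (hz.1 l fun h => hR h.1).symm
  refine Finset.sum_nbij' (fun z l => if l.1 ∈ R then z l else w' l)
    (fun z l => if l.1 ∈ R then z l else w l) ?_ ?_ ?_ ?_ ?_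
  · intro z hz
    exact Finset.mem_filter.2 ⟨Finset.mem_univ _, key w w' z h (Finset.mem_filter.1 hz).2⟩
  · intro z hz
    exact Finset.mem_filter.2 ⟨Finset.mem_univ _,
      key w' w z (fun l h1 h2 => (h l h1 h2).symm) (Finset.mem_filter.1 hz).2⟩
  · intro z hz
    exact inv w w' z (Finset.mem_filter.1 hz).2
  · intro z hz
    exact inv w' w z (Finset.mem_filter.1 hz).2
  · intro z hz
    refine Finset.prod_congr rfl fun t ht => ?_
    simp only [ht, if_true]

/-- The bits `w`, overwritten by `u` on the edges that join the tile `t` to another tile of `R`. -/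
def extend (R : Finset net.Tile) (t : net.Tile) (w : net.Leg → Fin N → Bool)
    (u : {i // Interior R (⟨t, i⟩ : net.Leg)} → Fin N → Bool) : net.Leg → Fin N → Bool :=
  fun l => if h : ∃ i : {i // Interior R (⟨t, i⟩ : net.Leg)}, l = ⟨t, i.1⟩ ∨ net.glued l ⟨t, i.1⟩
    then u h.choose else w l

theorem leg_ext {t : net.Tile} {i j : Fin (net.kind t).legs}
    (h : (⟨t, i⟩ : net.Leg) = ⟨t, j⟩) : i = j := by
  injection h with _ h2

theorem Proper.leg_injective (hnet : net.Proper) {t : net.Tile} {l : net.Leg}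
    {i j : Fin (net.kind t).legs} (hi : l = ⟨t, i⟩ ∨ net.glued l ⟨t, i⟩)
    (hj : l = ⟨t, j⟩ ∨ net.glued l ⟨t, j⟩) : i = j := by
  rcases hi with rfl | hi
  · rcases hj with hj | hj
    · exact leg_ext hj
    · exact (hnet.ne_tile hj rfl).elim
  · rcases hj with rfl | hj
    · exact (hnet.ne_tile hi rfl).elim
    · exact leg_ext (hnet.unique _ _ _ hi hj)

theorem extend_of (hnet : net.Proper) {R : Finset net.Tile} {t : net.Tile}
    (w : net.Leg → Fin N → Bool) (u : {i // Interior R (⟨t, i⟩ : net.Leg)} → Fin N → Bool)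
    {l : net.Leg} (i : {i // Interior R (⟨t, i⟩ : net.Leg)})
    (h : l = ⟨t, i.1⟩ ∨ net.glued l ⟨t, i.1⟩) : extend R t w u l = u i := by
  have hex : ∃ i : {i // Interior R (⟨t, i⟩ : net.Leg)},
    l = ⟨t, i.1⟩ ∨ net.glued l ⟨t, i.1⟩ := ⟨i, h⟩
  rw [extend, dif_pos hex]
  congr 1
  exact Subtype.ext (hnet.leg_injective hex.choose_spec h)

theorem extend_of_not {R : Finset net.Tile} {t : net.Tile}
    (w : net.Leg → Fin N → Bool) (u : {i // Interior R (⟨t, i⟩ : net.Leg)} → Fin N → Bool)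
    {l : net.Leg} (h : ∀ i, Interior R (⟨t, i⟩ : net.Leg) → l ≠ ⟨t, i⟩ ∧ ¬ net.glued l ⟨t, i⟩) :
    extend R t w u l = w l := by
  rw [extend, dif_neg]
  rintro ⟨i, hi | hi⟩
  · exact (h i.1 i.2).1 hi
  · exact (h i.1 i.2).2 hi

/-- Cutting the edges between the tile `t` and the rest `R'` of `R`: the assignments `z` that
contribute to the contraction of `R` and have the bits `u` on these edges are those that contribute
to the contraction of `R'` with `u` on its new open legs. -/
theorem consistent_extend (hnet : net.Proper) {R R' : Finset net.Tile} {t : net.Tile}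
    (hR : ∀ u, u ∈ R ↔ u = t ∨ u ∈ R') (ht : t ∉ R') (w z : net.Leg → Fin N → Bool)
    (u : {i // Interior R (⟨t, i⟩ : net.Leg)} → Fin N → Bool) :
    (Consistent R w z ∧ ∀ i, u i = z ⟨t, i.1⟩) ↔ Consistent R' (extend R t w u) z := by
  have hmono : ∀ l, Interior R' l → Interior R l := by
    rintro l ⟨h1, l', h2, h3⟩
    exact ⟨(hR _).2 (Or.inr h1), l', h2, (hR _).2 (Or.inr h3)⟩
  constructor
  · rintro ⟨⟨h1, h2⟩, h3⟩
    refine ⟨fun l hl => ?_, fun l l' hl => h2 l l' (hmono l hl)⟩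
    by_cases hex : ∃ i : {i // Interior R (⟨t, i⟩ : net.Leg)}, l = ⟨t, i.1⟩ ∨ net.glued l ⟨t, i.1⟩
    · obtain ⟨i, hi⟩ := hex
      rw [extend_of hnet w u i hi, h3]
      rcases hi with rfl | hi
      · rfl
      · exact (h2 _ _ i.2 (hnet.symm _ _ hi)).symm
    · rw [extend_of_not w u fun i hi => ⟨fun h => hex ⟨⟨i, hi⟩, Or.inl h⟩,
        fun h => hex ⟨⟨i, hi⟩, Or.inr h⟩⟩]
      refine h1 l fun hI => hex ?_
      obtain ⟨h4, l', h5, h6⟩ := id hI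
      rcases (hR _).1 h4 with h4 | h4
      · obtain ⟨t', i⟩ := l
        obtain rfl := h4
        exact ⟨⟨i, hI⟩, Or.inl rfl⟩
      · rcases (hR _).1 h6 with h6 | h6
        · obtain ⟨t', i⟩ := l'
          obtain rfl := h6
          exact ⟨⟨i, ⟨(hR _).2 (Or.inl rfl), l, hnet.symm _ _ h5, hI.1⟩⟩, Or.inr h5⟩
        · exact absurd ⟨h4, l', h5, h6⟩ hl
  · rintro ⟨h1, h2⟩
    have h3 : ∀ i, u i = z ⟨t, i.1⟩ := by
      intro i
      rw [h1 ⟨t, i.1⟩ fun h => ht h.1, extend_of hnet w u i (Or.inl rfl)]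
    refine ⟨⟨fun l hl => ?_, fun l l' hl hll' => ?_⟩, h3⟩
    · rw [h1 l fun h => hl (hmono l h), extend_of_not]
      intro i hi
      constructor
      · rintro rfl
        exact hl hi
      · intro h
        obtain ⟨h4, l', h5, h6⟩ := hi
        obtain rfl := hnet.unique _ _ _ (hnet.symm _ _ h) h5
        exact hl ⟨h6, _, h, h4⟩
    · obtain ⟨h4, l'', h5, h6⟩ := id hl
      obtain rfl := hnet.unique _ _ _ hll' h5
      rcases (hR _).1 h4 with h7 | h7
      · obtain ⟨t', i⟩ := l
        obtain rfl := h7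
        rw [← h3 ⟨i, hl⟩, h1 l' fun ⟨_, l'', h8, h9⟩ => ?_,
          extend_of hnet w u ⟨i, hl⟩ (Or.inr (hnet.symm _ _ hll'))]
        rw [hnet.unique _ _ _ h8 (hnet.symm _ _ hll')] at h9
        exact ht h9
      · rcases (hR _).1 h6 with h8 | h8
        · obtain ⟨t', i⟩ := l'
          obtain rfl := h8
          have hi : Interior R (⟨t', i⟩ : net.Leg) := ⟨h6, l, hnet.symm _ _ hll', h4⟩
          rw [← h3 ⟨i, hi⟩, h1 l fun ⟨_, l'', h8, h9⟩ => ?_,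
            extend_of hnet w u ⟨i, hi⟩ (Or.inr hll')]
          rw [hnet.unique _ _ _ h8 hll'] at h9
          exact ht h9
        · exact h2 l l' ⟨h7, l', hll', h8⟩ hll'

theorem edgeCount_insert (hnet : net.Proper) {R R' : Finset net.Tile} {t : net.Tile}
    (hR : ∀ u, u ∈ R ↔ u = t ∨ u ∈ R') (ht : t ∉ R') :
    edgeCount R = edgeCount R' +
      (Finset.univ.filter fun i => Interior R (⟨t, i⟩ : net.Leg)).card := by
  have hpart : ∀ i : Fin (net.kind t).legs, ∃ l : net.Leg, Interior R (⟨t, i⟩ : net.Leg) →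
      net.glued l ⟨t, i⟩ ∧ l.1 ∈ R := by
    intro i
    by_cases h : Interior R (⟨t, i⟩ : net.Leg)
    · obtain ⟨-, l, h1, h2⟩ := h
      exact ⟨l, fun _ => ⟨hnet.symm _ _ h1, h2⟩⟩
    · exact ⟨⟨t, i⟩, fun h' => absurd h' h⟩
  -- `f i` is the far end of the edge of the leg `i` of `t`.
  choose f hf using hpart
  set I := Finset.univ.filter fun i => Interior R (⟨t, i⟩ : net.Leg) with hI
  have hmem : ∀ i, i ∈ I ↔ Interior R (⟨t, i⟩ : net.Leg) := fun i => by simp [hI]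
  have h1 : (Finset.univ.filter fun l : net.Leg => Interior R l) =
      (Finset.univ.filter fun l : net.Leg => Interior R' l) ∪
        (I.image (fun i => (⟨t, i⟩ : net.Leg)) ∪ I.image f) := by
    ext l
    simp only [Finset.mem_filter, Finset.mem_univ, true_and, Finset.mem_union, Finset.mem_image,
      hmem]
    constructor
    · intro hl
      obtain ⟨h4, l', h5, h6⟩ := id hl
      rcases (hR _).1 h4 with h4 | h4
      · obtain ⟨t', i⟩ := l
        obtain rfl := h4
        exact Or.inr (Or.inl ⟨i, hl, rfl⟩)
      · rcases (hR _).1 h6 with h6 | h6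
        · obtain ⟨t', i⟩ := l'
          obtain rfl := h6
          have hi : Interior R (⟨t', i⟩ : net.Leg) :=
            ⟨(hR _).2 (Or.inl rfl), l, hnet.symm _ _ h5, hl.1⟩
          exact Or.inr (Or.inr ⟨i, hi, hnet.unique _ _ _ (hnet.symm _ _ (hf i hi).1)
            (hnet.symm _ _ h5)⟩)
        · exact Or.inl ⟨h4, l', h5, h6⟩
    · rintro (⟨h1, l', h2, h3⟩ | ⟨i, hi, rfl⟩ | ⟨i, hi, rfl⟩)
      · exact ⟨(hR _).2 (Or.inr h1), l', h2, (hR _).2 (Or.inr h3)⟩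
      · exact hi
      · exact ⟨(hf i hi).2, _, (hf i hi).1, hi.1⟩
  have h2 : Disjoint (I.image (fun i => (⟨t, i⟩ : net.Leg))) (I.image f) := by
    rw [Finset.disjoint_left]
    intro l hl hl'
    obtain ⟨i, hi, rfl⟩ := Finset.mem_image.1 hl
    obtain ⟨j, hj, h⟩ := Finset.mem_image.1 hl'
    refine hnet.ne_tile (hf j ((hmem j).1 hj)).1 ?_
    rw [h]
  have h3 : Disjoint (Finset.univ.filter fun l : net.Leg => Interior R' l)
      (I.image (fun i => (⟨t, i⟩ : net.Leg)) ∪ I.image f) := by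
    rw [Finset.disjoint_left]
    intro l hl hl'
    obtain ⟨h4, l', h5, h6⟩ := (Finset.mem_filter.1 hl).2
    rcases Finset.mem_union.1 hl' with hl' | hl'
    · obtain ⟨i, hi, rfl⟩ := Finset.mem_image.1 hl'
      exact ht h4
    · obtain ⟨j, hj, rfl⟩ := Finset.mem_image.1 hl'
      rw [hnet.unique _ _ _ h5 (hf j ((hmem j).1 hj)).1] at h6
      exact ht h6
  unfold edgeCount
  rw [h1, Finset.card_union_of_disjoint h3, Finset.card_union_of_disjoint h2,
    Finset.card_image_of_injective _ fun i j h => leg_ext h, Finset.card_image_of_injOn]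
  · omega
  · intro i hi j hj hij
    have h4 := (hf i ((hmem i).1 hi)).1
    have h5 := (hf j ((hmem j).1 hj)).1
    rw [hij] at h4
    exact hnet.leg_injective (Or.inr h4) (Or.inr h5)

/-- Pulling the tensor of one tile out of a contraction leaves a sum over the bits `u` on the edges
between this tile and the others. -/
theorem Dressing.contract_insert (hnet : net.Proper) (D : net.Dressing N) {R R' : Finset net.Tile}
    {t : net.Tile} (hR : ∀ u, u ∈ R ↔ u = t ∨ u ∈ R') (ht : t ∉ R') (x : net.Bulk → Bool)
    (w : net.Leg → Fin N → Bool) :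
    D.contract R x w = ((Real.sqrt 2 : ℝ) : ℂ) ^
        (N * (Finset.univ.filter fun i => Interior R (⟨t, i⟩ : net.Leg)).card) *
      ∑ u : {i // Interior R (⟨t, i⟩ : net.Leg)} → Fin N → Bool,
        D.tile x t (fun i => extend R t w u ⟨t, i⟩) * D.contract R' x (extend R t w u) := by
  have hsplit : ∀ z : net.Leg → Fin N → Bool,
      (if Consistent R w z then ∏ s ∈ R, D.tile x s fun i => z ⟨s, i⟩ else 0) =
      ∑ u : {i // Interior R (⟨t, i⟩ : net.Leg)} → Fin N → Bool,
        D.tile x t (fun i => extend R t w u ⟨t, i⟩) *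
        if Consistent R' (extend R t w u) z then ∏ s ∈ R', D.tile x s fun i => z ⟨s, i⟩ else 0 := by
    intro z
    rw [Finset.sum_eq_single fun i => z ⟨t, i.1⟩]
    · by_cases h : Consistent R w z
      · have h' := (consistent_extend hnet hR ht w z fun i => z ⟨t, i.1⟩).1 ⟨h, fun _ => rfl⟩
        have hins : R = insert t R' := by
          ext s
          rw [hR, Finset.mem_insert]
        rw [if_pos h, if_pos h', hins, Finset.prod_insert ht, ← hins]
        congr 2
        funext i
        exact h'.1 _ fun h => ht h.1
      · have h' : ¬ Consistent R' (extend R t w fun i => z ⟨t, i.1⟩) z := fun h' =>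
          h ((consistent_extend hnet hR ht w z _).2 h').1
        rw [if_neg h, if_neg h', mul_zero]
    · intro u _ hu
      rw [if_neg, mul_zero]
      exact fun h => hu (funext ((consistent_extend hnet hR ht w z u).2 h).2)
    · simp
  rw [Dressing.contract_eq, Finset.sum_congr rfl fun z _ => hsplit z, Finset.sum_comm,
    edgeCount_insert hnet hR ht, Nat.mul_add, pow_add, mul_comm (_ ^ (N * edgeCount R')), mul_assoc]
  congr 1
  rw [Finset.mul_sum]
  refine Finset.sum_congr rfl fun u _ => ?_
  rw [← Finset.mul_sum, Dressing.contract_eq]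
  ring

end Contract
end Network

namespace Network

/-! ### Absorbing one tile -/

section Step

variable {net : Network} {N : ℕ} {A : Set net.Boundary} {W : Finset net.Tile} {t : net.Tile}

/-- The leg glued to `l`, or `l` itself if it lies on the boundary: the leg on which the cut
meets the edge of `l` after the tile of `l` is absorbed. -/
def outerEnd (l : net.Leg) : net.Leg := if h : ∃ l', net.glued l l' then h.choose else l

theorem outerEnd_of_glued (hnet : net.Proper) {l l' : net.Leg} (h : net.glued l l') :
    outerEnd l = l' := by
  have hex : ∃ l', net.glued l l' := ⟨l', h⟩
  rw [outerEnd, dif_pos hex]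
  exact hnet.unique _ _ _ hex.choose_spec h

theorem outerEnd_of_isBoundary {l : net.Leg} (h : net.IsBoundary l) : outerEnd l = l := by
  rw [outerEnd, dif_neg]
  rintro ⟨l', hl'⟩
  exact h l' hl'

theorem glued_or_isBoundary (l : net.Leg) : (∃ l', net.glued l l') ∨ net.IsBoundary l := by
  by_cases h : ∃ l', net.glued l l'
  · exact Or.inl h
  · exact Or.inr fun l' hl' => h ⟨l', hl'⟩

theorem outerEnd_injective (hnet : net.Proper) {i j : Fin (net.kind t).legs}
    (h : outerEnd (⟨t, i⟩ : net.Leg) = outerEnd ⟨t, j⟩) : i = j := by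
  have key : ∀ i : Fin (net.kind t).legs, outerEnd (⟨t, i⟩ : net.Leg) = ⟨t, i⟩ ∨
      net.glued (outerEnd (⟨t, i⟩ : net.Leg)) ⟨t, i⟩ := by
    intro i
    rcases glued_or_isBoundary (⟨t, i⟩ : net.Leg) with ⟨l', hl'⟩ | hb
    · rw [outerEnd_of_glued hnet hl']
      exact Or.inr (hnet.symm _ _ hl')
    · exact Or.inl (outerEnd_of_isBoundary hb)
  exact hnet.leg_injective (key i) (h ▸ key j)

/-- The accessible legs of the tile `t`. -/
def accessibleLegs (A : Set net.Boundary) (W : Finset net.Tile) (t : net.Tile) :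
    Finset (Fin (net.kind t).legs) :=
  Finset.univ.filter fun i => Accessible A W (⟨t, i⟩ : net.Leg)

theorem mem_accessibleLegs {i : Fin (net.kind t).legs} :
    i ∈ accessibleLegs A W t ↔ Accessible A W ⟨t, i⟩ := by
  simp [accessibleLegs]

theorem Accessible.mono {W' : Finset net.Tile} (hW : W ⊆ W') {l : net.Leg}
    (h : Accessible A W l) : Accessible A W' l :=
  h.imp id fun ⟨l', h1, h2⟩ => ⟨l', h1, hW h2⟩

theorem onCut_accessible (ht : t ∉ W) {l : net.Leg} (hl : l.1 = t) (h : OnCut A W l) :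
    Accessible A W l := by
  rcases h with h | h
  · exact h.2
  · exact absurd (hl ▸ h.1) ht

theorem exists_leg_of_onCut (ht : t ∉ W) {l : net.Leg} (hl : l.1 = t) (h : OnCut A W l) :
    ∃ i ∈ accessibleLegs A W t, l = ⟨t, i⟩ := by
  have := onCut_accessible ht hl h
  obtain ⟨t', i⟩ := l
  obtain rfl := hl
  exact ⟨i, mem_accessibleLegs.2 this, rfl⟩

theorem onCut_of_mem (ht : t ∉ W) {i : Fin (net.kind t).legs} (h : i ∈ accessibleLegs A W t) :
    OnCut A W ⟨t, i⟩ := Or.inl ⟨ht, mem_accessibleLegs.1 h⟩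

theorem onCut_insert_iff (hnet : net.Proper) (ht : t ∉ W) (l : net.Leg) :
    OnCut A (insert t W) l ↔ (OnCut A W l ∧ l.1 ≠ t) ∨
      ∃ i, i ∉ accessibleLegs A W t ∧ outerEnd (⟨t, i⟩ : net.Leg) = l := by
  simp only [mem_accessibleLegs]
  constructor
  · rintro (⟨h1, h2⟩ | ⟨h1, hb, h2⟩)
    · have h3 : l.1 ≠ t := fun h => h1 (h ▸ Finset.mem_insert_self _ _)
      have h4 : l.1 ∉ W := fun h => h1 (Finset.mem_insert_of_mem h)
      rcases h2 with h2 | ⟨⟨u, i⟩, h2, h5⟩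
      · exact Or.inl ⟨Or.inl ⟨h4, Or.inl h2⟩, h3⟩
      · rcases Finset.mem_insert.1 h5 with h5 | h5
        · obtain rfl := h5
          refine Or.inr ⟨i, ?_, outerEnd_of_glued hnet (hnet.symm _ _ h2)⟩
          rintro (⟨hb, -⟩ | ⟨l'', h6, h7⟩)
          · exact hb _ (hnet.symm _ _ h2)
          · rw [hnet.unique _ _ _ h6 (hnet.symm _ _ h2)] at h7
            exact h4 h7
        · exact Or.inl ⟨Or.inl ⟨h4, Or.inr ⟨_, h2, h5⟩⟩, h3⟩
    · rcases Finset.mem_insert.1 h1 with h1 | h1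
      · obtain ⟨u, i⟩ := l
        obtain rfl := h1
        refine Or.inr ⟨i, ?_, outerEnd_of_isBoundary hb⟩
        rintro (⟨_, h3⟩ | ⟨l'', h6, -⟩)
        · exact h2 h3
        · exact hb _ h6
      · exact Or.inl ⟨Or.inr ⟨h1, hb, h2⟩, fun h => ht (h ▸ h1)⟩
  · rintro (⟨(⟨h1, h2⟩ | ⟨h1, h2⟩), h3⟩ | ⟨i, h1, rfl⟩)
    · refine Or.inl ⟨fun h => ?_, h2.mono (Finset.subset_insert _ _)⟩
      rcases Finset.mem_insert.1 h with h | h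
      · exact h3 h
      · exact h1 h
    · exact Or.inr ⟨Finset.mem_insert_of_mem h1, h2⟩
    · rcases glued_or_isBoundary (⟨t, i⟩ : net.Leg) with ⟨l', hl'⟩ | hb
      · rw [outerEnd_of_glued hnet hl']
        refine Or.inl ⟨fun h => ?_, Or.inr ⟨_, hnet.symm _ _ hl', Finset.mem_insert_self _ _⟩⟩
        rcases Finset.mem_insert.1 h with h | h
        · exact hnet.ne_tile hl' h.symm
        · exact h1 (Or.inr ⟨l', hl', h⟩)
      · rw [outerEnd_of_isBoundary hb]
        exact Or.inr ⟨Finset.mem_insert_self _ _, hb, fun h => h1 (Or.inl ⟨hb, h⟩)⟩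

theorem not_onCut_outerEnd (hnet : net.Proper) (ht : t ∉ W) {i : Fin (net.kind t).legs}
    (hi : i ∉ accessibleLegs A W t) : ¬ OnCut A W (outerEnd (⟨t, i⟩ : net.Leg)) := by
  rw [mem_accessibleLegs] at hi
  rcases glued_or_isBoundary (⟨t, i⟩ : net.Leg) with ⟨l', hl'⟩ | hb
  · rw [outerEnd_of_glued hnet hl']
    rintro (⟨h1, ⟨hb, -⟩ | ⟨l'', h2, h3⟩⟩ | ⟨h1, -⟩)
    · exact hb _ (hnet.symm _ _ hl')
    · rw [hnet.unique _ _ _ h2 (hnet.symm _ _ hl')] at h3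
      exact ht h3
    · exact hi (Or.inr ⟨l', hl', h1⟩)
  · rw [outerEnd_of_isBoundary hb]
    exact fun h => hi (onCut_accessible ht rfl h)

/-- The qubit that carries a given copy of a leg of `t`. -/
def Placement.onTile (p : Placement net N) (t : net.Tile) (k : Fin (net.kind t).legs × Fin N) :
    net.Qubit N := p.carrier ⟨t, k.1⟩ k.2

/-- The placement after the tile `t` has been decoded with Bell pairs `(j, β j)` and the bulk qubit
at `a`: the qubit `β j` now stands for the far end of the edge of `j`. -/
def Placement.step (p : Placement net N) (A : Set net.Boundary) (W : Finset net.Tile)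
    (t : net.Tile) (β : Fin (net.kind t).legs × Fin N → Fin (net.kind t).legs × Fin N)
    (a : Option (Fin (net.kind t).legs × Fin N)) : Placement net N where
  carrier l c :=
    if h : ∃ i, i ∉ accessibleLegs A W t ∧ outerEnd (⟨t, i⟩ : net.Leg) = l then
      p.onTile t (β (h.choose, c)) else p.carrier l c
  logical s := if h : s.1 = t ∧ ∃ k, a = some k then p.onTile t h.2.choose else p.logical s

section

variable {p : Placement net N} {β : Fin (net.kind t).legs × Fin N → Fin (net.kind t).legs × Fin N}
  {a : Option (Fin (net.kind t).legs × Fin N)}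

theorem Placement.step_carrier_new (hnet : net.Proper) {i : Fin (net.kind t).legs}
    (hi : i ∉ accessibleLegs A W t) (c : Fin N) :
    (p.step A W t β a).carrier (outerEnd (⟨t, i⟩ : net.Leg)) c = p.onTile t (β (i, c)) := by
  have hex : ∃ j, j ∉ accessibleLegs A W t ∧ outerEnd (⟨t, j⟩ : net.Leg) = outerEnd ⟨t, i⟩ :=
    ⟨i, hi, rfl⟩
  have : hex.choose = i := outerEnd_injective hnet hex.choose_spec.2
  simp only [Placement.step]
  rw [dif_pos hex, this]

theorem Placement.step_carrier_old (hnet : net.Proper) (ht : t ∉ W) {l : net.Leg}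
    (hl : OnCut A W l) (c : Fin N) : (p.step A W t β a).carrier l c = p.carrier l c := by
  simp only [Placement.step]
  rw [dif_neg]
  rintro ⟨i, hi, rfl⟩
  exact not_onCut_outerEnd hnet ht hi hl

theorem Placement.step_logical_old {s : net.Bulk} (hs : s.1 ≠ t) :
    (p.step A W t β a).logical s = p.logical s := by
  simp only [Placement.step]
  rw [dif_neg]
  exact fun h => hs h.1

theorem Placement.step_logical_new {s : net.Bulk} (hs : s.1 = t)
    {k : Fin (net.kind t).legs × Fin N} (hk : a = some k) :
    (p.step A W t β a).logical s = p.onTile t k := by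
  have hex : ∃ k, a = some k := ⟨k, hk⟩
  simp only [Placement.step]
  rw [dif_pos ⟨hs, hex⟩]
  congr 1
  exact Option.some_injective _ ((Exists.choose_spec hex).symm.trans hk)

theorem mem_region_iff {q : net.Qubit N} : q ∈ p.region A W t ↔
    ∃ k ∈ accessibleLegs A W t ×ˢ (Finset.univ : Finset (Fin N)), p.onTile t k = q := by
  constructor
  · rintro ⟨i, c, h, rfl⟩
    exact ⟨(i, c), by simpa using mem_accessibleLegs.2 h, rfl⟩
  · rintro ⟨⟨i, c⟩, h, rfl⟩
    exact ⟨i, c, mem_accessibleLegs.1 (Finset.mem_product.1 h).1, rfl⟩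

variable (hp : p.Valid A W) (ht : t ∉ W)
include hp ht

theorem onTile_mem {k : Fin (net.kind t).legs × Fin N}
    (hk : k ∈ accessibleLegs A W t ×ˢ (Finset.univ : Finset (Fin N))) : (p.onTile t k).1 ∈ A :=
  hp.carrier_mem _ _ (onCut_of_mem ht (Finset.mem_product.1 hk).1)

theorem onTile_injOn : Set.InjOn (p.onTile t)
    ((accessibleLegs A W t ×ˢ (Finset.univ : Finset (Fin N)) : Finset _) : Set _) := by
  rintro ⟨i, c⟩ hk ⟨j, c'⟩ hk' h
  obtain ⟨h1, h2⟩ := hp.carrier_inj _ _ _ _ (onCut_of_mem ht (Finset.mem_product.1 hk).1)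
    (onCut_of_mem ht (Finset.mem_product.1 hk').1) h
  exact Prod.ext (leg_ext h1) h2

theorem carrier_ne_onTile {k : Fin (net.kind t).legs × Fin N}
    (hk : k ∈ accessibleLegs A W t ×ˢ (Finset.univ : Finset (Fin N))) {l : net.Leg}
    (hl : OnCut A W l) (hlt : l.1 ≠ t) (c : Fin N) : p.carrier l c ≠ p.onTile t k := by
  intro h
  obtain ⟨h1, -⟩ := hp.carrier_inj _ _ _ _ hl (onCut_of_mem ht (Finset.mem_product.1 hk).1) h
  exact hlt (by rw [h1])

theorem logical_ne_onTile {k : Fin (net.kind t).legs × Fin N}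
    (hk : k ∈ accessibleLegs A W t ×ˢ (Finset.univ : Finset (Fin N))) {s : net.Bulk}
    (hs : s.1 ∈ W) : p.logical s ≠ p.onTile t k := fun h =>
  hp.disjoint _ _ _ (onCut_of_mem ht (Finset.mem_product.1 hk).1) hs h.symm

variable (hnet : net.Proper) {φ : Bool → QState (Fin (net.kind t).legs × Fin N)}
  {G : List (Gate (Fin (net.kind t).legs × Fin N))}
  (h : LocallyDecodes (accessibleLegs A W t ×ˢ (Finset.univ : Finset (Fin N))) φ G β a)
  (ha : a.isSome ↔ net.kind t = TileKind.square)
include hnet h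

omit hp in
/-- Every carrier after the step is an old carrier of another tile, or one of the qubits on which
the step acts that is a half of a new Bell pair. -/
theorem Placement.step_carrier_cases {l : net.Leg} (hl : OnCut A (insert t W) l) (c : Fin N) :
    (OnCut A W l ∧ l.1 ≠ t ∧ (p.step A W t β a).carrier l c = p.carrier l c) ∨
      ∃ i, i ∉ accessibleLegs A W t ∧ outerEnd (⟨t, i⟩ : net.Leg) = l ∧
        β (i, c) ∈ accessibleLegs A W t ×ˢ (Finset.univ : Finset (Fin N)) ∧
        (p.step A W t β a).carrier l c = p.onTile t (β (i, c)) := by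
  rcases (onCut_insert_iff hnet ht l).1 hl with ⟨h1, h2⟩ | ⟨i, hi, rfl⟩
  · exact Or.inl ⟨h1, h2, step_carrier_old hnet ht h1 c⟩
  · refine Or.inr ⟨i, hi, rfl, h.mem _ fun h' => hi (Finset.mem_product.1 h').1,
      step_carrier_new hnet hi c⟩

include ha

omit hp hnet in
theorem Placement.step_logical_cases {s : net.Bulk} (hs : s.1 ∈ insert t W) :
    (s.1 ∈ W ∧ s.1 ≠ t ∧ (p.step A W t β a).logical s = p.logical s) ∨
      ∃ k, s.1 = t ∧ a = some k ∧
        k ∈ accessibleLegs A W t ×ˢ (Finset.univ : Finset (Fin N)) ∧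
        (p.step A W t β a).logical s = p.onTile t k := by
  rcases Finset.mem_insert.1 hs with h1 | h1
  · obtain ⟨k, hk⟩ := Option.isSome_iff_exists.1 (ha.2 (h1 ▸ s.2))
    exact Or.inr ⟨k, h1, hk, (h.logical k hk).1, step_logical_new h1 hk⟩
  · have h2 : s.1 ≠ t := fun h => ht (h ▸ h1)
    exact Or.inl ⟨h1, h2, step_logical_old h2⟩

theorem Placement.step_valid : (p.step A W t β a).Valid A (insert t W) where
  carrier_mem l c hl := by
    rcases step_carrier_cases ht hnet h hl c with ⟨h1, h2, h3⟩ | ⟨i, h1, h2, h3, h4⟩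
    · rw [h3]
      exact hp.carrier_mem _ _ h1
    · rw [h4]
      exact onTile_mem hp ht h3
  logical_mem s hs := by
    rcases step_logical_cases ht h ha hs with ⟨h1, h2, h3⟩ | ⟨k, h1, h2, h3, h4⟩
    · rw [h3]
      exact hp.logical_mem _ h1
    · rw [h4]
      exact onTile_mem hp ht h3
  carrier_inj l c l' c' hl hl' hll' := by
    rcases step_carrier_cases ht hnet h hl c with ⟨h1, h2, h3⟩ | ⟨i, h1, h2, h3, h4⟩ <;>
    rcases step_carrier_cases ht hnet h hl' c' with ⟨h1', h2', h3'⟩ | ⟨i', h1', h2', h3', h4'⟩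
    · rw [h3, h3'] at hll'
      exact hp.carrier_inj _ _ _ _ h1 h1' hll'
    · rw [h3, h4'] at hll'
      exact absurd hll' (carrier_ne_onTile hp ht h3' h1 h2 c)
    · rw [h4, h3'] at hll'
      exact absurd hll'.symm (carrier_ne_onTile hp ht h3 h1' h2' c')
    · rw [h4, h4'] at hll'
      have h5 := h.inj (fun h' => h1 (Finset.mem_product.1 h').1)
        (fun h' => h1' (Finset.mem_product.1 h').1) (onTile_injOn hp ht h3 h3' hll')
      obtain ⟨rfl, rfl⟩ := Prod.mk.inj h5
      exact ⟨h2.symm.trans h2', rfl⟩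
  logical_inj s s' hs hs' hss' := by
    rcases step_logical_cases ht h ha hs with ⟨h1, h2, h3⟩ | ⟨k, h1, h2, h3, h4⟩ <;>
    rcases step_logical_cases ht h ha hs' with ⟨h1', h2', h3'⟩ | ⟨k', h1', h2', h3', h4'⟩
    · rw [h3, h3'] at hss'
      exact hp.logical_inj _ _ h1 h1' hss'
    · rw [h3, h4'] at hss'
      exact absurd hss' (logical_ne_onTile hp ht h3' h1)
    · rw [h4, h3'] at hss'
      exact absurd hss'.symm (logical_ne_onTile hp ht h3 h1')
    · exact Subtype.ext (h1.trans h1'.symm)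
  disjoint l c s hl hs hls := by
    rcases step_carrier_cases ht hnet h hl c with ⟨h1, h2, h3⟩ | ⟨i, h1, h2, h3, h4⟩ <;>
    rcases step_logical_cases ht h ha hs with ⟨h1', h2', h3'⟩ | ⟨k', h1', h2', h3', h4'⟩
    · rw [h3, h3'] at hls
      exact hp.disjoint _ _ _ h1 h1' hls
    · rw [h3, h4'] at hls
      exact carrier_ne_onTile hp ht h3' h1 h2 c hls
    · rw [h4, h3'] at hls
      exact logical_ne_onTile hp ht h3 h1' hls.symm
    · rw [h4, h4'] at hls
      exact (h.logical _ h2').2 _ (fun h' => h1 (Finset.mem_product.1 h').1)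
        (onTile_injOn hp ht h3 h3' hls)

theorem Placement.step_idle_iff (q : net.Qubit N) :
    (p.step A W t β a).Idle A (insert t W) q ↔ p.Idle A W q ∨
      ∃ k ∈ accessibleLegs A W t ×ˢ (Finset.univ : Finset (Fin N)), a ≠ some k ∧
        (∀ j, j ∉ accessibleLegs A W t ×ˢ (Finset.univ : Finset (Fin N)) → β j ≠ k) ∧
        p.onTile t k = q := by
  constructor
  · rintro ⟨h1, h2, h3⟩
    by_cases hk : ∃ k ∈ accessibleLegs A W t ×ˢ (Finset.univ : Finset (Fin N)), p.onTile t k = q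
    · obtain ⟨k, hk, rfl⟩ := hk
      refine Or.inr ⟨k, hk, fun hak => ?_, fun j hj hjk => ?_, rfl⟩
      · have hsq := ha.1 (Option.isSome_iff_exists.2 ⟨k, hak⟩)
        exact h3 ⟨t, hsq⟩ (Finset.mem_insert_self _ _) (step_logical_new rfl hak)
      · have hj1 : j.1 ∉ accessibleLegs A W t := fun h' => hj (by simpa using h')
        refine h2 (outerEnd ⟨t, j.1⟩) j.2
          ((onCut_insert_iff hnet ht _).2 (Or.inr ⟨j.1, hj1, rfl⟩)) ?_
        rw [step_carrier_new hnet hj1, hjk]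
    · refine Or.inl ⟨h1, fun l c hl hlq => ?_, fun s hs hsq => ?_⟩
      · by_cases hlt : l.1 = t
        · obtain ⟨i, hi, rfl⟩ := exists_leg_of_onCut ht hlt hl
          exact hk ⟨(i, c), by simpa using hi, hlq⟩
        · refine h2 l c ((onCut_insert_iff hnet ht _).2 (Or.inl ⟨hl, hlt⟩)) ?_
          rw [step_carrier_old hnet ht hl, hlq]
      · refine h3 s (Finset.mem_insert_of_mem hs) ?_
        rw [step_logical_old (fun h' => ht (h' ▸ hs) : s.1 ≠ t), hsq]
  · rintro (⟨h1, h2, h3⟩ | ⟨k, hk, h1, h2, rfl⟩)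
    · refine ⟨h1, fun l c hl => ?_, fun s hs => ?_⟩
      · rcases step_carrier_cases ht hnet h hl c with ⟨h4, h5, h6⟩ | ⟨i, h4, h5, h6, h7⟩
        · rw [h6]
          exact h2 _ _ h4
        · rw [h7]
          exact h2 _ _ (onCut_of_mem ht (Finset.mem_product.1 h6).1)
      · rcases step_logical_cases ht h ha hs with ⟨h4, h5, h6⟩ | ⟨k, h4, h5, h6, h7⟩
        · rw [h6]
          exact h3 _ h4
        · rw [h7]
          exact h2 _ _ (onCut_of_mem ht (Finset.mem_product.1 h6).1)
    · refine ⟨onTile_mem hp ht hk, fun l c hl hlk => ?_, fun s hs hsk => ?_⟩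
      · rcases step_carrier_cases ht hnet h hl c with ⟨h4, h5, h6⟩ | ⟨i, h4, h5, h6, h7⟩
        · rw [h6] at hlk
          exact carrier_ne_onTile hp ht hk h4 h5 c hlk
        · rw [h7] at hlk
          exact h2 _ (fun h' => h4 (Finset.mem_product.1 h').1) (onTile_injOn hp ht h6 hk hlk)
      · rcases step_logical_cases ht h ha hs with ⟨h4, h5, h6⟩ | ⟨k', h4, h5, h6, h7⟩
        · rw [h6] at hsk
          exact logical_ne_onTile hp ht hk h4 hsk
        · rw [h7] at hsk
          exact h1 (h5.trans (congrArg some (onTile_injOn hp ht h6 hk hsk)))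

end

end Step
end Network

namespace Network

/-! ### The decoded state before and after a tile is absorbed -/

section StepState

variable {net : Network} {N : ℕ} {A : Set net.Boundary} {W : Finset net.Tile} {t : net.Tile}

theorem prod_ite_ite {Q : Type} [Fintype Q] (P R : Q → Prop) {_ : DecidablePred P}
    {_ : DecidablePred R} (a : ℂ) :
    ∏ q, (if P q then (if R q then a else 0) else 1) =
      if ∀ q, P q → R q then a ^ (Finset.univ.filter P).card else 0 := by
  rw [← Finset.prod_filter]
  by_cases h : ∀ q, P q → R q
  · rw [if_pos h, Finset.prod_congr rfl fun q hq => if_pos (h q (Finset.mem_filter.1 hq).2),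
      Finset.prod_const]
  · rw [if_neg h]
    push Not at h
    obtain ⟨q, h1, h2⟩ := h
    exact Finset.prod_eq_zero (Finset.mem_filter.2 ⟨Finset.mem_univ q, h1⟩) (if_neg h2)

/-- The basis states of the boundary register that can occur once `W` is decoded, for bulk
bits `x`. -/
def Placement.Fits (p : Placement net N) (A : Set net.Boundary) (W : Finset net.Tile)
    (x : net.Bulk → Bool) (y : net.Qubit N → Bool) : Prop :=
  (∀ s : net.Bulk, s.1 ∈ W → y (p.logical s) = x s) ∧ (∀ q, p.Idle A W q → y q = false) ∧
    ∀ q : net.Qubit N, q.1.1.1 ∈ W ∧ q.1 ∉ A → y (p.carrier q.1.1 q.2) = y q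

/-- The bits on the open legs of the part of the network that is not yet decoded. -/
def Placement.openBits (p : Placement net N) (A : Set net.Boundary) (W : Finset net.Tile)
    (y : net.Qubit N → Bool) : net.Leg → Fin N → Bool := fun l c =>
  if OnCut A W l then y (p.carrier l c) else if h : net.IsBoundary l then y (⟨l, h⟩, c) else false

/-- The number of Bell pairs across `A | Aᶜ` once `W` is decoded. -/
def bellCount (N : ℕ) (A : Set net.Boundary) (W : Finset net.Tile) : ℕ :=
  (Finset.univ.filter fun q : net.Qubit N => q.1.1.1 ∈ W ∧ q.1 ∉ A).card

theorem Dressing.decodedState_apply (D : net.Dressing N) (p : Placement net N)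
    (ψ : QState net.Bulk) (y : net.Qubit N → Bool) : D.decodedState A W p ψ y =
      ∑ x, ψ x * ((if p.Fits A W x y then invSqrtTwo ^ bellCount N A W else 0) *
        D.contract Wᶜ x (p.openBits A W y)) := by
  unfold Dressing.decodedState
  refine Finset.sum_congr rfl fun x _ => ?_
  congr 2
  rw [prod_ite_ite, prod_ite_ite, one_pow]
  have h2 : ∏ q : net.Qubit N, (if p.Idle A W q then (if y q then 0 else 1) else 1) =
      if ∀ q, p.Idle A W q → y q = false then (1 : ℂ) else 0 := by
    have h3 : ∀ q : net.Qubit N, (if p.Idle A W q then (if y q then 0 else 1) else 1) =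
        if p.Idle A W q then (if y q = false then (1 : ℂ) else 0) else 1 := by
      intro q
      cases y q <;> simp
    rw [Finset.prod_congr rfl fun q _ => h3 q, prod_ite_ite, one_pow]
  rw [h2]
  by_cases h : p.Fits A W x y
  · rw [if_pos h, if_pos h.1, if_pos h.2.1, if_pos h.2.2, one_mul, one_mul]
    rfl
  · rw [if_neg h]
    by_cases h3 : ∀ s : net.Bulk, s.1 ∈ W → y (p.logical s) = x s
    · by_cases h4 : ∀ q, p.Idle A W q → y q = false
      · rw [if_neg (fun h5 => h ⟨h3, h4, h5⟩), mul_zero]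
      · rw [if_neg h4, mul_zero, zero_mul]
    · rw [if_neg h3, zero_mul, zero_mul]

/-- The bulk bit that enters the tensor of `t`; it is irrelevant for a hexagon. -/
def bulkBit (x : net.Bulk → Bool) (t : net.Tile) : Bool :=
  if h : net.kind t = TileKind.square then x ⟨t, h⟩ else false

theorem interior_compl_iff (ht : t ∉ W) {i : Fin (net.kind t).legs} :
    Interior Wᶜ (⟨t, i⟩ : net.Leg) ↔ ∃ l', net.glued ⟨t, i⟩ l' ∧ l'.1 ∉ W := by
  simp only [Interior, Finset.mem_compl, ht, not_false_eq_true, true_and]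

theorem not_interior_of_accessible (hnet : net.Proper) (ht : t ∉ W) {i : Fin (net.kind t).legs}
    (hi : i ∈ accessibleLegs A W t) : ¬ Interior Wᶜ (⟨t, i⟩ : net.Leg) := by
  rw [interior_compl_iff ht]
  rintro ⟨l', h1, h2⟩
  rcases mem_accessibleLegs.1 hi with ⟨hb, -⟩ | ⟨l'', h3, h4⟩
  · exact hb _ h1
  · rw [hnet.unique _ _ _ h1 h3] at h2
    exact h2 h4

theorem interior_or_isBoundary (ht : t ∉ W) {i : Fin (net.kind t).legs}
    (hi : i ∉ accessibleLegs A W t) : Interior Wᶜ (⟨t, i⟩ : net.Leg) ∨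
      ∃ h : net.IsBoundary (⟨t, i⟩ : net.Leg), (⟨⟨t, i⟩, h⟩ : net.Boundary) ∉ A := by
  rw [interior_compl_iff ht]
  rw [mem_accessibleLegs] at hi
  rcases glued_or_isBoundary (⟨t, i⟩ : net.Leg) with ⟨l', hl'⟩ | hb
  · exact Or.inl ⟨l', hl', fun h => hi (Or.inr ⟨l', hl', h⟩)⟩
  · exact Or.inr ⟨hb, fun h => hi (Or.inl ⟨hb, h⟩)⟩

variable {p : Placement net N}

theorem extend_accessible (hnet : net.Proper)
    (w : net.Leg → Fin N → Bool) (u : {i // Interior Wᶜ (⟨t, i⟩ : net.Leg)} → Fin N → Bool)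
    {i : Fin (net.kind t).legs} (hi : ¬ Interior Wᶜ (⟨t, i⟩ : net.Leg)) :
    extend Wᶜ t w u ⟨t, i⟩ = w ⟨t, i⟩ := by
  refine extend_of_not w u fun j hj => ⟨fun h => ?_, fun h => hnet.ne_tile h rfl⟩
  rw [leg_ext h] at hi
  exact hi hj

theorem extend_other
    (w : net.Leg → Fin N → Bool) (u : {i // Interior Wᶜ (⟨t, i⟩ : net.Leg)} → Fin N → Bool)
    {l : net.Leg} (hlt : l.1 ≠ t) (hl : ∀ i, ¬ net.glued l ⟨t, i⟩) :
    extend Wᶜ t w u l = w l :=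
  extend_of_not w u fun j _ => ⟨fun h => hlt (by rw [h]), hl j⟩

theorem openBits_accessible (ht : t ∉ W) (y : net.Qubit N → Bool) {i : Fin (net.kind t).legs}
    (hi : i ∈ accessibleLegs A W t) (c : Fin N) :
    p.openBits A W y ⟨t, i⟩ c = y (p.onTile t (i, c)) := if_pos (onCut_of_mem ht hi)

theorem openBits_outside (ht : t ∉ W) (y : net.Qubit N → Bool) {i : Fin (net.kind t).legs}
    (hi : i ∉ accessibleLegs A W t) (hb : net.IsBoundary (⟨t, i⟩ : net.Leg)) (c : Fin N) :
    p.openBits A W y ⟨t, i⟩ c = y (⟨⟨t, i⟩, hb⟩, c) := by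
  unfold Placement.openBits
  rw [if_neg fun h => hi (mem_accessibleLegs.2 (onCut_accessible ht rfl h)), dif_pos hb]

section

variable {β : Fin (net.kind t).legs × Fin N → Fin (net.kind t).legs × Fin N}
  {a : Option (Fin (net.kind t).legs × Fin N)} (hp : p.Valid A W) (ht : t ∉ W)
  (hnet : net.Proper) {φ : Bool → QState (Fin (net.kind t).legs × Fin N)}
  {G : List (Gate (Fin (net.kind t).legs × Fin N))}
  (h : LocallyDecodes (accessibleLegs A W t ×ˢ (Finset.univ : Finset (Fin N))) φ G β a)
  (ha : a.isSome ↔ net.kind t = TileKind.square)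

/-- The bits on the inner edges of `t` that are compatible with its decoded state. -/
def innerBits (p : Placement net N) (t : net.Tile)
    (β : Fin (net.kind t).legs × Fin N → Fin (net.kind t).legs × Fin N)
    (y : net.Qubit N → Bool) : {i // Interior Wᶜ (⟨t, i⟩ : net.Leg)} → Fin N → Bool :=
  fun i c => y (p.onTile t (β (i.1, c)))

/-- The bits on the legs of `t`. -/
def tileBits (p : Placement net N) (A : Set net.Boundary) (W : Finset net.Tile) (t : net.Tile)
    (u : {i // Interior Wᶜ (⟨t, i⟩ : net.Leg)} → Fin N → Bool) (y : net.Qubit N → Bool) :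
    Fin (net.kind t).legs × Fin N → Bool :=
  fun k => extend Wᶜ t (p.openBits A W y) u ⟨t, k.1⟩ k.2

include ht hnet in
theorem tileBits_accessible (u : {i // Interior Wᶜ (⟨t, i⟩ : net.Leg)} → Fin N → Bool)
    (y : net.Qubit N → Bool) {k : Fin (net.kind t).legs × Fin N}
    (hk : k ∈ accessibleLegs A W t ×ˢ (Finset.univ : Finset (Fin N))) :
    tileBits p A W t u y k = y (p.onTile t k) := by
  have hk1 := (Finset.mem_product.1 hk).1
  unfold tileBits
  rw [extend_accessible hnet _ _ (not_interior_of_accessible hnet ht hk1),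
    openBits_accessible ht y hk1]

include ht hnet h in
theorem decodedAt_tileBits_iff (u : {i // Interior Wᶜ (⟨t, i⟩ : net.Leg)} → Fin N → Bool)
    (x : Bool) (y : net.Qubit N → Bool) :
    DecodedAt (accessibleLegs A W t ×ˢ (Finset.univ : Finset (Fin N))) β a x
      (tileBits p A W t u y) ↔ u = innerBits p t β y ∧
      (∀ k, a = some k → y (p.onTile t k) = x) ∧
      (∀ k ∈ accessibleLegs A W t ×ˢ (Finset.univ : Finset (Fin N)), a ≠ some k →
        (∀ j, j ∉ accessibleLegs A W t ×ˢ (Finset.univ : Finset (Fin N)) → β j ≠ k) →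
          y (p.onTile t k) = false) ∧
      ∀ i c, ∀ hb : net.IsBoundary (⟨t, i⟩ : net.Leg), (⟨⟨t, i⟩, hb⟩ : net.Boundary) ∉ A →
        y (p.onTile t (β (i, c))) = y (⟨⟨t, i⟩, hb⟩, c) := by
  have hS : ∀ (i : Fin (net.kind t).legs) (c : Fin N),
      (i, c) ∉ accessibleLegs A W t ×ˢ (Finset.univ : Finset (Fin N)) ↔
        i ∉ accessibleLegs A W t := fun i c => by simp
  have hout : ∀ i, (hb : net.IsBoundary (⟨t, i⟩ : net.Leg)) →
      (⟨⟨t, i⟩, hb⟩ : net.Boundary) ∉ A → i ∉ accessibleLegs A W t := by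
    intro i hb hA hi
    rcases mem_accessibleLegs.1 hi with ⟨_, h1⟩ | ⟨l, h1, -⟩
    · exact hA h1
    · exact hb _ h1
  have hbd : ∀ i c, ∀ hb : net.IsBoundary (⟨t, i⟩ : net.Leg), (⟨⟨t, i⟩, hb⟩ : net.Boundary) ∉ A →
      tileBits p A W t u y (i, c) = y (⟨⟨t, i⟩, hb⟩, c) := by
    intro i c hb hA
    have hi : ¬ Interior Wᶜ (⟨t, i⟩ : net.Leg) := by
      rintro ⟨-, l', h1, -⟩
      exact hb _ h1
    unfold tileBits
    rw [extend_accessible hnet _ _ hi, openBits_outside ht y (hout i hb hA) hb]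
  have hin : ∀ i c, (hi : Interior Wᶜ (⟨t, i⟩ : net.Leg)) →
      tileBits p A W t u y (i, c) = u ⟨i, hi⟩ c := by
    intro i c hi
    unfold tileBits
    rw [extend_of hnet _ u ⟨i, hi⟩ (Or.inl rfl)]
  unfold DecodedAt
  constructor
  · rintro ⟨h1, h2, h3⟩
    refine ⟨?_, fun k hk => ?_, fun k hk h4 h5 => ?_, fun i c hb hA => ?_⟩
    · funext ⟨i, hi⟩ c
      have h4 : (i, c) ∉ accessibleLegs A W t ×ˢ (Finset.univ : Finset (Fin N)) :=
        (hS i c).2 fun h' => not_interior_of_accessible hnet ht h' hi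
      rw [← hin i c hi, ← h3 _ h4, tileBits_accessible ht hnet u y (h.mem _ h4)]
      rfl
    · rw [← h1 k hk, tileBits_accessible ht hnet u y (h.logical k hk).1]
    · rw [← h2 k hk h4 h5, tileBits_accessible ht hnet u y hk]
    · have h4 := (hS i c).2 (hout i hb hA)
      rw [← hbd i c hb hA, ← h3 _ h4, tileBits_accessible ht hnet u y (h.mem _ h4)]
  · rintro ⟨rfl, h1, h2, h3⟩
    refine ⟨fun k hk => ?_, fun k hk h4 h5 => ?_, ?_⟩
    · rw [← h1 k hk, tileBits_accessible ht hnet _ y (h.logical k hk).1]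
    · rw [← h2 k hk h4 h5, tileBits_accessible ht hnet _ y hk]
    · rintro ⟨i, c⟩ h4
      rw [tileBits_accessible ht hnet _ y (h.mem _ h4)]
      rcases interior_or_isBoundary ht ((hS i c).1 h4) with hi | ⟨hb, hA⟩
      · rw [hin i c hi]
        rfl
      · rw [hbd i c hb hA, h3 i c hb hA]

include hp ht hnet h ha in
theorem fits_step_iff (x : net.Bulk → Bool) (y : net.Qubit N → Bool) :
    (p.step A W t β a).Fits A (insert t W) x y ↔ p.Fits A W x y ∧
      (∀ k, a = some k → y (p.onTile t k) = bulkBit x t) ∧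
      (∀ k ∈ accessibleLegs A W t ×ˢ (Finset.univ : Finset (Fin N)), a ≠ some k →
        (∀ j, j ∉ accessibleLegs A W t ×ˢ (Finset.univ : Finset (Fin N)) → β j ≠ k) →
          y (p.onTile t k) = false) ∧
      ∀ i c, ∀ hb : net.IsBoundary (⟨t, i⟩ : net.Leg), (⟨⟨t, i⟩, hb⟩ : net.Boundary) ∉ A →
        y (p.onTile t (β (i, c))) = y (⟨⟨t, i⟩, hb⟩, c) := by
  have hcar : ∀ q : net.Qubit N, q.1.1.1 ∈ W ∧ q.1 ∉ A →
      (p.step A W t β a).carrier q.1.1 q.2 = p.carrier q.1.1 q.2 := fun q hq =>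
    Placement.step_carrier_old hnet ht (Or.inr ⟨hq.1, q.1.2, hq.2⟩) _
  have hcar' : ∀ i c, ∀ hb : net.IsBoundary (⟨t, i⟩ : net.Leg),
      (⟨⟨t, i⟩, hb⟩ : net.Boundary) ∉ A →
      (p.step A W t β a).carrier ⟨t, i⟩ c = p.onTile t (β (i, c)) := by
    intro i c hb hA
    have hi : i ∉ accessibleLegs A W t := by
      intro hi
      rcases mem_accessibleLegs.1 hi with ⟨_, h1⟩ | ⟨l, h1, -⟩
      · exact hA h1
      · exact hb _ h1
    have := Placement.step_carrier_new (p := p) (β := β) (a := a) hnet hi c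
    rwa [outerEnd_of_isBoundary hb] at this
  have hlog : ∀ s : net.Bulk, s.1 ∈ W → (p.step A W t β a).logical s = p.logical s := fun s hs =>
    Placement.step_logical_old fun h' => ht (h' ▸ hs)
  constructor
  · rintro ⟨h1, h2, h3⟩
    refine ⟨⟨fun s hs => ?_, fun q hq => ?_, fun q hq => ?_⟩, fun k hk => ?_,
      fun k hk h4 h5 => ?_, fun i c hb hA => ?_⟩
    · rw [← hlog s hs]
      exact h1 s (Finset.mem_insert_of_mem hs)
    · exact h2 q ((Placement.step_idle_iff hp ht hnet h ha q).2 (Or.inl hq))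
    · rw [← hcar q hq]
      exact h3 q ⟨Finset.mem_insert_of_mem hq.1, hq.2⟩
    · have hsq := ha.1 (Option.isSome_iff_exists.2 ⟨k, hk⟩)
      rw [bulkBit, dif_pos hsq, ← h1 ⟨t, hsq⟩ (Finset.mem_insert_self _ _)]
      exact congrArg y
        (Placement.step_logical_new (t := t) (s := (⟨t, hsq⟩ : net.Bulk)) rfl hk).symm
    · exact h2 _ ((Placement.step_idle_iff hp ht hnet h ha _).2 (Or.inr ⟨k, hk, h4, h5, rfl⟩))
    · rw [← hcar' i c hb hA]
      exact h3 (⟨⟨t, i⟩, hb⟩, c) ⟨Finset.mem_insert_self _ _, hA⟩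
  · rintro ⟨⟨h1, h2, h3⟩, h4, h5, h6⟩
    refine ⟨fun s hs => ?_, fun q hq => ?_, fun q hq => ?_⟩
    · rcases Placement.step_logical_cases (p := p) ht h ha hs with ⟨h7, h8, h9⟩ | ⟨k, h7, h8, h9, h10⟩
      · rw [h9]
        exact h1 s h7
      · rw [h10, h4 k h8]
        obtain ⟨s, hs'⟩ := s
        obtain rfl := h7
        exact dif_pos hs'
    · rcases (Placement.step_idle_iff hp ht hnet h ha q).1 hq with hq | ⟨k, hk, h7, h8, rfl⟩
      · exact h2 q hq
      · exact h5 k hk h7 h8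
    · obtain ⟨⟨⟨u, i⟩, hb⟩, c⟩ := q
      rcases Finset.mem_insert.1 hq.1 with hq1 | hq1
      · change u = t at hq1
        subst hq1
        exact (congrArg y (hcar' i c hb hq.2)).trans (h6 i c hb hq.2)
      · rw [hcar _ ⟨hq1, hq.2⟩]
        exact h3 _ ⟨hq1, hq.2⟩

theorem bellCount_insert (ht : t ∉ W) : bellCount N A (insert t W) = bellCount N A W +
    N * (Finset.univ.filter fun i => ∃ h : net.IsBoundary (⟨t, i⟩ : net.Leg),
      (⟨⟨t, i⟩, h⟩ : net.Boundary) ∉ A).card := by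
  set J := Finset.univ.filter fun i => ∃ h : net.IsBoundary (⟨t, i⟩ : net.Leg),
      (⟨⟨t, i⟩, h⟩ : net.Boundary) ∉ A with hJ
  have h1 : (Finset.univ.filter fun q : net.Qubit N => q.1.1.1 ∈ insert t W ∧ q.1 ∉ A) =
      (Finset.univ.filter fun q : net.Qubit N => q.1.1.1 ∈ W ∧ q.1 ∉ A) ∪
      Finset.univ.filter fun q : net.Qubit N => q.1.1.1 = t ∧ q.1 ∉ A := by
    ext q
    simp only [Finset.mem_filter, Finset.mem_univ, true_and, Finset.mem_union, Finset.mem_insert]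
    tauto
  have h2 : Disjoint (Finset.univ.filter fun q : net.Qubit N => q.1.1.1 ∈ W ∧ q.1 ∉ A)
      (Finset.univ.filter fun q : net.Qubit N => q.1.1.1 = t ∧ q.1 ∉ A) := by
    rw [Finset.disjoint_left]
    intro q hq hq'
    exact ht ((Finset.mem_filter.1 hq').2.1 ▸ (Finset.mem_filter.1 hq).2.1)
  unfold bellCount
  rw [h1, Finset.card_union_of_disjoint h2]
  congr 1
  have h3 : ∀ i ∈ J, ∃ h : net.IsBoundary (⟨t, i⟩ : net.Leg),
      (⟨⟨t, i⟩, h⟩ : net.Boundary) ∉ A := fun i hi => (Finset.mem_filter.1 hi).2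
  have h4 : (J ×ˢ (Finset.univ : Finset (Fin N))).card = N * J.card := by
    rw [Finset.card_product, Finset.card_univ, Fintype.card_fin, mul_comm]
  rw [← h4]
  symm
  refine Finset.card_bij (fun k hk => (⟨⟨t, k.1⟩,
    (h3 k.1 (Finset.mem_product.1 hk).1).1⟩, k.2)) ?_ ?_ ?_
  · intro k hk
    exact Finset.mem_filter.2 ⟨Finset.mem_univ _, rfl, (h3 k.1 (Finset.mem_product.1 hk).1).2⟩
  · intro k hk k' hk' hkk'
    obtain ⟨h5, h6⟩ := Prod.mk.inj hkk'
    exact Prod.ext (leg_ext (Subtype.mk.inj h5)) h6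
  · rintro ⟨⟨⟨u, i⟩, hb⟩, c⟩ hq
    obtain ⟨-, h5, h6⟩ := Finset.mem_filter.1 hq
    change u = t at h5
    subst h5
    exact ⟨(i, c), Finset.mem_product.2
      ⟨Finset.mem_filter.2 ⟨Finset.mem_univ _, hb, h6⟩, Finset.mem_univ _⟩, rfl⟩

theorem card_not_accessible (hnet : net.Proper) (ht : t ∉ W)
    {_ : DecidablePred fun j => j ∉ accessibleLegs A W t ×ˢ (Finset.univ : Finset (Fin N))} :
    (Finset.univ.filter fun j => j ∉ accessibleLegs A W t ×ˢ (Finset.univ : Finset (Fin N))).card =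
      N * (Finset.univ.filter fun i => Interior Wᶜ (⟨t, i⟩ : net.Leg)).card +
      N * (Finset.univ.filter fun i => ∃ h : net.IsBoundary (⟨t, i⟩ : net.Leg),
        (⟨⟨t, i⟩, h⟩ : net.Boundary) ∉ A).card := by
  rw [← Nat.mul_add, ← Finset.card_union_of_disjoint]
  · have : (Finset.univ.filter fun j => j ∉ accessibleLegs A W t ×ˢ (Finset.univ : Finset (Fin N))) =
        ((Finset.univ.filter fun i => Interior Wᶜ (⟨t, i⟩ : net.Leg)) ∪
          Finset.univ.filter fun i => ∃ h : net.IsBoundary (⟨t, i⟩ : net.Leg),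
            (⟨⟨t, i⟩, h⟩ : net.Boundary) ∉ A) ×ˢ (Finset.univ : Finset (Fin N)) := by
      ext ⟨i, c⟩
      simp only [Finset.mem_filter, Finset.mem_univ, true_and, Finset.mem_product, and_true,
        Finset.mem_union]
      constructor
      · exact interior_or_isBoundary ht
      · rintro (hi | ⟨hb, hA⟩) hi'
        · exact not_interior_of_accessible hnet ht hi' hi
        · rcases mem_accessibleLegs.1 hi' with ⟨_, h1⟩ | ⟨l, h1, -⟩
          · exact hA h1
          · exact hb _ h1
    rw [this, Finset.card_product, Finset.card_univ, Fintype.card_fin, mul_comm]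
  · rw [Finset.disjoint_left]
    intro i hi hi'
    obtain ⟨-, -, l, h1, -⟩ := Finset.mem_filter.1 hi
    obtain ⟨-, hb, -⟩ := Finset.mem_filter.1 hi'
    exact hb _ h1

end

end StepState
end Network

namespace Network

/-! ### The circuit that absorbs a tile -/

section StepRun

variable {net : Network} {N : ℕ} {A : Set net.Boundary} {W : Finset net.Tile} {t : net.Tile}
  {p : Placement net N} {β : Fin (net.kind t).legs × Fin N → Fin (net.kind t).legs × Fin N}
  {a : Option (Fin (net.kind t).legs × Fin N)} {G : List (Gate (Fin (net.kind t).legs × Fin N))}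

theorem update_bit_self {Q : Type} {_ : DecidableEq Q} (y : Q → Bool) (q : Q) (b : Bool) :
    Function.update y q b q = b := Function.update_self _ _ _

theorem openBits_update {_ : DecidableEq (net.Qubit N)} (hp : p.Valid A W) (ht : t ∉ W)
    {k : Fin (net.kind t).legs × Fin N}
    (hk : k ∈ accessibleLegs A W t ×ˢ (Finset.univ : Finset (Fin N))) (y : net.Qubit N → Bool)
    (b : Bool) {l : net.Leg} (hlt : l.1 ∉ W) {c : Fin N} (hl : l ≠ ⟨t, k.1⟩ ∨ c ≠ k.2) :
    p.openBits A W (Function.update y (p.onTile t k) b) l c = p.openBits A W y l c := by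
  unfold Placement.openBits
  by_cases h1 : OnCut A W l
  · rw [if_pos h1, if_pos h1, Function.update_of_ne]
    intro h2
    obtain ⟨h3, h4⟩ := hp.carrier_inj _ _ _ _ h1
      (onCut_of_mem ht (Finset.mem_product.1 hk).1) h2
    rcases hl with hl | hl
    · exact hl h3
    · exact hl h4
  · rw [if_neg h1, if_neg h1]
    by_cases h2 : net.IsBoundary l
    · rw [dif_pos h2, dif_pos h2, Function.update_of_ne]
      intro h3
      refine h1 (Or.inl ⟨hlt, Or.inl ⟨h2, ?_⟩⟩)
      have := onTile_mem hp ht hk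
      rwa [← h3] at this
    · rw [dif_neg h2, dif_neg h2]

theorem fits_update {_ : DecidableEq (net.Qubit N)} (hp : p.Valid A W) (ht : t ∉ W)
    {k : Fin (net.kind t).legs × Fin N}
    (hk : k ∈ accessibleLegs A W t ×ˢ (Finset.univ : Finset (Fin N))) (x : net.Bulk → Bool)
    (y : net.Qubit N → Bool) (b : Bool) :
    p.Fits A W x (Function.update y (p.onTile t k) b) ↔ p.Fits A W x y := by
  have hA := onTile_mem hp ht hk
  have h1 : ∀ s : net.Bulk, s.1 ∈ W →
      Function.update y (p.onTile t k) b (p.logical s) = y (p.logical s) := fun s hs =>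
    Function.update_of_ne (logical_ne_onTile hp ht hk hs) _ _
  have h2 : ∀ q, p.Idle A W q → Function.update y (p.onTile t k) b q = y q := fun q hq =>
    Function.update_of_ne
      (fun h => hq.2.1 _ _ (onCut_of_mem ht (Finset.mem_product.1 hk).1) h.symm) _ _
  have h3 : ∀ q : net.Qubit N, q.1.1.1 ∈ W ∧ q.1 ∉ A →
      Function.update y (p.onTile t k) b (p.carrier q.1.1 q.2) = y (p.carrier q.1.1 q.2) :=
    fun q hq => Function.update_of_ne (carrier_ne_onTile hp ht hk (Or.inr ⟨hq.1, q.1.2, hq.2⟩)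
      (fun h => ht (h ▸ hq.1)) _) _ _
  have h4 : ∀ q : net.Qubit N, q.1.1.1 ∈ W ∧ q.1 ∉ A →
      Function.update y (p.onTile t k) b q = y q :=
    fun q hq => Function.update_of_ne (fun h => hq.2 (by rw [h]; exact hA)) _ _
  unfold Placement.Fits
  refine and_congr (forall₂_congr fun s hs => by rw [h1 s hs]) (and_congr
    (forall₂_congr fun q hq => by rw [h2 q hq])
    (forall₂_congr fun q hq => by rw [h3 q hq, h4 q hq]))

/-- The open bits after the step, in terms of those before the step. -/
theorem openBits_step (hnet : net.Proper) (ht : t ∉ W) (y : net.Qubit N → Bool) {l : net.Leg}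
    (hlW : l.1 ∉ W) (hlt : l.1 ≠ t) :
    extend Wᶜ t (p.openBits A W y) (innerBits p t β y) l =
      (p.step A W t β a).openBits A (insert t W) y l := by
  funext c
  by_cases hg : ∃ i, net.glued l ⟨t, i⟩
  · obtain ⟨i, hi⟩ := hg
    have hI : Interior Wᶜ (⟨t, i⟩ : net.Leg) :=
      (interior_compl_iff ht).2 ⟨l, hnet.symm _ _ hi, hlW⟩
    have hiS : i ∉ accessibleLegs A W t := fun h => not_interior_of_accessible hnet ht h hI
    have hout : outerEnd (⟨t, i⟩ : net.Leg) = l := outerEnd_of_glued hnet (hnet.symm _ _ hi)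
    rw [extend_of hnet _ _ ⟨i, hI⟩ (Or.inr hi)]
    unfold Placement.openBits
    have h1 := Placement.step_carrier_new (p := p) (β := β) (a := a) hnet hiS c
    rw [hout] at h1
    rw [if_pos ((onCut_insert_iff hnet ht l).2 (Or.inr ⟨i, hiS, hout⟩)), h1]
    rfl
  · rw [extend_other _ _ hlt fun i hi => hg ⟨i, hi⟩]
    have h1 : OnCut A (insert t W) l ↔ OnCut A W l := by
      rw [onCut_insert_iff hnet ht]
      constructor
      · rintro (h | ⟨i, hi, rfl⟩)
        · exact h.1
        · exfalso
          rcases glued_or_isBoundary (⟨t, i⟩ : net.Leg) with ⟨l', hl'⟩ | hb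
          · rw [outerEnd_of_glued hnet hl'] at hg
            exact hg ⟨i, hnet.symm _ _ hl'⟩
          · rw [outerEnd_of_isBoundary hb] at hlt
            exact hlt rfl
      · exact fun h => Or.inl ⟨h, hlt⟩
    unfold Placement.openBits
    by_cases h2 : OnCut A W l
    · rw [if_pos h2, if_pos (h1.2 h2), Placement.step_carrier_old hnet ht h2]
    · rw [if_neg h2, if_neg fun h => h2 (h1.1 h)]

theorem step_power (n m k : ℕ) :
    ((Real.sqrt 2 : ℝ) : ℂ) ^ m * (invSqrtTwo ^ n * invSqrtTwo ^ (m + k)) =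
      invSqrtTwo ^ (n + k) := by
  rw [pow_add _ m k, pow_add _ n k]
  calc _ = (((Real.sqrt 2 : ℝ) : ℂ) * invSqrtTwo) ^ m * (invSqrtTwo ^ n * invSqrtTwo ^ k) := by
        rw [mul_pow]; ring
    _ = _ := by rw [sqrtTwo_mul_invSqrtTwo, one_pow, one_mul]

/-- Decoding the tensor of one tile decodes the corresponding part of the network. -/
theorem runGates_step (hnet : net.Proper) (D : net.Dressing N) (hp : p.Valid A W) (ht : t ∉ W)
    (h : LocallyDecodes (accessibleLegs A W t ×ˢ (Finset.univ : Finset (Fin N)))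
      (fun x y => tileAmp (net.kind t) (D.orient t) (D.gauge t) x fun i c => y (i, c)) G β a)
    (ha : a.isSome ↔ net.kind t = TileKind.square) (ψ : QState net.Bulk) :
    runGates (G.map (Gate.map (p.onTile t))) (D.decodedState A W p ψ) =
      D.decodedState A (insert t W) (p.step A W t β a) ψ := by
  set κ := (Finset.univ.filter fun i => Interior Wᶜ (⟨t, i⟩ : net.Leg)).card
  let φ : Bool → QState (Fin (net.kind t).legs × Fin N) :=
    fun x y => tileAmp (net.kind t) (D.orient t) (D.gauge t) x fun i c => y (i, c)
  let c : (net.Bulk → Bool) → ({i // Interior Wᶜ (⟨t, i⟩ : net.Leg)} → Fin N → Bool) →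
      QState (net.Qubit N) := fun x u y =>
    (if p.Fits A W x y then invSqrtTwo ^ bellCount N A W else 0) *
      D.contract (insert t W)ᶜ x (extend Wᶜ t (p.openBits A W y) u)
  have hR : ∀ u, u ∈ Wᶜ ↔ u = t ∨ u ∈ (insert t W)ᶜ := by
    intro u
    simp only [Finset.mem_compl, Finset.mem_insert, not_or]
    by_cases hu : u = t
    · simp [hu, ht]
    · simp [hu]
  -- Before the step the tensor of `t` is a factor, once the bits `u` on its edges to the other
  -- undecoded tiles are fixed.
  have h1 : D.decodedState A W p ψ = fun y =>
      ∑ xu : (net.Bulk → Bool) × ({i // Interior Wᶜ (⟨t, i⟩ : net.Leg)} → Fin N → Bool),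
        (ψ xu.1 * ((Real.sqrt 2 : ℝ) : ℂ) ^ (N * κ)) *
          (c xu.1 xu.2 y * φ (bulkBit xu.1 t) (tileBits p A W t xu.2 y)) := by
    funext y
    rw [Dressing.decodedState_apply, Fintype.sum_prod_type]
    refine Finset.sum_congr rfl fun x _ => ?_
    rw [Dressing.contract_insert hnet D hR (by simp), Finset.mul_sum, Finset.mul_sum,
      Finset.mul_sum]
    refine Finset.sum_congr rfl fun u _ => ?_
    simp only [c, φ]
    change _ * (_ * (_ * (D.tile x t (fun i => extend Wᶜ t (p.openBits A W y) u ⟨t, i⟩) * _))) =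
      _ * (_ * D.tile x t (fun i => extend Wᶜ t (p.openBits A W y) u ⟨t, i⟩))
    ring
  -- The gates act on this factor only.
  have h2 : ∀ x u, runGates (G.map (Gate.map (p.onTile t)))
      (fun y => c x u y * φ (bulkBit x t) (tileBits p A W t u y)) =
      fun y => c x u y * runGates G (φ (bulkBit x t)) (tileBits p A W t u y) := by
    intro x u
    refine runGates_map (p.onTile t) _ (onTile_injOn hp ht) (c x u) (tileBits p A W t u) ?_ ?_
      (fun y k hk => tileBits_accessible ht hnet u y hk) G h.support _
    · intro y k hk b
      simp only [c]
      congr 1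
      · exact ite_eq_of_iff (fits_update hp ht hk x y b) _ _
      · refine D.contract_congr hnet _ x fun l hl _ => ?_
        rw [Finset.mem_compl, Finset.mem_insert, not_or] at hl
        by_cases hex : ∃ i : {i // Interior Wᶜ (⟨t, i⟩ : net.Leg)},
            l = ⟨t, i.1⟩ ∨ net.glued l ⟨t, i.1⟩
        · obtain ⟨i, hi⟩ := hex
          rw [extend_of hnet _ _ i hi, extend_of hnet _ _ i hi]
        · have hno : ∀ i, Interior Wᶜ (⟨t, i⟩ : net.Leg) → l ≠ ⟨t, i⟩ ∧ ¬ net.glued l ⟨t, i⟩ :=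
            fun i hi => ⟨fun h => hex ⟨⟨i, hi⟩, Or.inl h⟩, fun h => hex ⟨⟨i, hi⟩, Or.inr h⟩⟩
          rw [extend_of_not _ _ hno, extend_of_not _ _ hno]
          funext c'
          exact openBits_update hp ht hk y b hl.2 (Or.inl fun h => hl.1 (by rw [h]))
    · intro y k hk b
      funext k'
      by_cases hkk : k' = k
      · subst hkk
        rw [tileBits_accessible ht hnet u _ hk, update_bit_self, update_bit_self]
      · rw [update_bit_of_ne hkk]
        unfold tileBits
        by_cases hi : Interior Wᶜ (⟨t, k'.1⟩ : net.Leg)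
        · rw [extend_of hnet _ u ⟨k'.1, hi⟩ (Or.inl rfl), extend_of hnet _ u ⟨k'.1, hi⟩ (Or.inl rfl)]
        · rw [extend_accessible hnet _ _ hi, extend_accessible hnet _ _ hi]
          refine openBits_update hp ht hk y b ht ?_
          by_contra hcon
          push Not at hcon
          exact hkk (Prod.ext (leg_ext hcon.1) hcon.2)
  rw [h1, runGates_sum]
  funext y
  rw [Dressing.decodedState_apply, Fintype.sum_prod_type]
  refine Finset.sum_congr rfl fun x _ => ?_
  -- The decoded tensor of `t` forces `u` to agree with the qubits that are the halves of its Bell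
  -- pairs; these qubits take over the part of the cut edges.
  have h3 : ∀ u, c x u y * runGates G (φ (bulkBit x t)) (tileBits p A W t u y) =
      if u = innerBits p t β y then
        ((if (p.step A W t β a).Fits A (insert t W) x y then
          invSqrtTwo ^ bellCount N A W * invSqrtTwo ^ (N * κ + N * (Finset.univ.filter fun i =>
            ∃ h : net.IsBoundary (⟨t, i⟩ : net.Leg), (⟨⟨t, i⟩, h⟩ : net.Boundary) ∉ A).card)
          else 0) *
          D.contract (insert t W)ᶜ x ((p.step A W t β a).openBits A (insert t W) y)) else 0 := by
    intro u
    rw [h.run, decodedAt_amp, card_not_accessible hnet ht]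
    have hd := decodedAt_tileBits_iff (p := p) ht hnet h u (bulkBit x t) y
    have hf := fits_step_iff hp ht hnet h ha x y
    simp only [c]
    by_cases hu : u = innerBits p t β y
    · rw [if_pos hu]
      have hcon : D.contract (insert t W)ᶜ x (extend Wᶜ t (p.openBits A W y) u) =
          D.contract (insert t W)ᶜ x ((p.step A W t β a).openBits A (insert t W) y) := by
        refine D.contract_congr hnet _ x fun l hl _ => ?_
        rw [Finset.mem_compl, Finset.mem_insert, not_or] at hl
        rw [hu]
        exact openBits_step hnet ht y hl.2 hl.1
      rw [hcon]
      by_cases hF : (p.step A W t β a).Fits A (insert t W) x y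
      · rw [if_pos hF, if_pos (hf.1 hF).1, if_pos (hd.2 ⟨hu, (hf.1 hF).2⟩)]
        ring
      · rw [if_neg hF, zero_mul]
        by_cases hF' : p.Fits A W x y
        · rw [if_neg fun h' => hF (hf.2 ⟨hF', (hd.1 h').2⟩), mul_zero]
        · rw [if_neg hF', zero_mul, zero_mul]
    · rw [if_neg hu, if_neg fun h' => hu (hd.1 h').1, mul_zero]
  -- The factors `√2` of the edges that are cut cancel the amplitudes of their Bell pairs.
  have h4 : ∀ u, ψ x * ((Real.sqrt 2 : ℝ) : ℂ) ^ (N * κ) *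
      runGates (G.map (Gate.map (p.onTile t)))
        (fun y => c x u y * φ (bulkBit x t) (tileBits p A W t u y)) y =
      if u = innerBits p t β y then ψ x * ((if (p.step A W t β a).Fits A (insert t W) x y then
        invSqrtTwo ^ bellCount N A (insert t W) else 0) *
        D.contract (insert t W)ᶜ x ((p.step A W t β a).openBits A (insert t W) y)) else 0 := by
    intro u
    rw [h2]
    beta_reduce
    rw [h3 u]
    by_cases hu : u = innerBits p t β y
    · rw [if_pos hu, if_pos hu, bellCount_insert ht, mul_assoc]
      congr 1
      by_cases hF : (p.step A W t β a).Fits A (insert t W) x y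
      · rw [if_pos hF, if_pos hF, ← mul_assoc, step_power]
      · rw [if_neg hF, if_neg hF, zero_mul, mul_zero]
    · rw [if_neg hu, if_neg hu, mul_zero]
  rw [Finset.sum_congr rfl fun u _ => h4 u, Finset.sum_ite_eq' Finset.univ (innerBits p t β y),
    if_pos (Finset.mem_univ _)]

end StepRun
end Network

/-! ### Running circuits in parallel -/

section Merge

variable {Q : Type}

/-- Puts the gates of `G` into the layers of `C`, the `k`-th gate into the `k`-th layer. -/
def addGates : List (Gate Q) → Circuit Q → Circuit Q
  | [], C => C
  | g :: G, [] => [g] :: addGates G []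
  | g :: G, L :: C => (g :: L) :: addGates G C

theorem addGates_length (G : List (Gate Q)) (C : Circuit Q) :
    (addGates G C).length = max G.length C.length := by
  induction G generalizing C with
  | nil => simp [addGates]
  | cons g G ih => cases C <;> simp [addGates, ih]

theorem mem_addGates {G : List (Gate Q)} {C : Circuit Q} {L : List (Gate Q)} (hL : L ∈ addGates G C)
    {g : Gate Q} (hg : g ∈ L) : g ∈ G ∨ ∃ L ∈ C, g ∈ L := by
  induction G generalizing C with
  | nil => exact Or.inr ⟨L, hL, hg⟩
  | cons g' G ih =>
    cases C with
    | nil =>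
      rcases List.mem_cons.1 hL with rfl | hL
      · exact Or.inl (List.mem_cons.2 (Or.inl (List.mem_singleton.1 hg)))
      · rcases ih hL with h | ⟨L', h, -⟩
        · exact Or.inl (List.mem_cons_of_mem _ h)
        · simp at h
    | cons L₀ C =>
      rcases List.mem_cons.1 hL with rfl | hL
      · rcases List.mem_cons.1 hg with rfl | hg
        · exact Or.inl List.mem_cons_self
        · exact Or.inr ⟨L₀, List.mem_cons_self, hg⟩
      · rcases ih hL with h | ⟨L', h, h'⟩
        · exact Or.inl (List.mem_cons_of_mem _ h)
        · exact Or.inr ⟨L', List.mem_cons_of_mem _ h, h'⟩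

theorem addGates_layered {G : List (Gate Q)} {C : Circuit Q} (hC : C.Layered)
    (h : ∀ g ∈ G, ∀ L ∈ C, ∀ g' ∈ L, Disjoint g.support g'.support) :
    (addGates G C).Layered := by
  induction G generalizing C with
  | nil => exact hC
  | cons g G ih =>
    cases C with
    | nil =>
      intro L hL
      rcases List.mem_cons.1 hL with rfl | hL
      · simp
      · exact ih (fun _ h => by simp at h) (fun _ _ _ h => by simp at h) L hL
    | cons L₀ C =>
      intro L hL
      rcases List.mem_cons.1 hL with rfl | hL
      · exact List.pairwise_cons.2 ⟨h g List.mem_cons_self L₀ List.mem_cons_self,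
          hC L₀ List.mem_cons_self⟩
      · exact ih (fun L hL => hC L (List.mem_cons_of_mem _ hL))
          (fun g hg L hL => h g (List.mem_cons_of_mem _ hg) L (List.mem_cons_of_mem _ hL)) L hL

theorem addGates_run {G : List (Gate Q)} {C : Circuit Q}
    (h : ∀ g ∈ G, ∀ L ∈ C, ∀ g' ∈ L, Disjoint g.support g'.support) (φ : QState Q) :
    (addGates G C).run φ = runGates G (Circuit.run C φ) := by
  induction G generalizing C φ with
  | nil => rfl
  | cons g G ih =>
    cases C with
    | nil => exact ih (C := []) (fun _ _ _ h => by simp at h) (g.apply φ)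
    | cons L₀ C =>
      have h1 : (addGates (g :: G) (L₀ :: C)).run φ =
          (addGates G C).run (runGates L₀ (g.apply φ)) := rfl
      have h2 : Circuit.run (L₀ :: C) φ = Circuit.run C (runGates L₀ φ) := rfl
      rw [h1, h2, ih fun g hg L hL => h g (List.mem_cons_of_mem _ hg) L (List.mem_cons_of_mem _ hL),
        runGates_cons]
      congr 1
      have h3 : ∀ g' ∈ L₀ ++ C.flatten, Disjoint g.support g'.support := by
        intro g' hg'
        rcases List.mem_append.1 hg' with hg' | hg'
        · exact h g List.mem_cons_self L₀ List.mem_cons_self g' hg'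
        · obtain ⟨L, hL, hg'⟩ := List.mem_flatten.1 hg'
          exact h g List.mem_cons_self L (List.mem_cons_of_mem _ hL) g' hg'
      rw [Circuit.run_eq_runGates, Circuit.run_eq_runGates, ← runGates_append, ← runGates_append,
        runGates_apply_comm h3]

end Merge

namespace Network

/-! ### One round of the Greedy algorithm -/

section Round

variable {net : Network} {N : ℕ} {A : Set net.Boundary} {W : Finset net.Tile}

/-- The circuit `B` decodes the tiles of `T` after the region `W` has been decoded. -/
structure Dressing.DecodesRound (D : net.Dressing N) (A : Set net.Boundary)
    (W T : Finset net.Tile) (p : Placement net N) (B : Circuit (net.Qubit N))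
    (p' : Placement net N) : Prop where
  valid : p'.Valid A (W ∪ T)
  layered : B.Layered
  isLocal : ∀ layer ∈ B, ∀ g ∈ layer, ∃ t ∈ T, g.support ⊆ p.region A W t
  carrier_old : ∀ l c, OnCut A W l → OnCut A (W ∪ T) l → p'.carrier l c = p.carrier l c
  carrier_new : ∀ l c, OnCut A (W ∪ T) l → ¬ OnCut A W l →
    ∃ t ∈ T, (l.1 = t ∨ ∃ i, net.glued l ⟨t, i⟩) ∧ p'.carrier l c ∈ p.region A W t
  logical_old : ∀ s : net.Bulk, s.1 ∈ W → p'.logical s = p.logical s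
  logical_new : ∀ s : net.Bulk, s.1 ∈ T → p'.logical s ∈ p.region A W s.1
  decoded : ∀ ψ : QState net.Bulk,
    B.run (D.decodedState A W p ψ) = D.decodedState A (W ∪ T) p' ψ

theorem onCut_of_subset {W₁ W₂ W₃ : Finset net.Tile} (h₁ : W₁ ⊆ W₂) (h₂ : W₂ ⊆ W₃) {l : net.Leg}
    (hl : OnCut A W₁ l) (hl' : OnCut A W₃ l) : OnCut A W₂ l := by
  rcases hl with ⟨h3, h4⟩ | ⟨h3, h4⟩
  · rcases hl' with ⟨h5, -⟩ | ⟨h5, hb, h6⟩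
    · exact Or.inl ⟨fun h => h5 (h₂ h), h4.mono h₁⟩
    · rcases h4 with ⟨_, h7⟩ | ⟨l', h7, -⟩
      · exact absurd h7 h6
      · exact absurd h7 (hb l')
  · exact Or.inr ⟨h₁ h3, h4⟩

theorem region_disjoint {p : Placement net N} (hp : p.Valid A W) {t u : net.Tile} (ht : t ∉ W)
    (hu : u ∉ W) (htu : t ≠ u) : Disjoint (p.region A W t) (p.region A W u) := by
  rw [Set.disjoint_left]
  rintro q ⟨i, c, hi, rfl⟩ ⟨j, c', hj, h⟩
  have := (hp.carrier_inj _ _ _ _ (Or.inl ⟨ht, hi⟩) (Or.inl ⟨hu, hj⟩) h).1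
  exact htu (congrArg Sigma.fst this)

theorem outerEnd_eq_or_glued (hnet : net.Proper) (l : net.Leg) :
    outerEnd l = l ∨ net.glued (outerEnd l) l := by
  rcases glued_or_isBoundary l with ⟨l', hl'⟩ | hb
  · rw [outerEnd_of_glued hnet hl']
    exact Or.inr (hnet.symm _ _ hl')
  · exact Or.inl (outerEnd_of_isBoundary hb)

/-- The tiles of one round are decoded one after the other. Their circuits act on disjoint sets of
qubits, hence can be run in parallel, and the depth does not add up. -/
theorem Dressing.exists_decodesRound (hnet : net.Proper) (D : net.Dressing N) {depth : ℕ}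
    (hdepth : ∀ (k : TileKind) (ρ : Fin N → Equiv.Perm (Fin k.legs)) (γ : Fin N → Gauge)
      (S : Finset (Fin k.legs)), 3 ≤ S.card → ∃ G β a,
        LocallyDecodes (S ×ˢ (Finset.univ : Finset (Fin N)))
          (fun x y => tileAmp k ρ γ x fun i c => y (i, c)) G β a ∧
        (a.isSome ↔ k = TileKind.square) ∧ G.length ≤ depth)
    {p : Placement net N} (hp : p.Valid A W) (T : Finset net.Tile)
    (hT : ∀ t ∈ T, t ∉ W ∧ ThreeLegs A W t)
    (hapart : ∀ t ∈ T, ∀ u ∈ T, ∀ i j, ¬ net.glued ⟨t, i⟩ ⟨u, j⟩) :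
    ∃ B p', D.DecodesRound A W T p B p' ∧ B.length ≤ depth := by
  induction T using Finset.induction_on with
  | empty =>
    refine ⟨[], p, ⟨?_, fun _ h => by simp at h, fun _ h => by simp at h, fun _ _ _ _ => rfl, ?_,
      fun _ _ => rfl, fun _ h => by simp at h, fun ψ => ?_⟩, Nat.zero_le _⟩
    · rwa [Finset.union_empty]
    · rw [Finset.union_empty]
      exact fun l c h h' => absurd h h'
    · rw [Finset.union_empty]
      rfl
  | insert t T htT ih =>
    obtain ⟨B, p₁, hB, hlen⟩ := ih (fun u hu => hT u (Finset.mem_insert_of_mem hu))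
      fun u hu v hv => hapart u (Finset.mem_insert_of_mem hu) v (Finset.mem_insert_of_mem hv)
    obtain ⟨htW, hthree⟩ := hT t (Finset.mem_insert_self _ _)
    have ht : t ∉ W ∪ T := fun h => (Finset.mem_union.1 h).elim htW htT
    have hsub : W ⊆ W ∪ T := Finset.subset_union_left
    have hins : W ∪ insert t T = insert t (W ∪ T) := Finset.union_insert _ _ _
    -- Tiles of the same round share no edge, so the other tiles do not make more legs of `t`
    -- accessible.
    have hacc : ∀ i, Accessible A (W ∪ T) (⟨t, i⟩ : net.Leg) ↔ Accessible A W ⟨t, i⟩ := by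
      intro i
      refine ⟨fun h => h.imp id ?_, fun h => h.mono hsub⟩
      rintro ⟨⟨u, j⟩, h1, h2⟩
      rcases Finset.mem_union.1 h2 with h2 | h2
      · exact ⟨⟨u, j⟩, h1, h2⟩
      · exact absurd h1 (hapart t (Finset.mem_insert_self _ _) u (Finset.mem_insert_of_mem h2) i j)
    have hlegs : accessibleLegs A (W ∪ T) t = accessibleLegs A W t :=
      Finset.filter_congr fun i _ => hacc i
    have hregion : p₁.region A (W ∪ T) t = p.region A W t := by
      ext q
      refine exists_congr fun i => exists_congr fun c => ?_
      rw [hacc]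
      refine and_congr_right fun hi => ?_
      rw [hB.carrier_old _ c (Or.inl ⟨htW, hi⟩) (Or.inl ⟨ht, (hacc i).2 hi⟩)]
    obtain ⟨G, β, a, h, ha, hG⟩ := hdepth (net.kind t) (D.orient t) (D.gauge t)
      (accessibleLegs A (W ∪ T) t) (by rw [hlegs]; exact hthree)
    have hsupp : ∀ g ∈ G.map (Gate.map (p₁.onTile t)), g.support ⊆ p.region A W t :=
      map_gates_support _ (fun k hk => by
        rw [← hregion]; exact mem_region_iff.2 ⟨k, hk, rfl⟩) h.support
    have hdisj : ∀ g ∈ G.map (Gate.map (p₁.onTile t)), ∀ L ∈ B, ∀ g' ∈ L,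
        Disjoint g.support g'.support := by
      intro g hg L hL g' hg'
      obtain ⟨u, hu, h1⟩ := hB.isLocal L hL g' hg'
      exact (region_disjoint hp htW (hT u (Finset.mem_insert_of_mem hu)).1
        fun h => htT (h ▸ hu)).mono (hsupp g hg) h1
    refine ⟨addGates (G.map (Gate.map (p₁.onTile t))) B, p₁.step A (W ∪ T) t β a,
      ⟨?_, addGates_layered hB.layered hdisj, ?_, ?_, ?_, ?_, ?_, ?_⟩, ?_⟩
    · rw [hins]
      exact Placement.step_valid hB.valid ht hnet h ha
    · intro L hL g hg
      rcases mem_addGates hL hg with hg | ⟨L', hL', hg⟩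
      · exact ⟨t, Finset.mem_insert_self _ _, hsupp g hg⟩
      · obtain ⟨u, hu, h1⟩ := hB.isLocal L' hL' g hg
        exact ⟨u, Finset.mem_insert_of_mem hu, h1⟩
    · intro l c h1 h2
      have h3 : OnCut A (W ∪ T) l := onCut_of_subset hsub
        (Finset.union_subset_union_right (Finset.subset_insert _ _)) h1 h2
      rw [Placement.step_carrier_old hnet ht h3, hB.carrier_old l c h1 h3]
    · intro l c h1 h2
      rw [hins] at h1
      by_cases h3 : OnCut A (W ∪ T) l
      · obtain ⟨u, hu, h4, h5⟩ := hB.carrier_new l c h3 h2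
        refine ⟨u, Finset.mem_insert_of_mem hu, h4, ?_⟩
        rwa [Placement.step_carrier_old hnet ht h3]
      · refine ⟨t, Finset.mem_insert_self _ _, ?_⟩
        rcases Placement.step_carrier_cases (p := p₁) ht hnet h h1 c with
          ⟨h4, -⟩ | ⟨i, h4, rfl, h6, h7⟩
        · exact absurd h4 h3
        · refine ⟨?_, ?_⟩
          · rcases outerEnd_eq_or_glued hnet (⟨t, i⟩ : net.Leg) with h8 | h8
            · exact Or.inl (by rw [h8])
            · exact Or.inr ⟨i, h8⟩
          · rw [h7, ← hregion]
            exact mem_region_iff.2 ⟨_, h6, rfl⟩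
    · intro s hs
      rw [Placement.step_logical_old (fun h' => htW (h' ▸ hs) : s.1 ≠ t), hB.logical_old s hs]
    · intro s hs
      rcases Finset.mem_insert.1 hs with hs | hs
      · obtain ⟨k, hk⟩ := Option.isSome_iff_exists.1 (ha.2 (hs ▸ s.2))
        rw [Placement.step_logical_new hs hk, hs, ← hregion]
        exact mem_region_iff.2 ⟨k, (h.logical k hk).1, rfl⟩
      · rw [Placement.step_logical_old (fun h' => htT (h' ▸ hs) : s.1 ≠ t)]
        exact hB.logical_new s hs
    · intro ψ
      rw [addGates_run hdisj, hB.decoded, runGates_step hnet D hB.valid ht h ha, hins]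
    · rw [addGates_length, List.length_map]
      exact max_le hG hlen

/-- Before any tile is absorbed, every leg is carried by its own qubits. -/
def Placement.initial (q₀ : net.Qubit N) : Placement net N where
  carrier l c := if h : net.IsBoundary l then (⟨l, h⟩, c) else q₀
  logical _ := q₀

theorem onCut_empty_iff (l : net.Leg) :
    OnCut A ∅ l ↔ ∃ h : net.IsBoundary l, (⟨l, h⟩ : net.Boundary) ∈ A := by
  simp [OnCut, Accessible]

theorem Placement.initial_carrier (q₀ : net.Qubit N) (b : net.Boundary) (c : Fin N) :
    (Placement.initial q₀).carrier b.1 c = (b, c) := dif_pos b.2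

theorem Placement.initial_valid (q₀ : net.Qubit N) : (Placement.initial q₀).Valid A ∅ where
  carrier_mem l c hl := by
    obtain ⟨hb, h⟩ := (onCut_empty_iff l).1 hl
    rw [Placement.initial_carrier q₀ ⟨l, hb⟩ c]
    exact h
  logical_mem s hs := by simp at hs
  carrier_inj l c l' c' hl hl' h := by
    obtain ⟨hb, -⟩ := (onCut_empty_iff l).1 hl
    obtain ⟨hb', -⟩ := (onCut_empty_iff l').1 hl'
    rw [Placement.initial_carrier q₀ ⟨l, hb⟩ c, Placement.initial_carrier q₀ ⟨l', hb'⟩ c'] at h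
    obtain ⟨h1, h2⟩ := Prod.mk.inj h
    exact ⟨Subtype.mk.inj h1, h2⟩
  logical_inj s s' hs := by simp at hs
  disjoint l c s _ hs := by simp at hs

theorem Dressing.encode_eq_decodedState (hnet : net.Proper) (D : net.Dressing N)
    (q₀ : net.Qubit N) (ψ : QState net.Bulk) :
    D.encode ψ = D.decodedState A ∅ (Placement.initial q₀) ψ := by
  funext y
  rw [Dressing.decodedState_apply, Finset.compl_empty]
  refine Finset.sum_congr rfl fun x _ => ?_
  congr 1
  have h1 : (Placement.initial q₀).Fits A ∅ x y := by
    refine ⟨fun s hs => by simp at hs, fun q hq => ?_, fun q hq => by simp at hq⟩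
    exact absurd (Placement.initial_carrier q₀ q.1 q.2)
      (hq.2.1 q.1.1 q.2 ((onCut_empty_iff _).2 ⟨q.1.2, hq.1⟩))
  have h2 : bellCount N A ∅ = 0 := by
    unfold bellCount
    rw [Finset.card_eq_zero, Finset.filter_eq_empty_iff]
    rintro q - ⟨h, -⟩
    simp at h
  rw [if_pos h1, h2, pow_zero, one_mul]
  refine D.contract_congr hnet _ x fun l _ _ => ?_
  funext c
  unfold Placement.openBits
  by_cases h : OnCut A ∅ l
  · obtain ⟨hb, -⟩ := (onCut_empty_iff l).1 h
    rw [if_pos h, dif_pos hb, Placement.initial_carrier q₀ ⟨l, hb⟩ c]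
  · rw [if_neg h]

theorem absorbed_zero (M : ℕ → Finset net.Tile) : absorbed M 0 = ∅ := by
  simp [absorbed]

theorem absorbed_succ (M : ℕ → Finset net.Tile) (r : ℕ) :
    absorbed M (r + 1) = absorbed M r ∪ M r := by
  simp [absorbed, Finset.range_add_one, Finset.union_comm]

theorem firstBlocks_succ {Q : Type} (B : ℕ → Circuit Q) (r : ℕ) :
    firstBlocks B (r + 1) = firstBlocks B r ++ B r := by
  simp [firstBlocks, List.range_succ]

theorem Dressing.exists_decodes (hnet : net.Proper) (D : net.Dressing N) {depth : ℕ}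
    (hdepth : ∀ (k : TileKind) (ρ : Fin N → Equiv.Perm (Fin k.legs)) (γ : Fin N → Gauge)
      (S : Finset (Fin k.legs)), 3 ≤ S.card → ∃ G β a,
        LocallyDecodes (S ×ˢ (Finset.univ : Finset (Fin N)))
          (fun x y => tileAmp k ρ γ x fun i c => y (i, c)) G β a ∧
        (a.isSome ↔ k = TileKind.square) ∧ G.length ≤ depth)
    (q₀ : net.Qubit N) {M : ℕ → Finset net.Tile} (hM : IsGreedyRun A M) :
    ∃ B p, D.Decodes A M B p ∧ ∀ r, (B r).length ≤ depth := by
  have hround : ∀ r (p : {p : Placement net N // p.Valid A (absorbed M r)}),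
      ∃ B p', D.DecodesRound A (absorbed M r) (M r) p.1 B p' ∧ B.length ≤ depth := fun r p =>
    D.exists_decodesRound hnet hdepth p.2 (M r) (hM.move r) (hM.apart r)
  choose B p' hB hlen using hround
  let p : (r : ℕ) → {p : Placement net N // p.Valid A (absorbed M r)} := fun r =>
    Nat.rec ⟨Placement.initial q₀, by rw [absorbed_zero]; exact Placement.initial_valid q₀⟩
      (fun r p => ⟨p' r p, by rw [absorbed_succ]; exact (hB r p).valid⟩) r
  refine ⟨fun r => B r (p r), fun r => (p r).1, ⟨fun b c _ => ?_, fun r => (p r).2,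
    fun r => (hB r (p r)).layered, fun r => (hB r (p r)).isLocal, fun r l c h1 h2 => ?_,
    fun r l c h1 h2 => ?_, fun r s hs => ?_, fun r s hs => ?_, fun r ψ => ?_⟩,
    fun r => hlen r (p r)⟩
  · exact Placement.initial_carrier q₀ b c
  · rw [absorbed_succ] at h2
    exact (hB r (p r)).carrier_old l c h1 h2
  · rw [absorbed_succ] at h1
    exact (hB r (p r)).carrier_new l c h1 h2
  · exact (hB r (p r)).logical_old s hs
  · exact (hB r (p r)).logical_new s hs
  · induction r with
    | zero =>
      change D.encode ψ = D.decodedState A (absorbed M 0) (Placement.initial q₀) ψ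
      rw [absorbed_zero]
      exact D.encode_eq_decodedState hnet q₀ ψ
    | succ r ih =>
      rw [firstBlocks_succ, Circuit.run_append, ih]
      change _ = D.decodedState A (absorbed M (r + 1)) (p' r (p r)) ψ
      rw [absorbed_succ]
      exact (hB r (p r)).decoded ψ

theorem firstBlocks_length_le {Q : Type} {B : ℕ → Circuit Q} {depth : ℕ}
    (h : ∀ r, (B r).length ≤ depth) (r : ℕ) : (firstBlocks B r).length ≤ r * depth := by
  induction r with
  | zero => simp [firstBlocks]
  | succ r ih =>
    rw [firstBlocks_succ, List.length_append, Nat.succ_mul]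
    exact Nat.add_le_add ih (h r)

end Round

/-! ### The Greedy wedge -/

section Wedge

variable {net : Network} {A : Set net.Boundary}

theorem ThreeLegs.mono {W W' : Finset net.Tile} (hW : W ⊆ W') {t : net.Tile}
    (h : ThreeLegs A W t) : ThreeLegs A W' t :=
  h.trans (Finset.card_le_card fun _ hi => Finset.mem_filter.2
    ⟨Finset.mem_univ _, (Finset.mem_filter.1 hi).2.mono hW⟩)

theorem mem_greedyWedge {t : net.Tile} : t ∈ greedyWedge A ↔
    ∀ W : Finset net.Tile, (∀ u, ThreeLegs A W u → u ∈ W) → t ∈ W := by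
  simp [greedyWedge]

theorem greedyWedge_closed {t : net.Tile} (h : ThreeLegs A (greedyWedge A) t) :
    t ∈ greedyWedge A :=
  mem_greedyWedge.2 fun W hW => hW t (h.mono fun _ hu => mem_greedyWedge.1 hu W hW)

theorem IsGreedyRun.absorbed_subset {M : ℕ → Finset net.Tile} (hM : IsGreedyRun A M) (r : ℕ) :
    absorbed M r ⊆ greedyWedge A := by
  induction r with
  | zero => simp [absorbed_zero]
  | succ r ih =>
    rw [absorbed_succ]
    exact Finset.union_subset ih fun t ht => greedyWedge_closed ((hM.move r t ht).2.mono ih)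

theorem IsGreedyRun.absorbed_eq {M : ℕ → Finset net.Tile} (hM : IsGreedyRun A M) (r : ℕ)
    (h : ∀ t, ThreeLegs A (absorbed M r) t → t ∈ absorbed M r) :
    absorbed M r = greedyWedge A :=
  (hM.absorbed_subset r).antisymm fun _ ht => mem_greedyWedge.1 ht _ h

/-- The tiles absorbed before round `r` if in round `r` all the tiles of the kind `layerKind r` that
can be absorbed are absorbed. -/
def scheduledSet (A : Set net.Boundary) : ℕ → Finset net.Tile
  | 0 => ∅
  | r + 1 => scheduledSet A r ∪ Finset.univ.filter fun t =>
      net.kind t = layerKind r ∧ t ∉ scheduledSet A r ∧ ThreeLegs A (scheduledSet A r) t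

/-- The run that alternates between squares and hexagons, absorbing all it can. -/
def scheduledRun (A : Set net.Boundary) (r : ℕ) : Finset net.Tile :=
  Finset.univ.filter fun t =>
    net.kind t = layerKind r ∧ t ∉ scheduledSet A r ∧ ThreeLegs A (scheduledSet A r) t

theorem absorbed_scheduledRun (r : ℕ) : absorbed (scheduledRun A) r = scheduledSet A r := by
  induction r with
  | zero => exact absorbed_zero _
  | succ r ih =>
    rw [absorbed_succ, ih]
    rfl

/-- Tiles of the same kind share no edge. -/
theorem scheduledRun_isGreedyRun (hnet : net.Proper) : IsGreedyRun A (scheduledRun A) where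
  move r t ht := by
    rw [absorbed_scheduledRun]
    exact (Finset.mem_filter.1 ht).2.2
  apart r t ht u hu i j h := hnet.bipartite _ _ h
    ((Finset.mem_filter.1 ht).2.1.trans (Finset.mem_filter.1 hu).2.1.symm)

theorem scheduledSet_mono {r r' : ℕ} (h : r ≤ r') : scheduledSet A r ⊆ scheduledSet A r' := by
  induction r', h using Nat.le_induction with
  | base => exact Finset.Subset.refl _
  | succ r' _ ih => exact ih.trans Finset.subset_union_left

theorem scheduledSet_subset (hnet : net.Proper) (r : ℕ) : scheduledSet A r ⊆ greedyWedge A := by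
  rw [← absorbed_scheduledRun]
  exact (scheduledRun_isGreedyRun hnet).absorbed_subset r

/-- A tile that can be absorbed is absorbed in one of the next two rounds. -/
theorem mem_scheduledSet_add_two {r : ℕ} {t : net.Tile} (h : ThreeLegs A (scheduledSet A r) t) :
    t ∈ scheduledSet A (r + 2) := by
  have key : ∀ r', r ≤ r' → net.kind t = layerKind r' → t ∈ scheduledSet A (r' + 1) := by
    intro r' hr hk
    by_cases ht : t ∈ scheduledSet A r'
    · exact scheduledSet_mono (Nat.le_succ _) ht
    · exact Finset.mem_union_right _ (Finset.mem_filter.2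
        ⟨Finset.mem_univ _, hk, ht, h.mono (scheduledSet_mono hr)⟩)
  by_cases hk : net.kind t = layerKind r
  · exact scheduledSet_mono (Nat.le_succ _) (key r le_rfl hk)
  · refine key (r + 1) (Nat.le_succ _) ?_
    unfold layerKind at hk ⊢
    rcases Nat.mod_two_eq_zero_or_one r with hr | hr
    · rw [if_pos hr] at hk
      rw [if_neg (by omega)]
      cases h' : net.kind t <;> simp_all
    · rw [if_neg (by omega)] at hk
      rw [if_pos (by omega)]
      cases h' : net.kind t <;> simp_all

/-- If at most the tiles of `U` are still to be absorbed, then `2 (|U| + 1)` more rounds suffice. -/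
theorem absorbed_scheduledRun_eq (hnet : net.Proper) (r₀ : ℕ) (U : Finset net.Tile)
    (hU : ∀ t ∈ greedyWedge A, t ∉ scheduledSet A r₀ → t ∈ U) :
    absorbed (scheduledRun A) (r₀ + 2 * (U.card + 1)) = greedyWedge A := by
  -- As long as a move is left, two more rounds absorb at least one more tile.
  have key : ∀ j, absorbed (scheduledRun A) (r₀ + 2 * j) = greedyWedge A ∨
      j ≤ (scheduledSet A (r₀ + 2 * j) \ scheduledSet A r₀).card := by
    intro j
    induction j with
    | zero => exact Or.inr (Nat.zero_le _)
    | succ j ih =>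
      by_cases hsat : ∀ t, ThreeLegs A (scheduledSet A (r₀ + 2 * j)) t →
          t ∈ scheduledSet A (r₀ + 2 * j)
      · left
        have h1 := (scheduledRun_isGreedyRun (A := A) hnet).absorbed_eq (r₀ + 2 * j)
          (by rwa [absorbed_scheduledRun])
        refine ((scheduledRun_isGreedyRun hnet).absorbed_subset _).antisymm ?_
        rw [← h1, absorbed_scheduledRun, absorbed_scheduledRun]
        exact scheduledSet_mono (by omega)
      · right
        push Not at hsat
        obtain ⟨t, h1, h2⟩ := hsat
        rcases ih with ih | ih
        · rw [absorbed_scheduledRun] at ih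
          rw [ih] at h1 h2
          exact absurd (greedyWedge_closed h1) h2
        · refine Nat.succ_le_of_lt (ih.trans_lt (Finset.card_lt_card ?_))
          rw [Finset.ssubset_iff_of_subset
            (Finset.sdiff_subset_sdiff (scheduledSet_mono (by omega)) (Finset.Subset.refl _))]
          exact ⟨t, Finset.mem_sdiff.2 ⟨mem_scheduledSet_add_two h1,
            fun h => h2 (scheduledSet_mono (by omega) h)⟩, fun h => h2 (Finset.mem_sdiff.1 h).1⟩
  rcases key (U.card + 1) with h | h
  · exact h
  · exfalso
    have : (scheduledSet A (r₀ + 2 * (U.card + 1)) \ scheduledSet A r₀).card ≤ U.card :=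
      Finset.card_le_card fun t ht => hU t (scheduledSet_subset hnet _ (Finset.mem_sdiff.1 ht).1)
        (Finset.mem_sdiff.1 ht).2
    omega

theorem exists_run_eq_greedyWedge (hnet : net.Proper) :
    ∃ M r, IsGreedyRun A M ∧ absorbed M r = greedyWedge A :=
  ⟨scheduledRun A, _, scheduledRun_isGreedyRun hnet,
    absorbed_scheduledRun_eq hnet 0 Finset.univ fun t _ _ => Finset.mem_univ t⟩

end Wedge

/-! ### Isometry -/

/-- If the Greedy wedge of the whole boundary consists of all tiles, then encoding preserves norms:
the decoded state is the bulk state, spread over some boundary qubits, with zeros elsewhere. -/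
theorem Dressing.norm_encode {net : Network} {N : ℕ} (hN : 0 < N) (hnet : net.Proper)
    (hne : Nonempty net.Boundary)
    (hW : greedyWedge (Set.univ : Set net.Boundary) = Finset.univ) (D : net.Dressing N)
    (ψ : QState net.Bulk) : ∑ y, ‖D.encode ψ y‖ ^ 2 = ∑ x, ‖ψ x‖ ^ 2 := by
  obtain ⟨M, r, hM, hr⟩ := exists_run_eq_greedyWedge (A := Set.univ) hnet
  rw [hW] at hr
  obtain ⟨depth, hdepth⟩ := exists_tile_depth hN
  obtain ⟨B, p', hB, -⟩ := D.exists_decodes hnet hdepth (hne.some, ⟨0, hN⟩) hM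
  have h1 := hB.decoded r ψ
  have hp := hB.valid r
  rw [hr] at h1 hp
  set p := p' r
  rw [Circuit.run_eq_runGates] at h1
  have h0 : ∑ y, ‖D.encode ψ y‖ ^ 2 = ∑ y, ‖D.decodedState Set.univ Finset.univ p ψ y‖ ^ 2 := by
    rw [← h1]
    convert (runGates_norm (firstBlocks B r).flatten (D.encode ψ)).symm
  rw [h0]
  -- The boundary basis state that decodes to the bulk bits `x`.
  let Y : (net.Bulk → Bool) → net.Qubit N → Bool := fun x q =>
    if h : ∃ s, p.logical s = q then x h.choose else false
  have hY : ∀ x s, Y x (p.logical s) = x s := by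
    intro x s
    have h : ∃ s', p.logical s' = p.logical s := ⟨s, rfl⟩
    have h2 : Y x (p.logical s) = x h.choose := dif_pos h
    rw [h2, hp.logical_inj _ _ (Finset.mem_univ _) (Finset.mem_univ _) h.choose_spec]
  have hcut : ∀ l : net.Leg, ¬ OnCut Set.univ Finset.univ l := by
    rintro l (⟨h, -⟩ | ⟨-, _, h⟩)
    · exact h (Finset.mem_univ _)
    · exact h (Set.mem_univ _)
  have hfits : ∀ x y, p.Fits Set.univ Finset.univ x y ↔ y = Y x := by
    intro x y
    constructor
    · rintro ⟨h2, h3, -⟩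
      funext q
      by_cases h : ∃ s, p.logical s = q
      · obtain ⟨s, rfl⟩ := h
        rw [hY, h2 s (Finset.mem_univ _)]
      · have h4 : Y x q = false := dif_neg h
        rw [h4]
        exact h3 q ⟨Set.mem_univ _, fun l c hl => absurd hl (hcut l), fun s _ hs => h ⟨s, hs⟩⟩
    · rintro rfl
      refine ⟨fun s _ => hY x s, fun q hq => dif_neg ?_, fun q hq => absurd (Set.mem_univ _) hq.2⟩
      rintro ⟨s, hs⟩
      exact hq.2.2 s (Finset.mem_univ _) hs
  have hYinj : Function.Injective Y := fun x x' h => funext fun s => by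
    rw [← hY x s, ← hY x' s, h]
  have hbell : bellCount N (Set.univ : Set net.Boundary) Finset.univ = 0 := by
    simp [bellCount]
  have hstate : ∀ y, D.decodedState Set.univ Finset.univ p ψ y =
      ∑ x, if y = Y x then ψ x else 0 := by
    intro y
    rw [Dressing.decodedState_apply]
    refine Finset.sum_congr rfl fun x _ => ?_
    rw [Finset.compl_univ, Dressing.contract_empty, hbell, pow_zero, mul_one]
    by_cases h : y = Y x
    · rw [if_pos h, if_pos ((hfits x y).2 h), mul_one]
    · rw [if_neg h, if_neg fun h' => h ((hfits x y).1 h'), mul_zero]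
  symm
  refine Finset.sum_of_injOn Y hYinj.injOn (fun _ _ => Finset.mem_coe.2 (Finset.mem_univ _)) ?_ ?_
  · intro y _ hy
    rw [hstate, Finset.sum_eq_zero fun x _ => if_neg fun h =>
      hy ⟨x, Finset.mem_coe.2 (Finset.mem_univ _), h.symm⟩]
    simp
  · intro x _
    rw [hstate, Finset.sum_eq_single x]
    · rw [if_pos rfl]
    · intro x' _ hx'
      exact if_neg fun h => hx' (hYinj h).symm
    · simp

end Network

/-! ### Patches of the tiling -/

section Attach

/-- The legs in a list of groups of exposed edges are those of the front. -/
theorem frontGroups_perm (d : ℕ) (f : List ((ℕ × ℕ) × ℕ)) :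
    ((frontGroups d f).flatMap Prod.fst).Perm (f.map Prod.fst) := by
  fun_induction frontGroups d f with
  | case1 => exact List.Perm.refl _
  | case2 l c => exact List.Perm.refl _
  | case3 l c l' c' rest h ih => exact (List.Perm.swap l l' _).trans ((ih.cons l').cons l)
  | case4 l c l' c' rest h ih => exact ih.cons l

theorem exists_mem_frontGroups {d : ℕ} {f : List ((ℕ × ℕ) × ℕ)} {g : List (ℕ × ℕ) × ℕ}
    (hg : g ∈ frontGroups d f) {l : ℕ × ℕ} (hl : l ∈ g.1) : l ∈ f.map Prod.fst :=
  (frontGroups_perm d f).subset (List.mem_flatMap.2 ⟨g, hg, hl⟩)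

/-- The number of exposed legs that the group `g` contributes to the front after a tile of kind `k`
has been attached to it, or not. -/
def blockLength (k : TileKind) (selected : Bool) (g : List (ℕ × ℕ) × ℕ) : ℕ :=
  if selected then k.legs - g.1.length else g.1.length

variable (k : TileKind) (sel : ℕ → Bool)

/-- Book-keeping of legs: those in the groups either get glued to a new tile or remain exposed, and
the only other exposed legs are outward legs of the new tiles, listed in `new`. -/
theorem attach_perm (pos idx : ℕ) (gs : List (List (ℕ × ℕ) × ℕ)) :
    ∃ new : List (ℕ × ℕ), new.Nodup ∧ (∀ l ∈ new, idx ≤ l.1) ∧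
      ((attach k sel pos idx gs).tiles.flatMap Prod.snd ++
        (attach k sel pos idx gs).front.map Prod.fst).Perm (gs.flatMap Prod.fst ++ new) := by
  induction gs generalizing pos idx with
  | nil => exact ⟨[], List.nodup_nil, by simp, List.Perm.refl _⟩
  | cons g gs ih =>
    by_cases h : sel pos
    · obtain ⟨new, h1, h2, h3⟩ := ih (pos + 1) (idx + 1)
      refine ⟨(List.range' g.1.length (k.legs - g.1.length)).map (fun i => (idx, i)) ++ new,
        ?_, ?_, ?_⟩
      · refine List.Nodup.append
          ((List.nodup_range' (s := g.1.length) (n := k.legs - g.1.length)).map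
            fun a b h => (Prod.mk.inj h).2) h1 ?_
        intro l hl hl'
        obtain ⟨i, -, rfl⟩ := List.mem_map.1 hl
        have := h2 _ hl'
        simp at this
      · intro l hl
        rcases List.mem_append.1 hl with hl | hl
        · obtain ⟨i, -, rfl⟩ := List.mem_map.1 hl
          exact le_rfl
        · exact (Nat.le_succ _).trans (h2 l hl)
      · simp only [attach, h, if_true, List.flatMap_cons, List.map_append, List.map_map,
          List.append_assoc]
        refine List.Perm.append_left _ ?_
        have h4 : (Prod.fst ∘ fun i => ((idx, i), if i + 1 = k.legs then g.2 + 2 else 1)) =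
          fun i => (idx, i) := rfl
        rw [h4]
        refine List.perm_append_comm_assoc _ _ _ |>.trans ?_
        refine List.Perm.trans ?_ (List.perm_append_comm_assoc _ _ _)
        exact h3.append_left _
    · obtain ⟨new, h1, h2, h3⟩ := ih (pos + 1) idx
      refine ⟨new, h1, h2, ?_⟩
      have h4 : (g.1.reverse.map fun l => (l, 0)).map Prod.fst = g.1.reverse := by
        rw [List.map_map]
        exact List.map_id _
      simp only [attach, h, Bool.false_eq_true, if_false, List.flatMap_cons, List.map_append, h4,
        List.append_assoc]
      refine (List.perm_append_comm_assoc _ _ _).trans ?_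
      exact (List.reverse_perm _).append h3

/-- The tile attached to the group number `j` comes after those attached to earlier groups. -/
theorem attach_tiles_getElem? (pos idx : ℕ) (gs : List (List (ℕ × ℕ) × ℕ)) (j : ℕ)
    (hj : j < gs.length) (hsel : sel (pos + j)) :
    (attach k sel pos idx gs).tiles[Nat.count (fun i => sel (pos + i)) j]? =
      some (k, gs[j].1) := by
  induction gs generalizing pos idx j with
  | nil => simp at hj
  | cons g gs ih =>
    cases j with
    | zero => simp [attach, show sel pos = true from hsel]
    | succ j =>
      have h1 := fun idx => ih (pos + 1) idx j (by simpa using hj)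
        (by rw [← hsel]; congr 1; omega)
      have h2 : Nat.count (fun i => sel (pos + i)) (j + 1) =
          Nat.count (fun i => sel (pos + 1 + i)) j + if sel pos then 1 else 0 := by
        rw [Nat.count_succ']
        congr 2
        funext i
        congr 2
        omega
      by_cases h : sel pos
      · simp only [attach, h, if_true, h2, List.getElem?_cons_succ, List.getElem_cons_succ]
        exact h1 _
      · simp only [attach, h, Bool.false_eq_true, if_false, h2, add_zero, List.getElem_cons_succ]
        exact h1 _

theorem exists_attach_tile (pos idx : ℕ) (gs : List (List (ℕ × ℕ) × ℕ)) (t : ℕ)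
    (ht : t < (attach k sel pos idx gs).tiles.length) :
    ∃ j, j < gs.length ∧ sel (pos + j) ∧ t = Nat.count (fun i => sel (pos + i)) j := by
  induction gs generalizing pos idx t with
  | nil => simp [attach] at ht
  | cons g gs ih =>
    have h2 : ∀ j, Nat.count (fun i => sel (pos + i)) (j + 1) =
        Nat.count (fun i => sel (pos + 1 + i)) j + if sel pos then 1 else 0 := by
      intro j
      rw [Nat.count_succ']
      congr 2
      funext i
      congr 2
      omega
    have h3 : ∀ j, pos + (j + 1) = pos + 1 + j := fun j => by omega
    by_cases h : sel pos
    · cases t with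
      | zero => exact ⟨0, by simp, h, by simp⟩
      | succ t =>
        simp only [attach, h, if_true, List.length_cons, Nat.succ_lt_succ_iff] at ht
        obtain ⟨j, h4, h5, h6⟩ := ih (pos + 1) (idx + 1) t ht
        exact ⟨j + 1, by simpa using h4, by rwa [h3], by rw [h2, h6, if_pos h]⟩
    · simp only [attach, h, Bool.false_eq_true, if_false] at ht
      obtain ⟨j, h4, h5, h6⟩ := ih (pos + 1) idx t ht
      exact ⟨j + 1, by simpa using h4, by rwa [h3], by rw [h2, h6, if_neg h, add_zero]⟩

/-- The position in the front at which the exposed legs of the `j`-th group begin. -/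
def blockStart (pos : ℕ) (gs : List (List (ℕ × ℕ) × ℕ)) (j : ℕ) : ℕ :=
  ∑ i ∈ Finset.range j, blockLength k (sel (pos + i)) (gs.getD i ([], 0))

theorem blockStart_cons (pos : ℕ) (g : List (ℕ × ℕ) × ℕ) (gs : List (List (ℕ × ℕ) × ℕ)) (j : ℕ) :
    blockStart k sel pos (g :: gs) (j + 1) =
      blockLength k (sel pos) g + blockStart k sel (pos + 1) gs j := by
  unfold blockStart
  rw [Finset.sum_range_succ', add_comm]
  congr 1
  refine Finset.sum_congr rfl fun i _ => ?_
  rw [List.getD_cons_succ]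
  congr 2
  omega

/-- The position in the front of an outward leg of a new tile. -/
theorem attach_front_selected (pos idx : ℕ) (gs : List (List (ℕ × ℕ) × ℕ)) (j : ℕ)
    (hj : j < gs.length) (hsel : sel (pos + j)) (i : ℕ) (hi : gs[j].1.length ≤ i)
    (hi' : i < k.legs) : ∃ c,
    (attach k sel pos idx gs).front[blockStart k sel pos gs j + (i - gs[j].1.length)]? =
      some ((idx + Nat.count (fun i => sel (pos + i)) j, i), c) := by
  induction gs generalizing pos idx j with
  | nil => simp at hj
  | cons g gs ih =>
    cases j with
    | zero =>
      simp only [List.getElem_cons_zero] at hi ⊢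
      refine ⟨if i + 1 = k.legs then g.2 + 2 else 1, ?_⟩
      simp only [attach, show sel pos = true from hsel, if_true, blockStart, Finset.range_zero,
        Finset.sum_empty, zero_add, Nat.count_zero, add_zero]
      rw [List.getElem?_append_left (by simp; omega), List.getElem?_map, List.getElem?_range'
        (by omega)]
      simp only [Option.map_some, one_mul, Nat.add_sub_cancel' hi]
    | succ j =>
      have h1 := fun idx => ih (pos + 1) idx j (by simpa using hj)
        (by rw [← hsel]; congr 1; omega) (by simpa using hi)
      have h2 : Nat.count (fun i => sel (pos + i)) (j + 1) =
          Nat.count (fun i => sel (pos + 1 + i)) j + if sel pos then 1 else 0 := by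
        rw [Nat.count_succ']
        congr 2
        funext i
        congr 2
        omega
      rw [blockStart_cons, h2, List.getElem_cons_succ]
      by_cases h : sel pos
      · simp only [attach, h, if_true, blockLength]
        obtain ⟨c, hc⟩ := h1 (idx + 1)
        refine ⟨c, ?_⟩
        rw [List.getElem?_append_right (by simp; omega), List.length_map, List.length_range',
          show ∀ a b c : ℕ, a + b + c - a = b + c by omega, hc,
          show ∀ a b : ℕ, a + 1 + b = a + (b + 1) by omega]
      · simp only [attach, h, Bool.false_eq_true, if_false, blockLength, add_zero]
        obtain ⟨c, hc⟩ := h1 idx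
        refine ⟨c, ?_⟩
        rw [List.getElem?_append_right (by simp; omega), List.length_map, List.length_reverse,
          show ∀ a b c : ℕ, a + b + c - a = b + c by omega, hc]

/-- The position in the front of a leg to which no tile is attached. -/
theorem attach_front_not_selected (pos idx : ℕ) (gs : List (List (ℕ × ℕ) × ℕ)) (j : ℕ)
    (hj : j < gs.length) (hsel : ¬ sel (pos + j)) (l : ℕ × ℕ) (hl : l ∈ gs[j].1) : ∃ r c,
    r < gs[j].1.length ∧
    (attach k sel pos idx gs).front[blockStart k sel pos gs j + r]? = some (l, c) := by
  induction gs generalizing pos idx j with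
  | nil => simp at hj
  | cons g gs ih =>
    cases j with
    | zero =>
      simp only [List.getElem_cons_zero] at hl ⊢
      obtain ⟨r, hr, hrl⟩ := List.getElem_of_mem (List.mem_reverse.2 hl)
      refine ⟨r, 0, by simpa using hr, ?_⟩
      simp only [attach, show ¬ sel pos = true from hsel, if_false, blockStart, Finset.range_zero,
        Finset.sum_empty, zero_add, Bool.false_eq_true]
      rw [List.getElem?_append_left (by simpa using hr), List.getElem?_map,
        List.getElem?_eq_getElem hr, hrl]
      rfl
    | succ j =>
      have h1 := fun idx => ih (pos + 1) idx j (by simpa using hj)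
        (by rwa [show pos + 1 + j = pos + (j + 1) by omega]) (by simpa using hl)
      rw [blockStart_cons, List.getElem_cons_succ]
      by_cases h : sel pos
      · simp only [attach, h, if_true, blockLength]
        obtain ⟨r, c, hr, hc⟩ := h1 (idx + 1)
        refine ⟨r, c, hr, ?_⟩
        rw [List.getElem?_append_right (by simp; omega), List.length_map, List.length_range',
          show ∀ a b c : ℕ, a + b + c - a = b + c by omega, hc]
      · simp only [attach, h, Bool.false_eq_true, if_false, blockLength]
        obtain ⟨r, c, hr, hc⟩ := h1 idx
        refine ⟨r, c, hr, ?_⟩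
        rw [List.getElem?_append_right (by simp; omega), List.length_map, List.length_reverse,
          show ∀ a b c : ℕ, a + b + c - a = b + c by omega, hc]

theorem attach_front_length (pos idx : ℕ) (gs : List (List (ℕ × ℕ) × ℕ)) :
    (attach k sel pos idx gs).front.length = blockStart k sel pos gs gs.length := by
  induction gs generalizing pos idx with
  | nil => simp [attach, blockStart]
  | cons g gs ih =>
    rw [List.length_cons, blockStart_cons]
    by_cases h : sel pos <;> simp [attach, h, blockLength, ih]

theorem attach_front_mem (pos idx : ℕ) (gs : List (List (ℕ × ℕ) × ℕ)) {x : (ℕ × ℕ) × ℕ}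
    (hx : x ∈ (attach k sel pos idx gs).front) :
    (∃ g ∈ gs, x.1 ∈ g.1) ∨ ∃ t es, x.1.1 = idx + t ∧
      (attach k sel pos idx gs).tiles[t]? = some (k, es) ∧ es.length ≤ x.1.2 ∧
      x.1.2 < k.legs := by
  induction gs generalizing pos idx with
  | nil => simp [attach] at hx
  | cons g gs ih =>
    by_cases h : sel pos
    · simp only [attach, h, if_true] at hx ⊢
      rcases List.mem_append.1 hx with hx | hx
      · obtain ⟨i, hi, rfl⟩ := List.mem_map.1 hx
        rw [List.mem_range'_1] at hi
        exact Or.inr ⟨0, g.1, rfl, rfl, hi.1, by simp only; omega⟩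
      · rcases ih _ _ hx with ⟨g', hg', h1⟩ | ⟨t, es, h1, h2, h3, h4⟩
        · exact Or.inl ⟨g', List.mem_cons_of_mem _ hg', h1⟩
        · exact Or.inr ⟨t + 1, es, by omega, h2, h3, h4⟩
    · simp only [attach, h, Bool.false_eq_true, if_false] at hx ⊢
      rcases List.mem_append.1 hx with hx | hx
      · obtain ⟨l, hl, rfl⟩ := List.mem_map.1 hx
        exact Or.inl ⟨g, List.mem_cons_self, List.mem_reverse.1 hl⟩
      · rcases ih _ _ hx with ⟨g', hg', h1⟩ | h1
        · exact Or.inl ⟨g', List.mem_cons_of_mem _ hg', h1⟩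
        · exact Or.inr h1

theorem attach_tiles_mem (pos idx : ℕ) (gs : List (List (ℕ × ℕ) × ℕ)) {x : TileKind × List (ℕ × ℕ)}
    (hx : x ∈ (attach k sel pos idx gs).tiles) : x.1 = k ∧ ∃ g ∈ gs, x.2 = g.1 := by
  obtain ⟨t, ht, rfl⟩ := List.getElem_of_mem hx
  obtain ⟨j, h1, h2, h3⟩ := exists_attach_tile k sel pos idx gs t ht
  have h4 := attach_tiles_getElem? k sel pos idx gs j h1 h2
  rw [← h3, List.getElem?_eq_getElem ht] at h4
  rw [Option.some_injective _ h4]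
  exact ⟨rfl, gs[j], List.getElem_mem _, rfl⟩

end Attach

/-- The legs to which the tiles of a patch are attached, together with the exposed legs, are
pairwise different outward legs, and tiles are attached to earlier tiles of the other kind. -/
structure Patch.WellFormed (P : Patch) : Prop where
  entry : ∀ (t : ℕ) (k : TileKind) (es : List (ℕ × ℕ)), P.tiles[t]? = some (k, es) →
    ∀ l ∈ es, l.1 < t ∧ ∃ (k' : TileKind) (es' : List (ℕ × ℕ)),
      P.tiles[l.1]? = some (k', es') ∧ k' ≠ k ∧ es'.length ≤ l.2
  front : ∀ l ∈ P.front.map Prod.fst, ∃ (k : TileKind) (es : List (ℕ × ℕ)),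
    P.tiles[l.1]? = some (k, es) ∧ es.length ≤ l.2 ∧
    l.2 < k.legs
  nodup : (P.tiles.flatMap Prod.snd ++ P.front.map Prod.fst).Nodup

theorem Patch.WellFormed.grow {P : Patch} (hP : P.WellFormed) (d : ℕ) (k : TileKind)
    (sel : ℕ → Bool)
    (hk : ∀ l ∈ P.front.map Prod.fst, ∀ k' es, P.tiles[l.1]? = some (k', es) → k' ≠ k) :
    (P.grow d k sel).WellFormed := by
  set P' := attach k sel 0 P.tiles.length (frontGroups d P.front) with hP'
  have hG : P.grow d k sel = ⟨P.tiles ++ P'.tiles, P'.front.rotate 1⟩ := rfl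
  have hold : ∀ (t : ℕ) (x : TileKind × List (ℕ × ℕ)),
      P.tiles[t]? = some x → (P.tiles ++ P'.tiles)[t]? = some x := by
    intro t x h
    have ht := (List.getElem?_eq_some_iff.1 h).1
    rw [List.getElem?_append_left ht, h]
  have hrot : ((P'.front.rotate 1).map Prod.fst).Perm (P'.front.map Prod.fst) :=
    (List.rotate_perm _ _).map _
  rw [hG]
  refine ⟨?_, ?_, ?_⟩
  · intro t k' es h l hl
    rcases lt_or_ge t P.tiles.length with ht | ht
    · rw [List.getElem?_append_left ht] at h
      obtain ⟨h1, k₁, es₁, h2, h3⟩ := hP.entry t k' es h l hl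
      exact ⟨h1, k₁, es₁, hold _ _ h2, h3⟩
    · rw [List.getElem?_append_right ht] at h
      obtain ⟨h1, g, hg, h2⟩ := attach_tiles_mem _ _ _ _ _ (List.mem_of_getElem? h)
      simp only at h1 h2
      subst h1 h2
      have h3 := exists_mem_frontGroups hg hl
      obtain ⟨k₁, es₁, h4, h5, -⟩ := hP.front l h3
      exact ⟨(List.getElem?_eq_some_iff.1 h4).1.trans_le ht, k₁, es₁, hold _ _ h4,
        hk l h3 k₁ es₁ h4, h5⟩
  · intro l hl
    obtain ⟨x, hx, rfl⟩ := List.mem_map.1 (hrot.subset hl)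
    rcases attach_front_mem _ _ _ _ _ hx with ⟨g, hg, h1⟩ | ⟨t, es, h1, h2, h3, h4⟩
    · obtain ⟨k₁, es₁, h2, h3⟩ := hP.front x.1 (exists_mem_frontGroups hg h1)
      exact ⟨k₁, es₁, hold _ _ h2, h3⟩
    · refine ⟨k, es, ?_, h3, h4⟩
      rw [h1, List.getElem?_append_right (Nat.le_add_right _ _), Nat.add_sub_cancel_left, h2]
  · obtain ⟨new, h1, h2, h3⟩ := attach_perm k sel 0 P.tiles.length (frontGroups d P.front)
    rw [← hP'] at h3
    have h4 : ((P.tiles ++ P'.tiles).flatMap Prod.snd ++ (P'.front.rotate 1).map Prod.fst).Perm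
        ((P.tiles.flatMap Prod.snd ++ P.front.map Prod.fst) ++ new) := by
      rw [List.flatMap_append, List.append_assoc, List.append_assoc]
      exact List.Perm.append_left _ ((hrot.append_left _).trans (h3.trans
        ((frontGroups_perm d P.front).append_right _)))
    rw [h4.nodup_iff]
    refine List.Nodup.append hP.nodup h1 fun l hl hl' => ?_
    have h5 : l.1 < P.tiles.length := by
      rcases List.mem_append.1 hl with hl | hl
      · obtain ⟨x, hx, hlx⟩ := List.mem_flatMap.1 hl
        obtain ⟨t, ht, rfl⟩ := List.getElem_of_mem hx
        exact ((hP.entry t _ _ (List.getElem?_eq_getElem ht) l hlx).1).trans ht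
      · obtain ⟨k₁, es₁, h5, -⟩ := hP.front l hl
        exact (List.getElem?_eq_some_iff.1 h5).1
    exact absurd (h2 l hl') (by omega)

section WellFormed

variable {P : Patch}

theorem Patch.network_getElem? (t : P.network.Tile) :
    P.tiles[t.val]? = some (P.network.kind t, (P.tiles.get t).2) :=
  List.getElem?_eq_getElem t.2

theorem Patch.WellFormed.entry_injective (hP : P.WellFormed) {t t' i i' : ℕ}
    {x x' : TileKind × List (ℕ × ℕ)} {l : ℕ × ℕ}
    (h : P.tiles[t]? = some x) (h' : P.tiles[t']? = some x') (hi : x.2[i]? = some l)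
    (hi' : x'.2[i']? = some l) : t = t' ∧ i = i' := by
  have h1 := hP.nodup.of_append_left
  rw [List.nodup_flatMap] at h1
  obtain ⟨ht, hx⟩ := List.getElem?_eq_some_iff.1 h
  obtain ⟨ht', hx'⟩ := List.getElem?_eq_some_iff.1 h'
  have hl := List.mem_of_getElem? hi
  have hl' := List.mem_of_getElem? hi'
  have htt : t = t' := by
    by_contra hne
    rcases lt_or_gt_of_ne hne with hlt | hlt
    · have := List.pairwise_iff_getElem.1 h1.2 t t' ht ht' hlt
      rw [hx, hx'] at this
      exact this hl hl'
    · have := List.pairwise_iff_getElem.1 h1.2 t' t ht' ht hlt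
      rw [hx, hx'] at this
      exact this hl' hl
  subst htt
  rw [h] at h'
  obtain rfl := Option.some_injective _ h'
  refine ⟨rfl, ?_⟩
  obtain ⟨hi1, hi2⟩ := List.getElem?_eq_some_iff.1 hi
  obtain ⟨hi1', hi2'⟩ := List.getElem?_eq_some_iff.1 hi'
  exact (h1.1 x (List.mem_of_getElem? h)).getElem_inj_iff.1 (hi2.trans hi2'.symm)

theorem Patch.leg_ext {l l' : P.network.Leg} (h1 : l.1.val = l'.1.val) (h2 : l.2.val = l'.2.val) :
    l = l' := by
  obtain ⟨t, i⟩ := l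
  obtain ⟨t', i'⟩ := l'
  obtain rfl : t = t' := Fin.ext h1
  obtain rfl : i = i' := Fin.ext h2
  rfl

theorem Patch.WellFormed.proper (hP : P.WellFormed) : P.network.Proper := by
  have hlt : ∀ l l' : P.network.Leg,
      (P.tiles.get l.1).2[l.2.val]? = some (l'.1.val, l'.2.val) →
      l.2.val < (P.tiles.get l.1).2.length ∧ (P.tiles.get l'.1).2.length ≤ l'.2.val ∧
        P.network.kind l'.1 ≠ P.network.kind l.1 := by
    intro l l' h
    obtain ⟨-, k', es', h1, h2, h3⟩ := hP.entry _ _ _ (P.network_getElem? l.1) _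
      (List.mem_of_getElem? h)
    rw [P.network_getElem? l'.1] at h1
    obtain ⟨rfl, rfl⟩ := Prod.mk.inj (Option.some_injective _ h1)
    exact ⟨(List.getElem?_eq_some_iff.1 h).1, h3, h2⟩
  refine ⟨fun l l' h => h.symm, ?_, ?_⟩
  · rintro l l' l'' (h | h) (h' | h')
    · rw [h] at h'
      obtain ⟨h1, h2⟩ := Prod.mk.inj (Option.some_injective _ h')
      exact Patch.leg_ext h1 h2
    · have h1 := (hlt _ _ h).1
      have h2 := (hlt _ _ h').2.1
      omega
    · have h1 := (hlt _ _ h').1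
      have h2 := (hlt _ _ h).2.1
      omega
    · obtain ⟨h1, h2⟩ := hP.entry_injective (P.network_getElem? l'.1) (P.network_getElem? l''.1) h h'
      exact Patch.leg_ext h1 h2
  · rintro l l' (h | h)
    · exact (hlt _ _ h).2.2.symm
    · exact (hlt _ _ h).2.2

theorem Patch.WellFormed.isBoundary (hP : P.WellFormed) (l : P.network.Leg)
    (hl : (l.1.val, l.2.val) ∈ P.front.map Prod.fst) : P.network.IsBoundary l := by
  rintro l' (h | h)
  · obtain ⟨k, es, h1, h2, -⟩ := hP.front _ hl
    rw [P.network_getElem? l.1] at h1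
    obtain ⟨rfl, rfl⟩ := Prod.mk.inj (Option.some_injective _ h1)
    have := (List.getElem?_eq_some_iff.1 h).1
    simp only at h2
    omega
  · exact (List.nodup_append.1 hP.nodup).2.2 _
      (List.mem_flatMap.2 ⟨_, List.get_mem _ l'.1, List.mem_of_getElem? h⟩) _ hl rfl

/-- The leg of the network with the given tile and leg numbers. -/
theorem Patch.WellFormed.exists_leg (hP : P.WellFormed) {x : ℕ × ℕ}
    (hx : x ∈ P.front.map Prod.fst) : ∃ l : P.network.Leg, (l.1.val, l.2.val) = x := by
  obtain ⟨k, es, h1, -, h2⟩ := hP.front x hx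
  obtain ⟨h3, h4⟩ := List.getElem?_eq_some_iff.1 h1
  refine ⟨⟨⟨x.1, h3⟩, ⟨x.2, ?_⟩⟩, rfl⟩
  change x.2 < (P.tiles.get ⟨x.1, h3⟩).1.legs
  rw [List.get_eq_getElem, h4]
  exact h2

theorem Patch.WellFormed.front_length_le (hP : P.WellFormed) :
    P.front.length ≤ Fintype.card P.network.Boundary := by
  have h1 : ∀ i : Fin (P.front.map Prod.fst).length, ∃ b : P.network.Boundary,
      (b.1.1.val, b.1.2.val) = (P.front.map Prod.fst).get i := by
    intro i
    obtain ⟨l, hl⟩ := hP.exists_leg (List.get_mem _ i)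
    exact ⟨⟨l, hP.isBoundary l (hl ▸ List.get_mem _ i)⟩, hl⟩
  choose f hf using h1
  have h2 : Function.Injective f := by
    intro i j hij
    have h3 := hP.nodup.of_append_right
    refine h3.injective_get ?_
    rw [← hf, ← hf, hij]
  simpa using Fintype.card_le_of_injective f h2

end WellFormed

/-! ### The layers of the tiling -/

/-- The exposed edges to which one tile is attached, with the number of tiles at the vertex that
follows them. -/
abbrev EdgeGroup := List (ℕ × ℕ) × ℕ

/-- The tiles that touch the tile number `idx`, attached to the group `g`, from outside: one on each
of its outward edges but the first, in cyclic order, where the tile on the last edge is also the one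
on the first outward edge `next` of the following tile, or is followed by the latter. -/
def chunk (d legs idx : ℕ) (g : EdgeGroup) (next : ℕ × ℕ) : List EdgeGroup :=
  (List.range' (g.1.length + 1) (legs - g.1.length - 2)).map (fun i => ([(idx, i)], 1)) ++
    if g.2 + 3 = d then [([next, (idx, legs - 1)], 1)]
    else [([(idx, legs - 1)], g.2 + 2), ([next], 1)]

/-- The groups of the next layer; `h` is the first outward edge of the first tile. -/
def nextGroups (d legs : ℕ) : ℕ → List EdgeGroup → ℕ × ℕ → List EdgeGroup
  | _, [], _ => []
  | idx, [g], h => chunk d legs idx g h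
  | idx, g :: g' :: gs, h =>
      chunk d legs idx g (idx + 1, g'.1.length) ++ nextGroups d legs (idx + 1) (g' :: gs) h

/-- The number of tiles in a chunk. -/
def width (d legs : ℕ) (g : EdgeGroup) : ℕ :=
  legs - g.1.length - 1 + if g.2 + 3 = d then 0 else 1

section Chunk

variable {d legs idx : ℕ} {g : EdgeGroup} {next : ℕ × ℕ}

theorem chunk_length (hg : g.1.length + 2 ≤ legs) :
    (chunk d legs idx g next).length = width d legs g := by
  unfold chunk width
  by_cases h : g.2 + 3 = d
  · simp only [h, if_true, List.length_append, List.length_map, List.length_range',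
      List.length_singleton]
    omega
  · simp only [h, if_false, List.length_append, List.length_map, List.length_range',
      List.length_cons, List.length_nil]
    omega

theorem chunk_getElem?_inner {r : ℕ} (hr : r < legs - g.1.length - 2) :
    (chunk d legs idx g next)[r]? = some ([(idx, g.1.length + 1 + r)], 1) := by
  unfold chunk
  rw [List.getElem?_append_left (by simpa using hr), List.getElem?_map,
    List.getElem?_range' hr]
  simp

theorem chunk_getElem?_pair (h : g.2 + 3 = d) :
    (chunk d legs idx g next)[legs - g.1.length - 2]? = some ([next, (idx, legs - 1)], 1) := by
  unfold chunk
  rw [List.getElem?_append_right (by simp), if_pos h]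
  simp

theorem chunk_getElem?_last (h : g.2 + 3 ≠ d) :
    (chunk d legs idx g next)[legs - g.1.length - 2]? = some ([(idx, legs - 1)], g.2 + 2) := by
  unfold chunk
  rw [List.getElem?_append_right (by simp), if_neg h]
  simp

theorem chunk_getElem?_next (hg : g.1.length + 2 ≤ legs) (h : g.2 + 3 ≠ d) :
    (chunk d legs idx g next)[legs - g.1.length - 1]? = some ([next], 1) := by
  unfold chunk
  rw [List.getElem?_append_right (by simp; omega), if_neg h, List.length_map, List.length_range',
    show legs - g.1.length - 1 - (legs - g.1.length - 2) = 1 by omega]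
  rfl

theorem frontGroups_single {c : ℕ} (hc : c + 1 ≠ d) (l : ℕ × ℕ) (rest : List ((ℕ × ℕ) × ℕ)) :
    frontGroups d ((l, c) :: rest) = ([l], c) :: frontGroups d rest := by
  cases rest with
  | nil => simp [frontGroups]
  | cons x rest => simp [frontGroups, hc]

/-- The front of a new tile, without its first leg but with the first leg `next` of the following
tile, is grouped into the chunk of the tile: only the vertex after its last leg may miss a single
tile. -/
theorem frontGroups_chunk (hd : 4 ≤ d) (hg : g.1.length + 2 ≤ legs)
    (rest : List ((ℕ × ℕ) × ℕ)) :
    frontGroups d (((List.range' g.1.length (legs - g.1.length)).map fun i =>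
        ((idx, i), if i + 1 = legs then g.2 + 2 else 1)).tail ++ (next, 1) :: rest) =
      chunk d legs idx g next ++ frontGroups d rest := by
  have h1 : ((List.range' g.1.length (legs - g.1.length)).map fun i =>
        ((idx, i), if i + 1 = legs then g.2 + 2 else 1)).tail =
      ((List.range' (g.1.length + 1) (legs - g.1.length - 2)).map fun i => ((idx, i), 1)) ++
        [((idx, legs - 1), g.2 + 2)] := by
    rw [← List.map_tail, List.tail_range', show legs - g.1.length - 1 =
      (legs - g.1.length - 2) + 1 by omega, List.range'_concat, List.map_append]
    congr 1
    · refine List.map_congr_left fun i hi => ?_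
      rw [List.mem_range'_1] at hi
      rw [if_neg (by omega)]
    · simp only [List.map_cons, List.map_nil, one_mul]
      rw [if_pos (by omega), show g.1.length + 1 + (legs - g.1.length - 2) = legs - 1 by omega]
  have h2 : ∀ (L : List ℕ) (rest' : List ((ℕ × ℕ) × ℕ)),
      frontGroups d ((L.map fun i => ((idx, i), 1)) ++ rest') =
        (L.map fun i => ([(idx, i)], 1)) ++ frontGroups d rest' := by
    intro L rest'
    induction L with
    | nil => rfl
    | cons i L ih =>
      rw [List.map_cons, List.cons_append, frontGroups_single (by omega), ih]
      rfl
  rw [h1, List.append_assoc, h2, chunk, List.append_assoc]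
  congr 1
  by_cases h : g.2 + 3 = d
  · rw [if_pos h]
    simp [frontGroups, show g.2 + 2 + 1 = d from h]
  · rw [if_neg h, List.singleton_append, frontGroups_single (by omega),
      frontGroups_single (by omega)]
    rfl

/-- The groups of the next layer, as obtained from the front of a layer rotated by one step. -/
theorem frontGroups_layer (hd : 4 ≤ d) (k : TileKind) (pos : ℕ) (gs : List EdgeGroup)
    (hgs : ∀ x ∈ g :: gs, x.1.length + 2 ≤ k.legs) :
    frontGroups d ((attach k (fun _ => true) pos idx (g :: gs)).front.tail ++ [(next, 1)]) =
      nextGroups d k.legs idx (g :: gs) next := by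
  induction gs generalizing pos idx g with
  | nil =>
    have := frontGroups_chunk (idx := idx) (next := next) hd (hgs g List.mem_cons_self) []
    simpa [attach, nextGroups, frontGroups] using this
  | cons g' gs ih =>
    have hg := hgs g List.mem_cons_self
    have hg' := hgs g' (List.mem_cons_of_mem _ List.mem_cons_self)
    have h1 : (attach k (fun _ => true) (pos + 1) (idx + 1) (g' :: gs)).front =
        ((idx + 1, g'.1.length), 1) ::
          (attach k (fun _ => true) (pos + 1) (idx + 1) (g' :: gs)).front.tail := by
      simp only [attach, if_true]
      rw [show k.legs - g'.1.length = (k.legs - g'.1.length - 1) + 1 by omega, List.range'_succ]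
      simp only [List.map_cons, List.cons_append, List.tail_cons]
      rw [if_neg (by omega)]
    have h2 : (attach k (fun _ => true) pos idx (g :: g' :: gs)).front.tail =
        ((List.range' g.1.length (k.legs - g.1.length)).map fun i =>
          ((idx, i), if i + 1 = k.legs then g.2 + 2 else 1)).tail ++
        (attach k (fun _ => true) (pos + 1) (idx + 1) (g' :: gs)).front := by
      rw [show (attach k (fun _ => true) pos idx (g :: g' :: gs)).front =
        ((List.range' g.1.length (k.legs - g.1.length)).map fun i =>
          ((idx, i), if i + 1 = k.legs then g.2 + 2 else 1)) ++
        (attach k (fun _ => true) (pos + 1) (idx + 1) (g' :: gs)).front from rfl]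
      refine List.tail_append_of_ne_nil ?_
      simp
      omega
    rw [h2, List.append_assoc, h1, List.cons_append, frontGroups_chunk hd hg,
      ih _ fun x hx => hgs x (List.mem_cons_of_mem _ hx)]
    rfl

/-- The position at which the `j`-th chunk begins. -/
def groupStart (d legs : ℕ) (gs : List EdgeGroup) (j : ℕ) : ℕ :=
  ∑ i ∈ Finset.range j, width d legs (gs.getD i ([], 0))

theorem groupStart_cons (g : EdgeGroup) (gs : List EdgeGroup) (j : ℕ) :
    groupStart d legs (g :: gs) (j + 1) = width d legs g + groupStart d legs gs j := by
  unfold groupStart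
  rw [Finset.sum_range_succ', add_comm]
  rfl

theorem nextGroups_length (gs : List EdgeGroup) (hgs : ∀ g ∈ gs, g.1.length + 2 ≤ legs) :
    (nextGroups d legs idx gs next).length = groupStart d legs gs gs.length := by
  induction gs generalizing idx with
  | nil => rfl
  | cons g gs ih =>
    rw [List.length_cons, groupStart_cons, ← ih (idx := idx + 1) fun g hg =>
      hgs g (List.mem_cons_of_mem _ hg)]
    have hg := hgs g List.mem_cons_self
    cases gs with
    | nil => exact chunk_length hg
    | cons g' gs => rw [nextGroups, List.length_append, chunk_length hg]

theorem nextGroups_getElem? (gs : List EdgeGroup) (hgs : ∀ g ∈ gs, g.1.length + 2 ≤ legs) (j r : ℕ)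
    (hj : j < gs.length) (hr : r < width d legs (gs.getD j ([], 0))) :
    (nextGroups d legs idx gs next)[groupStart d legs gs j + r]? =
      (chunk d legs (idx + j) (gs.getD j ([], 0)) (if j + 1 < gs.length then
        (idx + (j + 1), (gs.getD (j + 1) ([], 0)).1.length) else next))[r]? := by
  induction gs generalizing idx j with
  | nil => simp at hj
  | cons g gs ih =>
    have hg := hgs g List.mem_cons_self
    cases j with
    | zero =>
      have h0 : groupStart d legs (g :: gs) 0 = 0 := rfl
      rw [h0, zero_add]
      cases gs with
      | nil => simp [nextGroups]
      | cons g' gs =>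
        rw [if_pos (by simp)]
        exact List.getElem?_append_left (by rwa [chunk_length hg])
    | succ j =>
      rw [List.getD_cons_succ] at hr
      simp only [List.length_cons, Nat.add_lt_add_iff_right] at hj ⊢
      cases gs with
      | nil => simp at hj
      | cons g' gs =>
        have h1 : nextGroups d legs idx (g :: g' :: gs) next =
          chunk d legs idx g (idx + 1, g'.1.length) ++ nextGroups d legs (idx + 1) (g' :: gs) next :=
          rfl
        rw [h1, groupStart_cons, List.getElem?_append_right (by rw [chunk_length hg]; omega),
          chunk_length hg, show ∀ a b c : ℕ, a + b + c - a = b + c by omega,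
          ih (fun g hg => hgs g (List.mem_cons_of_mem _ hg)) j hj hr]
        simp only [List.getD_cons_succ, List.length_cons]
        rw [show idx + 1 + j = idx + (j + 1) by omega,
          show idx + 1 + (j + 1) = idx + (j + 1 + 1) by omega]

end Chunk

theorem mem_frontGroups_length {d : ℕ} {f : List ((ℕ × ℕ) × ℕ)} {g : EdgeGroup}
    (hg : g ∈ frontGroups d f) : g.1.length = 1 ∨ g.1.length = 2 := by
  revert hg
  fun_induction frontGroups d f with
  | case1 => simp
  | case2 l c =>
    intro hg
    rw [List.mem_singleton.1 hg]
    exact Or.inl rfl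
  | case3 l c l' c' rest h ih =>
    intro hg
    rcases List.mem_cons.1 hg with rfl | hg
    · exact Or.inr rfl
    · exact ih hg
  | case4 l c l' c' rest h ih =>
    intro hg
    rcases List.mem_cons.1 hg with rfl | hg
    · exact Or.inl rfl
    · exact ih hg

theorem exists_eq_sum_add (f : ℕ → ℕ) (n i : ℕ) (hi : i < ∑ j ∈ Finset.range n, f j) :
    ∃ j r, j < n ∧ r < f j ∧ i = ∑ j ∈ Finset.range j, f j + r := by
  induction n with
  | zero => simp at hi
  | succ n ih =>
    rw [Finset.sum_range_succ] at hi
    by_cases h : i < ∑ j ∈ Finset.range n, f j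
    · obtain ⟨j, r, h1, h2, h3⟩ := ih h
      exact ⟨j, r, by omega, h2, h3⟩
    · exact ⟨n, i - ∑ j ∈ Finset.range n, f j, by omega, by omega, by omega⟩

section Layer

variable (d : ℕ)

/-- The edge groups to which the tiles of the layer `k ≥ 1` are attached. -/
def layer (k : ℕ) : List EdgeGroup := frontGroups d (ball d (k - 1)).front

/-- The edge group of the tile number `j` of the layer `k`. -/
def grp (k j : ℕ) : EdgeGroup := (layer d k).getD j ([], 0)

/-- The number of inward edges of the tile number `j` of the layer `k`. -/
def inward (k j : ℕ) : ℕ := (grp d k j).1.length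

/-- The number of tiles in the layers before the layer `k`. -/
def layerOffset (k : ℕ) : ℕ := (ball d (k - 1)).tiles.length

/-- The number of legs of the tiles of the layer `k`. -/
def layerLegs (k : ℕ) : ℕ := (layerKind k).legs

/-- The position in the layer `k + 1` of the first tile that touches the tile number `j` of the
layer `k` along its second outward edge. -/
def start (k j : ℕ) : ℕ := groupStart d (layerLegs k) (layer d k) j

theorem layerLegs_of_odd {k : ℕ} (hk : k % 2 = 1) : layerLegs k = 6 := by
  simp [layerLegs, layerKind, hk, TileKind.legs]

theorem layerLegs_of_even {k : ℕ} (hk : k % 2 = 0) : layerLegs k = 4 := by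
  simp [layerLegs, layerKind, hk, TileKind.legs]

theorem layerLegs_cases (k : ℕ) : layerLegs k = 4 ∨ layerLegs k = 6 := by
  rcases Nat.mod_two_eq_zero_or_one k with h | h
  · exact Or.inl (layerLegs_of_even h)
  · exact Or.inr (layerLegs_of_odd h)

theorem layerKind_succ_ne (k : ℕ) : layerKind k ≠ layerKind (k + 1) := by
  unfold layerKind
  rcases Nat.mod_two_eq_zero_or_one k with h | h
  · rw [if_pos h, if_neg (by omega)]
    exact fun h => by cases h
  · rw [if_neg (by omega), if_pos (by omega)]
    exact fun h => by cases h

variable {d}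

theorem grp_mem {k j : ℕ} (hj : j < (layer d k).length) : grp d k j ∈ layer d k := by
  unfold grp
  rw [List.getD_eq_getElem _ _ hj]
  exact List.getElem_mem _

theorem grp_eq_of_getElem? {k j : ℕ} {g : EdgeGroup} (h : (layer d k)[j]? = some g) :
    grp d k j = g := by
  unfold grp
  rw [List.getD_eq_getElem?_getD, h]
  rfl

theorem inward_cases {k j : ℕ} (hj : j < (layer d k).length) :
    inward d k j = 1 ∨ inward d k j = 2 := mem_frontGroups_length (grp_mem hj)

theorem layer_legs {k : ℕ} : ∀ g ∈ layer d k, g.1.length + 2 ≤ layerLegs k := by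
  intro g hg
  have h1 := mem_frontGroups_length hg
  have h2 := layerLegs_cases k
  omega

theorem layer_one (hd : 4 ≤ d) : layer d 1 =
    [([(0, 0)], 1), ([(0, 1)], 1), ([(0, 2)], 1), ([(0, 3)], 1)] := by
  simp only [layer, ball, Nat.sub_self]
  rw [frontGroups_single (by omega), frontGroups_single (by omega), frontGroups_single (by omega),
    frontGroups_single (by omega)]
  rfl

theorem start_succ (k j : ℕ) :
    start d k (j + 1) = start d k j + width d (layerLegs k) (grp d k j) :=
  Finset.sum_range_succ _ _

theorem start_zero (k : ℕ) : start d k 0 = 0 := rfl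

theorem start_mono (k : ℕ) {i j : ℕ} (h : i ≤ j) : start d k i ≤ start d k j :=
  Finset.sum_le_sum_of_subset (Finset.range_mono h)

variable (hd : 4 ≤ d)
include hd

theorem layer_succ_of_ne_nil {k : ℕ} (hk : 1 ≤ k) (hne : layer d k ≠ []) :
    layer d (k + 1) = nextGroups d (layerLegs k) (layerOffset d k) (layer d k)
      (layerOffset d k, inward d k 0) := by
  obtain ⟨k, rfl⟩ : ∃ m, k = m + 1 := ⟨k - 1, by omega⟩
  have h1 : (ball d (k + 1)).front = (attach (layerKind (k + 1)) (fun _ => true) 0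
      (layerOffset d (k + 1)) (layer d (k + 1))).front.rotate 1 := rfl
  have h2 : layer d (k + 1 + 1) = frontGroups d (ball d (k + 1)).front := rfl
  have h3 := layer_legs (d := d) (k := k + 1)
  have h4 : inward d (k + 1) 0 = ((layer d (k + 1)).getD 0 ([], 0)).1.length := rfl
  rw [h2, h1, h4]
  cases hL : layer d (k + 1) with
  | nil => exact absurd hL hne
  | cons g gs =>
    rw [hL] at h3
    rw [layerLegs] at h3 ⊢
    rw [← frontGroups_layer hd (layerKind (k + 1)) 0 gs h3]
    congr 1
    have hg := h3 g List.mem_cons_self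
    simp only [attach, if_true]
    rw [show (layerKind (k + 1)).legs - g.1.length =
      ((layerKind (k + 1)).legs - g.1.length - 1) + 1 by omega, List.range'_succ]
    simp only [List.map_cons, List.cons_append, List.rotate_cons_succ, List.rotate_zero,
      List.tail_cons, List.getD_cons_zero]
    rw [if_neg (by omega)]

theorem layer_ne_nil {k : ℕ} (hk : 1 ≤ k) : layer d k ≠ [] := by
  induction k, hk using Nat.le_induction with
  | base =>
    rw [layer_one hd]
    simp
  | succ k hk ih =>
    rw [layer_succ_of_ne_nil hd hk ih]
    cases hL : layer d k with
    | nil => exact absurd hL ih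
    | cons g gs =>
      have h1 := layer_legs (d := d) (k := k)
      intro h
      have h2 := congrArg List.length h
      rw [hL] at h1
      rw [nextGroups_length _ h1, List.length_cons, groupStart_cons, List.length_nil] at h2
      have := h1 g List.mem_cons_self
      unfold width at h2
      omega

/-- Each layer determines the next one. The rotation of the front by one step is what makes the last
tile of a layer meet the first one. -/
theorem layer_succ {k : ℕ} (hk : 1 ≤ k) :
    layer d (k + 1) = nextGroups d (layerLegs k) (layerOffset d k) (layer d k)
      (layerOffset d k, inward d k 0) := layer_succ_of_ne_nil hd hk (layer_ne_nil hd hk)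

theorem start_length {k : ℕ} (hk : 1 ≤ k) :
    start d k (layer d k).length = (layer d (k + 1)).length := by
  rw [layer_succ hd hk, nextGroups_length _ layer_legs]
  rfl

/-- The first outward leg of the tile that follows the tile number `j` of the layer `k`. -/
def nextLeg (d k j : ℕ) : ℕ × ℕ :=
  if j + 1 < (layer d k).length then (layerOffset d k + (j + 1), inward d k (j + 1))
  else (layerOffset d k, inward d k 0)

theorem grp_succ {k : ℕ} (hk : 1 ≤ k) {j r : ℕ} (hj : j < (layer d k).length)
    (hr : r < width d (layerLegs k) (grp d k j)) {g : EdgeGroup}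
    (h : (chunk d (layerLegs k) (layerOffset d k + j) (grp d k j) (nextLeg d k j))[r]? = some g) :
    grp d (k + 1) (start d k j + r) = g := by
  refine grp_eq_of_getElem? ?_
  rw [layer_succ hd hk, ← h]
  exact nextGroups_getElem? _ layer_legs j r hj hr

theorem exists_eq_start_add {k : ℕ} (hk : 1 ≤ k) {i : ℕ} (hi : i < (layer d (k + 1)).length) :
    ∃ j r, j < (layer d k).length ∧ r < width d (layerLegs k) (grp d k j) ∧
      i = start d k j + r := by
  rw [← start_length hd hk] at hi
  exact exists_eq_sum_add _ _ _ hi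

omit hd in
theorem width_pos {k j : ℕ} (hj : j < (layer d k).length) :
    layerLegs k - inward d k j - 1 ≤ width d (layerLegs k) (grp d k j) ∧
    width d (layerLegs k) (grp d k j) ≤ layerLegs k - inward d k j ∧
    inward d k j + 2 ≤ layerLegs k := by
  have := layer_legs _ (grp_mem hj)
  unfold width inward
  split <;> omega

theorem grp_succ_inner {k : ℕ} (hk : 1 ≤ k) {j r : ℕ} (hj : j < (layer d k).length)
    (hr : r + inward d k j + 2 < layerLegs k) :
    grp d (k + 1) (start d k j + r) =
      ([(layerOffset d k + j, inward d k j + 1 + r)], 1) := by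
  have h1 := width_pos hj
  refine grp_succ hd hk hj (by omega) ?_
  exact chunk_getElem?_inner (by unfold inward at hr; omega)

theorem grp_succ_pair {k : ℕ} (hk : 1 ≤ k) {j : ℕ} (hj : j < (layer d k).length)
    (h : (grp d k j).2 + 3 = d) :
    grp d (k + 1) (start d k j + (layerLegs k - inward d k j - 2)) =
      ([nextLeg d k j, (layerOffset d k + j, layerLegs k - 1)], 1) := by
  have h1 := width_pos hj
  exact grp_succ hd hk hj (by omega) (chunk_getElem?_pair h)

theorem grp_succ_last {k : ℕ} (hk : 1 ≤ k) {j : ℕ} (hj : j < (layer d k).length)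
    (h : (grp d k j).2 + 3 ≠ d) :
    grp d (k + 1) (start d k j + (layerLegs k - inward d k j - 2)) =
      ([(layerOffset d k + j, layerLegs k - 1)], (grp d k j).2 + 2) := by
  have h1 := width_pos hj
  exact grp_succ hd hk hj (by omega) (chunk_getElem?_last h)

theorem grp_succ_next {k : ℕ} (hk : 1 ≤ k) {j : ℕ} (hj : j < (layer d k).length)
    (h : (grp d k j).2 + 3 ≠ d) :
    grp d (k + 1) (start d k j + (layerLegs k - inward d k j - 1)) = ([nextLeg d k j], 1) := by
  have h1 := layer_legs _ (grp_mem hj)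
  refine grp_succ hd hk hj ?_ (chunk_getElem?_next h1 h)
  have h2 : (grp d k j).1.length = inward d k j := rfl
  unfold width
  rw [if_neg h]
  omega

omit hd in
theorem width_eq {k j : ℕ} : width d (layerLegs k) (grp d k j) =
    layerLegs k - inward d k j - 1 + if (grp d k j).2 + 3 = d then 0 else 1 := rfl

/-- Every outward leg of a tile but the first one sits in the chunk of the tile. -/
theorem mem_grp_succ {k : ℕ} (hk : 1 ≤ k) {j e : ℕ} (hj : j < (layer d k).length)
    (he : inward d k j + 1 + e < layerLegs k) :
    start d k j + e < start d k (j + 1) ∧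
    (layerOffset d k + j, inward d k j + 1 + e) ∈ (grp d (k + 1) (start d k j + e)).1 := by
  have h1 := width_pos hj
  refine ⟨by rw [start_succ]; omega, ?_⟩
  by_cases h2 : e + inward d k j + 2 < layerLegs k
  · rw [grp_succ_inner hd hk hj h2]
    exact List.mem_singleton.2 rfl
  · obtain rfl : e = layerLegs k - inward d k j - 2 := by omega
    rw [show inward d k j + 1 + (layerLegs k - inward d k j - 2) = layerLegs k - 1 by omega]
    by_cases h3 : (grp d k j).2 + 3 = d
    · rw [grp_succ_pair hd hk hj h3]
      simp
    · rw [grp_succ_last hd hk hj h3]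
      simp

theorem nextLeg_mem {k : ℕ} (hk : 1 ≤ k) {j : ℕ} (hj : j < (layer d k).length) :
    start d k j < start d k (j + 1) ∧ nextLeg d k j ∈ (grp d (k + 1) (start d k (j + 1) - 1)).1 := by
  have h1 := width_pos hj
  have h2 := start_succ (d := d) k j
  refine ⟨by omega, ?_⟩
  by_cases h3 : (grp d k j).2 + 3 = d
  · rw [width_eq, if_pos h3] at h2
    rw [show start d k (j + 1) - 1 = start d k j + (layerLegs k - inward d k j - 2) by omega,
      grp_succ_pair hd hk hj h3]
    simp
  · rw [width_eq, if_neg h3] at h2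
    rw [show start d k (j + 1) - 1 = start d k j + (layerLegs k - inward d k j - 1) by omega,
      grp_succ_next hd hk hj h3]
    simp

/-- The position in the layer `k + 1` of the tile on the outward leg number `e` of the tile number
`j` of the layer `k`. -/
def slot (d k j e : ℕ) : ℕ :=
  if j = 0 ∧ e = 0 then (layer d (k + 1)).length - 1 else start d k j + e - 1

theorem slot_spec {k : ℕ} (hk : 1 ≤ k) {j e : ℕ} (hj : j < (layer d k).length)
    (he : inward d k j + e < layerLegs k) :
    slot d k j e < (layer d (k + 1)).length ∧
      (layerOffset d k + j, inward d k j + e) ∈ (grp d (k + 1) (slot d k j e)).1 := by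
  rcases Nat.eq_zero_or_pos e with rfl | he0
  · rcases Nat.eq_zero_or_pos j with rfl | hj0
    · have hne : (layer d k).length - 1 < (layer d k).length := by omega
      have h1 := nextLeg_mem hd hk hne
      rw [show (layer d k).length - 1 + 1 = (layer d k).length by omega, start_length hd hk] at h1
      rw [slot, if_pos ⟨rfl, rfl⟩]
      refine ⟨by omega, ?_⟩
      have h2 := h1.2
      unfold nextLeg at h2
      rw [if_neg (by omega)] at h2
      exact h2
    · have h1 := nextLeg_mem hd hk (show j - 1 < (layer d k).length by omega)
      rw [show j - 1 + 1 = j by omega] at h1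
      have h3 := start_mono (d := d) k hj.le
      rw [start_length hd hk] at h3
      rw [slot, if_neg (by omega)]
      refine ⟨by omega, ?_⟩
      have h2 := h1.2
      unfold nextLeg at h2
      rw [if_pos (by omega), show j - 1 + 1 = j by omega] at h2
      exact h2
  · obtain ⟨e, rfl⟩ : ∃ m, e = m + 1 := ⟨e - 1, by omega⟩
    have h1 := mem_grp_succ hd hk (e := e) hj (by omega)
    have h3 := start_mono (d := d) k (show j + 1 ≤ (layer d k).length from hj)
    rw [start_length hd hk] at h3
    rw [slot, if_neg (by omega), show start d k j + (e + 1) - 1 = start d k j + e by omega]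
    refine ⟨by omega, ?_⟩
    rw [show inward d k j + (e + 1) = inward d k j + 1 + e by omega]
    exact h1.2

/-- A tile of the layer `k + 1` with two inward edges touches a tile of the layer `k` along the last
leg of the latter, and its successor along its first outward leg. -/
theorem inward_eq_two {k : ℕ} (hk : 1 ≤ k) {j r : ℕ} (hj : j < (layer d k).length)
    (hr : r < width d (layerLegs k) (grp d k j)) (h : inward d (k + 1) (start d k j + r) = 2) :
    (grp d k j).2 + 3 = d ∧ r + inward d k j + 2 = layerLegs k ∧
      (grp d (k + 1) (start d k j + r)).2 = 1 := by
  have h1 := width_pos hj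
  have h2 := width_eq (d := d) (k := k) (j := j)
  by_cases h3 : r + inward d k j + 2 < layerLegs k
  · rw [inward, grp_succ_inner hd hk hj h3] at h
    simp at h
  · by_cases h4 : (grp d k j).2 + 3 = d
    · rw [if_pos h4] at h2
      obtain rfl : r = layerLegs k - inward d k j - 2 := by omega
      refine ⟨h4, by omega, ?_⟩
      rw [grp_succ_pair hd hk hj h4]
    · rw [if_neg h4] at h2
      exfalso
      by_cases h5 : r = layerLegs k - inward d k j - 2
      · rw [h5, inward, grp_succ_last hd hk hj h4] at h
        simp at h
      · rw [show r = layerLegs k - inward d k j - 1 by omega, inward,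
          grp_succ_next hd hk hj h4] at h
        simp at h

theorem inward_inner {k : ℕ} (hk : 1 ≤ k) {j r : ℕ} (hj : j < (layer d k).length)
    (hr : r + inward d k j + 2 < layerLegs k) : inward d (k + 1) (start d k j + r) = 1 := by
  rw [inward, grp_succ_inner hd hk hj hr]
  rfl

theorem inward_layer_one {j : ℕ} (hj : j < (layer d 1).length) : inward d 1 j = 1 := by
  rw [layer_one hd] at hj
  simp only [List.length_cons, List.length_nil] at hj
  unfold inward grp
  rw [layer_one hd]
  interval_cases j <;> rfl

/-- In a layer of squares, a tile with two inward edges is preceded by one with one inward edge. -/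
theorem inward_pred_square {k : ℕ} (hk : 1 ≤ k) (hk2 : k % 2 = 0) {i : ℕ}
    (hi : i < (layer d k).length) (h : inward d k i = 2) : 1 ≤ i ∧ inward d k (i - 1) = 1 := by
  obtain ⟨k, rfl⟩ : ∃ m, k = m + 1 := ⟨k - 1, by omega⟩
  obtain ⟨j, r, hj, hr, rfl⟩ := exists_eq_start_add hd (show 1 ≤ k by omega) hi
  obtain ⟨h1, h2, -⟩ := inward_eq_two hd (by omega) hj hr h
  rw [layerLegs_of_odd (by omega)] at h2
  have h3 := inward_cases hj
  refine ⟨by omega, ?_⟩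
  rw [show start d k j + r - 1 = start d k j + (r - 1) by omega]
  exact inward_inner hd (by omega) hj (by rw [layerLegs_of_odd (by omega)]; omega)

/-- In a layer of hexagons, of three consecutive tiles one has one inward edge. -/
theorem inward_pred_hexagon {k : ℕ} (hk2 : k % 2 = 1) {i : ℕ}
    (hi : i < (layer d k).length) (h : inward d k i = 2) :
    1 ≤ i ∧ (inward d k (i - 1) = 1 ∨ 2 ≤ i ∧ inward d k (i - 2) = 1) := by
  rcases Nat.lt_or_ge k 2 with hk | hk
  · obtain rfl : k = 1 := by omega
    rw [inward_layer_one hd hi] at h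
    omega
  obtain ⟨k, rfl⟩ : ∃ m, k = m + 1 := ⟨k - 1, by omega⟩
  have hk' : 1 ≤ k := by omega
  have hlegs : layerLegs k = 4 := layerLegs_of_even (by omega)
  obtain ⟨j, r, hj, hr, rfl⟩ := exists_eq_start_add hd hk' hi
  obtain ⟨h1, h2, -⟩ := inward_eq_two hd hk' hj hr h
  rw [hlegs] at h2
  rcases inward_cases hj with h3 | h3
  · refine ⟨by omega, Or.inl ?_⟩
    rw [show start d k j + r - 1 = start d k j + 0 by omega]
    exact inward_inner hd hk' hj (by omega)
  · obtain ⟨h4, h5⟩ := inward_pred_square hd hk' (by omega) hj h3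
    obtain ⟨j, rfl⟩ : ∃ m, j = m + 1 := ⟨j - 1, by omega⟩
    rw [Nat.add_sub_cancel] at h5
    have hj' : j < (layer d k).length := by omega
    have h6 := start_succ (d := d) k j
    rw [width_eq, hlegs, h5] at h6
    obtain rfl : r = 0 := by omega
    by_cases h7 : (grp d k j).2 + 3 = d
    · rw [if_pos h7] at h6
      refine ⟨by omega, Or.inr ⟨by omega, ?_⟩⟩
      rw [show start d k (j + 1) + 0 - 2 = start d k j + 0 by omega]
      exact inward_inner hd hk' hj' (by omega)
    · rw [if_neg h7] at h6
      refine ⟨by omega, Or.inl ?_⟩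
      rw [show start d k (j + 1) + 0 - 1 = start d k j + (layerLegs k - inward d k j - 1) by omega,
        inward, grp_succ_next hd hk' hj' h7]
      rfl

/-- If four tiles meet at each vertex, then every tile shares its last outward edge's neighbour. -/
theorem grp_snd_of_four (h4 : d = 4) {k : ℕ} (hk : 1 ≤ k) {j : ℕ} (hj : j < (layer d k).length) :
    (grp d k j).2 = 1 := by
  induction k, hk using Nat.le_induction generalizing j with
  | base =>
    rw [layer_one hd] at hj
    simp only [List.length_cons, List.length_nil] at hj
    unfold grp
    rw [layer_one hd]
    interval_cases j <;> rfl
  | succ k hk ih =>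
    obtain ⟨j, r, hj', hr, rfl⟩ := exists_eq_start_add hd hk hj
    have h1 := ih hj'
    have h2 := width_pos hj'
    have h3 := width_eq (d := d) (k := k) (j := j)
    rw [if_pos (by omega)] at h3
    by_cases h5 : r + inward d k j + 2 < layerLegs k
    · rw [grp_succ_inner hd hk hj' h5]
    · rw [show r = layerLegs k - inward d k j - 2 by omega, grp_succ_pair hd hk hj' (by omega)]

/-- A tile with two inward edges is followed by one missing tile at each of its inner vertices. -/
theorem grp_snd_of_inward_eq_two {k : ℕ} (hk : 1 ≤ k) {j : ℕ} (hj : j < (layer d k).length)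
    (h : inward d k j = 2) : (grp d k j).2 = 1 := by
  rcases Nat.lt_or_ge k 2 with hk' | hk'
  · obtain rfl : k = 1 := by omega
    rw [inward_layer_one hd hj] at h
    omega
  obtain ⟨k, rfl⟩ : ∃ m, k = m + 1 := ⟨k - 1, by omega⟩
  obtain ⟨j, r, hj', hr, rfl⟩ := exists_eq_start_add hd (show 1 ≤ k by omega) hj
  exact (inward_eq_two hd (by omega) hj' hr h).2.2

end Layer

open Network

/-! ### The tiles of the patch, by layers -/

section Tiles

variable {d n : ℕ} {sel : ℕ → Bool}

theorem attach_all_front_mem (k : TileKind) (pos idx : ℕ) (gs : List EdgeGroup)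
    {x : (ℕ × ℕ) × ℕ} (hx : x ∈ (attach k (fun _ => true) pos idx gs).front) :
    ∃ t, t < gs.length ∧ x.1.1 = idx + t := by
  induction gs generalizing pos idx with
  | nil => simp [attach] at hx
  | cons g gs ih =>
    simp only [attach, if_true] at hx
    rcases List.mem_append.1 hx with hx | hx
    · obtain ⟨i, hi, rfl⟩ := List.mem_map.1 hx
      exact ⟨0, by simp, rfl⟩
    · obtain ⟨t, h1, h2⟩ := ih _ _ hx
      exact ⟨t + 1, by simpa using h1, by omega⟩

theorem ball_tiles_succ (m t : ℕ) {x : TileKind × List (ℕ × ℕ)}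
    (h : (ball d m).tiles[t]? = some x) (k : TileKind) (sel : ℕ → Bool) :
    ((ball d m).grow d k sel).tiles[t]? = some x := by
  have ht := (List.getElem?_eq_some_iff.1 h).1
  exact (List.getElem?_append_left ht).trans h

theorem grow_tiles (P : Patch) (k : TileKind) {j : ℕ}
    (hj : j < (frontGroups d P.front).length) (hsel : sel j) :
    (P.grow d k sel).tiles[P.tiles.length + Nat.count (fun i => sel i) j]? =
      some (k, ((frontGroups d P.front).getD j ([], 0)).1) := by
  have h1 := attach_tiles_getElem? k sel 0 P.tiles.length (frontGroups d P.front) j hj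
    (by rwa [Nat.zero_add])
  simp only [Nat.zero_add] at h1
  rw [List.getD_eq_getElem _ _ hj, ← h1]
  refine (List.getElem?_append_right (Nat.le_add_right _ _)).trans ?_
  rw [Nat.add_sub_cancel_left]

theorem count_all (j : ℕ) : Nat.count (fun _ => true = true) j = j := by
  simp

theorem ball_tile {k m j : ℕ} (hk : 1 ≤ k) (hkm : k ≤ m) (hj : j < (layer d k).length) :
    (ball d m).tiles[layerOffset d k + j]? = some (layerKind k, (grp d k j).1) := by
  induction m, hkm using Nat.le_induction with
  | base =>
    obtain ⟨k, rfl⟩ : ∃ m, k = m + 1 := ⟨k - 1, by omega⟩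
    have h1 := grow_tiles (d := d) (sel := fun _ => true) (ball d k) (layerKind (k + 1)) hj rfl
    rw [count_all] at h1
    exact h1
  | succ m hm ih => exact ball_tiles_succ m _ ih _ _

theorem ball_tile_zero (m : ℕ) : (ball d m).tiles[0]? = some (.square, []) := by
  induction m with
  | zero => rfl
  | succ m ih => exact ball_tiles_succ m _ ih _ _

theorem ball_wellFormed (d m : ℕ) : (ball d m).WellFormed ∧
    ∀ l ∈ (ball d m).front.map Prod.fst, ∀ k' es, (ball d m).tiles[l.1]? = some (k', es) →
      k' = layerKind m := by
  induction m with
  | zero =>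
    refine ⟨⟨?_, ?_, ?_⟩, ?_⟩
    · intro t k es h l hl
      cases t with
      | zero =>
        obtain ⟨-, rfl⟩ := Prod.mk.inj (Option.some_injective _ h)
        simp at hl
      | succ t => simp [ball] at h
    · intro l hl
      simp only [ball, List.map_cons, List.map_nil, List.mem_cons, List.not_mem_nil,
        or_false] at hl
      rcases hl with rfl | rfl | rfl | rfl <;> exact ⟨_, _, rfl, by simp, by simp [TileKind.legs]⟩
    · simp [ball]
    · intro l hl k' es h
      simp only [ball, List.map_cons, List.map_nil, List.mem_cons, List.not_mem_nil,
        or_false] at hl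
      rcases hl with rfl | rfl | rfl | rfl <;>
        exact (Prod.mk.inj (Option.some_injective _ h)).1.symm
  | succ m ih =>
    refine ⟨ih.1.grow d _ _ fun l hl k' es h => ?_, fun l hl k' es h => ?_⟩
    · rw [ih.2 l hl k' es h]
      exact layerKind_succ_ne m
    · obtain ⟨x, hx, rfl⟩ := List.mem_map.1 hl
      have h1 : x ∈ (attach (layerKind (m + 1)) (fun _ => true) 0 (ball d m).tiles.length
        (layer d (m + 1))).front := List.mem_rotate.1 hx
      obtain ⟨t, ht, h2⟩ := attach_all_front_mem _ _ _ _ h1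
      have h3 := ball_tile (m := m + 1) (by omega) le_rfl ht
      rw [h2] at h
      exact (Prod.mk.inj (Option.some_injective _ (h.symm.trans h3))).1

theorem tiling_wellFormed (d n : ℕ) (sel : ℕ → Bool) : (tiling d n sel).WellFormed :=
  (ball_wellFormed d n).1.grow d _ _ fun l hl k' es h => by
    rw [(ball_wellFormed d n).2 l hl k' es h]
    exact layerKind_succ_ne n

/-- The index of the tile number `j` of the layer `k` of the tiling. In the outermost layer `n + 1`,
`j` is the number of a group of exposed edges, to which a tile may or may not be attached. -/
def tileIdx (d n : ℕ) (sel : ℕ → Bool) (k j : ℕ) : ℕ :=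
  layerOffset d k + if k ≤ n then j else Nat.count (fun i => sel i) j

/-- There is a tile number `j` in the layer `k`. -/
def Present (d n : ℕ) (sel : ℕ → Bool) (k j : ℕ) : Prop :=
  1 ≤ k ∧ j < (layer d k).length ∧ (k ≤ n ∨ k = n + 1 ∧ sel j)

theorem tiling_tile {k j : ℕ} (h : Present d n sel k j) :
    (tiling d n sel).tiles[tileIdx d n sel k j]? = some (layerKind k, (grp d k j).1) := by
  obtain ⟨h1, h2, h3 | ⟨rfl, h3⟩⟩ := h
  · rw [tileIdx, if_pos h3]
    exact ball_tiles_succ n _ (ball_tile h1 h3 h2) _ _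
  · rw [tileIdx, if_neg (by omega)]
    exact grow_tiles (ball d n) (layerKind (n + 1)) h2 h3

theorem tiling_tile_zero : (tiling d n sel).tiles[0]? = some (.square, []) :=
  ball_tiles_succ n _ (ball_tile_zero n) _ _

theorem ball_tile_cases (m t : ℕ) (ht : t < (ball d m).tiles.length) :
    t = 0 ∨ ∃ k j, 1 ≤ k ∧ k ≤ m ∧ j < (layer d k).length ∧ t = layerOffset d k + j := by
  induction m with
  | zero => exact Or.inl (by simpa [ball] using ht)
  | succ m ih =>
    rcases lt_or_ge t (ball d m).tiles.length with h | h
    · rcases ih h with h | ⟨k, j, h1, h2, h3⟩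
      · exact Or.inl h
      · exact Or.inr ⟨k, j, h1, by omega, h3⟩
    · have h1 : (ball d (m + 1)).tiles = (ball d m).tiles ++
        (attach (layerKind (m + 1)) (fun _ => true) 0 (ball d m).tiles.length
          (layer d (m + 1))).tiles := rfl
      rw [h1, List.length_append] at ht
      obtain ⟨j, h2, -, h3⟩ := exists_attach_tile (layerKind (m + 1)) (fun _ => true) 0
        (ball d m).tiles.length (layer d (m + 1)) (t - (ball d m).tiles.length) (by omega)
      rw [count_all] at h3
      exact Or.inr ⟨m + 1, j, by omega, le_rfl, h2, by
        change t = (ball d m).tiles.length + j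
        omega⟩

theorem tiling_tile_cases (t : ℕ) (ht : t < (tiling d n sel).tiles.length) :
    t = 0 ∨ ∃ k j, Present d n sel k j ∧ t = tileIdx d n sel k j := by
  rcases lt_or_ge t (ball d n).tiles.length with h | h
  · rcases ball_tile_cases n t h with h | ⟨k, j, h1, h2, h3, h4⟩
    · exact Or.inl h
    · exact Or.inr ⟨k, j, ⟨h1, h3, Or.inl h2⟩, by rw [tileIdx, if_pos h2, h4]⟩
  · have h1 : (tiling d n sel).tiles = (ball d n).tiles ++
      (attach (layerKind (n + 1)) sel 0 (ball d n).tiles.length (layer d (n + 1))).tiles := rfl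
    rw [h1, List.length_append] at ht
    obtain ⟨j, h2, h3, h4⟩ := exists_attach_tile (layerKind (n + 1)) sel 0
      (ball d n).tiles.length (layer d (n + 1)) (t - (ball d n).tiles.length) (by omega)
    simp only [Nat.zero_add] at h3 h4
    refine Or.inr ⟨n + 1, j, ⟨by omega, h2, Or.inr ⟨rfl, h3⟩⟩, ?_⟩
    rw [tileIdx, if_neg (by omega)]
    change t = (ball d n).tiles.length + _
    omega

/-- The exposed legs of the tiling, before the rotation of the list. -/
def outerFront (d n : ℕ) (sel : ℕ → Bool) : List ((ℕ × ℕ) × ℕ) :=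
  (attach (layerKind (n + 1)) sel 0 (layerOffset d (n + 1)) (layer d (n + 1))).front

/-- The position in `outerFront` of the first exposed leg at the `j`-th group of the layer
`n + 1`. -/
def outerStart (d n : ℕ) (sel : ℕ → Bool) (j : ℕ) : ℕ :=
  blockStart (layerKind (n + 1)) sel 0 (layer d (n + 1)) j

theorem tiling_front : (tiling d n sel).front = (outerFront d n sel).rotate 1 := rfl

theorem outerStart_succ (j : ℕ) : outerStart d n sel (j + 1) = outerStart d n sel j +
    blockLength (layerKind (n + 1)) (sel j) (grp d (n + 1) j) := by
  unfold outerStart blockStart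
  rw [Finset.sum_range_succ, Nat.zero_add]
  rfl

/-- The exposed legs at the `j`-th group of the layer `n + 1`: the outward legs of its tile, if
there is one, and the legs of the group otherwise. -/
def Exposed (d n : ℕ) (sel : ℕ → Bool) (j : ℕ) (l : ℕ × ℕ) : Prop :=
  (sel j ∧ ∃ i, inward d (n + 1) j ≤ i ∧ i < layerLegs (n + 1) ∧
    l = (tileIdx d n sel (n + 1) j, i)) ∨ (¬ sel j ∧ l ∈ (grp d (n + 1) j).1)

theorem Exposed.exists_position {j : ℕ} {l : ℕ × ℕ} (hj : j < (layer d (n + 1)).length)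
    (h : Exposed d n sel j l) : ∃ p c, outerStart d n sel j ≤ p ∧ p < outerStart d n sel (j + 1) ∧
      (outerFront d n sel)[p]? = some (l, c) := by
  have hg : grp d (n + 1) j = (layer d (n + 1))[j] := List.getD_eq_getElem _ _ hj
  rw [outerStart_succ]
  unfold blockLength
  rcases h with ⟨h1, i, h2, h3, rfl⟩ | ⟨h1, h2⟩
  · unfold inward at h2
    rw [hg] at h2 ⊢
    obtain ⟨c, hc⟩ := attach_front_selected (layerKind (n + 1)) sel 0 (layerOffset d (n + 1))
      (layer d (n + 1)) j hj (by rwa [Nat.zero_add]) i h2 h3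
    refine ⟨_, c, Nat.le_add_right _ _, ?_, hc.trans ?_⟩
    · rw [if_pos h1]
      unfold layerLegs at h3
      unfold outerStart
      omega
    · rw [tileIdx, if_neg (by omega)]
      simp only [Nat.zero_add]
  · rw [hg] at h2 ⊢
    obtain ⟨r, c, hr, hc⟩ := attach_front_not_selected (layerKind (n + 1)) sel 0
      (layerOffset d (n + 1)) (layer d (n + 1)) j hj (by rwa [Nat.zero_add]) l h2
    refine ⟨_, c, Nat.le_add_right _ r, ?_, hc⟩
    rw [if_neg h1]
    unfold outerStart
    omega

theorem outerFront_length : (outerFront d n sel).length =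
    outerStart d n sel (layer d (n + 1)).length := attach_front_length _ _ _ _ _

end Tiles

/-! ### Absorbing the layers from outside -/

section Absorb

variable {d n : ℕ} {sel : ℕ → Bool} (A : Set (tiling d n sel).network.Boundary)

/-- The tile with the given index has been absorbed before round `r`. -/
def Absorbed (r t : ℕ) : Prop := ∃ u ∈ scheduledSet A r, u.val = t

/-- The leg number `i` of the tile with index `t` is accessible in round `r`. -/
def Reached (r t i : ℕ) : Prop :=
  ∃ l : (tiling d n sel).network.Leg, l.1.val = t ∧ l.2.val = i ∧ Accessible A (scheduledSet A r) l

/-- The given leg is a boundary leg in `A`. -/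
def InRegion (l : ℕ × ℕ) : Prop :=
  ∃ b : (tiling d n sel).network.Boundary, (b.1.1.val, b.1.2.val) = l ∧ b ∈ A

variable {A}

theorem Absorbed.mono {r r' t : ℕ} (h : Absorbed A r t) (hr : r ≤ r') : Absorbed A r' t := by
  obtain ⟨u, hu, rfl⟩ := h
  exact ⟨u, scheduledSet_mono hr hu, rfl⟩

theorem Reached.mono {r r' t i : ℕ} (h : Reached A r t i) (hr : r ≤ r') : Reached A r' t i := by
  obtain ⟨l, h1, h2, h3⟩ := h
  exact ⟨l, h1, h2, h3.mono (scheduledSet_mono hr)⟩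

/-- Three accessible legs suffice. -/
theorem absorbed_of_reached {r t i₁ i₂ i₃ : ℕ} (h₁ : Reached A r t i₁) (h₂ : Reached A r t i₂)
    (h₃ : Reached A r t i₃) (h₁₂ : i₁ ≠ i₂) (h₁₃ : i₁ ≠ i₃) (h₂₃ : i₂ ≠ i₃) :
    Absorbed A (r + 2) t := by
  obtain ⟨⟨u, a₁⟩, rfl, rfl, h₁⟩ := h₁
  obtain ⟨⟨u₂, a₂⟩, hu₂, rfl, h₂⟩ := h₂
  obtain ⟨⟨u₃, a₃⟩, hu₃, rfl, h₃⟩ := h₃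
  obtain rfl : u₂ = u := Fin.ext hu₂
  obtain rfl : u₃ = u₂ := Fin.ext hu₃
  refine ⟨u₃, mem_scheduledSet_add_two ?_, rfl⟩
  have h4 : ({a₁, a₂, a₃} : Finset _) ⊆ accessibleLegs A (scheduledSet A r) u₃ := by
    intro a ha
    rw [mem_accessibleLegs]
    simp only [Finset.mem_insert, Finset.mem_singleton] at ha
    rcases ha with rfl | rfl | rfl <;> assumption
  have h5 : ({a₁, a₂, a₃} : Finset _).card = 3 := Finset.card_eq_three.2
    ⟨a₁, a₂, a₃, fun h => h₁₂ (by rw [h]), fun h => h₁₃ (by rw [h]), fun h => h₂₃ (by rw [h]), rfl⟩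
  have h6 := Finset.card_le_card h4
  rw [h5] at h6
  exact h6

theorem InRegion.reached {l : ℕ × ℕ} (h : InRegion A l) (r : ℕ) : Reached A r l.1 l.2 := by
  obtain ⟨b, rfl, hb⟩ := h
  exact ⟨b.1, rfl, rfl, Or.inl ⟨b.2, hb⟩⟩

/-- A tile and a leg of the network, from their numbers. -/
theorem exists_leg {t i : ℕ} {k : TileKind} {es : List (ℕ × ℕ)}
    (h : (tiling d n sel).tiles[t]? = some (k, es)) (hi : i < k.legs) :
    ∃ l : (tiling d n sel).network.Leg, l.1.val = t ∧ l.2.val = i ∧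
      (tiling d n sel).tiles.get l.1 = (k, es) := by
  obtain ⟨h1, h2⟩ := List.getElem?_eq_some_iff.1 h
  refine ⟨⟨⟨t, h1⟩, ⟨i, ?_⟩⟩, rfl, rfl, h2⟩
  change i < ((tiling d n sel).tiles.get ⟨t, h1⟩).1.legs
  rw [List.get_eq_getElem, h2]
  exact hi

/-- The legs of a tile that are glued to absorbed tiles of the next layer are accessible. -/
theorem reached_of_outer {r t i t' : ℕ} {k k' : TileKind} {es es' : List (ℕ × ℕ)}
    (h : (tiling d n sel).tiles[t]? = some (k, es)) (hi : i < k.legs)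
    (h' : (tiling d n sel).tiles[t']? = some (k', es')) (hes : es'.length ≤ k'.legs)
    (hmem : (t, i) ∈ es') (hA : Absorbed A r t') : Reached A r t i := by
  obtain ⟨b, hb, hb'⟩ := List.getElem_of_mem hmem
  obtain ⟨l, rfl, rfl, hl⟩ := exists_leg h hi
  obtain ⟨l', rfl, rfl, hl'⟩ := exists_leg h' (hb.trans_le hes)
  obtain ⟨u, hu, hul⟩ := hA
  obtain rfl : u = l'.1 := Fin.ext hul
  refine ⟨l, rfl, rfl, Or.inr ⟨l', Or.inr ?_, hu⟩⟩
  have h1 : ((tiling d n sel).tiles.get l'.1).2 = es' := congrArg Prod.snd hl'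
  exact (congrArg (fun x : List (ℕ × ℕ) => x[l'.2.val]?) h1).trans
    (List.getElem?_eq_some_iff.2 ⟨hb, hb'⟩)

/-- The inward legs of a tile that are glued to absorbed tiles are accessible. -/
theorem reached_of_inner {r t i t' i' : ℕ} {k k' : TileKind} {es es' : List (ℕ × ℕ)}
    (h : (tiling d n sel).tiles[t]? = some (k, es)) (hi : i < k.legs)
    (h' : (tiling d n sel).tiles[t']? = some (k', es')) (hi' : i' < k'.legs)
    (hmem : es[i]? = some (t', i')) (hA : Absorbed A r t') : Reached A r t i := by
  obtain ⟨l, rfl, rfl, hl⟩ := exists_leg h hi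
  obtain ⟨l', rfl, rfl, hl'⟩ := exists_leg h' hi'
  obtain ⟨u, hu, hul⟩ := hA
  obtain rfl : u = l'.1 := Fin.ext hul
  refine ⟨l, rfl, rfl, Or.inr ⟨l', Or.inl ?_, hu⟩⟩
  have h1 : ((tiling d n sel).tiles.get l.1).2 = es := congrArg Prod.snd hl
  exact (congrArg (fun x : List (ℕ × ℕ) => x[l.2.val]?) h1).trans hmem

variable (A) in
/-- From round `r` on, the edges of the `i`-th group of the layer `k` are accessible from outside.
-/
def SlotReached (r k i : ℕ) : Prop :=
  (Present d n sel k i → Absorbed A r (tileIdx d n sel k i)) ∧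
    (¬ Present d n sel k i → ∀ l ∈ (grp d k i).1, InRegion A l)

theorem tileIdx_of_le {k j : ℕ} (hk : k ≤ n) : tileIdx d n sel k j = layerOffset d k + j := by
  rw [tileIdx, if_pos hk]

theorem SlotReached.reached {r k i t e : ℕ} {k' : TileKind} {es : List (ℕ × ℕ)}
    (h : SlotReached A r k i) (ht : (tiling d n sel).tiles[t]? = some (k', es)) (he : e < k'.legs)
    (hmem : (t, e) ∈ (grp d k i).1) : Reached A r t e := by
  by_cases hp : Present d n sel k i
  · refine reached_of_outer ht he (tiling_tile hp) ?_ hmem (h.1 hp)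
    have := layer_legs _ (grp_mem hp.2.1)
    unfold layerLegs at this
    omega
  · exact (h.2 hp _ hmem).reached r

variable (A) in
/-- A family of groups of edges all of whose descendants (and those of their neighbours that matter)
end in `A`. -/
structure GoodFamily (g : ℕ → ℕ → Prop) : Prop where
  exposed : ∀ j l, j < (layer d (n + 1)).length → g (n + 1) j → Exposed d n sel j l →
    InRegion A l
  square : ∀ k j e, 1 ≤ k → k ≤ n → k % 2 = 0 → j < (layer d k).length → g k j →
    inward d k j + e < 4 → g (k + 1) (slot d k j e)
  hexagon : ∀ k j j' i, 1 ≤ k → k ≤ n → k % 2 = 1 → j < (layer d k).length → g k j →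
    j' ≤ j → j ≤ j' + 2 → start d k j' ≤ i → i < start d k (j' + 1) → g (k + 1) i

variable (A) in
/-- All the good hexagons, and all the good squares with one inward edge, of the layer `k` have been
absorbed before round `r`. -/
def LayerAbsorbed (g : ℕ → ℕ → Prop) (r k : ℕ) : Prop :=
  ∀ j, g k j → Present d n sel k j → (k % 2 = 1 ∨ inward d k j = 1) →
    Absorbed A r (tileIdx d n sel k j)

theorem LayerAbsorbed.mono {g : ℕ → ℕ → Prop} {r r' k : ℕ} (h : LayerAbsorbed A g r k)
    (hr : r ≤ r') : LayerAbsorbed A g r' k := fun j h1 h2 h3 => (h j h1 h2 h3).mono hr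

variable {g : ℕ → ℕ → Prop} (hg : GoodFamily A g)
include hg

theorem LayerAbsorbed.slotReached {r k i : ℕ} (hk : 1 ≤ k) (hkn : k ≤ n + 1)
    (hi : i < (layer d k).length) (h : LayerAbsorbed A g r k) (hgi : g k i)
    (hi' : k % 2 = 1 ∨ inward d k i = 1) : SlotReached A r k i := by
  refine ⟨fun hp => h i hgi hp hi', fun hp l hl => ?_⟩
  have h1 : k = n + 1 ∧ ¬ sel i := by
    unfold Present at hp
    by_contra hcon
    refine hp ⟨hk, hi, ?_⟩
    by_contra h3
    push Not at h3
    exact hcon ⟨by omega, fun h4 => h3.2 (by omega) h4⟩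
  obtain ⟨rfl, h2⟩ := h1
  exact hg.exposed i l hi hgi (Or.inr ⟨h2, hl⟩)

/-- The outward legs of the good tiles of the outermost layer lie in `A`. -/
theorem reached_of_outermost {r j i : ℕ} (hp : Present d n sel (n + 1) j) (hgj : g (n + 1) j)
    (hi : inward d (n + 1) j ≤ i) (hi' : i < layerLegs (n + 1)) :
    Reached A r (tileIdx d n sel (n + 1) j) i := by
  refine (hg.exposed j _ hp.2.1 hgj (Or.inl ⟨?_, i, hi, hi', rfl⟩)).reached r
  rcases hp.2.2 with h | h
  · omega
  · exact h.2

variable (hd : 4 ≤ d)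
include hd

/-- All outward legs of a good square are accessible once the good hexagons of the next layer have
been absorbed. -/
theorem reached_of_square {r k j i : ℕ} (hp : Present d n sel k j) (hk2 : k % 2 = 0)
    (hgj : g k j) (hnext : k ≤ n → LayerAbsorbed A g r (k + 1)) (hi : inward d k j ≤ i)
    (hi' : i < 4) : Reached A r (tileIdx d n sel k j) i := by
  have hlegs := layerLegs_of_even hk2
  rcases Nat.lt_or_ge n k with hkn | hkn
  · obtain rfl : k = n + 1 := by
      have := hp.2.2
      omega
    exact reached_of_outermost hg hp hgj hi (by omega)
  · have h1 := slot_spec hd hp.1 (e := i - inward d k j) hp.2.1 (by omega)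
    have h2 := hg.square k j (i - inward d k j) hp.1 hkn hk2 hp.2.1 hgj (by omega)
    have h3 := (hnext hkn).slotReached hg (by omega) (by omega) h1.1 h2 (Or.inl (by omega))
    refine h3.reached (tiling_tile hp) (by rw [← layerLegs, hlegs]; exact hi') ?_
    rw [tileIdx_of_le hkn, ← Nat.add_sub_cancel' hi, Nat.add_sub_cancel_left]
    exact h1.2

/-- A good square between two hexagons can be absorbed once the first of these has been. -/
theorem slotReached_of_pred {r k j : ℕ} (hk : 1 ≤ k) (hkn : k ≤ n) (hk2 : k % 2 = 1)
    (hj : j < (layer d k).length) (hpair : (grp d k j).2 + 3 = d)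
    (hgi : g (k + 1) (start d k (j + 1) - 1)) (hA : Absorbed A r (tileIdx d n sel k j))
    (hnext : k + 1 ≤ n → LayerAbsorbed A g r (k + 2)) :
    SlotReached A (r + 2) (k + 1) (start d k (j + 1) - 1) := by
  have hlegs := layerLegs_of_odd hk2
  have hlegs' : layerLegs (k + 1) = 4 := layerLegs_of_even (by omega)
  have h1 := width_pos hj
  have h2 := start_succ (d := d) k j
  rw [width_eq, if_pos hpair] at h2
  have h3 := grp_succ_pair hd hk hj hpair
  rw [show start d k j + (layerLegs k - inward d k j - 2) = start d k (j + 1) - 1 by omega] at h3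
  have h4 : inward d (k + 1) (start d k (j + 1) - 1) = 2 := by
    rw [inward, h3]
    rfl
  have h5 : start d k (j + 1) - 1 < (layer d (k + 1)).length := by
    have := start_mono (d := d) k (show j + 1 ≤ (layer d k).length from hj)
    rw [start_length hd hk] at this
    omega
  refine ⟨fun hp => ?_, fun hp l hl => ?_⟩
  · have h6 := fun i (hi : 2 ≤ i) (hi' : i < 4) => reached_of_square hg hd (r := r) hp (by omega)
      hgi (fun h => hnext h) (by omega) hi'
    have h7 : Reached A r (tileIdx d n sel (k + 1) (start d k (j + 1) - 1)) 1 := by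
      refine reached_of_inner (tiling_tile hp) ?_
        (tiling_tile (k := k) (j := j) ⟨hk, hj, Or.inl hkn⟩) (i' := layerLegs k - 1) ?_ ?_ hA
      · rw [← layerLegs, hlegs']
        omega
      · rw [← layerLegs]
        omega
      · rw [h3, tileIdx_of_le hkn]
        rfl
    exact absorbed_of_reached h7 (h6 2 (by omega) (by omega)) (h6 3 (by omega) (by omega))
      (by omega) (by omega) (by omega)
  · have h6 : k + 1 = n + 1 ∧ ¬ sel (start d k (j + 1) - 1) := by
      unfold Present at hp
      by_contra hcon
      refine hp ⟨by omega, h5, ?_⟩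
      by_contra h3
      push Not at h3
      exact hcon ⟨by omega, fun h4 => h3.2 (by omega) h4⟩
    obtain ⟨h7, h8⟩ := h6
    obtain rfl : k = n := by omega
    exact hg.exposed _ l h5 hgi (Or.inr ⟨h8, hl⟩)

/-- The leg `inward + 1 + e` of a hexagon is reached through its own chunk. -/
theorem reached_of_chunk {r k j e : ℕ} (hk : 1 ≤ k) (hkn : k ≤ n) (hk2 : k % 2 = 1)
    (hj : j < (layer d k).length)
    (hgi : ∀ i, start d k j ≤ i → i < start d k (j + 1) → g (k + 1) i)
    (hnext : LayerAbsorbed A g r (k + 1)) (he : inward d k j + 1 + e < 6)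
    (hone : inward d (k + 1) (start d k j + e) = 1) :
    Reached A r (tileIdx d n sel k j) (inward d k j + 1 + e) := by
  have hlegs := layerLegs_of_odd hk2
  have h1 := mem_grp_succ hd hk hj (show inward d k j + 1 + e < layerLegs k by omega)
  have h2 := start_mono (d := d) k (show j + 1 ≤ (layer d k).length from hj)
  rw [start_length hd hk] at h2
  have h3 := hnext.slotReached hg (by omega) (by omega) (h1.1.trans_le h2)
    (hgi _ (Nat.le_add_right _ _) h1.1) (Or.inr hone)
  refine h3.reached (tiling_tile ⟨hk, hj, Or.inl hkn⟩) (by rw [← layerLegs]; omega) ?_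
  rw [tileIdx_of_le hkn]
  exact h1.2

/-- A hexagon that has one inward edge, or is followed by a tile that it does not share, is absorbed
through its own chunk. -/
theorem absorbed_of_chunk {r k j : ℕ} (hk : 1 ≤ k) (hkn : k ≤ n) (hk2 : k % 2 = 1)
    (hj : j < (layer d k).length)
    (hgi : ∀ i, start d k j ≤ i → i < start d k (j + 1) → g (k + 1) i)
    (hnext : LayerAbsorbed A g r (k + 1))
    (h : inward d k j = 1 ∨ inward d k j = 2 ∧ (grp d k j).2 + 3 ≠ d) :
    Absorbed A (r + 2) (tileIdx d n sel k j) := by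
  have hlegs := layerLegs_of_odd hk2
  have key := fun e (he : e < 3) (hone : inward d (k + 1) (start d k j + e) = 1) =>
    reached_of_chunk hg hd hk hkn hk2 hj hgi hnext (e := e) (by omega) hone
  have h2 : inward d (k + 1) (start d k j + 2) = 1 := by
    rcases h with h | ⟨h, h'⟩
    · exact inward_inner hd hk hj (by omega)
    · have := grp_succ_last hd hk hj h'
      rw [hlegs, h] at this
      rw [inward, this]
      rfl
  exact absorbed_of_reached (key 0 (by omega) (inward_inner hd hk hj (by omega)))
    (key 1 (by omega) (inward_inner hd hk hj (by omega))) (key 2 (by omega) h2)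
    (by omega) (by omega) (by omega)

/-- A hexagon with two inward edges can also be absorbed after its predecessor, through the square
between the two. -/
theorem absorbed_of_pred {r k j : ℕ} (hk : 1 ≤ k) (hkn : k ≤ n) (hk2 : k % 2 = 1)
    (hj : j + 1 < (layer d k).length) (hpair : (grp d k j).2 + 3 = d)
    (hgi : ∀ i, start d k (j + 1) - 1 ≤ i → i < start d k (j + 2) → g (k + 1) i)
    (hA : Absorbed A r (tileIdx d n sel k j)) (hnext : LayerAbsorbed A g r (k + 1))
    (hnext' : k + 1 ≤ n → LayerAbsorbed A g r (k + 2)) (h : inward d k (j + 1) = 2) :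
    Absorbed A (r + 4) (tileIdx d n sel k (j + 1)) := by
  have hlegs := layerLegs_of_odd hk2
  have hlt := start_mono (d := d) k (show j + 1 ≤ j + 2 by omega)
  have h0 := (nextLeg_mem hd hk hj).1
  have h1 := slotReached_of_pred hg hd hk hkn hk2 (by omega) hpair
    (hgi (start d k (j + 1) - 1) le_rfl
      (show start d k (j + 1) - 1 < start d k (j + 1 + 1) by omega)) hA hnext'
  have h2 := slot_spec hd hk (e := 0) hj (by omega)
  rw [slot, if_neg (by omega), Nat.add_zero] at h2
  have key := fun e (he : e < 2) => reached_of_chunk hg hd hk hkn hk2 hj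
    (fun i hi hi' => hgi i (by omega) hi') hnext (e := e) (by omega)
    (inward_inner hd hk hj (by omega))
  have h3 := h1.reached (tiling_tile (k := k) (j := j + 1) ⟨hk, hj, Or.inl hkn⟩)
    (e := inward d k (j + 1)) (by rw [← layerLegs]; omega)
    (by rw [tileIdx_of_le hkn]; exact h2.2)
  exact absorbed_of_reached h3 ((key 0 (by omega)).mono (by omega))
    ((key 1 (by omega)).mono (by omega)) (by omega) (by omega) (by omega)

/-- A hexagon that gets only two legs from its own chunk has two inward edges and shares a square
with its predecessor. It then follows the latter, and of three consecutive hexagons one has a single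
inward edge and can start such a chain. -/
theorem layerAbsorbed_hexagon {r k : ℕ} (hk : 1 ≤ k) (hkn : k ≤ n) (hk2 : k % 2 = 1)
    (hnext : LayerAbsorbed A g r (k + 1)) (hnext' : k + 1 ≤ n → LayerAbsorbed A g r (k + 2)) :
    LayerAbsorbed A g (r + 10) k := by
  intro j hgj hp _
  have hj := hp.2.1
  have hhex := fun j' i => hg.hexagon k j j' i hk hkn hk2 hj hgj
  by_cases h1 : inward d k j = 1 ∨ inward d k j = 2 ∧ (grp d k j).2 + 3 ≠ d
  · exact (absorbed_of_chunk hg hd hk hkn hk2 hj (fun i => hhex j i le_rfl (by omega)) hnext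
      h1).mono (by omega)
  have h2 := inward_cases hj
  have h3 : inward d k j = 2 := by omega
  have h4 : (grp d k j).2 + 3 = d := by omega
  -- This happens only if every vertex is surrounded by four tiles.
  have hd4 : d = 4 := by
    have := grp_snd_of_inward_eq_two hd hk hj h3
    omega
  have hpair : ∀ j', j' < (layer d k).length → (grp d k j').2 + 3 = d := fun j' hj' => by
    rw [grp_snd_of_four hd hd4 hk hj', hd4]
  obtain ⟨h5, h6⟩ := inward_pred_hexagon hd hk2 hj h3
  obtain ⟨j, rfl⟩ : ∃ m, j = m + 1 := ⟨j - 1, by omega⟩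
  have hchunk : ∀ j', j' ≤ j + 1 → j + 1 ≤ j' + 1 → 1 ≤ j' → ∀ i, start d k j' - 1 ≤ i →
      i < start d k (j' + 1) → g (k + 1) i := by
    intro j' h7 h8 h9 i h10 h11
    rcases Nat.lt_or_ge i (start d k j') with h12 | h12
    · obtain ⟨j', rfl⟩ : ∃ m, j' = m + 1 := ⟨j' - 1, by omega⟩
      have h13 := (nextLeg_mem hd hk (show j' < (layer d k).length by omega)).1
      exact hhex j' i (by omega) (by omega) (by omega) h12
    · exact hhex j' i h7 (by omega) h12 h11
  rw [Nat.add_sub_cancel] at h6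
  rcases h6 with h6 | ⟨h6, h7⟩
  · have h8 := absorbed_of_chunk hg hd hk hkn hk2 (show j < (layer d k).length by omega)
      (fun i => hhex j i (by omega) (by omega)) hnext (Or.inl h6)
    exact (absorbed_of_pred hg hd hk hkn hk2 hj (hpair j (by omega))
      (hchunk (j + 1) le_rfl (by omega) (by omega)) h8 (hnext.mono (by omega))
      (fun h => (hnext' h).mono (by omega)) h3).mono (by omega)
  · obtain ⟨j, rfl⟩ : ∃ m, j = m + 1 := ⟨j - 1, by omega⟩
    rw [show j + 1 + 1 - 2 = j by omega] at h7
    have h8 := absorbed_of_chunk hg hd hk hkn hk2 (show j < (layer d k).length by omega)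
      (fun i => hhex j i (by omega) (by omega)) hnext (Or.inl h7)
    -- The hexagon `j` has one inward edge, and the absorption passes to `j + 1` and `j + 2`.
    have h9 : Absorbed A (r + 6) (tileIdx d n sel k (j + 1)) := by
      by_cases h10 : inward d k (j + 1) = 1
      · exact (absorbed_of_chunk hg hd hk hkn hk2 (show j + 1 < (layer d k).length by omega)
          (fun i => hhex (j + 1) i (by omega) (by omega)) hnext (Or.inl h10)).mono (by omega)
      · exact absorbed_of_pred hg hd hk hkn hk2 (by omega) (hpair j (by omega))
          (hchunk (j + 1) (by omega) (by omega) (by omega)) h8 (hnext.mono (by omega))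
          (fun h => (hnext' h).mono (by omega))
          ((inward_cases (show j + 1 < (layer d k).length by omega)).resolve_left h10)
    exact absorbed_of_pred hg hd hk hkn hk2 hj (hpair (j + 1) (by omega))
      (hchunk (j + 1 + 1) le_rfl (by omega) (by omega)) h9 (hnext.mono (by omega))
      (fun h => (hnext' h).mono (by omega)) h3

/-- The good tiles of the layer `k` are absorbed after a number of rounds proportional to the number
of layers outside. -/
theorem layerAbsorbed_of_good {k : ℕ} (hk : 1 ≤ k) (hkn : k ≤ n + 1) :
    LayerAbsorbed A g (10 * (n + 2 - k)) k := by
  obtain ⟨m, hm⟩ : ∃ m, k + m = n + 1 := ⟨n + 1 - k, by omega⟩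
  induction m using Nat.strong_induction_on generalizing k with
  | _ m ih =>
  rcases Nat.eq_zero_or_pos m with rfl | hm0
  · obtain rfl : k = n + 1 := by omega
    intro j hgj hp h
    have h1 := fun i => reached_of_outermost hg (r := 0) (i := i) hp hgj
    have h2 := inward_cases hp.2.1
    have h3 : inward d (n + 1) j + 2 < layerLegs (n + 1) := by
      rcases Nat.mod_two_eq_zero_or_one (n + 1) with h4 | h4
      · have := layerLegs_of_even h4
        omega
      · have := layerLegs_of_odd h4
        omega
    exact (absorbed_of_reached (h1 (inward d (n + 1) j) (by omega) (by omega))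
      (h1 (inward d (n + 1) j + 1) (by omega) (by omega))
      (h1 (inward d (n + 1) j + 2) (by omega) (by omega))
      (by omega) (by omega) (by omega)).mono (by omega)
  · have hnext := ih (m - 1) (by omega) (k := k + 1) (by omega) (by omega) (by omega)
    rcases Nat.mod_two_eq_zero_or_one k with hk2 | hk2
    · intro j hgj hp h
      have h1 : inward d k j = 1 := by omega
      have h2 := fun i => reached_of_square hg hd (i := i) hp hk2 hgj (fun _ => hnext)
      exact (absorbed_of_reached (h2 1 (by omega) (by omega)) (h2 2 (by omega) (by omega))
        (h2 3 (by omega) (by omega)) (by omega) (by omega) (by omega)).mono (by omega)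
    · refine (layerAbsorbed_hexagon hg hd hk (by omega) hk2 hnext fun h => ?_).mono (by omega)
      exact (ih (m - 2) (by omega) (k := k + 2) (by omega) (by omega) (by omega)).mono (by omega)

/-- All good tiles with a good parent are absorbed. -/
theorem absorbed_of_good {k j : ℕ} (hp : Present d n sel k j) (hgj : g k j)
    (hpar : ∀ k' j' r, k = k' + 1 → 1 ≤ k' → j' < (layer d k').length →
      r < width d (layerLegs k') (grp d k' j') → j = start d k' j' + r → g k' j') :
    Absorbed A (10 * (n + 3)) (tileIdx d n sel k j) := by
  have hkn : k ≤ n + 1 := by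
    have := hp.2.2
    omega
  have h1 := layerAbsorbed_of_good hg hd hp.1 hkn j hgj hp
  by_cases h2 : k % 2 = 1 ∨ inward d k j = 1
  · exact (h1 h2).mono (by omega)
  have h3 := (inward_cases hp.2.1).resolve_left fun h => h2 (Or.inr h)
  have hk1 := hp.1
  obtain ⟨k, rfl⟩ : ∃ m, k = m + 1 := ⟨k - 1, by omega⟩
  have hk2 : (k + 1) % 2 ≠ 1 := fun h => h2 (Or.inl h)
  have hk : 1 ≤ k := by omega
  obtain ⟨j', r, h4, h5, rfl⟩ := exists_eq_start_add hd hk hp.2.1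
  obtain ⟨h6, h7, -⟩ := inward_eq_two hd hk h4 h5 h3
  have h8 := hpar k j' r rfl hk h4 h5 rfl
  have h9 := layerAbsorbed_of_good hg hd hk (by omega) j' h8 ⟨hk, h4, Or.inl (by omega)⟩
    (Or.inl (by omega))
  have h10 := start_succ (d := d) k j'
  rw [width_eq, if_pos h6] at h10
  have h11 : start d k j' + r = start d k (j' + 1) - 1 := by omega
  rw [h11] at hgj hp ⊢
  exact ((slotReached_of_pred hg hd hk (by omega) (by omega) h4 h6 hgj h9 fun h =>
    (layerAbsorbed_of_good hg hd (k := k + 2) (by omega) (by omega)).mono (by omega)).1 hp).mono (by omega)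

/-- The central tile is absorbed if the whole first layer is good. -/
theorem absorbed_center (h : ∀ j, g 1 j) : Absorbed A (10 * (n + 3)) 0 := by
  have h1 := layerAbsorbed_of_good hg hd (k := 1) le_rfl (by omega)
  have h2 : ∀ e, e < 4 → Reached A (10 * (n + 1)) 0 e := by
    intro e he
    have h3 : e < (layer d 1).length := by
      rw [layer_one hd]
      exact he
    refine (h1.slotReached hg le_rfl (by omega) h3 (h e) (Or.inl rfl)).reached
      (tiling_tile_zero) he ?_
    unfold grp
    rw [layer_one hd]
    interval_cases e <;> simp
  exact (absorbed_of_reached (h2 0 (by omega)) (h2 1 (by omega)) (h2 2 (by omega)) (by omega)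
    (by omega) (by omega)).mono (by omega)

end Absorb

section Global

variable {d n : ℕ} {sel : ℕ → Bool}

theorem Exposed.mem_front {j : ℕ} {l : ℕ × ℕ} (hj : j < (layer d (n + 1)).length)
    (h : Exposed d n sel j l) : l ∈ (tiling d n sel).front.map Prod.fst := by
  obtain ⟨p, c, -, -, h1⟩ := h.exists_position hj
  rw [tiling_front]
  exact List.mem_map.2 ⟨(l, c), List.mem_rotate.2 (List.mem_of_getElem? h1), rfl⟩

theorem Exposed.exists_boundary {j : ℕ} {l : ℕ × ℕ} (hj : j < (layer d (n + 1)).length)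
    (h : Exposed d n sel j l) :
    ∃ b : (tiling d n sel).network.Boundary, (b.1.1.val, b.1.2.val) = l := by
  have hP := tiling_wellFormed d n sel
  obtain ⟨l', hl'⟩ := hP.exists_leg (h.mem_front hj)
  exact ⟨⟨l', hP.isBoundary l' (hl' ▸ h.mem_front hj)⟩, hl'⟩

/-- Every group of the outermost layer has an exposed leg. -/
theorem exists_exposed {j : ℕ} (hj : j < (layer d (n + 1)).length) :
    ∃ l, Exposed d n sel j l := by
  by_cases h : sel j
  · exact ⟨_, Or.inl ⟨h, inward d (n + 1) j, le_rfl, by have := width_pos hj; omega, rfl⟩⟩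
  · have h1 : 0 < (grp d (n + 1) j).1.length := by
      have := inward_cases hj
      unfold inward at this
      omega
    exact ⟨_, Or.inr ⟨h, List.getElem_mem h1⟩⟩

variable (hd : 4 ≤ d)
include hd

theorem tiling_boundary_nonempty : Nonempty (tiling d n sel).network.Boundary := by
  have h1 : 0 < (layer d (n + 1)).length :=
    List.length_pos_iff.2 (layer_ne_nil hd (by omega))
  obtain ⟨l, hl⟩ := exists_exposed (sel := sel) h1
  exact ⟨(hl.exists_boundary h1).choose⟩

/-- If `A` is the whole boundary, then all tiles are good. -/
theorem tiling_greedyWedge_univ :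
    greedyWedge (Set.univ : Set (tiling d n sel).network.Boundary) = Finset.univ := by
  have hg : GoodFamily (Set.univ : Set (tiling d n sel).network.Boundary) fun _ _ => True :=
    ⟨fun j l hj _ h => by
      obtain ⟨b, hb⟩ := h.exists_boundary hj
      exact ⟨b, hb, Set.mem_univ _⟩, fun _ _ _ _ _ _ _ _ _ => trivial,
      fun _ _ _ _ _ _ _ _ _ _ _ _ _ => trivial⟩
  refine Finset.eq_univ_iff_forall.2 fun t => ?_
  have h1 : Absorbed (Set.univ : Set (tiling d n sel).network.Boundary) (10 * (n + 3)) t.val := by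
    rcases tiling_tile_cases t.val t.2 with h | ⟨k, j, h1, h2⟩
    · rw [h]
      exact absorbed_center hg hd fun _ => trivial
    · rw [h2]
      exact absorbed_of_good hg hd h1 trivial fun _ _ _ _ _ _ _ _ => trivial
  obtain ⟨u, hu, hut⟩ := h1
  obtain rfl : u = t := Fin.ext hut
  exact scheduledSet_subset (tiling_wellFormed d n sel).proper _ hu

end Global

open Network

/-! ### The colouring of the boundary by a union of intervals -/

section Colour

theorem mem_take_rotate {α : Type*} {F : List α} (hF : F.Nodup) {p : ℕ} (hp : p < F.length)
    (s e : ℕ) : F[p] ∈ (F.rotate s).take e ↔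
      ∃ i, i < e ∧ i < F.length ∧ (i + s) % F.length = p := by
  rw [List.mem_iff_getElem]
  constructor
  · rintro ⟨i, hi, h⟩
    rw [List.length_take, List.length_rotate] at hi
    rw [List.getElem_take, List.getElem_rotate] at h
    exact ⟨i, by omega, by omega, (hF.getElem_inj_iff).1 h⟩
  · rintro ⟨i, h1, h2, h3⟩
    refine ⟨i, by rw [List.length_take, List.length_rotate]; omega, ?_⟩
    rw [List.getElem_take, List.getElem_rotate]
    simp only [h3]

/-- A union of `m` cyclic intervals has at most `2 m` end points. -/
theorem exists_changes (L m : ℕ) (s e : Fin m → ℕ) : ∃ Ch : Finset ℕ, Ch.card ≤ 2 * m ∧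
    ∀ q, q + 1 < L → q ∉ Ch →
      ((∃ j i, i < e j ∧ i < L ∧ (i + s j) % L = q) ↔
        ∃ j i, i < e j ∧ i < L ∧ (i + s j) % L = q + 1) := by
  refine ⟨(Finset.univ.image fun j => (min (e j) L - 1 + s j) % L) ∪
    Finset.univ.image fun j => s j % L - 1, ?_, fun q hq hCh => ?_⟩
  · refine (Finset.card_union_le _ _).trans ?_
    have h1 := Finset.card_image_le (s := (Finset.univ : Finset (Fin m)))
      (f := fun j => (min (e j) L - 1 + s j) % L)
    have h2 := Finset.card_image_le (s := (Finset.univ : Finset (Fin m)))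
      (f := fun j => s j % L - 1)
    rw [Finset.card_univ, Fintype.card_fin] at h1 h2
    omega
  simp only [Finset.mem_union, Finset.mem_image, Finset.mem_univ, true_and, not_or,
    not_exists] at hCh
  constructor
  · rintro ⟨j, i, h1, h2, h3⟩
    -- Otherwise `q` is the last position of an interval.
    have h4 : i ≠ min (e j) L - 1 := fun h => hCh.1 j (h ▸ h3)
    refine ⟨j, i + 1, by omega, by omega, ?_⟩
    rw [show i + 1 + s j = i + s j + 1 by omega, Nat.add_mod, h3, Nat.mod_eq_of_lt (a := 1) (by omega),
      Nat.mod_eq_of_lt hq]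
  · rintro ⟨j, i, h1, h2, h3⟩
    -- If `i = 0`, then `q + 1` is the first position of an interval.
    rcases Nat.eq_zero_or_pos i with rfl | h4
    · rw [Nat.zero_add] at h3
      exact absurd (by omega) (hCh.2 j)
    · refine ⟨j, i - 1, by omega, by omega, ?_⟩
      have h5 : ((i - 1 + s j) % L + 1) % L = q + 1 := by
        rw [← h3, Nat.mod_add_mod]
        congr 1
        omega
      have h6 : (i - 1 + s j) % L < L := Nat.mod_lt _ (by omega)
      rcases Nat.lt_or_ge ((i - 1 + s j) % L + 1) L with h7 | h7
      · rw [Nat.mod_eq_of_lt h7] at h5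
        omega
      · rw [show (i - 1 + s j) % L + 1 = L by omega, Nat.mod_self] at h5
        omega

variable {d n : ℕ} {sel : ℕ → Bool} (A : Set (tiling d n sel).network.Boundary)

/-- The exposed leg at the position `p` lies in `A`. -/
def Coloured (p : ℕ) : Prop := ∃ l c, (outerFront d n sel)[p]? = some (l, c) ∧ InRegion A l

variable {A}

/-- The colour of consecutive exposed legs changes at most `2 m` times. -/
theorem coloured_changes {m : ℕ} (hA : (tiling d n sel).IsUnionOfIntervals m A) :
    ∃ Ch : Finset ℕ, Ch.card ≤ 2 * m ∧ ∀ q, q + 1 < (outerFront d n sel).length → q ∉ Ch →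
      (Coloured A q ↔ Coloured A (q + 1)) := by
  obtain ⟨s, e, hA⟩ := hA
  obtain ⟨Ch, h1, h2⟩ := exists_changes (outerFront d n sel).length m (fun j => 1 + s j) e
  have hP := tiling_wellFormed d n sel
  have hnodup : ((outerFront d n sel).map Prod.fst).Nodup := by
    have h3 := hP.nodup.of_append_right
    rw [tiling_front, List.map_rotate, List.nodup_rotate] at h3
    exact h3
  have key : ∀ p, p < (outerFront d n sel).length → (Coloured A p ↔
      ∃ j i, i < e j ∧ i < (outerFront d n sel).length ∧
        (i + (1 + s j)) % (outerFront d n sel).length = p) := by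
    intro p hp
    have hp' : p < ((outerFront d n sel).map Prod.fst).length := by rwa [List.length_map]
    have h3 : Coloured A p ↔ InRegion A ((outerFront d n sel).map Prod.fst)[p] := by
      rw [List.getElem_map]
      constructor
      · rintro ⟨l, c, h, h'⟩
        rw [List.getElem?_eq_getElem hp] at h
        rwa [Option.some_injective _ h]
      · intro h
        exact ⟨_, _, List.getElem?_eq_getElem hp, h⟩
    have h4 : InRegion A ((outerFront d n sel).map Prod.fst)[p] ↔
        ∃ j, ((outerFront d n sel).map Prod.fst)[p] ∈
          (((tiling d n sel).front.map Prod.fst).rotate (s j)).take (e j) := by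
      constructor
      · rintro ⟨b, hb, hbA⟩
        rw [← hb]
        exact (hA b).1 hbA
      · intro h
        have h5 : ((outerFront d n sel).map Prod.fst)[p] ∈
            (tiling d n sel).front.map Prod.fst := by
          rw [tiling_front, List.map_rotate, List.mem_rotate]
          exact List.getElem_mem _
        obtain ⟨l, hl⟩ := hP.exists_leg h5
        refine ⟨⟨l, hP.isBoundary l (hl ▸ h5)⟩, hl, (hA _).2 ?_⟩
        rw [← hl] at h
        exact h
    rw [h3, h4]
    refine exists_congr fun j => ?_
    rw [tiling_front, List.map_rotate, List.rotate_rotate, mem_take_rotate hnodup hp',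
      List.length_map]
  exact ⟨Ch, h1, fun q hq hCh => by rw [key q (by omega), key (q + 1) hq]; exact h2 q hq hCh⟩

end Colour

/-! ### Windows -/

section Window

variable {d n : ℕ} {sel : ℕ → Bool}

theorem start_add_le (k a b : ℕ) : start d k (a + b) ≤ start d k a + 6 * b := by
  induction b with
  | zero => exact le_rfl
  | succ b ih =>
    have h1 : width d (layerLegs k) (grp d k (a + b)) ≤ 6 := by
      have h2 := layerLegs_cases k
      rw [width_eq]
      split <;> omega
    rw [← Nat.add_assoc, start_succ]
    omega

theorem start_lt {k j : ℕ} (hj : j < (layer d k).length) : start d k j < start d k (j + 1) := by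
  have h1 := width_pos hj
  rw [start_succ]
  omega

theorem start_add_three_le_of_odd {k j : ℕ} (hk2 : k % 2 = 1) (hj : j < (layer d k).length) :
    start d k j + 3 ≤ start d k (j + 1) := by
  have h1 := width_pos hj
  have h2 := inward_cases hj
  have h3 := layerLegs_of_odd hk2
  rw [start_succ]
  omega

/-- Three consecutive tiles have at least four children. -/
theorem start_add_four_le (hd : 4 ≤ d) {k j : ℕ} (hk : 1 ≤ k) (hj : j + 3 ≤ (layer d k).length) :
    start d k j + 4 ≤ start d k (j + 3) := by
  have h1 := start_lt (d := d) (k := k) (j := j) (by omega)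
  have h2 := start_lt (d := d) (k := k) (j := j + 1) (by omega)
  have h3 := start_lt (d := d) (k := k) (j := j + 2) (by omega)
  rw [show j + 1 + 1 = j + 2 from rfl] at h2
  rw [show j + 2 + 1 = j + 3 from rfl] at h3
  rcases Nat.mod_two_eq_zero_or_one k with hk2 | hk2
  · have h4 : ∀ i, i < (layer d k).length → inward d k i = 1 →
        start d k i + 2 ≤ start d k (i + 1) := by
      intro i hi h
      have h5 := width_pos hi
      have h6 := layerLegs_of_even hk2
      rw [start_succ]
      omega
    rcases inward_cases (d := d) (k := k) (j := j + 1) (by omega) with h5 | h5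
    · have := h4 (j + 1) (by omega) h5
      rw [show j + 1 + 1 = j + 2 from rfl] at this
      omega
    · have h6 := (inward_pred_square hd hk hk2 (by omega) h5).2
      have := h4 j (by omega) h6
      omega
  · have := start_add_three_le_of_odd (d := d) (j := j) hk2 (by omega)
    omega

/-- Auxiliary to `shadow`, by recursion from the outermost layer inwards. -/
def shadowAux (d n : ℕ) (sel : ℕ → Bool) : ℕ → ℕ → ℕ
  | 0, j => outerStart d n sel j
  | m + 1, j => shadowAux d n sel m (start d (n - m) j)

/-- The position in the front of the first leg that descends from the tile number `j` of the layer
`k`. -/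
def shadow (d n : ℕ) (sel : ℕ → Bool) (k j : ℕ) : ℕ := shadowAux d n sel (n + 1 - k) j

theorem shadow_outermost (j : ℕ) : shadow d n sel (n + 1) j = outerStart d n sel j := by
  rw [shadow, Nat.sub_self]
  rfl

theorem shadow_eq {k : ℕ} (hk : k ≤ n) (j : ℕ) :
    shadow d n sel k j = shadow d n sel (k + 1) (start d k j) := by
  rw [shadow, shadow, show n + 1 - k = (n - k) + 1 by omega, shadowAux,
    show n + 1 - (k + 1) = n - k by omega, show n - (n - k) = k by omega]

theorem outerStart_mono {i j : ℕ} (h : i ≤ j) : outerStart d n sel i ≤ outerStart d n sel j :=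
  Finset.sum_le_sum_of_subset (Finset.range_mono h)

theorem shadow_mono (k : ℕ) {i j : ℕ} (h : i ≤ j) : shadow d n sel k i ≤ shadow d n sel k j := by
  unfold shadow
  generalize n + 1 - k = m
  induction m generalizing i j with
  | zero => exact outerStart_mono h
  | succ m ih => exact ih (start_mono _ h)

theorem shadow_length (hd : 4 ≤ d) {k : ℕ} (hk : 1 ≤ k) (hkn : k ≤ n + 1) :
    shadow d n sel k (layer d k).length = (outerFront d n sel).length := by
  obtain ⟨m, hm⟩ : ∃ m, k + m = n + 1 := ⟨n + 1 - k, by omega⟩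
  induction m generalizing k with
  | zero =>
    obtain rfl : k = n + 1 := by omega
    rw [shadow_outermost, outerFront_length]
  | succ m ih => rw [shadow_eq (by omega), start_length hd hk, ih (by omega) (by omega) (by omega)]

variable (d n sel) in
/-- All the legs that descend from the tiles number `j - w, …, j + w` of the layer `k` satisfy `P`.
These tiles are required to exist, so that no window crosses the seam between the last and the first
tile of a layer. -/
def Window (P : ℕ → Prop) (w k j : ℕ) : Prop :=
  w ≤ j ∧ j + w + 1 ≤ (layer d k).length ∧
    ∀ p, shadow d n sel k (j - w) ≤ p → p < shadow d n sel k (j + w + 1) → P p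

theorem Window.mono {P : ℕ → Prop} {w w' k j : ℕ} (h : Window d n sel P w k j) (hw : w' ≤ w) :
    Window d n sel P w' k j := by
  obtain ⟨h1, h2, h3⟩ := h
  exact ⟨by omega, by omega, fun p hp hp' => h3 p ((shadow_mono k (by omega)).trans hp)
    (hp'.trans_le (shadow_mono k (by omega)))⟩

variable (hd : 4 ≤ d)
include hd

/-- The window of a tile in the next layer is contained in that of a tile whose neighbours it
touches. -/
theorem Window.child {P : ℕ → Prop} {w w' k j i : ℕ} (h : Window d n sel P w k j) (hk : 1 ≤ k)
    (hkn : k ≤ n) (h1 : start d k (j - w) + w' ≤ i) (h2 : i + w' + 1 ≤ start d k (j + w + 1)) :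
    Window d n sel P w' (k + 1) i := by
  have h3 := start_mono (d := d) k h.2.1
  rw [start_length hd hk] at h3
  refine ⟨by omega, by omega, fun p hp hp' => h.2.2 p ?_ ?_⟩
  · rw [shadow_eq hkn]
    exact (shadow_mono _ (by omega)).trans hp
  · rw [shadow_eq hkn]
    exact hp'.trans_le (shadow_mono _ h2)

/-- A tile has at most six children, so the 25 neighbours of a tile on each side contain the
children of the three neighbours of its parent on each side. -/
theorem Window.parent {P : ℕ → Prop} {k j r : ℕ} (hk : 1 ≤ k) (hkn : k ≤ n)
    (hr : r < width d (layerLegs k) (grp d k j))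
    (h : Window d n sel P 25 (k + 1) (start d k j + r)) : Window d n sel P 3 k j := by
  obtain ⟨h1, h2, h3⟩ := h
  have h4 := start_succ (d := d) k j
  have h5 := start_add_le (d := d) k j 1
  have h6 := start_add_le (d := d) k 0 j
  rw [start_zero, Nat.zero_add] at h6
  have hj3 : 3 ≤ j := by omega
  have hj4 : j + 3 + 1 ≤ (layer d k).length := by
    by_contra hcon
    have h7 := start_mono (d := d) k (show (layer d k).length ≤ j + 3 by omega)
    have h8 := start_add_le (d := d) k j 3
    rw [start_length hd hk] at h7
    omega
  have h9 := start_add_le (d := d) k j 4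
  have h10 := start_add_le (d := d) k (j - 3) 3
  rw [Nat.sub_add_cancel hj3] at h10
  refine ⟨hj3, hj4, fun p hp hp' => h3 p ?_ ?_⟩
  · rw [shadow_eq hkn] at hp
    exact (shadow_mono _ (by omega)).trans hp
  · rw [shadow_eq hkn] at hp'
    exact hp'.trans_le (shadow_mono _ (show start d k (j + 4) ≤ _ by omega))

/-- The windows of the outer neighbours of a tile are contained in its own window. -/
theorem Window.slot {P : ℕ → Prop} {k j e : ℕ} (h : Window d n sel P 3 k j) (hk : 1 ≤ k)
    (hkn : k ≤ n) (he : inward d k j + e < layerLegs k) :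
    Window d n sel P 3 (k + 1) (slot d k j e) := by
  obtain ⟨h1, h2, -⟩ := id h
  have h3 := start_add_four_le hd hk (j := j - 3) (by omega)
  have h4 := start_add_four_le hd hk (j := j + 1) (by omega)
  rw [Nat.sub_add_cancel h1] at h3
  rw [show j + 1 + 3 = j + 4 by omega] at h4
  have h5 := width_pos (d := d) (k := k) (j := j) (by omega)
  have h6 := start_succ (d := d) k j
  rw [HybridCode.slot, if_neg (by omega)]
  exact h.child hd hk hkn (by omega) (show _ ≤ start d k (j + 4) by omega)

theorem Window.chunk {P : ℕ → Prop} {k j j' i : ℕ} (h : Window d n sel P 3 k j) (hk : 1 ≤ k)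
    (hkn : k ≤ n) (hk2 : k % 2 = 1) (hj' : j' ≤ j) (hj : j ≤ j' + 2) (hi : start d k j' ≤ i)
    (hi' : i < start d k (j' + 1)) : Window d n sel P 3 (k + 1) i := by
  obtain ⟨h1, h2, -⟩ := id h
  have h3 := start_add_three_le_of_odd (d := d) (k := k) (j := j - 3) hk2 (by omega)
  have h4 := start_mono (d := d) k (show j - 3 + 1 ≤ j' by omega)
  have h5 := start_mono (d := d) k (show j' + 1 ≤ j + 1 by omega)
  have h6 := start_add_four_le hd hk (j := j + 1) (by omega)
  rw [show j + 1 + 3 = j + 4 by omega] at h6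
  exact h.child hd hk hkn (by omega) (show _ ≤ start d k (j + 4) by omega)

variable {A : Set (tiling d n sel).network.Boundary}

omit hd in
theorem Window.exposed {P : ℕ → Prop} {j : ℕ} {l : ℕ × ℕ} (h : Window d n sel P 3 (n + 1) j)
    (hl : Exposed d n sel j l) : ∃ p c, P p ∧ (outerFront d n sel)[p]? = some (l, c) := by
  obtain ⟨h1, h2, h3⟩ := h
  obtain ⟨p, c, h4, h5, h6⟩ := hl.exists_position (by omega)
  refine ⟨p, c, h3 p ?_ ?_, h6⟩
  · rw [shadow_outermost]
    exact (outerStart_mono (by omega)).trans h4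
  · rw [shadow_outermost]
    exact h5.trans_le (outerStart_mono (by omega))

/-- Tiles whose window is contained in `A` are absorbed layer by layer. -/
theorem goodFamily_window : GoodFamily A (Window d n sel (Coloured A) 3) where
  exposed j l _ h hl := by
    obtain ⟨p, c, ⟨l', c', h1, h2⟩, h3⟩ := h.exposed hl
    rw [h3] at h1
    rwa [(Prod.mk.inj (Option.some_injective _ h1)).1]
  square k j e hk hkn hk2 _ h he := h.slot hd hk hkn (by rwa [layerLegs_of_even hk2])
  hexagon k j j' i hk hkn hk2 _ h h1 h2 h3 h4 := h.chunk hd hk hkn hk2 h1 h2 h3 h4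

/-- Tiles whose descendants lie outside `A` are not absorbed: at most their inward legs can become
accessible. -/
theorem not_mem_greedyWedge_of_window {t : (tiling d n sel).network.Tile} {k j : ℕ}
    (hp : Present d n sel k j) (ht : t.val = tileIdx d n sel k j)
    (h : Window d n sel (fun p => ¬ Coloured A p) 3 k j) : t ∉ greedyWedge A := by
  have hP := tiling_wellFormed d n sel
  intro hmem
  -- The tiles with no such window form a set to which no local move can be applied.
  set X : Finset (tiling d n sel).network.Tile := Finset.univ.filter fun u =>
    ¬ ∃ k j, Present d n sel k j ∧ u.val = tileIdx d n sel k j ∧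
      Window d n sel (fun p => ¬ Coloured A p) 3 k j with hX
  have hXmem : ∀ u, u ∈ X ↔ ¬ ∃ k j, Present d n sel k j ∧ u.val = tileIdx d n sel k j ∧
      Window d n sel (fun p => ¬ Coloured A p) 3 k j := fun u => by simp [hX]
  refine (hXmem t).1 (mem_greedyWedge.1 hmem X fun u hu => (hXmem u).2 ?_) ⟨k, j, hp, ht, h⟩
  clear hmem ht hp h t k j
  rintro ⟨k, j, hp, ht, h⟩
  have htile := tiling_tile hp
  have hpj := hp.2.1
  have hnot : ∀ i, inward d k j ≤ i.val →
      ¬ Accessible A X (⟨u, i⟩ : (tiling d n sel).network.Leg) := by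
    intro i hi hacc
    have hlegs : i.val < layerLegs k := by
      have h1 := (tiling d n sel).network_getElem? u
      rw [ht, htile] at h1
      have h2 := (Prod.mk.inj (Option.some_injective _ h1)).1
      exact i.2.trans_eq (congrArg TileKind.legs h2.symm)
    have hexp : ∀ j', Window d n sel (fun p => ¬ Coloured A p) 3 (n + 1) j' →
        Exposed d n sel j' (tileIdx d n sel k j, i.val) → False := by
      intro j' hw he
      obtain ⟨b, hb⟩ := he.exists_boundary (by have := hw.2.1; omega)
      have hbl : b.1 = ⟨u, i⟩ := Patch.leg_ext
        ((congrArg Prod.fst hb).trans ht.symm) (congrArg Prod.snd hb)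
      rcases hacc with ⟨h1, h2⟩ | ⟨l', h1, h2⟩
      · obtain ⟨p, c, h3, h4⟩ := hw.exposed he
        exact h3 ⟨_, c, h4, ⟨_, h1⟩, by rw [ht], h2⟩
      · exact b.2 l' (by rw [hbl]; exact h1)
    rcases Nat.lt_or_ge n k with hkn | hkn
    · have hk2 := hp.2.2
      obtain rfl : k = n + 1 := by omega
      exact hexp j h (Or.inl ⟨(hk2.resolve_left (by omega)).2, i.val, hi, hlegs, rfl⟩)
    · have h1 := slot_spec hd hp.1 (e := i.val - inward d k j) hpj (by omega)
      rw [Nat.add_sub_cancel' hi, ← tileIdx_of_le (sel := sel) hkn] at h1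
      have h2 := h.slot hd hp.1 hkn (e := i.val - inward d k j) (by omega)
      generalize slot d k j (i.val - inward d k j) = i' at h1 h2
      by_cases hp' : Present d n sel (k + 1) i'
      · obtain ⟨a, ha, ha'⟩ := List.getElem_of_mem h1.2
        have h3 := layer_legs _ (grp_mem hp'.2.1)
        unfold layerLegs at h3
        obtain ⟨l', hl1, hl2, hl3⟩ := exists_leg (tiling_tile hp') (i := a) (by omega)
        have hgl : (tiling d n sel).network.glued ⟨u, i⟩ l' := by
          refine Or.inr ?_
          have h4 : ((tiling d n sel).tiles.get l'.1).2 = (grp d (k + 1) i').1 :=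
            congrArg Prod.snd hl3
          refine (congrArg (fun x : List (ℕ × ℕ) => x[l'.2.val]?) h4).trans ?_
          rw [hl2, ht]
          exact List.getElem?_eq_some_iff.2 ⟨ha, ha'⟩
        rcases hacc with ⟨h5, -⟩ | ⟨l'', h5, h6⟩
        · exact h5 l' hgl
        · rw [← hP.proper.unique _ _ _ hgl h5] at h6
          exact (hXmem _).1 h6 ⟨k + 1, i', hp', hl1, h2⟩
      · have h3 : k = n ∧ ¬ sel i' := by
          by_contra hcon
          refine hp' ⟨by omega, h1.1, ?_⟩
          by_contra h4
          push Not at h4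
          exact hcon ⟨by omega, fun h5 => h4.2 (by omega) h5⟩
        obtain ⟨rfl, h4⟩ := h3
        exact hexp i' h2 (Or.inr ⟨h4, h1.2⟩)
  have hle : (Finset.univ.filter fun i =>
      Accessible A X (⟨u, i⟩ : (tiling d n sel).network.Leg)).card ≤ inward d k j := by
    rw [← Finset.card_range (inward d k j)]
    refine Finset.card_le_card_of_injOn (fun i => i.val) (fun i hi => ?_) fun i _ i' _ h =>
      Fin.ext h
    have hi' := (Finset.mem_filter.1 hi).2
    refine Finset.mem_coe.2 (Finset.mem_range.2 ?_)
    exact lt_of_not_ge fun hcon => hnot i hcon hi'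
  have h1 := inward_cases hpj
  unfold ThreeLegs at hu
  omega

end Window

/-! ### Counting the tiles near the end points of the intervals -/

section Count

variable {d n : ℕ} {sel : ℕ → Bool}

theorem card_le_of_diam {T : Finset ℕ} {c : ℕ} (h : ∀ a ∈ T, ∀ b ∈ T, b < a + c) :
    T.card ≤ c := by
  rcases T.eq_empty_or_nonempty with rfl | hT
  · exact Nat.zero_le _
  · have h1 : T ⊆ Finset.Ico (T.min' hT) (T.min' hT + c) := fun b hb =>
      Finset.mem_Ico.2 ⟨T.min'_le b hb, h _ (T.min'_mem hT) b hb⟩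
    have h2 := Finset.card_le_card h1
    rw [Nat.card_Ico] at h2
    omega

theorem exists_change {P : ℕ → Prop} {a b : ℕ} (h : ¬ ∀ p, a ≤ p → p < b → P p)
    (h' : ¬ ∀ p, a ≤ p → p < b → ¬ P p) :
    ∃ q, a ≤ q ∧ q + 1 < b ∧ ¬ (P q ↔ P (q + 1)) := by
  by_contra hcon
  push Not at h h' hcon
  obtain ⟨p, hp1, hp2, hp3⟩ := h
  obtain ⟨p', hp1', hp2', hp3'⟩ := h'
  have key : ∀ q, a ≤ q → q < b → (P a ↔ P q) := by
    intro q hq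
    induction q, hq using Nat.le_induction with
    | base => exact fun _ => Iff.rfl
    | succ q hq ih => exact fun h => (ih (by omega)).trans (hcon q hq h)
  exact hp3 ((key p hp1 hp2).1 ((key p' hp1' hp2').2 hp3'))

variable (d n sel) in
/-- The positions in the layer `k` whose window of width `w` is not of one colour. -/
def mixed (P : ℕ → Prop) (w k : ℕ) : Finset ℕ :=
  (Finset.range (layer d k).length).filter fun j =>
    ¬ Window d n sel P w k j ∧ ¬ Window d n sel (fun p => ¬ P p) w k j

/-- Besides the `w` tiles at either side of the seam, a mixed window has a change of colour in it.
-/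
theorem card_mixed_le (hd : 4 ≤ d) {P : ℕ → Prop} {Ch : Finset ℕ}
    (hCh : ∀ q, q + 1 < (outerFront d n sel).length → q ∉ Ch → (P q ↔ P (q + 1)))
    {w k : ℕ} (hk : 1 ≤ k) (hkn : k ≤ n + 1) :
    (mixed d n sel P w k).card ≤ 2 * w + (2 * w + 1) * Ch.card := by
  set len := (layer d k).length with hlen
  set T : ℕ → Finset ℕ := fun q => (Finset.range len).filter fun j => w ≤ j ∧
    shadow d n sel k (j - w) ≤ q ∧ q < shadow d n sel k (j + w + 1) with hT
  -- The windows that contain a given position are those of at most `2 w + 1` consecutive tiles.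
  have hTc : ∀ q ∈ Ch, (T q).card ≤ 2 * w + 1 := by
    intro q _
    refine card_le_of_diam fun a ha b hb => ?_
    obtain ⟨-, ha1, ha2, ha3⟩ := Finset.mem_filter.1 ha
    obtain ⟨-, hb1, hb2, hb3⟩ := Finset.mem_filter.1 hb
    by_contra hcon
    have := shadow_mono (d := d) (n := n) (sel := sel) k (show a + w + 1 ≤ b - w by omega)
    omega
  have hsub : mixed d n sel P w k ⊆
      (Finset.range w ∪ Finset.Ico (len - w) len) ∪ Ch.biUnion T := by
    intro j hj
    obtain ⟨h1, h2, h3⟩ := Finset.mem_filter.1 hj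
    rw [Finset.mem_range] at h1
    rcases Nat.lt_or_ge j w with h4 | h4
    · exact Finset.mem_union_left _ (Finset.mem_union_left _ (Finset.mem_range.2 h4))
    rcases Nat.lt_or_ge len (j + w + 1) with h5 | h5
    · exact Finset.mem_union_left _ (Finset.mem_union_right _ (Finset.mem_Ico.2 (by omega)))
    obtain ⟨q, h6, h7, h8⟩ := exists_change (fun h => h2 ⟨h4, h5, h⟩) (fun h => h3 ⟨h4, h5, h⟩)
    refine Finset.mem_union_right _ (Finset.mem_biUnion.2 ⟨q, ?_, ?_⟩)
    · by_contra hq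
      have h9 := shadow_mono (d := d) (n := n) (sel := sel) k h5
      rw [shadow_length hd hk hkn] at h9
      exact h8 (hCh q (by omega) hq)
    · exact Finset.mem_filter.2 ⟨Finset.mem_range.2 h1, h4, h6, by omega⟩
  have h1 := Finset.card_le_card hsub
  have h2 := Finset.card_union_le (Finset.range w ∪ Finset.Ico (len - w) len) (Ch.biUnion T)
  have h3 := Finset.card_union_le (Finset.range w) (Finset.Ico (len - w) len)
  have h4 := Finset.card_biUnion_le_card_mul Ch T (2 * w + 1) hTc
  rw [Finset.card_range, Nat.card_Ico] at h3
  rw [Nat.mul_comm] at h4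
  omega

/-- For a union of `m` intervals, all but a number proportional to the number of layers of tiles of
the wedge are absorbed after a number of rounds proportional to the number of layers. -/
theorem exists_exceptional (hd : 4 ≤ d) {m : ℕ} {A : Set (tiling d n sel).network.Boundary}
    (hA : (tiling d n sel).IsUnionOfIntervals m A) :
    ∃ U : Finset (tiling d n sel).network.Tile, U.card ≤ (n + 1) * (50 + 102 * m) + 1 ∧
      ∀ t ∈ greedyWedge A, t ∉ scheduledSet A (10 * (n + 3)) → t ∈ U := by
  obtain ⟨Ch, hCh1, hCh2⟩ := coloured_changes hA
  set V : Finset ℕ := insert 0 ((Finset.Icc 1 (n + 1)).biUnion fun k =>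
    (mixed d n sel (Coloured A) 25 k).image (tileIdx d n sel k)) with hV
  refine ⟨Finset.univ.filter fun t => t.val ∈ V, ?_, fun t ht hts => ?_⟩
  · have h1 : (Finset.univ.filter fun t : (tiling d n sel).network.Tile => t.val ∈ V).card ≤
        V.card := Finset.card_le_card_of_injOn (fun t => t.val)
      (fun t ht => (Finset.mem_filter.1 ht).2) fun t _ t' _ h => Fin.ext h
    have h2 := Finset.card_insert_le 0 ((Finset.Icc 1 (n + 1)).biUnion fun k =>
      (mixed d n sel (Coloured A) 25 k).image (tileIdx d n sel k))
    have h3 := Finset.card_biUnion_le_card_mul (Finset.Icc 1 (n + 1))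
      (fun k => (mixed d n sel (Coloured A) 25 k).image (tileIdx d n sel k)) (50 + 102 * m)
      fun k hk => by
        rw [Finset.mem_Icc] at hk
        have h4 := card_mixed_le hd hCh2 (w := 25) hk.1 hk.2
        refine Finset.card_image_le.trans (h4.trans ?_)
        omega
    rw [Nat.card_Icc, Nat.add_sub_cancel] at h3
    exact h1.trans (h2.trans (Nat.succ_le_succ h3))
  · refine Finset.mem_filter.2 ⟨Finset.mem_univ _, ?_⟩
    rcases tiling_tile_cases t.val t.2 with h | ⟨k, j, hp, h⟩
    · rw [h]
      exact Finset.mem_insert_self _ _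
    refine Finset.mem_insert_of_mem (Finset.mem_biUnion.2 ⟨k, ?_, ?_⟩)
    · have h1 := hp.1
      have h2 := hp.2.2
      exact Finset.mem_Icc.2 (by omega)
    rw [h]
    refine Finset.mem_image_of_mem _ (Finset.mem_filter.2 ⟨Finset.mem_range.2 hp.2.1, ?_, ?_⟩)
    · intro hw
      refine hts ?_
      have h1 : Absorbed A (10 * (n + 3)) (tileIdx d n sel k j) := by
        refine absorbed_of_good (goodFamily_window hd) hd hp (hw.mono (by omega)) ?_
        rintro k' j' r rfl hk' - hr rfl
        have h2 := hp.2.2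
        exact Window.parent hd hk' (by omega) hr hw
      obtain ⟨u, hu, hut⟩ := h1
      obtain rfl : u = t := Fin.ext (hut.trans h.symm)
      exact hu
    · intro hw
      exact not_mem_greedyWedge_of_window hd hp h (hw.mono (by omega)) ht

end Count

/-! ### Exponential growth of the layers -/

section Growth

variable {d n : ℕ} {sel : ℕ → Bool} (hd : 4 ≤ d)
include hd

theorem layer_length_le {k c : ℕ} (hk : 1 ≤ k)
    (h : ∀ j, j < (layer d k).length → start d k j + c ≤ start d k (j + 1)) :
    (layer d k).length * c ≤ (layer d (k + 1)).length := by
  rw [← start_length hd hk]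
  have key : ∀ j, j ≤ (layer d k).length → j * c ≤ start d k j := by
    intro j hj
    induction j with
    | zero => simp
    | succ j ih =>
      have h1 := ih (by omega)
      have h2 := h j (by omega)
      rw [Nat.succ_mul]
      omega
  exact key _ le_rfl

/-- Hexagons have at least three children, so the number of tiles at least doubles every two layers.
-/
theorem two_pow_le_layer {k : ℕ} (hk : 1 ≤ k) : 2 ^ k ≤ (layer d k).length ^ 2 := by
  have hmono : ∀ k, 1 ≤ k → (layer d k).length ≤ (layer d (k + 1)).length := fun k hk => by
    simpa using layer_length_le hd hk (c := 1) fun j hj => start_lt hj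
  have h1 : (layer d 1).length = 4 := by
    rw [layer_one hd]
    rfl
  have h2 := hmono 1 le_rfl
  have key : ∀ k, 2 ^ (k + 1) ≤ (layer d (k + 1)).length ^ 2 ∧
      2 ^ (k + 2) ≤ (layer d (k + 2)).length ^ 2 := by
    intro k
    induction k with
    | zero =>
      refine ⟨by rw [Nat.zero_add, h1]; norm_num, ?_⟩
      exact (by norm_num : 2 ^ (0 + 2) ≤ 4 ^ 2).trans
        (Nat.pow_le_pow_left (h1.symm.le.trans h2) 2)
    | succ k ih =>
      refine ⟨ih.2, ?_⟩
      have h3 : 2 * (layer d (k + 1)).length ≤ (layer d (k + 3)).length := by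
        have h4 := hmono (k + 1) (by omega)
        have h5 := hmono (k + 2) (by omega)
        rcases Nat.mod_two_eq_zero_or_one (k + 1) with hk2 | hk2
        · have := layer_length_le hd (k := k + 2) (by omega) (c := 3)
            fun j hj => start_add_three_le_of_odd (by omega) hj
          rw [show k + 2 + 1 = k + 3 from rfl] at this
          rw [show k + 1 + 1 = k + 2 from rfl] at h4
          omega
        · have := layer_length_le hd (k := k + 1) (by omega) (c := 3)
            fun j hj => start_add_three_le_of_odd hk2 hj
          rw [show k + 1 + 1 = k + 2 from rfl] at this
          rw [show k + 2 + 1 = k + 3 from rfl] at h5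
          omega
      calc 2 ^ (k + 1 + 2) = 4 * 2 ^ (k + 1) := by ring
        _ ≤ 4 * (layer d (k + 1)).length ^ 2 := Nat.mul_le_mul_left _ ih.1
        _ = (2 * (layer d (k + 1)).length) ^ 2 := by ring
        _ ≤ _ := Nat.pow_le_pow_left h3 2
  obtain ⟨k, rfl⟩ : ∃ m, k = m + 1 := ⟨k - 1, by omega⟩
  exact (key k).1

omit hd in
theorem layer_length_le_front : (layer d (n + 1)).length ≤ (outerFront d n sel).length := by
  rw [outerFront_length]
  have key : ∀ j, j ≤ (layer d (n + 1)).length → j ≤ outerStart d n sel j := by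
    intro j hj
    induction j with
    | zero => exact Nat.zero_le _
    | succ j ih =>
      have h1 := ih (by omega)
      obtain ⟨l, hl⟩ := exists_exposed (sel := sel) (show j < (layer d (n + 1)).length by omega)
      obtain ⟨p, c, h2, h3, -⟩ := hl.exists_position (by omega)
      omega
  exact key _ le_rfl

/-- The number of layers is at most proportional to the logarithm of the number of physical
qubits. -/
theorem succ_mul_log_two_le {N : ℕ} (hN : 0 < N) : ((n : ℝ) + 1) * Real.log 2 ≤
    2 * Real.log (Fintype.card ((tiling d n sel).network.Qubit N)) := by
  have h1 : (layer d (n + 1)).length ≤ Fintype.card ((tiling d n sel).network.Qubit N) := by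
    have h2 := (tiling_wellFormed d n sel).front_length_le
    rw [tiling_front, List.length_rotate] at h2
    rw [Fintype.card_prod, Fintype.card_fin]
    exact layer_length_le_front.trans (h2.trans (Nat.le_mul_of_pos_right _ hN))
  have h2 := (two_pow_le_layer hd (k := n + 1) (by omega)).trans (Nat.pow_le_pow_left h1 2)
  have h3 : (2 : ℝ) ^ (n + 1) ≤ (Fintype.card ((tiling d n sel).network.Qubit N) : ℝ) ^ 2 := by
    exact_mod_cast h2
  have h4 := Real.log_le_log (by positivity) h3
  rw [Real.log_pow, Real.log_pow] at h4
  push_cast at h4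
  exact h4

end Growth

/-- The number of rounds is proportional to the number of layers, and the latter is logarithmic in
the number of qubits. -/
theorem log_depth_decoding {N : ℕ} (hN : 0 < N) {d : ℕ} (hd : 4 ≤ d) (m : ℕ) : ∃ C : ℝ,
    ∀ (n : ℕ) (sel : ℕ → Bool) (D : (tiling d n sel).network.Dressing N)
      (A : Set (tiling d n sel).network.Boundary),
      (tiling d n sel).IsUnionOfIntervals m A →
      ∃ (M : ℕ → Finset (tiling d n sel).network.Tile) (R : ℕ)
        (B : ℕ → Circuit ((tiling d n sel).network.Qubit N))
        (p : ℕ → Placement (tiling d n sel).network N),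
        IsGreedyRun A M ∧ absorbed M R = greedyWedge A ∧ D.Decodes A M B p ∧
        ((firstBlocks B R).length : ℝ) ≤
          C * Real.log (Fintype.card ((tiling d n sel).network.Qubit N)) := by
  obtain ⟨depth, hdepth⟩ := exists_tile_depth hN
  refine ⟨(134 + 204 * m) * depth * (2 / Real.log 2), fun n sel D A hA => ?_⟩
  have hnet := (tiling_wellFormed d n sel).proper
  obtain ⟨U, hU, hU'⟩ := exists_exceptional hd hA
  have hM := scheduledRun_isGreedyRun (A := A) hnet
  obtain ⟨B, p, hB, hlen⟩ := D.exists_decodes hnet hdepth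
    ((tiling_boundary_nonempty hd).some, ⟨0, hN⟩) hM
  refine ⟨scheduledRun A, 10 * (n + 3) + 2 * (U.card + 1), B, p, hM,
    absorbed_scheduledRun_eq hnet _ U hU', hB, ?_⟩
  have h1 := firstBlocks_length_le hlen (10 * (n + 3) + 2 * (U.card + 1))
  have h2 : 10 * (n + 3) + 2 * (U.card + 1) ≤ (n + 1) * (134 + 204 * m) := by nlinarith
  have h3 : ((firstBlocks B (10 * (n + 3) + 2 * (U.card + 1))).length : ℝ) ≤
      ((n : ℝ) + 1) * (134 + 204 * m) * depth := by
    exact_mod_cast h1.trans (Nat.mul_le_mul_right depth h2)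
  have h4 := succ_mul_log_two_le (n := n) (sel := sel) hd hN
  have h5 : 0 < Real.log 2 := Real.log_pos (by norm_num)
  have h6 : (n : ℝ) + 1 ≤
      2 / Real.log 2 * Real.log (Fintype.card ((tiling d n sel).network.Qubit N)) := by
    rw [div_mul_eq_mul_div, le_div_iff₀ h5]
    exact h4
  calc ((firstBlocks B (10 * (n + 3) + 2 * (U.card + 1))).length : ℝ)
      ≤ ((n : ℝ) + 1) * ((134 + 204 * m) * depth) := by rw [← mul_assoc]; exact h3
    _ ≤ (2 / Real.log 2 * Real.log (Fintype.card ((tiling d n sel).network.Qubit N))) *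
        ((134 + 204 * m) * depth) := mul_le_mul_of_nonneg_right h6 (by positivity)
    _ = _ := by ring

end HybridCode

end

open HybridCode HybridCode.Network in
theorem mainTheorem4 :
    -- local moves through a perfect tensor
    (∀ S : Finset (Fin 6), List.TFAE [
      3 ≤ S.card,
      ∀ K, ∃ K', localOp Sᶜ K perfectTensor = localOp S K' perfectTensor,
      ∃ (C : Circuit (Fin 6)) (β : Fin 6 → Fin 6),
        C.Layered ∧ C.ActsOn ↑S ∧ Set.InjOn β {j | j ∉ S} ∧ (∀ j, j ∉ S → β j ∈ S) ∧
        C.run perfectTensor = bellAndZeros S β ∅]) ∧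
    -- local moves through a (multi-copy) Bacon-Shor tensor
    (∀ (N : ℕ), 0 < N → ∀ (ρ : Fin N → Equiv.Perm (Fin 4)) (γ : Fin N → Gauge)
      (S : Finset (Fin 4)), List.TFAE [
      3 ≤ S.card,
      ∀ K, ∃ K', ∀ ψ : Bool → ℂ,
        localOp (S ×ˢ Finset.univ)ᶜ K (bsEncode ρ γ ψ) =
          localOp (S ×ˢ Finset.univ) K' (bsEncode ρ γ ψ),
      ∃ (C : Circuit (Fin 4 × Fin N)) (β : Fin 4 × Fin N → Fin 4 × Fin N) (a : Fin 4 × Fin N),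
        C.Layered ∧ C.ActsOn {q | q.1 ∈ S} ∧ a.1 ∈ S ∧
        Set.InjOn β {j | j.1 ∉ S} ∧ (∀ j, j.1 ∉ S → (β j).1 ∈ S ∧ β j ≠ a) ∧
        ∀ (ψ : Bool → ℂ) (y : Fin 4 × Fin N → Bool), C.run (bsEncode ρ γ ψ) y =
          ψ (y a) * bellAndZeros (S ×ˢ Finset.univ) β {a} y]) ∧
    -- GHZ-like entanglement across a 2-2 cut of the Bacon-Shor tensor in the gauge ZZ = +1
    (∀ (N : ℕ) (ρ : Fin N → Equiv.Perm (Fin 4)) (S : Finset (Fin 4)), S.card = 2 →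
      (∃ c, ∃ i ∈ S, ∃ j ∈ S, ((ρ c).symm i).val < 2 ∧ 2 ≤ ((ρ c).symm j).val) →
      ∃ (C : Circuit (Fin 4 × Fin N)) (a : Fin 4 × Fin N) (f : Bool → Fin 4 × Fin N → Bool),
        C.Layered ∧ C.ActsOn {q | q.1 ∈ S} ∧ a.1 ∈ S ∧
        ∀ x y, C.run (bsEncode ρ (fun _ => Gauge.zPlus) (fun x' => if x' = x then 1 else 0)) y =
          (if y a = x then 1 else 0) *
            ∏ c, ghzLike (fun q => q.2 = c ∧ q ≠ a) (f x) y) ∧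
    -- composing local moves in an arbitrary network
    (∀ N : ℕ, 0 < N → ∃ depth : ℕ, ∀ net : Network, net.Proper → Nonempty net.Boundary →
      ∀ A : Set net.Boundary,
        (∀ M, IsGreedyRun A M → ∀ r,
          (∀ t, ThreeLegs A (absorbed M r) t → t ∈ absorbed M r) →
            absorbed M r = greedyWedge A) ∧
        (∃ M r, IsGreedyRun A M ∧ absorbed M r = greedyWedge A) ∧
        ∀ (D : net.Dressing N) (M : ℕ → Finset net.Tile), IsGreedyRun A M →
          ∃ B p, D.Decodes A M B p ∧ ∀ r, (B r).length ≤ depth) ∧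
    -- the holographic code: an encoding isometry, all of whose bulk qubits are decodable
    (∀ d : ℕ, Even d → 4 ≤ d → ∀ (n : ℕ) (sel : ℕ → Bool),
      (tiling d n sel).network.Proper ∧ Nonempty (tiling d n sel).network.Boundary ∧
      greedyWedge (Set.univ : Set (tiling d n sel).network.Boundary) = Finset.univ ∧
      ∀ N : ℕ, 0 < N → ∀ (D : (tiling d n sel).network.Dressing N)
        (ψ : QState (tiling d n sel).network.Bulk),
          ∑ y, ‖D.encode ψ y‖ ^ 2 = ∑ x, ‖ψ x‖ ^ 2) ∧
    -- the holographic code: log-depth decoding of the Greedy wedge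
    (∀ N : ℕ, 0 < N → ∀ d : ℕ, Even d → 4 ≤ d → ∀ m : ℕ, ∃ C : ℝ,
      ∀ (n : ℕ) (sel : ℕ → Bool) (D : (tiling d n sel).network.Dressing N)
        (A : Set (tiling d n sel).network.Boundary),
        (tiling d n sel).IsUnionOfIntervals m A →
        ∃ (M : ℕ → Finset (tiling d n sel).network.Tile) (R : ℕ)
          (B : ℕ → Circuit ((tiling d n sel).network.Qubit N))
          (p : ℕ → Placement (tiling d n sel).network N),
          IsGreedyRun A M ∧ absorbed M R = greedyWedge A ∧ D.Decodes A M B p ∧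
          ((firstBlocks B R).length : ℝ) ≤
            C * Real.log (Fintype.card ((tiling d n sel).network.Qubit N))) := by
  refine ⟨perfectTensor_local_moves, fun N hN ρ γ S => baconShor_local_moves N hN ρ γ S,
    fun N ρ S _ h => baconShor_ghz N ρ S h, fun N hN => ?_, ?_, ?_⟩
  · obtain ⟨depth, hdepth⟩ := exists_tile_depth hN
    refine ⟨depth, fun net hnet hne A => ⟨fun M hM r h => hM.absorbed_eq r h,
      exists_run_eq_greedyWedge hnet, fun D M hM => ?_⟩⟩
    exact D.exists_decodes hnet hdepth (hne.some, ⟨0, hN⟩) hM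
  · intro d _ hd n sel
    have hnet := (tiling_wellFormed d n sel).proper
    have hne := tiling_boundary_nonempty (n := n) (sel := sel) hd
    have huniv := tiling_greedyWedge_univ (n := n) (sel := sel) hd
    exact ⟨hnet, hne, huniv, fun N hN D ψ => D.norm_encode hN hnet hne huniv ψ⟩
  · exact fun N hN d _ hd m => log_depth_decoding hN hd m
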